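/- There are absolute constants $C_S>0$ and $C>0$ such that, for every $F\ge 2$ and every $\lambda\in\mathbb R^F$ with $\lambda(f)>0$ for all $f$ and $\sum_f\lambda(f)=1$, there is a constant $C_N>0$ depending only on $\lambda$ (hence on $F$) for which the following holds. **Model.** Let $1\le M\le N$, $I\ge1$, $S\ge1$, $p\in(0,1]$, $\eta>0$ and $0<\delta\le 1/2$. Let $A_1,\dots,A_N\in\mathbb R^{I\times F}$ be independent random matrices. Each $A_n$ is obtained by drawing $I$ independent rows uniformly from the $(F-1)$-probability simplex, conditioned on the existence of positive row scalings that make all column sums equal to one, and by applying such a scaling, so that $\mathbf 1^\top A_n=\mathbf 1^\top$. Given the $A_n$, $S$ independent samples are drawn: in sample $s$ a latent variable $H_s$ has $\Pr(H_s=f)=\lambda(f)$; given $H_s=f$ the variables $Z_{s,1},\dots,Z_{s,N}\in\{1,\dots,I\}$ are independent with $\Pr(Z_{s,n}=i\mid H_s=f)=A_n(i,f)$; each $Z_{s,n}$ is observed with probability $p$, independently of everything else. For $j\ne k$ let $\widehat X_{jk}\in\mathbb R^{I\times I}$ be the empirical joint distribution of the variables $j,k$ over the samples in which both are observed (zero if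 there are none). **Algorithm (CNMF-SPA, factors $1,\dots,M$).** Let $\mathcal S_1=\{1,\dots,M\}$, $\mathcal S_2=\{M+1,\dots,N\}$, and let $\widehat X\in\mathbb R^{MI\times(N-M)I}$ be the matrix with blocks $\widehat X_{jk}$, $j\in\mathcal S_1$, $k\in\mathcal S_2$. Let $\overline X$ be $\widehat X$ with its columns normalized to unit $\ell_1$ norm. For $f=1,\dots,F$ choose a column index $\hat l_f$ of $\overline X$ that maximizes the Euclidean norm of the projection of the column onto the orthogonal complement of the span of the columns $\hat l_1,\dots,\hat l_{f-1}$ of $\overline X$ (ties broken arbitrarily). For $m\in\mathcal S_1$, $\widehat A_m\in\mathbb R^{I\times F}$ is the $m$-th block of $I$ rows of $[\widehat X(:,\hat l_1),\dots,\widehat X(:,\hat l_F)]$ with columns normalized to unit $\ell_1$ norm. **Claim.** Let $W=[A_1^\top,\dots,A_M^\top]^\top\in\mathbb R^{MI\times F}$, let $\sigma_{\max}(W),\sigma_{\min}(W)$ be its largest and smallest singular values, $\kappa(W)=\sigma_{\max}(W)/\sigma_{\min}(W)$, and $$\varepsilon=\frac{M\min\left(\frac1{2\sqrt{F-1}},\frac14\right)}{2\kappa(W)(1+80\kappa^2(W))},\qquad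 \zeta=\max\left(\sigma_{\max}(W)\,\varepsilon,\ \frac{M\sqrt{I\log(1/\delta)}}{\eta\,p\sqrt S}\right).$$ Assume $M\ge F/I$ and $p\ge\left(\frac8S\log\frac4\delta\right)^{1/2}$. Let $\mathcal W$ be the event that $\sigma_{\min}(W)>0$, $$S\ge C_S\,\frac{M^2I\log(1/\delta)}{\sigma_{\max}^2(W)\,\eta^2\varepsilon^2p^2}\qquad\text{and}\qquad N\ge M+C_N\,\frac{\varepsilon^{-2(F-1)}}{IF}\log\frac F\delta .$$ Then, conditionally on $\mathcal W$ (if it has positive probability), the following holds with probability at least $1-\delta$: if $\|\widehat X_{jk}(:,q)\|_1\ge\eta$ for all $j\in\mathcal S_1$, $k\in\mathcal S_2$ and $q\in\{1,\dots,I\}$, then for every $m\in\mathcal S_1$ $$\min_{\Pi\ \text{permutation}}\big\|\widehat A_m\Pi-A_m\big\|_2\le C\,\kappa^2(W)\sqrt F\,\zeta ,$$ where $\|\cdot\|_2$ is the spectral norm. -/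

import Mathlib

open MeasureTheory

noncomputable section

/-! ### Singular values -/

/-- The largest singular value, which is also the spectral norm `‖B‖₂`. -/
def sigmaMax {ρ γ : Type*} [Fintype ρ] [Fintype γ] [DecidableEq γ] (B : Matrix ρ γ ℝ) : ℝ :=
  (Matrix.toEuclideanLin B).singularValues 0

/-- The smallest of the `|γ|` singular values of `B`, for a matrix with at least as many rows
as columns. -/
def sigmaMin {ρ γ : Type*} [Fintype ρ] [Fintype γ] [DecidableEq γ] (B : Matrix ρ γ ℝ) : ℝ :=
  (Matrix.toEuclideanLin B).singularValues (Fintype.card γ - 1)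

/-- The condition number `σ_max / σ_min`; used below only where `0 < σ_min`. -/
def condNumber {ρ γ : Type*} [Fintype ρ] [Fintype γ] [DecidableEq γ] (B : Matrix ρ γ ℝ) : ℝ :=
  sigmaMax B / sigmaMin B

/-! ### The random factor matrices -/

/-- The affine parametrization `(x₁, …, x_{F-1}) ↦ (x₁, …, x_{F-1}, 1 - ∑ xⱼ)` of the hyperplane
`∑ yᵢ = 1` of `ℝ^F`. -/
def simplexChart (F : ℕ) (x : Fin (F - 1) → ℝ) : Fin F → ℝ :=
  fun i => if h : (i : ℕ) < F - 1 then x ⟨i, h⟩ else 1 - ∑ j, x j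

/-- The uniform distribution on the `(F-1)`-probability simplex in `ℝ^F`: normalized Lebesgue
measure in the affine coordinates `(x₁, …, x_{F-1})`. -/
def uniformSimplex (F : ℕ) : Measure (Fin F → ℝ) :=
  (ProbabilityTheory.cond volume
    {x : Fin (F - 1) → ℝ | (∀ j, 0 ≤ x j) ∧ ∑ j, x j ≤ 1}).map (simplexChart F)

/-- The rows of `G` can be scaled by positive scalars so that all column sums become one. -/
def Scalable {I F : ℕ} (G : Fin I → Fin F → ℝ) : Prop :=
  ∃ d : Fin I → ℝ, (∀ i, 0 < d i) ∧ ∀ f, ∑ i, d i * G i f = 1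

/-- The law of an `I × F` matrix with independent rows, uniform on the simplex, given that a
positive row scaling to unit column sums exists. -/
def scalableUniform (I F : ℕ) : Measure (Fin I → Fin F → ℝ) :=
  ProbabilityTheory.cond (Measure.pi fun _ : Fin I => uniformSimplex F) {G | Scalable G}

/-- `A` is a random `I × F` matrix whose rows are drawn uniformly from the simplex and then
positively scaled so that all columns of `A` sum to one. -/
def IsScaledSimplexFactor {Ω : Type*} [MeasurableSpace Ω] (P : Measure Ω) {I F : ℕ}
    (A : Ω → Fin I → Fin F → ℝ) : Prop :=
  ∃ (G : Ω → Fin I → Fin F → ℝ) (d : Ω → Fin I → ℝ), Measurable G ∧ Measurable d ∧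
    P.map G = scalableUniform I F ∧
    ∀ᵐ ω ∂P, (∀ i, 0 < d ω i) ∧ (∀ i f, A ω i f = d ω i * G ω i f) ∧ ∀ f, ∑ i, A ω i f = 1

/-! ### The latent variable model and its partially observed samples -/

/-- The random factors `A₁, …, A_N` are independent and follow the scaled simplex model.
Given the factors, the `S` samples are independent and follow the naive Bayes model: the latent
variable `H s` has prior `lam`, the variables `Z s n` are conditionally independent given
`H s = f` with probabilities `A n (·, f)`, and every `Z s n` is observed (`V s n = true`) with
probability `p`, independently of everything else. -/
structure IsModel {Ω : Type*} [MeasurableSpace Ω] (P : Measure Ω) {N I F S : ℕ}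
    (lam : Fin F → ℝ) (p : ℝ) (A : Fin N → Ω → Fin I → Fin F → ℝ)
    (H : Fin S → Ω → Fin F) (Z : Fin S → Fin N → Ω → Fin I) (V : Fin S → Fin N → Ω → Bool) :
    Prop where
  measurable_factor : ∀ n, Measurable (A n)
  measurable_latent : ∀ s, Measurable (H s)
  measurable_value : ∀ s n, Measurable (Z s n)
  measurable_observed : ∀ s n, Measurable (V s n)
  indep_factor : ProbabilityTheory.iIndepFun A P
  law_factor : ∀ n, IsScaledSimplexFactor P (A n)
  law_sample : ∀ (B : Set (Fin N → Fin I → Fin F → ℝ)), MeasurableSet B →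
    ∀ (h : Fin S → Fin F) (z : Fin S → Fin N → Fin I) (v : Fin S → Fin N → Bool),
      P {ω | (fun n => A n ω) ∈ B ∧ ∀ s, H s ω = h s ∧ ∀ n, Z s n ω = z s n ∧ V s n ω = v s n} =
        ∫⁻ ω in {ω | (fun n => A n ω) ∈ B}, ENNReal.ofReal
          (∏ s, (lam (h s) * ∏ n, A n ω (z s n) (h s) * (if v s n = true then p else 1 - p))) ∂P

/-- The recorded data: entry `n` of sample `s` is `some i` if `Z s n = i` is observed, and `none`
if it is missing. -/
def samples {Ω : Type*} {N I S : ℕ} (Z : Fin S → Fin N → Ω → Fin I)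
    (V : Fin S → Fin N → Ω → Bool) (ω : Ω) : Fin S → Fin N → Option (Fin I) :=
  fun s n => if V s n ω = true then some (Z s n ω) else none

/-! ### The virtual NMF of the split `{1, …, M}`, `{M+1, …, N}` -/

/-- The first `M` of the `N` variables. -/
abbrev Part1 (N M : ℕ) : Type := {n : Fin N // (n : ℕ) < M}

/-- The last `N - M` of the `N` variables. -/
abbrev Part2 (N M : ℕ) : Type := {n : Fin N // M ≤ (n : ℕ)}

/-- The left factor `W`, i.e. `A₁, …, A_M` stacked on top of each other. -/
def stackedFactor {N I F : ℕ} (M : ℕ) (A : Fin N → Fin I → Fin F → ℝ) :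
    Matrix (Part1 N M × Fin I) (Fin F) ℝ :=
  Matrix.of fun r f => A r.1 r.2 f

/-- The empirical pairwise marginal of the variables `j` and `k`, averaged over the samples in which
both are observed (zero if there is no such sample). -/
def empMarginal {N I S : ℕ} (D : Fin S → Fin N → Option (Fin I)) (j k : Fin N) :
    Matrix (Fin I) (Fin I) ℝ :=
  Matrix.of fun a b =>
    (Finset.card {s : Fin S | D s j = some a ∧ D s k = some b} : ℝ) /
      (Finset.card {s : Fin S | D s j ≠ none ∧ D s k ≠ none} : ℝ)

/-- The matrix with blocks `empMarginal j k`, `j` among the first `M` variables and `k` among the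
others. -/
def empVirtual {N I S : ℕ} (M : ℕ) (D : Fin S → Fin N → Option (Fin I)) :
    Matrix (Part1 N M × Fin I) (Part2 N M × Fin I) ℝ :=
  Matrix.of fun r q => empMarginal D r.1 q.1 r.2 q.2

/-! ### CNMF-SPA -/

/-- `ℓ¹`-normalization of the columns of a matrix. -/
def colNormalize {ρ γ : Type*} [Fintype ρ] (X : Matrix ρ γ ℝ) : Matrix ρ γ ℝ :=
  Matrix.of fun r q => X r q / ∑ r', |X r' q|

/-- Column `q` of a matrix as a Euclidean vector. -/
def euclCol {ρ γ : Type*} (X : Matrix ρ γ ℝ) (q : γ) : EuclideanSpace ℝ ρ :=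
  WithLp.toLp 2 fun r => X r q

/-- `Λ` is a possible run of the successive projection algorithm on the columns of `Y`: in step `f`
it selects a column whose projection onto the orthogonal complement of the span of the previously
selected columns has maximal Euclidean norm (ties may be broken in any way). -/
def IsSPARun {ρ γ : Type*} [Fintype ρ] {F : ℕ} (Y : Matrix ρ γ ℝ) (Λ : Fin F → γ) : Prop :=
  ∀ (f : Fin F) (q : γ),
    ‖(Submodule.span ℝ {y | ∃ g < f, y = euclCol Y (Λ g)})ᗮ.starProjection (euclCol Y q)‖ ≤
      ‖(Submodule.span ℝ {y | ∃ g < f, y = euclCol Y (Λ g)})ᗮ.starProjection (euclCol Y (Λ f))‖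

/-- The estimate of `A_m` that CNMF-SPA returns when successive projection selects `Λ`: the `m`-th
block of rows of the selected columns, with columns normalized in `ℓ¹`. -/
def spaEstimate {N M I S F : ℕ} (D : Fin S → Fin N → Option (Fin I))
    (Λ : Fin F → Part2 N M × Fin I) (m : Part1 N M) : Matrix (Fin I) (Fin F) ℝ :=
  colNormalize (Matrix.of fun i f => empVirtual M D (m, i) (Λ f))

/-! ### The quantities in the bound -/

/-- `ε = M min(1 / (2 √(F-1)), 1/4) / (2 κ (1 + 80 κ²))`. -/
def sepEps (F M : ℕ) (κ : ℝ) : ℝ :=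
  M * min (1 / (2 * Real.sqrt (F - 1))) (1 / 4) / (2 * κ * (1 + 80 * κ ^ 2))

/-- `ζ = max(σ ε, M √(I log(1/δ)) / (η p √S))`. -/
def spaZeta (M I S : ℕ) (p δ η σ ε : ℝ) : ℝ :=
  max (σ * ε) (M * Real.sqrt (I * Real.log (1 / δ)) / (η * p * Real.sqrt S))

/-- The requirements on `W`: it has full column rank (so that `κ(W)` is finite), and `S` and `N` are
as large as required, with constants `CS` and `CN`. -/
def SizeConditions {ρ : Type*} [Fintype ρ] {F : ℕ} (CS CN : ℝ) (N M I S : ℕ) (p δ η : ℝ)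
    (W : Matrix ρ (Fin F) ℝ) : Prop :=
  0 < sigmaMin W ∧
  CS * (M ^ 2 * I * Real.log (1 / δ) /
    (sigmaMax W ^ 2 * η ^ 2 * sepEps F M (condNumber W) ^ 2 * p ^ 2)) ≤ S ∧
  M + CN * ((1 / sepEps F M (condNumber W)) ^ (2 * (F - 1)) / (I * F) * Real.log (F / δ)) ≤ N

/-- All columns of the pairwise marginals that enter the algorithm have `ℓ¹`-mass at least `η`. -/
def MassAtLeast {N I S : ℕ} (M : ℕ) (η : ℝ) (D : Fin S → Fin N → Option (Fin I)) : Prop :=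
  ∀ (j : Part1 N M) (k : Part2 N M) (q : Fin I), η ≤ ∑ a, |empMarginal D j k a q|

/-- However ties are broken, the output of CNMF-SPA satisfies
`min_Π ‖Â_m Π - A_m‖₂ ≤ b` for all `m ≤ M`. -/
def SPAErrorAtMost {N I S F : ℕ} (M : ℕ) (D : Fin S → Fin N → Option (Fin I))
    (A : Fin N → Fin I → Fin F → ℝ) (b : ℝ) : Prop :=
  ∀ Λ : Fin F → Part2 N M × Fin I, IsSPARun (colNormalize (empVirtual M D)) Λ →
    ∀ m : Part1 N M, ∃ π : Equiv.Perm (Fin F),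
      sigmaMax ((spaEstimate D Λ m).submatrix id π - Matrix.of (A m)) ≤ b

end

/-!
The proof works with the constants `1000` for `C` and `1` for `CS`; the dependence on `F` and `lam`
is carried by `CN`.

**Deterministic part.** Column `q` of the empirical marginals with a variable `k` of the second part
equals, up to noise, a multiple of `W g`, where `g` is the frequency vector of the latent values
among the samples in which `k` is observed with value `q`. Successive projection is robust
(`exists_perm_of_successive_projection`): if the normalized columns are close to `W h` for
probability vectors `h`, and every vertex of the simplex is nearly attained by some `h`, then it
selects one column close to every vertex, and the normalized blocks of these columns approximate
the factors (`spaErrorAtMost_of_columns`, `spaErrorAtMost_of_records`). Bounds of at least `2 √F`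
hold trivially, so a failure forces the factors of the first part into the set `CriticalFactors`,
on which `κ² σ_max ε` is small and `S` exceeds a multiple of `κ⁴ M² I log(1/δ) / (η p)²`.

**Typical records.** Three properties of the records of a variable `k` of the second part are needed:
enough common observations, little noise in all columns, and few samples with other latent values
in the rows that are dominated by a single entry. In each block, the noise of a column is a sum of
independent vectors; the total squared norm over all blocks is controlled by a Huber-type potential (`sum_prod_indicator_norm_sq_le`), whose exponential moment grows no faster
than for sub-Gaussian vectors. A dominated row for every vertex exists in some factor of the second
part, since a random row is near a given vertex with probability of order `t ^ (F - 1)`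
(`IsScaledSimplexFactor.prob_no_dominated_row`); this is where the condition on `N` enters.

**Uniformity in `N`.** No upper bound for `N` is available, so the failure probabilities of the
variables of the second part cannot simply be added. But the bound is asserted only under the mass
condition, and a random factor has, with some probability `2 r > 0`, a row so small that the
variable violates the mass condition with conditional probability at least `1 / 2`
(`IsScaledSimplexFactor.le_prob_small_row`). Since all other variables must satisfy the mass
condition, the union bound over `N - M` variables with failure probability `τ` each is at most
`(N - M) (1 - r) ^ (N - M - 1) τ ≤ τ / r`, up to constants (`IsModel.prob_mass_atypical_le`). The
mass condition also gives `I η ≤ 1`. Three cases remain.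

* If `η` is bounded below, then `I` is bounded, so that `r` is, and the mass condition itself is
  improbable for the `N` in question (`IsModel.prob_critical_mass_le`).
* If `η` is small and `M` is at least a multiple of `I ^ (3 / 2) log(1/δ)`, then critical factors
  are improbable: they satisfy `σ_min ≤ 2 √F / M`, while a net argument shows that
  `σ_min < √I (2 √F / M)` has probability at most `δ / 2` (`exists_prob_sigmaMin_le`). The event is
  to be compared with the size conditions, which are monotone in `σ_min`: if they hold for one
  matrix with small `σ_min`, they hold for all matrices with a `√I` times larger one
  (`prob_size_and_sigmaMin_le`).
* If `η` is small and `M` is smaller than that, then `τ / r ≤ δ / 2`, because `τ` is exponentially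
  small in `I log(1/δ) / η`, while `1 / r` is at most exponential in `I + log(1/η)`
  (`exists_exceptional_le`, `IsModel.prob_critical_failure_le`).
-/

/-! ### Singular values as extreme values of `‖B x‖` -/

section SingularValues

variable {ρ γ : Type*} [Fintype ρ] [Fintype γ] [DecidableEq γ]

theorem sum_eigenvalues_mul_inner_sq (B : Matrix ρ γ ℝ) (x : EuclideanSpace ℝ γ) :
    ‖Matrix.toEuclideanLin B x‖ ^ 2 =
      ∑ i : Fin (Fintype.card γ), (Matrix.toEuclideanLin B).singularValues i ^ 2 *
        inner ℝ ((Matrix.toEuclideanLin B).isSymmetric_adjoint_comp_self.eigenvectorBasis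
          (finrank_euclideanSpace (𝕜 := ℝ)) i) x ^ 2 := by
  set T := Matrix.toEuclideanLin B
  set hT := T.isSymmetric_adjoint_comp_self
  have hn : Module.finrank ℝ (EuclideanSpace ℝ γ) = Fintype.card γ := finrank_euclideanSpace
  set b := hT.eigenvectorBasis hn
  have h1 : ‖T x‖ ^ 2 = inner ℝ ((LinearMap.adjoint T ∘ₗ T) x) x := by
    rw [LinearMap.comp_apply, LinearMap.adjoint_inner_left, real_inner_self_eq_norm_sq]
  rw [h1, ← b.sum_inner_mul_inner]
  refine Finset.sum_congr rfl fun i _ => ?_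
  have h2 : inner ℝ ((LinearMap.adjoint T ∘ₗ T) x) (b i) =
      hT.eigenvalues hn i * inner ℝ x (b i) := by
    rw [hT x (b i)]
    have := hT.apply_eigenvectorBasis hn i
    rw [this, inner_smul_right]
    rfl
  rw [h2, T.sq_singularValues_fin hn i, real_inner_comm x (b i)]
  ring

theorem norm_sq_eq_sum_inner_sq (B : Matrix ρ γ ℝ) (x : EuclideanSpace ℝ γ) :
    ‖x‖ ^ 2 = ∑ i : Fin (Fintype.card γ),
        inner ℝ ((Matrix.toEuclideanLin B).isSymmetric_adjoint_comp_self.eigenvectorBasis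
          (finrank_euclideanSpace (𝕜 := ℝ)) i) x ^ 2 := by
  rw [← OrthonormalBasis.sum_sq_norm_inner_right
    ((Matrix.toEuclideanLin B).isSymmetric_adjoint_comp_self.eigenvectorBasis
          (finrank_euclideanSpace (𝕜 := ℝ))) x]
  simp

theorem sigmaMax_nonneg (B : Matrix ρ γ ℝ) : 0 ≤ sigmaMax B :=
  LinearMap.singularValues_nonneg _ _

theorem sigmaMin_nonneg (B : Matrix ρ γ ℝ) : 0 ≤ sigmaMin B :=
  LinearMap.singularValues_nonneg _ _

theorem norm_toEuclideanLin_le (B : Matrix ρ γ ℝ) (x : EuclideanSpace ℝ γ) :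
    ‖Matrix.toEuclideanLin B x‖ ≤ sigmaMax B * ‖x‖ := by
  refine le_of_sq_le_sq ?_ (mul_nonneg (sigmaMax_nonneg B) (norm_nonneg x))
  rw [sum_eigenvalues_mul_inner_sq, mul_pow, norm_sq_eq_sum_inner_sq B x, Finset.mul_sum]
  refine Finset.sum_le_sum fun i _ => mul_le_mul_of_nonneg_right ?_ (sq_nonneg _)
  exact pow_le_pow_left₀ (LinearMap.singularValues_nonneg _ _)
    ((Matrix.toEuclideanLin B).singularValues_antitone (Nat.zero_le _)) 2

theorem sigmaMin_mul_norm_le (B : Matrix ρ γ ℝ) (x : EuclideanSpace ℝ γ) :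
    sigmaMin B * ‖x‖ ≤ ‖Matrix.toEuclideanLin B x‖ := by
  refine le_of_sq_le_sq ?_ (norm_nonneg _)
  rw [sum_eigenvalues_mul_inner_sq, mul_pow, norm_sq_eq_sum_inner_sq B x, Finset.mul_sum]
  refine Finset.sum_le_sum fun i _ => mul_le_mul_of_nonneg_right ?_ (sq_nonneg _)
  exact pow_le_pow_left₀ (LinearMap.singularValues_nonneg _ _)
    ((Matrix.toEuclideanLin B).singularValues_antitone (by have := i.2; omega)) 2

theorem exists_norm_eq_singularValue (B : Matrix ρ γ ℝ) (i : Fin (Fintype.card γ)) :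
    ∃ x : EuclideanSpace ℝ γ, ‖x‖ = 1 ∧
      ‖Matrix.toEuclideanLin B x‖ = (Matrix.toEuclideanLin B).singularValues i := by
  refine ⟨(Matrix.toEuclideanLin B).isSymmetric_adjoint_comp_self.eigenvectorBasis
          (finrank_euclideanSpace (𝕜 := ℝ)) i, OrthonormalBasis.norm_eq_one _ _, ?_⟩
  refine (sq_eq_sq₀ (norm_nonneg _) (LinearMap.singularValues_nonneg _ _)).1 ?_
  rw [sum_eigenvalues_mul_inner_sq, Finset.sum_eq_single i]
  · simp
  · intro j _ hj
    rw [OrthonormalBasis.inner_eq_zero _ hj]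
    simp
  · simp

theorem exists_norm_eq_sigmaMin [Nonempty γ] (B : Matrix ρ γ ℝ) :
    ∃ x : EuclideanSpace ℝ γ, ‖x‖ = 1 ∧ ‖Matrix.toEuclideanLin B x‖ = sigmaMin B :=
  exists_norm_eq_singularValue B ⟨Fintype.card γ - 1, Nat.sub_lt Fintype.card_pos Nat.one_pos⟩

theorem exists_norm_eq_sigmaMax [Nonempty γ] (B : Matrix ρ γ ℝ) :
    ∃ x : EuclideanSpace ℝ γ, ‖x‖ = 1 ∧ ‖Matrix.toEuclideanLin B x‖ = sigmaMax B :=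
  exists_norm_eq_singularValue B ⟨0, Fintype.card_pos⟩

theorem sigmaMax_le_of_forall [Nonempty γ] (B : Matrix ρ γ ℝ) {c : ℝ}
    (h : ∀ x : EuclideanSpace ℝ γ, ‖x‖ = 1 → ‖Matrix.toEuclideanLin B x‖ ≤ c) :
    sigmaMax B ≤ c := by
  obtain ⟨x, hx, hx'⟩ := exists_norm_eq_sigmaMax B
  exact hx' ▸ h x hx

theorem le_sigmaMin_of_forall [Nonempty γ] (B : Matrix ρ γ ℝ) {c : ℝ}
    (h : ∀ x : EuclideanSpace ℝ γ, ‖x‖ = 1 → c ≤ ‖Matrix.toEuclideanLin B x‖) :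
    c ≤ sigmaMin B := by
  obtain ⟨x, hx, hx'⟩ := exists_norm_eq_sigmaMin B
  exact hx' ▸ h x hx

theorem sigmaMin_le_sigmaMax (B : Matrix ρ γ ℝ) : sigmaMin B ≤ sigmaMax B :=
  (Matrix.toEuclideanLin B).singularValues_antitone (Nat.zero_le _)

theorem norm_toEuclideanLin_sq (B : Matrix ρ γ ℝ) (x : EuclideanSpace ℝ γ) :
    ‖Matrix.toEuclideanLin B x‖ ^ 2 = ∑ r, (∑ c, B r c * x c) ^ 2 := by
  rw [EuclideanSpace.norm_sq_eq]
  simp [Matrix.toLpLin_apply, Matrix.mulVec, dotProduct]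

/-- The spectral norm is at most the Frobenius norm. -/
theorem norm_toEuclideanLin_le_frobenius (B : Matrix ρ γ ℝ) (x : EuclideanSpace ℝ γ) :
    ‖Matrix.toEuclideanLin B x‖ ≤ Real.sqrt (∑ r, ∑ c, B r c ^ 2) * ‖x‖ := by
  refine le_of_sq_le_sq ?_ (mul_nonneg (Real.sqrt_nonneg _) (norm_nonneg x))
  rw [norm_toEuclideanLin_sq, mul_pow, Real.sq_sqrt (by positivity), EuclideanSpace.norm_sq_eq,
    Finset.sum_mul]
  refine Finset.sum_le_sum fun r _ => ?_
  simpa using Finset.sum_mul_sq_le_sq_mul_sq Finset.univ (fun c => B r c) (fun c => x c)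

theorem sigmaMax_le_frobenius [Nonempty γ] (B : Matrix ρ γ ℝ) :
    sigmaMax B ≤ Real.sqrt (∑ r, ∑ c, B r c ^ 2) :=
  sigmaMax_le_of_forall B fun x hx => by simpa [hx] using norm_toEuclideanLin_le_frobenius B x

/-- The spectral norm is controlled by the Euclidean norms of the columns. -/
theorem sigmaMax_le_sqrt_card_mul [Nonempty γ] (B : Matrix ρ γ ℝ) {c : ℝ} (hc : 0 ≤ c)
    (h : ∀ f, ∑ r, B r f ^ 2 ≤ c ^ 2) : sigmaMax B ≤ Real.sqrt (Fintype.card γ) * c := by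
  refine (sigmaMax_le_frobenius B).trans ?_
  rw [Finset.sum_comm]
  refine Real.sqrt_le_iff.2 ⟨by positivity, ?_⟩
  rw [mul_pow, Real.sq_sqrt (by positivity)]
  refine (Finset.sum_le_sum fun f _ => h f).trans ?_
  simp

theorem abs_sigmaMax_sub_le [Nonempty γ] (B B' : Matrix ρ γ ℝ) :
    |sigmaMax B - sigmaMax B'| ≤ Real.sqrt (∑ r, ∑ c, (B - B') r c ^ 2) := by
  have key : ∀ B B' : Matrix ρ γ ℝ,
      sigmaMax B ≤ sigmaMax B' + Real.sqrt (∑ r, ∑ c, (B - B') r c ^ 2) := by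
    intro B B'
    refine sigmaMax_le_of_forall B fun x hx => ?_
    have h1 : Matrix.toEuclideanLin B x =
        Matrix.toEuclideanLin B' x + Matrix.toEuclideanLin (B - B') x := by
      simp [map_sub]
    rw [h1]
    refine (norm_add_le _ _).trans (add_le_add ?_ ?_)
    · simpa [hx] using norm_toEuclideanLin_le B' x
    · simpa [hx] using norm_toEuclideanLin_le_frobenius (B - B') x
  have h1 := key B B'
  have h2 := key B' B
  have h3 : ∑ r, ∑ c, (B' - B) r c ^ 2 = ∑ r, ∑ c, (B - B') r c ^ 2 :=
    Finset.sum_congr rfl fun r _ => Finset.sum_congr rfl fun c _ => by simp; ring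
  rw [h3] at h2
  exact abs_le.2 ⟨by linarith, by linarith⟩

theorem abs_sigmaMin_sub_le [Nonempty γ] (B B' : Matrix ρ γ ℝ) :
    |sigmaMin B - sigmaMin B'| ≤ Real.sqrt (∑ r, ∑ c, (B - B') r c ^ 2) := by
  have key : ∀ B B' : Matrix ρ γ ℝ,
      sigmaMin B ≤ sigmaMin B' + Real.sqrt (∑ r, ∑ c, (B - B') r c ^ 2) := by
    intro B B'
    obtain ⟨x, hx, hx'⟩ := exists_norm_eq_sigmaMin B'
    have h1 : Matrix.toEuclideanLin B x =
        Matrix.toEuclideanLin B' x + Matrix.toEuclideanLin (B - B') x := by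
      simp [map_sub]
    have h2 := sigmaMin_mul_norm_le B x
    rw [hx, mul_one, h1] at h2
    refine h2.trans ((norm_add_le _ _).trans (add_le_add hx'.le ?_))
    simpa [hx] using norm_toEuclideanLin_le_frobenius (B - B') x
  have h1 := key B B'
  have h2 := key B' B
  have h3 : ∑ r, ∑ c, (B' - B) r c ^ 2 = ∑ r, ∑ c, (B - B') r c ^ 2 :=
    Finset.sum_congr rfl fun r _ => Finset.sum_congr rfl fun c _ => by simp; ring
  rw [h3] at h2
  exact abs_le.2 ⟨by linarith, by linarith⟩

omit [DecidableEq γ] in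
theorem continuous_of_abs_sub_le_frobenius {φ : Matrix ρ γ ℝ → ℝ}
    (h : ∀ B B', |φ B - φ B'| ≤ Real.sqrt (∑ r, ∑ c, (B - B') r c ^ 2)) : Continuous φ := by
  refine continuous_iff_continuousAt.2 fun B' => ?_
  refine tendsto_iff_dist_tendsto_zero.2 ?_
  refine squeeze_zero (fun _ => dist_nonneg) (fun B => h B B') ?_
  have hc : Continuous fun B : Matrix ρ γ ℝ => Real.sqrt (∑ r, ∑ c, (B - B') r c ^ 2) := by
    refine Real.continuous_sqrt.comp ?_
    refine continuous_finsetSum _ fun r _ => continuous_finsetSum _ fun c _ => ?_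
    exact ((continuous_id.sub continuous_const).matrix_elem r c).pow 2
  simpa using hc.tendsto B'

theorem continuous_sigmaMax [Nonempty γ] : Continuous (sigmaMax : Matrix ρ γ ℝ → ℝ) :=
  continuous_of_abs_sub_le_frobenius abs_sigmaMax_sub_le

theorem continuous_sigmaMin [Nonempty γ] : Continuous (sigmaMin : Matrix ρ γ ℝ → ℝ) :=
  continuous_of_abs_sub_le_frobenius abs_sigmaMin_sub_le

end SingularValues

/-! ### Robustness of the successive projection algorithm -/

section SuccessiveProjection

variable {E : Type*} [NormedAddCommGroup E] [InnerProductSpace ℝ E] [FiniteDimensional ℝ E]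
  {F : ℕ}

omit [FiniteDimensional ℝ E] in
/-- A lower bound for `‖∑ x f • w f‖` survives a small perturbation of the vectors `w f`. -/
theorem half_mul_sq_le_of_perturbation {w w' : Fin F → E} {s τ : ℝ} (hs : 0 < s)
    (hw : ∀ x : Fin F → ℝ, s ^ 2 * ∑ f, x f ^ 2 ≤ ‖∑ f, x f • w f‖ ^ 2)
    (hτs : 4 * F * τ ≤ s) (hw' : ∀ f, ‖w' f - w f‖ ≤ τ) (x : Fin F → ℝ) :
    (s / 2) ^ 2 * ∑ f, x f ^ 2 ≤ ‖∑ f, x f • w' f‖ ^ 2 := by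
  set r := Real.sqrt (∑ f, x f ^ 2)
  have hr0 : 0 ≤ r := Real.sqrt_nonneg _
  have hr2 : r ^ 2 = ∑ f, x f ^ 2 := Real.sq_sqrt (by positivity)
  have h1 : s * r ≤ ‖∑ f, x f • w f‖ := by
    refine le_of_sq_le_sq ?_ (norm_nonneg _)
    rw [mul_pow, hr2]; exact hw x
  have hx : ∀ f, |x f| ≤ r := fun f => by
    rw [← Real.sqrt_sq_eq_abs]
    exact Real.sqrt_le_sqrt (Finset.single_le_sum (f := fun f => x f ^ 2)
      (fun _ _ => sq_nonneg _) (Finset.mem_univ f))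
  have h2 : ‖∑ f, x f • w f - ∑ f, x f • w' f‖ ≤ F * (r * τ) := by
    rw [← Finset.sum_sub_distrib]
    refine (norm_sum_le _ _).trans ?_
    refine (Finset.sum_le_card_nsmul _ _ (r * τ) fun f _ => ?_).trans (by simp)
    rw [← smul_sub, norm_smul, norm_sub_rev]
    exact mul_le_mul (hx f) (hw' f) (norm_nonneg _) hr0
  have h3 : s / 2 * r ≤ ‖∑ f, x f • w' f‖ := by
    have h4 := norm_sub_norm_le (∑ f, x f • w f) (∑ f, x f • w' f)
    have h5 : F * (r * τ) ≤ s / 4 * r := by nlinarith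
    nlinarith
  rw [← hr2, ← mul_pow]
  exact pow_le_pow_left₀ (by positivity) h3 2

theorem sum_single_sq (f : Fin F) : ∑ g, (Pi.single f (1 : ℝ) : Fin F → ℝ) g ^ 2 = 1 := by
  rw [Finset.sum_eq_single f] <;> simp +contextual

omit [InnerProductSpace ℝ E] [FiniteDimensional ℝ E] in
theorem sum_single_smul [NormedSpace ℝ E] (w : Fin F → E) (f : Fin F) :
    ∑ g, (Pi.single f (1 : ℝ) : Fin F → ℝ) g • w g = w f := by
  rw [Finset.sum_eq_single f] <;> simp +contextual

omit [FiniteDimensional ℝ E] in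
theorem le_norm_of_sq_mul_le {w : Fin F → E} {s : ℝ}
    (hw : ∀ x : Fin F → ℝ, s ^ 2 * ∑ f, x f ^ 2 ≤ ‖∑ f, x f • w f‖ ^ 2) (f : Fin F) :
    s ≤ ‖w f‖ := by
  have h2 := hw (Pi.single f 1)
  rw [sum_single_sq, sum_single_smul, mul_one] at h2
  exact le_of_sq_le_sq h2 (norm_nonneg _)

/-- Projecting out approximations `w' f` of some of the vertices keeps the other vertices
well conditioned. -/
theorem half_mul_sq_le_norm_residual {w w' : Fin F → E} {s τ : ℝ} {Sel : Finset (Fin F)}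
    (hs : 0 < s) (hw : ∀ x : Fin F → ℝ, s ^ 2 * ∑ f, x f ^ 2 ≤ ‖∑ f, x f • w f‖ ^ 2)
    (hτs : 4 * F * τ ≤ s) (hw' : ∀ f, ‖w' f - w f‖ ≤ τ)
    (hsel : ∀ f ∉ Sel, w' f = w f) (x : Fin F → ℝ) (hx : ∀ f ∈ Sel, x f = 0) :
    (s / 2) ^ 2 * ∑ f, x f ^ 2 ≤
      ‖(Submodule.span ℝ (w' '' (Sel : Set (Fin F))))ᗮ.starProjection (∑ f, x f • w f)‖ ^ 2 := by
  classical
  set U := Submodule.span ℝ (w' '' (Sel : Set (Fin F)))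
  set v := ∑ f, x f • w f
  have hmem : U.starProjection v ∈ U := U.starProjection_apply_mem v
  obtain ⟨z, hz⟩ := (Submodule.mem_span_image_finset_iff_exists_fun ℝ).1 hmem
  set z' : Fin F → ℝ := fun f => if hf : f ∈ Sel then z ⟨f, hf⟩ else 0 with hz'
  have hz2 : U.starProjection v = ∑ f, z' f • w' f := by
    have h3 : ∑ f ∈ Sel, z' f • w' f = ∑ f : Sel, z f • w' f := by
      rw [← Finset.sum_coe_sort Sel]
      exact Finset.sum_congr rfl fun f _ => by simp [hz']
    rw [← hz, ← h3]
    exact Finset.sum_subset (Finset.subset_univ Sel) fun f _ hf => by simp [hz', hf]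
  have hv2 : v = ∑ f, x f • w' f := by
    refine Finset.sum_congr rfl fun f _ => ?_
    by_cases hf : f ∈ Sel
    · simp [hx f hf]
    · rw [hsel f hf]
  have h2 : Uᗮ.starProjection v = ∑ f, (x f - z' f) • w' f := by
    have h3 : Uᗮ.starProjection v = v - U.starProjection v := U.starProjection_orthogonal_val v
    rw [h3, hz2]
    conv_lhs => rw [hv2]
    rw [← Finset.sum_sub_distrib]
    exact Finset.sum_congr rfl fun f _ => (sub_smul _ _ _).symm
  rw [h2]
  refine le_trans ?_ (half_mul_sq_le_of_perturbation hs hw hτs hw' fun f => x f - z' f)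
  refine mul_le_mul_of_nonneg_left (Finset.sum_le_sum fun f _ => ?_) (by positivity)
  by_cases hf : f ∈ Sel
  · simp [hx f hf, sq_nonneg]
  · simp [hz', hf]

omit [FiniteDimensional ℝ E] in
/-- Strict convexity of the norm: a convex combination of well separated vectors is considerably
shorter than the longest of them, unless the weights are concentrated on a single vector. -/
theorem norm_sum_smul_sq_le {ι : Type*} [DecidableEq ι] {T : Finset ι} {c : ι → ℝ} {v : ι → E}
    {m d : ℝ} (hc : ∀ f ∈ T, 0 ≤ c f) (hm : ∀ f ∈ T, ‖v f‖ ≤ m)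
    (hd : ∀ f ∈ T, ∀ g ∈ T, f ≠ g → 2 * d ≤ ‖v f - v g‖ ^ 2) :
    ‖∑ f ∈ T, c f • v f‖ ^ 2 ≤
      m ^ 2 * (∑ f ∈ T, c f) ^ 2 - d * ((∑ f ∈ T, c f) ^ 2 - ∑ f ∈ T, c f ^ 2) := by
  have hterm : ∀ f ∈ T, ∀ g ∈ T, inner ℝ (c f • v f) (c g • v g) ≤
      c f * c g * (m ^ 2 - d) + (if f = g then d * c f ^ 2 else 0) := by
    intro f hf g hg
    rw [inner_smul_left, inner_smul_right]
    simp only [conj_trivial]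
    have hf2 : ‖v f‖ ^ 2 ≤ m ^ 2 := pow_le_pow_left₀ (norm_nonneg _) (hm f hf) 2
    have hg2 : ‖v g‖ ^ 2 ≤ m ^ 2 := pow_le_pow_left₀ (norm_nonneg _) (hm g hg) 2
    by_cases hfg' : f = g
    · subst hfg'
      rw [real_inner_self_eq_norm_sq, if_pos rfl]
      nlinarith [mul_le_mul_of_nonneg_left hf2 (sq_nonneg (c f))]
    · rw [if_neg hfg', add_zero, ← mul_assoc]
      refine mul_le_mul_of_nonneg_left ?_ (mul_nonneg (hc f hf) (hc g hg))
      have h2 := hd f hf g hg hfg'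
      rw [norm_sub_sq_real] at h2
      linarith
  rw [← real_inner_self_eq_norm_sq, sum_inner]
  simp_rw [inner_sum]
  refine (Finset.sum_le_sum fun f hf => Finset.sum_le_sum fun g hg => hterm f hf g hg).trans
    (le_of_eq ?_)
  have h3 : ∑ f ∈ T, ∑ g ∈ T, c f * c g * (m ^ 2 - d) = (∑ f ∈ T, c f) ^ 2 * (m ^ 2 - d) := by
    simp only [← Finset.sum_mul, ← Finset.mul_sum]
    ring
  have h4 : ∑ f ∈ T, ∑ g ∈ T, (if f = g then d * c f ^ 2 else 0) = d * ∑ f ∈ T, c f ^ 2 := by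
    rw [Finset.mul_sum]
    refine Finset.sum_congr rfl fun f hf => ?_
    rw [Finset.sum_ite_eq, if_pos hf]
  simp only [Finset.sum_add_distrib, h3, h4]
  ring

/-- One step of successive projection. The vectors `w f` with `f ∈ Sel` have been found, up to an
error `τ`, as `w' f`, and `U` is spanned by them. A column of maximal residual is then close to a
vertex `w f₀` that has not been found before, with an accuracy that does not depend on `τ`. -/
theorem exists_near_vertex_of_max_residual {γ : Type*} {w w' : Fin F → E} {h : γ → Fin F → ℝ}
    {y : γ → E} {s K ν τ : ℝ} {Sel : Finset (Fin F)} (hs : 0 < s)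
    (hw : ∀ x : Fin F → ℝ, s ^ 2 * ∑ f, x f ^ 2 ≤ ‖∑ f, x f • w f‖ ^ 2)
    (hK : ∀ f, ‖w f‖ ≤ K) (h0 : ∀ c f, 0 ≤ h c f) (h1 : ∀ c, ∑ f, h c f = 1)
    (hν : 0 ≤ ν) (hνs : 24 * ν ≤ s) (hy : ∀ c, ‖y c - ∑ f, h c f • w f‖ ≤ ν)
    (hnear : ∀ f, ∃ c, ‖y c - w f‖ ≤ 2 * ν)
    (hτ : 0 ≤ τ) (hτs : 4 * F * τ ≤ s) (hw' : ∀ f, ‖w' f - w f‖ ≤ τ)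
    (hsel : ∀ f ∉ Sel, w' f = w f) (hSel : Sel ≠ Finset.univ) (c : γ)
    (hc : ∀ q, ‖(Submodule.span ℝ (w' '' Sel))ᗮ.starProjection (y q)‖ ≤
      ‖(Submodule.span ℝ (w' '' Sel))ᗮ.starProjection (y c)‖) :
    ∃ f₀ ∉ Sel, 1 - 72 * K * ν / s ^ 2 ≤ h c f₀ := by
  classical
  set U := Submodule.span ℝ (w' '' (Sel : Set (Fin F)))
  set Q : E → E := fun v => Uᗮ.starProjection v with hQ
  have hQle : ∀ v, ‖Q v‖ ≤ ‖v‖ := fun v => Uᗮ.norm_starProjection_apply_le v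
  have hQsub : ∀ u v, Q (u - v) = Q u - Q v := fun u v => map_sub _ u v
  have hQsm : ∀ (a : ℝ) v, Q (a • v) = a • Q v := fun a v => map_smul _ a v
  have hQsum : ∀ (S : Finset (Fin F)) (g : Fin F → E), Q (∑ f ∈ S, g f) = ∑ f ∈ S, Q (g f) :=
    fun S g => map_sum _ _ _
  have hQU : ∀ u ∈ U, Q u = 0 := fun u hu => by
    have := U.starProjection_orthogonal_val (𝕜 := ℝ) u
    simp only [hQ, this, Submodule.starProjection_eq_self_iff.2 hu, sub_self]
  -- the residuals of the vertices found so far are small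
  have hQsel : ∀ f ∈ Sel, ‖Q (w f)‖ ≤ τ := fun f hf => by
    have h2 : Q (w' f) = 0 := hQU _ (Submodule.subset_span ⟨f, hf, rfl⟩)
    have h3 : ‖Q (w f)‖ = ‖Q (w' f - w f)‖ := by rw [hQsub, h2, zero_sub, norm_neg]
    rw [h3]; exact (hQle _).trans (hw' f)
  -- the residuals of the other vertices are well conditioned
  have hlow : ∀ x : Fin F → ℝ, (∀ f ∈ Sel, x f = 0) →
      (s / 2) ^ 2 * ∑ f, x f ^ 2 ≤ ‖Q (∑ f, x f • w f)‖ ^ 2 := by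
    exact fun x hx => half_mul_sq_le_norm_residual hs hw hτs hw' hsel x hx
  set T := Selᶜ with hT
  have hTne : T.Nonempty := by
    rw [hT, Finset.nonempty_iff_ne_empty, Ne, Finset.compl_eq_empty_iff]; exact hSel
  obtain ⟨fm, hfmT, hfm⟩ := T.exists_max_image (fun f => ‖Q (w f)‖) hTne
  set m := ‖Q (w fm)‖
  have hmK : m ≤ K := (hQle _).trans (hK fm)
  have hsingle : ∀ f ∉ Sel, s / 2 ≤ ‖Q (w f)‖ := by
    intro f hf
    have h2 := hlow (Pi.single f 1) fun g hg => by
      rw [Pi.single_eq_of_ne]; rintro rfl; exact hf hg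
    rw [sum_single_sq, sum_single_smul, mul_one] at h2
    exact le_of_sq_le_sq h2 (norm_nonneg _)
  have hms : s / 2 ≤ m := hsingle fm (by simpa [hT] using hfmT)
  have hF1 : (1 : ℝ) ≤ F := by
    have := fm.2
    exact_mod_cast (by omega : 1 ≤ F)
  have hτ4 : 4 * τ ≤ s := by nlinarith
  have hsK : s ≤ K := (le_norm_of_sq_mul_le hw fm).trans (hK fm)
  obtain ⟨cm, hcm⟩ := hnear fm
  have hyc : m - 2 * ν ≤ ‖Q (y c)‖ := by
    refine le_trans ?_ (hc cm)
    have h2 : ‖Q (w fm)‖ ≤ ‖Q (y cm)‖ + ‖Q (y cm - w fm)‖ := by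
      have : Q (w fm) = Q (y cm) - Q (y cm - w fm) := by rw [← hQsub]; congr 1; abel
      rw [this]; exact norm_sub_le _ _
    have h3 := (hQle (y cm - w fm)).trans hcm
    change m - 2 * ν ≤ ‖Q (y cm)‖
    linarith
  set hS := ∑ f ∈ Sel, h c f with hhS
  set hTs := ∑ f ∈ T, h c f with hhT
  have hST : hS + hTs = 1 := by rw [hhS, hhT, hT, Finset.sum_add_sum_compl, h1 c]
  have hS0 : 0 ≤ hS := Finset.sum_nonneg fun f _ => h0 c f
  have hT0 : 0 ≤ hTs := Finset.sum_nonneg fun f _ => h0 c f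
  set X := ‖∑ f ∈ T, h c f • Q (w f)‖ with hX
  have hX0 : 0 ≤ X := norm_nonneg _
  have hyX : ‖Q (y c)‖ ≤ X + hS * τ + ν := by
    have h2 : Q (y c) = ∑ f ∈ T, h c f • Q (w f) + ∑ f ∈ Sel, h c f • Q (w f) +
        Q (y c - ∑ f, h c f • w f) := by
      rw [add_comm (∑ f ∈ T, _), hT, Finset.sum_add_sum_compl, hQsub, hQsum]
      simp only [hQsm]; abel
    rw [h2]
    refine (norm_add_le _ _).trans (add_le_add ((norm_add_le _ _).trans (add_le_add le_rfl ?_))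
      ((hQle _).trans (hy c)))
    refine (norm_sum_le _ _).trans ?_
    rw [hhS, Finset.sum_mul]
    refine Finset.sum_le_sum fun f hf => ?_
    rw [norm_smul, Real.norm_of_nonneg (h0 c f)]
    exact mul_le_mul_of_nonneg_left (hQsel f hf) (h0 c f)
  have hXm : X ≤ hTs * m := by
    refine (norm_sum_le _ _).trans ?_
    rw [hhT, Finset.sum_mul]
    refine Finset.sum_le_sum fun f hf => ?_
    rw [norm_smul, Real.norm_of_nonneg (h0 c f)]
    exact mul_le_mul_of_nonneg_left (hfm f hf) (h0 c f)
  have hSle : hS * s ≤ 12 * ν := by nlinarith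
  have hXlow : m - 6 * ν ≤ X := by nlinarith
  have hX2 : m ^ 2 - 12 * m * ν ≤ X ^ 2 := by nlinarith
  -- expand the square of the residual of the convex combination
  have hexp : X ^ 2 ≤ m ^ 2 * hTs ^ 2 - s ^ 2 / 4 * (hTs ^ 2 - ∑ f ∈ T, h c f ^ 2) := by
    have h2 := norm_sum_smul_sq_le (T := T) (c := h c) (v := fun f => Q (w f)) (m := m)
      (d := s ^ 2 / 4) (fun f _ => h0 c f) hfm fun f hf g hg hfg => ?_
    · rw [hX, hhT]; exact h2
    · have h2 := hlow (Pi.single f 1 - Pi.single g 1) fun k hk => by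
        have h3 : k ≠ f := by rintro rfl; simp [hT] at hf; exact hf hk
        have h4 : k ≠ g := by rintro rfl; simp [hT] at hg; exact hg hk
        simp [h3, h4]
      have h3 : ∑ k, (Pi.single f 1 - Pi.single g 1 : Fin F → ℝ) k ^ 2 = 2 := by
        have : ∀ k, (Pi.single f 1 - Pi.single g 1 : Fin F → ℝ) k ^ 2 =
            (Pi.single f (1 : ℝ) : Fin F → ℝ) k ^ 2 + (Pi.single g (1 : ℝ) : Fin F → ℝ) k ^ 2 := by
          intro k
          by_cases hk : k = f
          · subst hk; simp [hfg]
          · simp [hk]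
        simp only [this, Finset.sum_add_distrib, sum_single_sq]
        norm_num
      have h4 : ∑ k, (Pi.single f 1 - Pi.single g 1 : Fin F → ℝ) k • w k = w f - w g := by
        simp only [Pi.sub_apply, sub_smul, Finset.sum_sub_distrib, sum_single_smul]
      rw [h3, h4, hQsub] at h2
      linarith
  obtain ⟨f₀, hf₀T, hf₀⟩ := T.exists_max_image (fun f => h c f) hTne
  refine ⟨f₀, by simpa [hT] using hf₀T, ?_⟩
  have hmax : ∑ f ∈ T, h c f ^ 2 ≤ h c f₀ := by
    have h2 : ∑ f ∈ T, h c f ^ 2 ≤ ∑ f ∈ T, h c f₀ * h c f :=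
      Finset.sum_le_sum fun f hf => by
        rw [sq]; exact mul_le_mul_of_nonneg_right (hf₀ f hf) (h0 c f)
    rw [← Finset.mul_sum] at h2
    have h3 : h c f₀ * hTs ≤ h c f₀ * 1 := mul_le_mul_of_nonneg_left (by linarith) (h0 c f₀)
    rw [← hhT] at h2
    linarith
  have hs2 : 0 < s ^ 2 := by positivity
  have hsum : s ^ 2 * (hTs ^ 2 - ∑ f ∈ T, h c f ^ 2) ≤ 48 * (K * ν) := by
    have h5 : m ^ 2 * hTs ^ 2 ≤ m ^ 2 := by
      have : hTs ^ 2 ≤ 1 := by nlinarith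
      nlinarith [sq_nonneg m]
    have h6 : m * ν ≤ K * ν := mul_le_mul_of_nonneg_right hmK hν
    linarith [hexp, hX2]
  have hsT : s ^ 2 * (1 - hTs ^ 2) ≤ 24 * (K * ν) := by
    have h5 : 1 - hTs ^ 2 ≤ 2 * hS := by nlinarith
    have h6 : s * ν ≤ K * ν := mul_le_mul_of_nonneg_right hsK hν
    calc s ^ 2 * (1 - hTs ^ 2) ≤ s ^ 2 * (2 * hS) := mul_le_mul_of_nonneg_left h5 hs2.le
      _ = 2 * s * (hS * s) := by ring
      _ ≤ 2 * s * (12 * ν) := mul_le_mul_of_nonneg_left hSle (by positivity)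
      _ = 24 * (s * ν) := by ring
      _ ≤ 24 * (K * ν) := by linarith
  have hfin : s ^ 2 * (1 - h c f₀) ≤ 72 * K * ν := by
    linarith [mul_le_mul_of_nonneg_left hmax hs2.le]
  rw [sub_le_comm, le_div_iff₀ hs2]
  linarith

/-- **Robustness of successive projection.** If the columns `y c` are convex combinations of the
vertices `w f` up to an error `ν` that is small compared with `s³ / K²`, and every vertex is almost
attained, then successive projection finds, in some order, columns whose weights are concentrated
on a single vertex. -/
theorem exists_perm_of_successive_projection {γ : Type*} {w : Fin F → E} {h : γ → Fin F → ℝ}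
    {y : γ → E} {s K ν : ℝ} (hs : 0 < s)
    (hw : ∀ x : Fin F → ℝ, s ^ 2 * ∑ f, x f ^ 2 ≤ ‖∑ f, x f • w f‖ ^ 2)
    (hK : ∀ f, ‖w f‖ ≤ K) (h0 : ∀ c f, 0 ≤ h c f) (h1 : ∀ c, ∑ f, h c f = 1)
    (hν : 0 ≤ ν) (hνs : 864 * F * (K ^ 2 * ν) ≤ s ^ 3)
    (hy : ∀ c, ‖y c - ∑ f, h c f • w f‖ ≤ ν) (hnear : ∀ f, ∃ c, ‖y c - w f‖ ≤ 2 * ν)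
    (Λ : Fin F → γ)
    (hΛ : ∀ (f : Fin F) (q : γ),
      ‖(Submodule.span ℝ {v | ∃ g < f, v = y (Λ g)})ᗮ.starProjection (y q)‖ ≤
        ‖(Submodule.span ℝ {v | ∃ g < f, v = y (Λ g)})ᗮ.starProjection (y (Λ f))‖) :
    ∃ π : Equiv.Perm (Fin F), ∀ f, 1 - 72 * K * ν / s ^ 2 ≤ h (Λ f) (π f) := by
  classical
  rcases Nat.eq_zero_or_pos F with hF | hF
  · subst hF
    exact ⟨1, fun f => f.elim0⟩
  have hF1 : (1 : ℝ) ≤ F := by exact_mod_cast hF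
  have hsK : s ≤ K := (le_norm_of_sq_mul_le hw ⟨0, hF⟩).trans (hK _)
  have hs2 : 0 < s ^ 2 := by positivity
  have hK0 : 0 < K := hs.trans_le hsK
  set β := 72 * K * ν / s ^ 2 with hβ
  set τ := 3 * K * β with hτ
  have hτ0 : 0 ≤ τ := by positivity
  have hτs : 4 * F * τ ≤ s := by
    have : 4 * F * τ = 864 * F * (K ^ 2 * ν) / s ^ 2 := by rw [hτ, hβ]; ring
    rw [this, div_le_iff₀ hs2]; linarith [hνs, pow_succ s 2]
  have hνK : s ^ 2 * ν ≤ K ^ 2 * ν :=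
    mul_le_mul_of_nonneg_right (pow_le_pow_left₀ hs.le hsK 2) hν
  have hν24 : 24 * ν ≤ s := by
    have h5 : 864 * (K ^ 2 * ν) ≤ 864 * F * (K ^ 2 * ν) := by
      have : 0 ≤ K ^ 2 * ν := by positivity
      nlinarith
    have h6 : 24 * (s ^ 2 * ν) ≤ s ^ 3 := by nlinarith
    have h7 : s ^ 2 * (24 * ν) ≤ s ^ 2 * s := by linarith [pow_succ s 2]
    exact le_of_mul_le_mul_left h7 hs2
  have hνβ : ν ≤ K * β := by
    rw [hβ, mul_div_assoc', le_div_iff₀ hs2]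
    nlinarith [mul_nonneg (sq_nonneg K) hν]
  -- a column whose weight is concentrated on `f₀` is close to `w f₀`
  have hclose : ∀ c f₀, 1 - β ≤ h c f₀ → ‖y c - w f₀‖ ≤ τ := by
    intro c f₀ hc
    have h2 : ‖∑ f, h c f • w f - w f₀‖ ≤ 2 * (K * β) := by
      have h3 : ∑ f, h c f • w f - w f₀ = ∑ f ∈ Finset.univ.erase f₀, h c f • w f -
          (1 - h c f₀) • w f₀ := by
        rw [← Finset.add_sum_erase _ _ (Finset.mem_univ f₀), sub_smul, one_smul]; abel
      have h4 : ∑ f ∈ Finset.univ.erase f₀, h c f = 1 - h c f₀ := by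
        rw [← h1 c, ← Finset.add_sum_erase _ _ (Finset.mem_univ f₀)]; ring
      have h5 : 0 ≤ 1 - h c f₀ := h4 ▸ Finset.sum_nonneg fun f _ => h0 c f
      rw [h3]
      refine (norm_sub_le _ _).trans ?_
      have h6 : ‖∑ f ∈ Finset.univ.erase f₀, h c f • w f‖ ≤ (1 - h c f₀) * K := by
        refine (norm_sum_le _ _).trans ?_
        rw [← h4, Finset.sum_mul]
        refine Finset.sum_le_sum fun f _ => ?_
        rw [norm_smul, Real.norm_of_nonneg (h0 c f)]
        exact mul_le_mul_of_nonneg_left (hK f) (h0 c f)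
      have h7 : ‖(1 - h c f₀) • w f₀‖ ≤ (1 - h c f₀) * K := by
        rw [norm_smul, Real.norm_of_nonneg h5]
        exact mul_le_mul_of_nonneg_left (hK _) h5
      nlinarith
    have h3 : y c - w f₀ = (y c - ∑ f, h c f • w f) + (∑ f, h c f • w f - w f₀) := by abel
    rw [h3]
    refine (norm_add_le _ _).trans ((add_le_add (hy c) h2).trans ?_)
    rw [hτ]; linarith
  have main : ∀ n : ℕ, n ≤ F → ∃ (Sel : Finset (Fin F)) (w' : Fin F → E) (π : Fin F → Fin F),
      (∀ f ∉ Sel, w' f = w f) ∧ (∀ f, ‖w' f - w f‖ ≤ τ) ∧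
      {v | ∃ g : Fin F, (g : ℕ) < n ∧ v = y (Λ g)} = w' '' (Sel : Set (Fin F)) ∧
      Sel = (Finset.univ.filter fun g : Fin F => (g : ℕ) < n).image π ∧ Sel.card = n ∧
      ∀ g : Fin F, (g : ℕ) < n → 1 - β ≤ h (Λ g) (π g) := by
    intro n
    induction n with
    | zero =>
      intro _
      exact ⟨∅, w, id, by simp, fun _ => by simpa using hτ0, by simp, by simp, by simp, by simp⟩
    | succ n ih =>
      intro hn
      obtain ⟨Sel, w', π, hA, hB, hC, hD, hE, hG⟩ := ih (by omega)
      have hne : Sel ≠ Finset.univ := by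
        rintro rfl
        rw [Finset.card_univ, Fintype.card_fin] at hE
        omega
      set fn : Fin F := ⟨n, by omega⟩ with hfn
      have hset : {v | ∃ g < fn, v = y (Λ g)} = w' '' (Sel : Set (Fin F)) := hC
      have hmax := hΛ fn
      rw [hset] at hmax
      obtain ⟨f₀, hf₀, hf₀'⟩ := exists_near_vertex_of_max_residual hs hw hK h0 h1 hν hν24 hy hnear
        hτ0 hτs hB hA hne (Λ fn) hmax
      have hlt : ∀ g : Fin F, (g : ℕ) < n + 1 ↔ (g : ℕ) < n ∨ g = fn := by
        intro g
        rw [Fin.ext_iff]; simp only [hfn]; omega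
      have himg : (Finset.univ.filter fun g : Fin F => (g : ℕ) < n + 1).image
          (Function.update π fn f₀) = insert f₀ Sel := by
        ext k
        simp only [Finset.mem_image, Finset.mem_filter, Finset.mem_univ, true_and, hlt,
          Finset.mem_insert, hD]
        constructor
        · rintro ⟨g, hg | rfl, rfl⟩
          · have : g ≠ fn := by rintro rfl; simp [hfn] at hg
            exact Or.inr ⟨g, hg, by simp [this]⟩
          · simp
        · rintro (rfl | ⟨g, hg, rfl⟩)
          · exact ⟨fn, Or.inr rfl, by simp⟩
          · have : g ≠ fn := by rintro rfl; simp [hfn] at hg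
            exact ⟨g, Or.inl hg, by simp [this]⟩
      refine ⟨insert f₀ Sel, Function.update w' f₀ (y (Λ fn)), Function.update π fn f₀,
        ?_, ?_, ?_, himg.symm, ?_, ?_⟩
      · intro f hf
        rw [Finset.mem_insert, not_or] at hf
        rw [Function.update_of_ne hf.1]; exact hA f hf.2
      · intro f
        by_cases hf : f = f₀
        · subst hf
          rw [Function.update_self]
          exact hclose _ _ hf₀'
        · rw [Function.update_of_ne hf]; exact hB f
      · have hS : Function.update w' f₀ (y (Λ fn)) '' ((insert f₀ Sel : Finset (Fin F)) :
            Set (Fin F)) = insert (y (Λ fn)) (w' '' (Sel : Set (Fin F))) := by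
          rw [Finset.coe_insert, Set.image_insert_eq, Function.update_self]
          congr 1
          refine Set.image_congr fun k hk => ?_
          rw [Function.update_of_ne]
          rintro rfl; exact hf₀ hk
        rw [hS, ← hC]
        ext v
        simp only [Set.mem_ofPred_eq, Set.mem_insert_iff, hlt]
        constructor
        · rintro ⟨g, hg | rfl, rfl⟩
          · exact Or.inr ⟨g, hg, rfl⟩
          · exact Or.inl rfl
        · rintro (rfl | ⟨g, hg, rfl⟩)
          · exact ⟨fn, Or.inr rfl, rfl⟩
          · exact ⟨g, Or.inl hg, rfl⟩
      · rw [Finset.card_insert_of_notMem hf₀, hE]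
      · intro g hg
        rcases (hlt g).1 hg with hg' | rfl
        · have : g ≠ fn := by rintro rfl; simp [hfn] at hg'
          rw [Function.update_of_ne this]; exact hG g hg'
        · rw [Function.update_self]; exact hf₀'
  obtain ⟨Sel, w', π, -, -, -, hD, hE, hG⟩ := main F le_rfl
  have hfil : (Finset.univ.filter fun g : Fin F => (g : ℕ) < F) = Finset.univ :=
    Finset.filter_true_of_mem fun g _ => g.2
  rw [hfil] at hD
  have hsurj : Function.Surjective π := by
    intro k
    have : Sel = Finset.univ := by
      rw [← Finset.card_eq_iff_eq_univ, hE, Fintype.card_fin]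
    have hk : k ∈ Sel := this ▸ Finset.mem_univ k
    rw [hD] at hk
    simpa using hk
  refine ⟨Equiv.ofBijective π (Finite.injective_iff_bijective.1
    (Finite.injective_iff_surjective.2 hsurj)), fun f => ?_⟩
  exact hG f f.2

end SuccessiveProjection

/-! ### Concentration of sums of independent vectors -/

section Concentration

/-- The Huber function: quadratic up to `R`, and linear from there on. -/
noncomputable def huber (R r : ℝ) : ℝ := if r ≤ R then r ^ 2 else 2 * R * r - R ^ 2

theorem huber_zero {R : ℝ} (hR : 0 ≤ R) : huber R 0 = 0 := by
  simp [huber, hR]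

theorem min_sq_le_huber {R r : ℝ} (hR : 0 ≤ R) : min (r ^ 2) (R ^ 2) ≤ huber R r := by
  unfold huber
  split_ifs with h
  · exact min_le_left _ _
  · exact (min_le_right _ _).trans (by nlinarith)

theorem huber_nonneg {R r : ℝ} (hR : 0 ≤ R) : 0 ≤ huber R r :=
  (le_min (sq_nonneg _) (sq_nonneg _)).trans (min_sq_le_huber hR)

/-- As a function of `r²`, the Huber function is concave: it lies below its tangents. -/
theorem exists_huber_tangent {R : ℝ} (hR : 0 ≤ R) {r : ℝ} (hr : 0 ≤ r) :
    ∃ a : ℝ, 0 ≤ a ∧ a ≤ 1 ∧ a * r ≤ R ∧ (a * r) ^ 2 ≤ huber R r ∧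
      ∀ u, 0 ≤ u → huber R u ≤ huber R r + a * (u ^ 2 - r ^ 2) := by
  by_cases h : r ≤ R
  · refine ⟨1, zero_le_one, le_rfl, by linarith, by simp [huber, h], fun u hu => ?_⟩
    simp only [huber, h, if_true]
    split_ifs with h'
    · linarith
    · nlinarith [sq_nonneg (u - R)]
  · push Not at h
    have hr0 : 0 < r := hR.trans_lt h
    have hm : R / r * r = R := div_mul_cancel₀ R hr0.ne'
    refine ⟨R / r, by positivity, (div_le_one hr0).2 h.le, hm.le, ?_, fun u hu => ?_⟩
    · rw [hm, huber, if_neg (not_le.2 h)]; nlinarith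
    · rw [huber, huber, if_neg (not_le.2 h)]
      set a := R / r with ha
      have ha0 : 0 ≤ a := by positivity
      have hRa : R = a * r := hm.symm
      have ha1 : a ≤ 1 := (div_le_one hr0).2 h.le
      have key : a * (u ^ 2 - r ^ 2) = a * (u - r) ^ 2 + 2 * R * u - 2 * R * r := by
        rw [hRa]; ring
      split_ifs with h'
      · have h3 : u ^ 2 = (R - u) ^ 2 + 2 * R * u - R ^ 2 := by ring
        have h4 : (R - u) ^ 2 ≤ a * (u - r) ^ 2 := by
          have h5 : 0 ≤ R - u := by linarith
          have h6 : R - u ≤ a * (r - u) := by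
            have : a * u ≤ u := by nlinarith
            rw [hRa] at *; nlinarith
          calc (R - u) ^ 2 ≤ (a * (r - u)) ^ 2 := pow_le_pow_left₀ h5 h6 2
            _ = a * (a * (u - r) ^ 2) := by ring
            _ ≤ 1 * (a * (u - r) ^ 2) := mul_le_mul_of_nonneg_right ha1 (by positivity)
            _ = a * (u - r) ^ 2 := one_mul _
        linarith
      · have : 0 ≤ a * (u - r) ^ 2 := by positivity
        linarith

theorem exp_le_one_add_add_sq {z : ℝ} (hz : |z| ≤ 1) : Real.exp z ≤ 1 + z + z ^ 2 := by
  have := Real.abs_exp_sub_one_sub_id_le hz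
  have := abs_le.1 this
  linarith [this.2]

variable {E : Type*} [NormedAddCommGroup E] [InnerProductSpace ℝ E] {α : Type*} [Fintype α]

/-- Adding one centered bounded random vector. -/
theorem sum_mul_exp_huber_le {p : α → ℝ} {y : α → E} {b v R t : ℝ} (hp : ∀ a, 0 ≤ p a)
    (hp1 : ∑ a, p a = 1) (hmean : ∑ a, p a • y a = 0) (hb : ∀ a, ‖y a‖ ≤ b)
    (hv : ∑ a, p a * ‖y a‖ ^ 2 ≤ v) (hR : 0 ≤ R) (ht : 0 ≤ t) (hRb : 4 * t * R * b ≤ 1)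
    (htb : 2 * t * b ^ 2 ≤ 1) (x : E) :
    ∑ a, p a * Real.exp (t * huber R ‖x + y a‖) ≤
      Real.exp (2 * t * v + t * (1 + 8 * t * v) * huber R ‖x‖) := by
  obtain ⟨c, hc0, hc1, hcR, hc2, htan⟩ := exists_huber_tangent hR (norm_nonneg x)
  have hv0 : 0 ≤ v := le_trans (Finset.sum_nonneg fun a _ => mul_nonneg (hp a) (sq_nonneg _)) hv
  set z : α → ℝ := fun a => t * c * (2 * inner ℝ x (y a) + ‖y a‖ ^ 2) with hz
  have htc : 0 ≤ t * c := mul_nonneg ht hc0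
  have hH := huber_nonneg (r := ‖x‖) hR
  have hin : ∀ a, |inner ℝ x (y a)| ≤ ‖x‖ * ‖y a‖ := fun a => abs_real_inner_le_norm _ _
  have hz1 : ∀ a, |z a| ≤ 1 := by
    intro a
    have hb0 : 0 ≤ b := (norm_nonneg _).trans (hb a)
    have h1 : |2 * inner ℝ x (y a) + ‖y a‖ ^ 2| ≤ 2 * (‖x‖ * b) + b ^ 2 := by
      refine (abs_add_le _ _).trans (add_le_add ?_ ?_)
      · rw [abs_mul, abs_two]
        exact mul_le_mul_of_nonneg_left ((hin a).trans
          (mul_le_mul_of_nonneg_left (hb a) (norm_nonneg _))) two_pos.le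
      · rw [abs_of_nonneg (sq_nonneg _)]
        exact pow_le_pow_left₀ (norm_nonneg _) (hb a) 2
    rw [hz]; simp only
    rw [abs_mul, abs_of_nonneg htc]
    calc t * c * |2 * inner ℝ x (y a) + ‖y a‖ ^ 2| ≤ t * c * (2 * (‖x‖ * b) + b ^ 2) :=
          mul_le_mul_of_nonneg_left h1 htc
      _ = 2 * t * b * (c * ‖x‖) + c * (t * b ^ 2) := by ring
      _ ≤ 2 * t * b * R + 1 * (t * b ^ 2) := by gcongr
      _ ≤ 1 := by linarith
  have hstep : ∀ a, p a * Real.exp (t * huber R ‖x + y a‖) ≤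
      Real.exp (t * huber R ‖x‖) * (p a * (1 + z a + z a ^ 2)) := by
    intro a
    have h1 : t * huber R ‖x + y a‖ ≤ t * huber R ‖x‖ + z a := by
      have h2 := htan ‖x + y a‖ (norm_nonneg _)
      rw [norm_add_sq_real] at h2
      have h3 := mul_le_mul_of_nonneg_left h2 ht
      rw [hz]; simp only
      linarith
    calc p a * Real.exp (t * huber R ‖x + y a‖) ≤ p a * Real.exp (t * huber R ‖x‖ + z a) :=
          mul_le_mul_of_nonneg_left (Real.exp_le_exp.2 h1) (hp a)
      _ = Real.exp (t * huber R ‖x‖) * (p a * Real.exp (z a)) := by rw [Real.exp_add]; ring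
      _ ≤ _ := mul_le_mul_of_nonneg_left (mul_le_mul_of_nonneg_left
          (exp_le_one_add_add_sq (hz1 a)) (hp a)) (Real.exp_pos _).le
  have hz2 : ∑ a, p a * (1 + z a + z a ^ 2) ≤ 1 + (2 * t * v + 8 * t ^ 2 * v * huber R ‖x‖) := by
    have h0 : ∑ a, p a * inner ℝ x (y a) = 0 := by
      have : ∑ a, p a * inner ℝ x (y a) = inner ℝ x (∑ a, p a • y a) := by
        rw [inner_sum]
        exact Finset.sum_congr rfl fun a _ => (inner_smul_right _ _ _).symm
      rw [this, hmean, inner_zero_right]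
    have hsq : ∀ a, z a ^ 2 ≤ (8 * t ^ 2 * huber R ‖x‖ + t) * ‖y a‖ ^ 2 := by
      intro a
      have h1 : inner ℝ x (y a) ^ 2 ≤ ‖x‖ ^ 2 * ‖y a‖ ^ 2 := by
        rw [← sq_abs, ← mul_pow]; exact pow_le_pow_left₀ (abs_nonneg _) (hin a) 2
      have h2 : ‖y a‖ ^ 2 ≤ b ^ 2 := pow_le_pow_left₀ (norm_nonneg _) (hb a) 2
      have h3 : (2 * inner ℝ x (y a) + ‖y a‖ ^ 2) ^ 2 ≤
          8 * (‖x‖ ^ 2 * ‖y a‖ ^ 2) + 2 * (b ^ 2 * ‖y a‖ ^ 2) := by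
        have h4 : (‖y a‖ ^ 2) ^ 2 ≤ b ^ 2 * ‖y a‖ ^ 2 := by
          rw [sq (‖y a‖ ^ 2)]; exact mul_le_mul_of_nonneg_right h2 (sq_nonneg _)
        nlinarith [sq_nonneg (2 * inner ℝ x (y a) - ‖y a‖ ^ 2)]
      calc z a ^ 2 = t ^ 2 * c ^ 2 * (2 * inner ℝ x (y a) + ‖y a‖ ^ 2) ^ 2 := by rw [hz]; ring
        _ ≤ t ^ 2 * c ^ 2 * (8 * (‖x‖ ^ 2 * ‖y a‖ ^ 2) + 2 * (b ^ 2 * ‖y a‖ ^ 2)) :=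
            mul_le_mul_of_nonneg_left h3 (by positivity)
        _ = 8 * t ^ 2 * (c * ‖x‖) ^ 2 * ‖y a‖ ^ 2 + c ^ 2 * (t * (2 * t * b ^ 2)) * ‖y a‖ ^ 2 := by
            ring
        _ ≤ 8 * t ^ 2 * huber R ‖x‖ * ‖y a‖ ^ 2 + 1 * (t * 1) * ‖y a‖ ^ 2 := by
            gcongr
            exact pow_le_one₀ hc0 hc1
        _ = _ := by ring
    have hz' : ∑ a, p a * z a ≤ t * v := by
      have : ∑ a, p a * z a = t * c * (2 * ∑ a, p a * inner ℝ x (y a) +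
          ∑ a, p a * ‖y a‖ ^ 2) := by
        rw [mul_add, Finset.mul_sum, Finset.mul_sum, Finset.mul_sum, ← Finset.sum_add_distrib]
        exact Finset.sum_congr rfl fun a _ => by rw [hz]; ring
      rw [this, h0, mul_zero, zero_add]
      calc t * c * ∑ a, p a * ‖y a‖ ^ 2 ≤ t * c * v := mul_le_mul_of_nonneg_left hv htc
        _ = c * (t * v) := by ring
        _ ≤ 1 * (t * v) := mul_le_mul_of_nonneg_right hc1 (by positivity)
        _ = t * v := one_mul _
    have hz'' : ∑ a, p a * z a ^ 2 ≤ (8 * t ^ 2 * huber R ‖x‖ + t) * v := by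
      refine le_trans ?_ (mul_le_mul_of_nonneg_left hv (by positivity))
      rw [Finset.mul_sum]
      refine Finset.sum_le_sum fun a _ => ?_
      calc p a * z a ^ 2 ≤ p a * ((8 * t ^ 2 * huber R ‖x‖ + t) * ‖y a‖ ^ 2) :=
            mul_le_mul_of_nonneg_left (hsq a) (hp a)
        _ = _ := by ring
    have : ∑ a, p a * (1 + z a + z a ^ 2) =
        ∑ a, p a + ∑ a, p a * z a + ∑ a, p a * z a ^ 2 := by
      rw [← Finset.sum_add_distrib, ← Finset.sum_add_distrib]
      exact Finset.sum_congr rfl fun a _ => by ring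
    rw [this, hp1]
    linarith
  calc ∑ a, p a * Real.exp (t * huber R ‖x + y a‖)
      ≤ ∑ a, Real.exp (t * huber R ‖x‖) * (p a * (1 + z a + z a ^ 2)) :=
        Finset.sum_le_sum fun a _ => hstep a
    _ = Real.exp (t * huber R ‖x‖) * ∑ a, p a * (1 + z a + z a ^ 2) := (Finset.mul_sum _ _ _).symm
    _ ≤ Real.exp (t * huber R ‖x‖) * Real.exp (2 * t * v + 8 * t ^ 2 * v * huber R ‖x‖) := by
        refine mul_le_mul_of_nonneg_left (hz2.trans ?_) (Real.exp_pos _).le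
        rw [add_comm]; exact Real.add_one_le_exp _
    _ = _ := by rw [← Real.exp_add]; congr 1; ring

theorem sum_fin_succ_pi {n : ℕ} {β : Type*} [AddCommMonoid β] (g : (Fin (n + 1) → α) → β) :
    ∑ d, g d = ∑ a, ∑ d : Fin n → α, g (Fin.cons a d) := by
  rw [← Fintype.sum_prod_type', ← (Fin.consEquiv fun _ => α).sum_comp]
  rfl

/-- The exponential moment of the Huber function of a sum of independent centered bounded random
vectors, bounded independently of the dimension. -/
theorem sum_prod_mul_exp_huber_le {b R T : ℝ} (hR : 0 ≤ R) (hRb : 4 * T * R * b ≤ 1)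
    (hTb : 2 * T * b ^ 2 ≤ 1) (hb0 : 0 ≤ b) :
    ∀ (n : ℕ) (p : Fin n → α → ℝ) (y : Fin n → α → E) (v : Fin n → ℝ),
      (∀ s a, 0 ≤ p s a) → (∀ s, ∑ a, p s a = 1) → (∀ s, ∑ a, p s a • y s a = 0) →
      (∀ s a, ‖y s a‖ ≤ b) → (∀ s, ∑ a, p s a * ‖y s a‖ ^ 2 ≤ v s) →
      ∀ (x : E) (t : ℝ), 0 ≤ t → t * Real.exp (8 * T * ∑ s, v s) ≤ T →
      ∑ d : Fin n → α, (∏ s, p s (d s)) * Real.exp (t * huber R ‖x + ∑ s, y s (d s)‖) ≤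
        Real.exp (2 * T * ∑ s, v s + t * Real.exp (8 * T * ∑ s, v s) * huber R ‖x‖) := by
  intro n
  induction n with
  | zero =>
    intro p y v _ _ _ _ _ x t _ _
    simp
  | succ n ih =>
    intro p y v hp hp1 hmean hb hv x t ht htT
    have hv0 : ∀ s, 0 ≤ v s := fun s =>
      le_trans (Finset.sum_nonneg fun a _ => mul_nonneg (hp s a) (sq_nonneg _)) (hv s)
    rw [Fin.sum_univ_succ] at htT ⊢
    set V := ∑ s : Fin n, v s.succ
    have hT : 0 ≤ T := le_trans (by positivity) htT
    set t' := t * Real.exp (8 * T * V) with ht'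
    have ht'0 : 0 ≤ t' := by positivity
    have hexp : t * Real.exp (8 * T * (v 0 + V)) = t' * Real.exp (8 * T * v 0) := by
      rw [ht', mul_add, Real.exp_add]; ring
    have ht'T : t' ≤ T := by
      refine le_trans ?_ htT
      rw [hexp]
      exact le_mul_of_one_le_right ht'0 (Real.one_le_exp (by have := hv0 0; positivity))
    have hH := huber_nonneg (r := ‖x‖) hR
    rw [sum_fin_succ_pi]
    calc ∑ a, ∑ d : Fin n → α, (∏ s, p s ((Fin.cons a d : Fin (n + 1) → α) s)) *
          Real.exp (t * huber R ‖x + ∑ s, y s ((Fin.cons a d : Fin (n + 1) → α) s)‖)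
        = ∑ a, p 0 a * ∑ d : Fin n → α, (∏ s, p s.succ (d s)) *
          Real.exp (t * huber R ‖x + y 0 a + ∑ s, y (Fin.succ s) (d s)‖) := by
          refine Finset.sum_congr rfl fun a _ => ?_
          rw [Finset.mul_sum]
          refine Finset.sum_congr rfl fun d _ => ?_
          rw [Fin.prod_univ_succ, Fin.sum_univ_succ]
          simp only [Fin.cons_zero, Fin.cons_succ, add_assoc, mul_assoc]
      _ ≤ ∑ a, p 0 a * Real.exp (2 * T * V + t' * huber R ‖x + y 0 a‖) :=
          Finset.sum_le_sum fun a _ => mul_le_mul_of_nonneg_left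
            (ih (fun s => p s.succ) (fun s => y s.succ) (fun s => v s.succ) (fun s => hp _)
              (fun s => hp1 _) (fun s => hmean _) (fun s => hb _) (fun s => hv _) (x + y 0 a) t ht
              ht'T) (hp 0 a)
      _ = Real.exp (2 * T * V) * ∑ a, p 0 a * Real.exp (t' * huber R ‖x + y 0 a‖) := by
          rw [Finset.mul_sum Finset.univ _ (Real.exp (2 * T * V))]
          exact Finset.sum_congr rfl fun a _ => by rw [Real.exp_add]; ring
      _ ≤ Real.exp (2 * T * V) *
          Real.exp (2 * t' * v 0 + t' * (1 + 8 * t' * v 0) * huber R ‖x‖) := by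
          refine mul_le_mul_of_nonneg_left ?_ (Real.exp_pos _).le
          refine sum_mul_exp_huber_le (hp 0) (hp1 0) (hmean 0) (hb 0) (hv 0) hR ht'0 ?_ ?_ x
          · refine le_trans ?_ hRb
            gcongr
          · refine le_trans ?_ hTb
            gcongr
      _ ≤ _ := by
          rw [← Real.exp_add, hexp]
          refine Real.exp_le_exp.2 ?_
          have h1 : 1 + 8 * t' * v 0 ≤ Real.exp (8 * T * v 0) := by
            have h2 := Real.add_one_le_exp (8 * T * v 0)
            have h3 : 8 * t' * v 0 ≤ 8 * T * v 0 := by have := hv0 0; gcongr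
            linarith
          have h4 : t' * (1 + 8 * t' * v 0) * huber R ‖x‖ ≤
              t' * Real.exp (8 * T * v 0) * huber R ‖x‖ := by gcongr
          have h5 : t' * v 0 ≤ T * v 0 := mul_le_mul_of_nonneg_right ht'T (hv0 0)
          linarith

/-- Concentration of the sum of the squared norms of independent blocks, each of which is a sum of
independent centered bounded vectors of total variance at most `V`. The number of blocks, but not
the dimension of the vectors, enters the bound. -/
theorem sum_prod_indicator_norm_sq_le {J : Type*} [Fintype J] [DecidableEq J] {n : ℕ} {b V K : ℝ}
    (p : J → Fin n → α → ℝ) (y : J → Fin n → α → E) (v : J → Fin n → ℝ)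
    (hp : ∀ j s a, 0 ≤ p j s a) (hp1 : ∀ j s, ∑ a, p j s a = 1)
    (hmean : ∀ j s, ∑ a, p j s a • y j s a = 0) (hb : ∀ j s a, ‖y j s a‖ ≤ b)
    (hv : ∀ j s, ∑ a, p j s a * ‖y j s a‖ ^ 2 ≤ v j s) (hvV : ∀ j, ∑ s, v j s ≤ V)
    (hb0 : 0 < b) (hV : 0 < V) (hVb : b ^ 2 ≤ 6 * V) (hVK : 8 * K * b ^ 2 ≤ 3 * V) :
    ∑ d : J → Fin n → α, (∏ j, ∏ s, p j s (d j s)) *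
      (if 24 * V * K ≤ ∑ j, ‖∑ s, y j s (d j s)‖ ^ 2 then 1 else 0) ≤
        Real.exp (-K + Fintype.card J / 6) := by
  set R := 3 * V / b with hR
  set T := 1 / (12 * V) with hT
  set t := 1 / (24 * V) with ht
  have hR0 : 0 ≤ R := by positivity
  have hblock : ∀ j, ∑ d : Fin n → α, (∏ s, p j s (d s)) *
      Real.exp (t * huber R ‖∑ s, y j s (d s)‖) ≤ Real.exp (1 / 6) := by
    intro j
    have hTV : T * V = 1 / 12 := by rw [hT]; field_simp
    have hT0 : 0 ≤ T := by positivity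
    have h1 : T * ∑ s, v j s ≤ 1 / 12 := hTV ▸ mul_le_mul_of_nonneg_left (hvV j) hT0
    have h2 := sum_prod_mul_exp_huber_le (E := E) (b := b) (R := R) (T := T) hR0
      (by rw [hR, hT]; field_simp; norm_num) (by rw [hT]; field_simp; linarith) hb0.le n (p j)
      (y j) (v j) (hp j) (hp1 j) (hmean j) (hb j) (hv j) 0 t (by positivity) (by
        have h3 : Real.exp (8 * T * ∑ s, v j s) ≤ 2 := by
          have h4 : 8 * T * ∑ s, v j s ≤ Real.log 2 := by
            have := Real.log_two_gt_d9; linarith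
          calc Real.exp (8 * T * ∑ s, v j s) ≤ Real.exp (Real.log 2) := Real.exp_le_exp.2 h4
            _ = 2 := Real.exp_log two_pos
        calc t * Real.exp (8 * T * ∑ s, v j s) ≤ t * 2 :=
              mul_le_mul_of_nonneg_left h3 (by positivity)
          _ = T := by rw [ht, hT]; field_simp; norm_num)
    simp only [zero_add, norm_zero, huber_zero hR0, mul_zero, add_zero] at h2
    refine h2.trans (Real.exp_le_exp.2 ?_)
    linarith
  have hpt : ∀ d : J → Fin n → α, (∏ j, ∏ s, p j s (d j s)) *
      (if 24 * V * K ≤ ∑ j, ‖∑ s, y j s (d j s)‖ ^ 2 then (1 : ℝ) else 0) ≤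
      Real.exp (-K) * ∏ j, ((∏ s, p j s (d j s)) *
        Real.exp (t * huber R ‖∑ s, y j s (d j s)‖)) := by
    intro d
    have hP : 0 ≤ ∏ j, ∏ s, p j s (d j s) :=
      Finset.prod_nonneg fun j _ => Finset.prod_nonneg fun s _ => hp j s _
    rw [Finset.prod_mul_distrib, ← Real.exp_sum, mul_left_comm, ← Real.exp_add]
    refine mul_le_mul_of_nonneg_left ?_ hP
    split_ifs with h
    · refine Real.one_le_exp ?_
      have hhub : 24 * V * K ≤ ∑ j, huber R ‖∑ s, y j s (d j s)‖ := by
        by_cases hall : ∀ j, ‖∑ s, y j s (d j s)‖ ≤ R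
        · refine h.trans (Finset.sum_le_sum fun j _ => ?_)
          rw [huber, if_pos (hall j)]
        · push Not at hall
          obtain ⟨j, hj⟩ := hall
          have h1 : R ^ 2 ≤ huber R ‖∑ s, y j s (d j s)‖ := by
            refine le_trans (le_min ?_ le_rfl) (min_sq_le_huber hR0)
            exact pow_le_pow_left₀ hR0 hj.le 2
          have h2 : huber R ‖∑ s, y j s (d j s)‖ ≤ ∑ j, huber R ‖∑ s, y j s (d j s)‖ :=
            Finset.single_le_sum (f := fun j => huber R ‖∑ s, y j s (d j s)‖)
              (fun j _ => huber_nonneg hR0) (Finset.mem_univ j)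
          refine le_trans ?_ (h1.trans h2)
          rw [hR, div_pow, le_div_iff₀ (by positivity)]
          nlinarith
      rw [← Finset.mul_sum]
      have h3 : K = t * (24 * V * K) := by rw [ht]; field_simp
      have h4 : t * (24 * V * K) ≤ t * ∑ j, huber R ‖∑ s, y j s (d j s)‖ :=
        mul_le_mul_of_nonneg_left hhub (by positivity)
      linarith
    · exact (Real.exp_pos _).le
  refine (Finset.sum_le_sum fun d _ => hpt d).trans ?_
  rw [← Finset.mul_sum, ← Fintype.prod_sum fun j (d : Fin n → α) => (∏ s, p j s (d s)) *
        Real.exp (t * huber R ‖∑ s, y j s (d s)‖), Real.exp_add]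
  refine mul_le_mul_of_nonneg_left ?_ (Real.exp_pos _).le
  calc ∏ j, ∑ d : Fin n → α, (∏ s, p j s (d s)) * Real.exp (t * huber R ‖∑ s, y j s (d s)‖)
      ≤ ∏ _j : J, Real.exp (1 / 6) := Finset.prod_le_prod (fun j _ => Finset.sum_nonneg fun d _ =>
        mul_nonneg (Finset.prod_nonneg fun s _ => hp j s _) (Real.exp_pos _).le)
        fun j _ => hblock j
    _ = Real.exp (Fintype.card J / 6) := by
        rw [Finset.prod_const, Finset.card_univ, ← Real.exp_nat_mul]; congr 1; ring

end Concentration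

/-! ### The uniform distribution on the simplex -/

section Simplex

theorem measurable_simplexChart (F : ℕ) : Measurable (simplexChart F) := by
  refine measurable_pi_lambda _ fun i => ?_
  unfold simplexChart
  by_cases h : (i : ℕ) < F - 1
  · simpa [h] using measurable_pi_apply _
  · simp only [h, dite_false]
    fun_prop

theorem simplexChart_castSucc {n : ℕ} (x : Fin n → ℝ) (j : Fin n) :
    simplexChart (n + 1) x j.castSucc = x j := by
  simp [simplexChart]

theorem simplexChart_last {n : ℕ} (x : Fin n → ℝ) :
    simplexChart (n + 1) x (Fin.last n) = 1 - ∑ j, x j := by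
  simp [simplexChart]

/-- The domain of the chart of the simplex. -/
def chartDomain (n : ℕ) : Set (Fin n → ℝ) := {x | (∀ j, 0 ≤ x j) ∧ ∑ j, x j ≤ 1}

theorem measurableSet_chartDomain (n : ℕ) : MeasurableSet (chartDomain n) := by
  have : chartDomain n = (⋂ j, {x | 0 ≤ x j}) ∩ {x | ∑ j, x j ≤ 1} := by
    ext; simp [chartDomain]
  rw [this]
  refine MeasurableSet.inter (MeasurableSet.iInter fun j => ?_) ?_
  · exact measurableSet_le measurable_const (measurable_pi_apply j)
  · exact measurableSet_le (by fun_prop) measurable_const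

theorem chartDomain_subset_Icc (n : ℕ) : chartDomain n ⊆ Set.Icc 0 1 := by
  rintro x ⟨h0, h1⟩
  refine ⟨fun j => h0 j, fun j => ?_⟩
  exact (Finset.single_le_sum (f := x) (fun i _ => h0 i) (Finset.mem_univ j)).trans h1

theorem volume_chartDomain_le_one (n : ℕ) : volume (chartDomain n) ≤ 1 := by
  refine (measure_mono (chartDomain_subset_Icc n)).trans ?_
  rw [Real.volume_Icc_pi]
  simp

theorem cube_subset_chartDomain {n : ℕ} {a : Fin n → ℝ} {c : ℝ} (ha : ∀ j, 0 ≤ a j)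
    (hs : ∑ j, (a j + c) ≤ 1) : Set.Icc a (fun j => a j + c) ⊆ chartDomain n := by
  rintro x ⟨h0, h1⟩
  exact ⟨fun j => (ha j).trans (h0 j), (Finset.sum_le_sum fun j _ => h1 j).trans hs⟩

theorem volume_cube {n : ℕ} (a : Fin n → ℝ) {c : ℝ} (hc : 0 ≤ c) :
    volume (Set.Icc a (fun j => a j + c)) = ENNReal.ofReal (c ^ n) := by
  rw [Real.volume_Icc_pi]
  simp [ENNReal.ofReal_pow hc]

theorem le_volume_chartDomain (n : ℕ) :
    ENNReal.ofReal ((1 / ((n + 1 : ℕ) : ℝ)) ^ n) ≤ volume (chartDomain n) := by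
  rw [← volume_cube 0 (by positivity)]
  refine measure_mono (cube_subset_chartDomain (fun _ => le_rfl) ?_)
  simp only [Pi.zero_apply, zero_add, Finset.sum_const, Finset.card_univ, Fintype.card_fin,
    nsmul_eq_mul, mul_one_div]
  rw [div_le_one (by positivity)]
  exact_mod_cast Nat.le_succ n

theorem volume_chartDomain_ne_zero (n : ℕ) : volume (chartDomain n) ≠ 0 :=
  (lt_of_lt_of_le (by rw [ENNReal.ofReal_pos]; positivity) (le_volume_chartDomain n)).ne'

theorem uniformSimplex_apply {n : ℕ} {t : Set (Fin (n + 1) → ℝ)} (ht : MeasurableSet t) :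
    uniformSimplex (n + 1) t =
      (volume (chartDomain n))⁻¹ * volume (chartDomain n ∩ simplexChart (n + 1) ⁻¹' t) := by
  unfold uniformSimplex
  rw [Measure.map_apply (measurable_simplexChart _) ht]
  exact ProbabilityTheory.cond_apply (measurableSet_chartDomain n) _ _

instance isProbabilityMeasure_uniformSimplex (n : ℕ) :
    IsProbabilityMeasure (uniformSimplex (n + 1)) := by
  refine ⟨?_⟩
  rw [uniformSimplex_apply MeasurableSet.univ, Set.preimage_univ, Set.inter_univ]
  exact ENNReal.inv_mul_cancel (volume_chartDomain_ne_zero n)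
    ((volume_chartDomain_le_one n).trans_lt ENNReal.one_lt_top).ne

theorem ae_uniformSimplex (n : ℕ) :
    ∀ᵐ g ∂uniformSimplex (n + 1), (∀ f, 0 ≤ g f) ∧ ∑ f, g f = 1 := by
  have hm : MeasurableSet {g : Fin (n + 1) → ℝ | (∀ f, 0 ≤ g f) ∧ ∑ f, g f = 1} := by
    have : {g : Fin (n + 1) → ℝ | (∀ f, 0 ≤ g f) ∧ ∑ f, g f = 1} =
        (⋂ j, {x | 0 ≤ x j}) ∩ {x | ∑ j, x j = 1} := by
      ext; simp
    rw [this]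
    refine MeasurableSet.inter (MeasurableSet.iInter fun j => ?_) ?_
    · exact measurableSet_le measurable_const (measurable_pi_apply j)
    · exact measurableSet_eq_fun (by fun_prop) measurable_const
  rw [ae_iff]
  change uniformSimplex (n + 1) {g | (∀ f, 0 ≤ g f) ∧ ∑ f, g f = 1}ᶜ = 0
  rw [uniformSimplex_apply hm.compl]
  have : chartDomain n ∩ simplexChart (n + 1) ⁻¹' {g | (∀ f, 0 ≤ g f) ∧ ∑ f, g f = 1}ᶜ = ∅ := by
    rw [Set.eq_empty_iff_forall_notMem]
    rintro x ⟨⟨h0, h1⟩, hx⟩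
    refine hx ⟨fun f => ?_, ?_⟩
    · induction f using Fin.lastCases with
      | last => rw [simplexChart_last]; linarith
      | cast j => rw [simplexChart_castSucc]; exact h0 j
    · rw [Fin.sum_univ_castSucc, simplexChart_last]
      simp [simplexChart_castSucc]
  rw [this]; simp

theorem measurableSet_pi_ball {F : ℕ} (y : Fin F → ℝ) (t : ℝ) :
    MeasurableSet {g : Fin F → ℝ | ∀ f, |g f - y f| ≤ t} := by
  have : {g : Fin F → ℝ | ∀ f, |g f - y f| ≤ t} = ⋂ f, {g | |g f - y f| ≤ t} := by ext; simp
  rw [this]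
  refine MeasurableSet.iInter fun f => measurableSet_le ?_ measurable_const
  exact ((measurable_pi_apply f).sub_const _).abs

/-- Every point of the simplex has neighbourhoods of the expected probability. -/
theorem le_uniformSimplex_ball {n : ℕ} {y : Fin (n + 1) → ℝ} (h0 : ∀ f, 0 ≤ y f)
    (h1 : ∑ f, y f = 1) {t : ℝ} (ht0 : 0 ≤ t) (ht1 : t ≤ 1) :
    ENNReal.ofReal ((t / ((n + 1 : ℕ) : ℝ)) ^ n) ≤
      uniformSimplex (n + 1) {g | ∀ f, |g f - y f| ≤ t} := by
  set c := t / ((n + 1 : ℕ) : ℝ) with hc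
  have hc0 : 0 ≤ c := by positivity
  set a : Fin n → ℝ := fun j => (1 - t) * y j.castSucc with ha
  have hy : ∑ j : Fin n, y j.castSucc ≤ 1 := by
    rw [Fin.sum_univ_castSucc] at h1
    linarith [h0 (Fin.last n)]
  have hy0 : 0 ≤ ∑ j : Fin n, y j.castSucc := Finset.sum_nonneg fun j _ => h0 _
  have hnc : n * c ≤ t := by
    rw [hc, mul_div_assoc', div_le_iff₀ (by positivity)]
    push_cast; nlinarith
  have hsum : ∑ j, (a j + c) ≤ 1 := by
    rw [Finset.sum_add_distrib, ← Finset.mul_sum]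
    simp only [Finset.sum_const, Finset.card_univ, Fintype.card_fin, nsmul_eq_mul]
    nlinarith
  rw [uniformSimplex_apply (measurableSet_pi_ball y t), ← volume_cube a hc0]
  have hsub : Set.Icc a (fun j => a j + c) ⊆
      chartDomain n ∩ simplexChart (n + 1) ⁻¹' {g | ∀ f, |g f - y f| ≤ t} := by
    refine Set.subset_inter (cube_subset_chartDomain (fun j => mul_nonneg (by linarith) (h0 _))
      hsum) ?_
    rintro x ⟨hx0, hx1⟩ f
    have hyj : ∀ j : Fin (n + 1), y j ≤ 1 := fun j => h1 ▸
      Finset.single_le_sum (f := y) (fun i _ => h0 i) (Finset.mem_univ j)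
    have hct : c ≤ t := by
      rw [hc]; exact div_le_self ht0 (by exact_mod_cast Nat.le_add_left 1 n)
    induction f using Fin.lastCases with
    | last =>
      rw [simplexChart_last]
      have e1 : y (Fin.last n) = 1 - ∑ j : Fin n, y j.castSucc := by
        rw [← h1, Fin.sum_univ_castSucc]; ring
      have e2 : ∑ j, a j ≤ ∑ j, x j := Finset.sum_le_sum fun j _ => hx0 j
      have e3 : ∑ j, x j ≤ ∑ j, (a j + c) := Finset.sum_le_sum fun j _ => hx1 j
      rw [Finset.sum_add_distrib] at e3
      simp only [ha, ← Finset.mul_sum, Finset.sum_const, Finset.card_univ, Fintype.card_fin,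
        nsmul_eq_mul] at e2 e3
      rw [e1, abs_le]
      constructor <;> nlinarith
    | cast j =>
      rw [simplexChart_castSucc, abs_le]
      have e1 := hx0 j
      have e2 := hx1 j
      have e3 := hyj j.castSucc
      have e4 := h0 j.castSucc
      simp only [ha] at e1 e2
      constructor <;> nlinarith
  have hinv : 1 ≤ (volume (chartDomain n))⁻¹ := by
    rw [ENNReal.one_le_inv]; exact volume_chartDomain_le_one n
  calc volume (Set.Icc a (fun j => a j + c)) ≤ volume (chartDomain n ∩ simplexChart (n + 1) ⁻¹'
        {g | ∀ f, |g f - y f| ≤ t}) := measure_mono hsub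
    _ ≤ _ := le_mul_of_one_le_left' hinv

/-- The part of the unit cube in a slab that is transversal to the `j`-th coordinate. -/
theorem volume_slab_le {n : ℕ} (α : ℝ) (b : Fin n → ℝ) (j : Fin n) (hj : b j ≠ 0) (t : ℝ) :
    volume {x : Fin n → ℝ | x ∈ Set.Icc 0 1 ∧ |α + ∑ i, b i * x i| ≤ t} ≤
      ENNReal.ofReal (2 * t / |b j|) := by
  obtain ⟨m, rfl⟩ : ∃ m, n = m + 1 := ⟨n - 1, by have := j.2; omega⟩
  set S : Set (ℝ × (Fin m → ℝ)) := {q | q.2 ∈ Set.Icc (0 : Fin m → ℝ) 1 ∧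
    |α + (b j * q.1 + ∑ i, b (j.succAbove i) * q.2 i)| ≤ t} with hS
  have hSm : MeasurableSet S := by
    have : S = Prod.snd ⁻¹' Set.Icc (0 : Fin m → ℝ) 1 ∩
        {q | |α + (b j * q.1 + ∑ i, b (j.succAbove i) * q.2 i)| ≤ t} := by
      ext; simp [hS]
    rw [this]
    refine MeasurableSet.inter (measurable_snd measurableSet_Icc) ?_
    exact measurableSet_le (by fun_prop) measurable_const
  have hsub : {x : Fin (m + 1) → ℝ | x ∈ Set.Icc 0 1 ∧ |α + ∑ i, b i * x i| ≤ t} ⊆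
      (MeasurableEquiv.piFinSuccAbove (fun _ => ℝ) j) ⁻¹' S := by
    rintro x ⟨⟨hx0, hx1⟩, hx⟩
    refine ⟨⟨fun i => hx0 _, fun i => hx1 _⟩, ?_⟩
    rw [Fin.sum_univ_succAbove _ j] at hx
    exact hx
  refine (measure_mono hsub).trans ?_
  rw [(volume_preserving_piFinSuccAbove (fun _ => ℝ) j).measure_preimage_equiv,
    Measure.volume_eq_prod, Measure.prod_apply_symm hSm]
  have hslice : ∀ z : Fin m → ℝ, volume ((fun u => (u, z)) ⁻¹' S) ≤
      (Set.Icc (0 : Fin m → ℝ) 1).indicator (fun _ => ENNReal.ofReal (2 * t / |b j|)) z := by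
    intro z
    by_cases hz : z ∈ Set.Icc (0 : Fin m → ℝ) 1
    · rw [Set.indicator_of_mem hz]
      set w := (α + ∑ i, b (j.succAbove i) * z i) / b j with hw
      have hsub2 : (fun u : ℝ => (u, z)) ⁻¹' S ⊆ Set.Icc (-w - t / |b j|) (-w + t / |b j|) := by
        rintro u ⟨-, hu⟩
        have h1 : α + (b j * u + ∑ i, b (j.succAbove i) * z i) = b j * (u + w) := by
          rw [hw]; field_simp; ring
        simp only at hu
        rw [h1, abs_mul] at hu
        have h2 : |u + w| ≤ t / |b j| := by
          rw [le_div_iff₀ (abs_pos.2 hj), mul_comm]; exact hu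
        have h3 := abs_le.1 h2
        constructor <;> linarith
      refine (measure_mono hsub2).trans ?_
      rw [Real.volume_Icc]
      refine ENNReal.ofReal_le_ofReal (le_of_eq ?_)
      ring
    · rw [Set.indicator_of_notMem hz]
      have : (fun u : ℝ => (u, z)) ⁻¹' S = ∅ := by
        rw [Set.eq_empty_iff_forall_notMem]
        rintro u ⟨hu, -⟩
        exact hz hu
      rw [this, measure_empty]
  refine (lintegral_mono hslice).trans ?_
  rw [lintegral_indicator measurableSet_Icc, setLIntegral_const, Real.volume_Icc_pi]
  simp

/-- The constant in the small ball estimate for the uniform distribution on the simplex. -/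
noncomputable def smallBallConst (F : ℕ) : ℝ := (F : ℝ) ^ (F - 1) * (16 * Real.sqrt F)

theorem smallBallConst_pos {F : ℕ} (hF : 0 < F) : 0 < smallBallConst F := by
  unfold smallBallConst; positivity

/-- A uniformly distributed point of the simplex is unlikely to be close to a hyperplane through
the origin. -/
theorem uniformSimplex_small_ball {n : ℕ} {x : Fin (n + 1) → ℝ} (hx : 1 / 4 ≤ ∑ f, x f ^ 2) {t : ℝ}
    (ht : 0 ≤ t) : uniformSimplex (n + 1) {g | |∑ f, g f * x f| ≤ t} ≤
      ENNReal.ofReal (smallBallConst (n + 1) * t) := by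
  have hm : MeasurableSet {g : Fin (n + 1) → ℝ | |∑ f, g f * x f| ≤ t} :=
    measurableSet_le (by fun_prop) measurable_const
  set q := Real.sqrt ((n + 1 : ℕ) : ℝ) with hq
  have hq2 : q ^ 2 = ((n + 1 : ℕ) : ℝ) := Real.sq_sqrt (by positivity)
  have hq0 : 0 < q := by rw [hq]; positivity
  have hFn : (1 : ℝ) ≤ ((n + 1 : ℕ) : ℝ) ^ n :=
    one_le_pow₀ (by exact_mod_cast Nat.le_add_left 1 n)
  have hC : smallBallConst (n + 1) = ((n + 1 : ℕ) : ℝ) ^ n * (16 * q) := rfl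
  by_cases hbig : 1 / (4 * q) ≤ t
  · refine prob_le_one.trans ?_
    rw [ENNReal.one_le_ofReal, hC]
    have h1 : 4 ≤ 16 * q * t := by
      rw [div_le_iff₀ (by positivity)] at hbig; linarith
    nlinarith
  push Not at hbig
  have hchart : ∀ u : Fin n → ℝ, ∑ f, simplexChart (n + 1) u f * x f =
      x (Fin.last n) + ∑ j : Fin n, (x j.castSucc - x (Fin.last n)) * u j := by
    intro u
    rw [Fin.sum_univ_castSucc, simplexChart_last]
    simp only [simplexChart_castSucc, sub_mul, Finset.sum_sub_distrib, ← Finset.mul_sum]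
    have : ∑ j : Fin n, u j * x j.castSucc = ∑ j : Fin n, x j.castSucc * u j :=
      Finset.sum_congr rfl fun j _ => mul_comm _ _
    rw [this]; ring
  by_cases hex : ∃ j : Fin n, 1 / (8 * q) ≤ |x j.castSucc - x (Fin.last n)|
  · obtain ⟨j, hj⟩ := hex
    have hjpos : 0 < |x j.castSucc - x (Fin.last n)| := lt_of_lt_of_le (by positivity) hj
    rw [uniformSimplex_apply hm]
    have h1 : volume (chartDomain n ∩ simplexChart (n + 1) ⁻¹' {g | |∑ f, g f * x f| ≤ t}) ≤
        ENNReal.ofReal (2 * t / |x j.castSucc - x (Fin.last n)|) := by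
      refine le_trans (measure_mono ?_) (volume_slab_le (x (Fin.last n))
        (fun j => x j.castSucc - x (Fin.last n)) j (abs_pos.1 hjpos) t)
      rintro u ⟨hu, hu'⟩
      refine ⟨chartDomain_subset_Icc n hu, ?_⟩
      have hu'' : |∑ f, simplexChart (n + 1) u f * x f| ≤ t := hu'
      rwa [hchart] at hu''
    have h2 : (volume (chartDomain n))⁻¹ ≤ ENNReal.ofReal (((n + 1 : ℕ) : ℝ) ^ n) := by
      refine (ENNReal.inv_le_inv.2 (le_volume_chartDomain n)).trans (le_of_eq ?_)
      rw [← ENNReal.ofReal_inv_of_pos (by positivity)]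
      congr 1
      rw [one_div, inv_pow, inv_inv]
    refine (mul_le_mul' h2 h1).trans ?_
    rw [← ENNReal.ofReal_mul (by positivity)]
    refine ENNReal.ofReal_le_ofReal ?_
    rw [hC, mul_assoc]
    refine mul_le_mul_of_nonneg_left ?_ (by positivity)
    rw [div_le_iff₀ hjpos]
    rw [div_le_iff₀ (by positivity)] at hj
    nlinarith
  · push Not at hex
    have hlast : 1 / (2 * q) ≤ |x (Fin.last n)| + 1 / (8 * q) := by
      have h1 : ∀ f, |x f| ≤ |x (Fin.last n)| + 1 / (8 * q) := by
        intro f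
        induction f using Fin.lastCases with
        | last => have : 0 ≤ 1 / (8 * q) := by positivity
                  linarith
        | cast j =>
          have h2 := abs_sub_abs_le_abs_sub (x j.castSucc) (x (Fin.last n))
          linarith [hex j]
      have h2 : ∑ f, x f ^ 2 ≤ ((n + 1 : ℕ) : ℝ) * (|x (Fin.last n)| + 1 / (8 * q)) ^ 2 := by
        refine (Finset.sum_le_card_nsmul _ _ _ fun f _ => ?_).trans
          (by rw [Finset.card_univ, Fintype.card_fin, nsmul_eq_mul])
        rw [← sq_abs]
        exact pow_le_pow_left₀ (abs_nonneg _) (h1 f) 2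
      have h3 : (1 / 2 : ℝ) ^ 2 ≤ (q * (|x (Fin.last n)| + 1 / (8 * q))) ^ 2 := by
        rw [mul_pow, hq2]; linarith
      have h4 := le_of_sq_le_sq h3 (by positivity)
      rw [div_le_iff₀ (by positivity)]
      linarith
    have hzero : uniformSimplex (n + 1) {g | |∑ f, g f * x f| ≤ t} = 0 := by
      rw [uniformSimplex_apply hm]
      have : chartDomain n ∩ simplexChart (n + 1) ⁻¹' {g | |∑ f, g f * x f| ≤ t} = ∅ := by
        rw [Set.eq_empty_iff_forall_notMem]
        rintro u ⟨⟨hu0, hu1⟩, hu'⟩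
        have hu'' : |∑ f, simplexChart (n + 1) u f * x f| ≤ t := hu'
        rw [hchart] at hu''
        have h5 : |∑ j : Fin n, (x j.castSucc - x (Fin.last n)) * u j| ≤ 1 / (8 * q) := by
          refine (Finset.abs_sum_le_sum_abs _ _).trans ?_
          calc ∑ j : Fin n, |(x j.castSucc - x (Fin.last n)) * u j|
              ≤ ∑ j : Fin n, 1 / (8 * q) * u j := by
                refine Finset.sum_le_sum fun j _ => ?_
                rw [abs_mul, abs_of_nonneg (hu0 j)]
                exact mul_le_mul_of_nonneg_right (hex j).le (hu0 j)
            _ = 1 / (8 * q) * ∑ j, u j := by rw [Finset.mul_sum]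
            _ ≤ 1 / (8 * q) * 1 := mul_le_mul_of_nonneg_left hu1 (by positivity)
            _ = 1 / (8 * q) := mul_one _
        have h6 := abs_sub_abs_le_abs_sub (x (Fin.last n))
          (-∑ j : Fin n, (x j.castSucc - x (Fin.last n)) * u j)
        rw [abs_neg, sub_neg_eq_add] at h6
        have e1 : 1 / (2 * q) = 4 * (1 / (8 * q)) := by field_simp; norm_num
        have e2 : 1 / (4 * q) = 2 * (1 / (8 * q)) := by field_simp; norm_num
        rw [e1] at hlast
        rw [e2] at hbig
        linarith
      rw [this]; simp
    rw [hzero]; exact zero_le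

theorem uniformSimplex_hyperplane {n : ℕ} {x : Fin (n + 1) → ℝ} (hx : x ≠ 0) :
    uniformSimplex (n + 1) {g | ∑ f, g f * x f = 0} = 0 := by
  have hpos : 0 < ∑ f, x f ^ 2 := by
    obtain ⟨f, hf⟩ := Function.ne_iff.1 hx
    refine Finset.sum_pos' (fun _ _ => sq_nonneg _) ⟨f, Finset.mem_univ f, ?_⟩
    have : x f ≠ 0 := hf
    positivity
  set r := Real.sqrt (∑ f, x f ^ 2) with hr
  have h1 := uniformSimplex_small_ball (n := n) (x := fun f => x f / r) (t := 0) (by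
    have : ∑ f, (x f / r) ^ 2 = 1 := by
      simp only [div_pow, ← Finset.sum_div]
      rw [hr, Real.sq_sqrt hpos.le, div_self hpos.ne']
    rw [this]; norm_num) le_rfl
  rw [mul_zero, ENNReal.ofReal_zero] at h1
  refine le_antisymm ((measure_mono ?_).trans h1) zero_le
  intro g hg
  have : ∑ f, g f * (x f / r) = (∑ f, g f * x f) / r := by
    rw [Finset.sum_div]; exact Finset.sum_congr rfl fun f _ => (mul_div_assoc _ _ _).symm
  change |∑ f, g f * (x f / r)| ≤ 0
  rw [this, show ∑ f, g f * x f = 0 from hg]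
  simp

end Simplex

/-! ### Matrices with random rows that admit a scaling to unit column sums -/

section ScalableMatrices

/-- A linear system with a nearly diagonal matrix and a right-hand side with entries between
`3 / 4` and `1` has a positive solution. -/
theorem exists_pos_solution {n : ℕ} (B : Matrix (Fin n) (Fin n) ℝ) (c : Fin n → ℝ)
    (hd : ∀ f, 1 / 4 ≤ B f f) (ho : ∀ f g, f ≠ g → |B f g| ≤ 1 / (16 * n))
    (hc : ∀ g, 3 / 4 ≤ c g) (hc1 : ∀ g, c g ≤ 1) :
    ∃ d : Fin n → ℝ, (∀ f, 0 < d f) ∧ ∀ g, ∑ f, d f * B f g = c g := by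
  classical
  rcases Nat.eq_zero_or_pos n with rfl | hn
  · exact ⟨fun _ => 1, fun f => f.elim0, fun g => g.elim0⟩
  have hsum : ∀ (g : Fin n) (u : Fin n → ℝ) (r : ℝ), (∀ f, |u f| ≤ r) → 0 ≤ r →
      ∑ f ∈ Finset.univ.erase g, |u f * B f g| ≤ r / 16 := by
    intro g u r hu hr
    have h1 : ∀ f ∈ Finset.univ.erase g, |u f * B f g| ≤ r * (1 / (16 * n)) := fun f hf => by
      rw [abs_mul]
      exact mul_le_mul (hu f) (ho f g (Finset.ne_of_mem_erase hf)) (abs_nonneg _) hr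
    refine (Finset.sum_le_sum h1).trans ?_
    rw [Finset.sum_const, nsmul_eq_mul]
    have h2 : ((Finset.univ.erase g).card : ℝ) ≤ n := by
      have := (Finset.univ.erase g).card_le_univ
      rw [Fintype.card_fin] at this
      exact_mod_cast this
    calc _ ≤ (n : ℝ) * (r * (1 / (16 * n))) := mul_le_mul_of_nonneg_right h2 (by positivity)
      _ = r / 16 := by field_simp
  have hdet : B.det ≠ 0 := by
    refine det_ne_zero_of_sum_col_lt_diag fun g => ?_
    have h1 := hsum g (fun _ => 1) 1 (by simp) zero_le_one
    simp only [one_mul] at h1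
    simp only [Real.norm_eq_abs]
    have h2 : 1 / 4 ≤ |B g g| := (hd g).trans (le_abs_self _)
    linarith
  set d := Matrix.vecMul c B⁻¹ with hdd
  have hsol : ∀ g, ∑ f, d f * B f g = c g := by
    intro g
    have h1 : Matrix.vecMul d B = c := by
      rw [hdd, Matrix.vecMul_vecMul, Matrix.nonsing_inv_mul _ (isUnit_iff_ne_zero.2 hdet),
        Matrix.vecMul_one]
    rw [← h1]; rfl
  have hsplit : ∀ g, d g * B g g = c g - ∑ f ∈ Finset.univ.erase g, d f * B f g := fun g => by
    rw [← hsol g, ← Finset.add_sum_erase _ _ (Finset.mem_univ g)]; ring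
  have hne : (Finset.univ : Finset (Fin n)).Nonempty := ⟨⟨0, hn⟩, Finset.mem_univ _⟩
  obtain ⟨k, -, hk⟩ := Finset.exists_max_image Finset.univ (fun f => |d f|) hne
  have hk' : ∀ f, |d f| ≤ |d k| := fun f => hk f (Finset.mem_univ f)
  have hsk := fun g => (Finset.abs_sum_le_sum_abs (fun f => d f * B f g)
    (Finset.univ.erase g)).trans (hsum g d _ hk' (abs_nonneg _))
  -- the largest entry of the solution is at most `16 / 3`
  have hmax : |d k| ≤ 16 / 3 := by
    have h1 : |d k| * (1 / 4) ≤ |d k * B k k| := by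
      rw [abs_mul]; exact mul_le_mul_of_nonneg_left ((hd k).trans (le_abs_self _)) (abs_nonneg _)
    have h2 : |d k * B k k| ≤ 1 + |d k| / 16 := by
      rw [hsplit k]
      refine (abs_sub _ _).trans (add_le_add ?_ (hsk k))
      rw [abs_of_nonneg (by linarith [hc k])]; exact hc1 k
    linarith
  refine ⟨d, fun g => ?_, hsol⟩
  have h1 := (abs_le.1 (hsk g)).2
  have h2 : 0 < d g * B g g := by rw [hsplit g]; linarith [hc g]
  exact pos_of_mul_pos_left h2 (by linarith [hd g])

/-- If the first `F` rows are close to the `F` vertices of the simplex, then the matrix can be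
scaled: all other rows get the same tiny weight, and the first `F` weights solve a nearly diagonal
system. -/
theorem scalable_of_near_diagonal {I F : ℕ} (hFI : F ≤ I) {G : Fin I → Fin F → ℝ}
    (h0 : ∀ i f, 0 ≤ G i f) (h1 : ∀ i, ∑ f, G i f = 1)
    (hG : ∀ f g : Fin F, |G (Fin.castLE hFI f) g - (Pi.single f 1 : Fin F → ℝ) g| ≤
      1 / (16 * F)) : Scalable G := by
  classical
  rcases Nat.eq_zero_or_pos F with rfl | hF
  · exact ⟨fun _ => 1, fun _ => one_pos, fun f => f.elim0⟩
  have hle1 : ∀ i f, G i f ≤ 1 := fun i f => h1 i ▸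
    Finset.single_le_sum (f := G i) (fun f _ => h0 i f) (Finset.mem_univ f)
  have hF1 : (1 : ℝ) ≤ F := by exact_mod_cast hF
  set ω : ℝ := 1 / (4 * (I + 1)) with hω
  have hω0 : 0 < ω := by positivity
  set X : Finset (Fin I) := Finset.univ.filter fun i => ¬ (i : ℕ) < F with hX
  have hXs : ∀ g, 0 ≤ ω * ∑ i ∈ X, G i g ∧ ω * ∑ i ∈ X, G i g ≤ 1 / 4 := by
    intro g
    refine ⟨mul_nonneg hω0.le (Finset.sum_nonneg fun i _ => h0 i g), ?_⟩
    have h2 : ∑ i ∈ X, G i g ≤ I := by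
      refine (Finset.sum_le_card_nsmul _ _ 1 fun i _ => hle1 i g).trans ?_
      rw [nsmul_eq_mul, mul_one]
      have := X.card_le_univ
      rw [Fintype.card_fin] at this
      exact_mod_cast this
    rw [hω, one_div, inv_mul_le_iff₀ (by positivity)]
    linarith
  obtain ⟨d, hd0, hd⟩ := exists_pos_solution (fun f g => G (Fin.castLE hFI f) g)
    (fun g => 1 - ω * ∑ i ∈ X, G i g) (fun f => by
      have h2 := (abs_le.1 (hG f f)).1
      rw [Pi.single_eq_same] at h2
      have h3 : 1 / (16 * (F : ℝ)) ≤ 1 / 16 := by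
        apply one_div_le_one_div_of_le <;> linarith
      linarith) (fun f g hfg => by
      have h2 := hG f g
      rwa [Pi.single_eq_of_ne (Ne.symm hfg), sub_zero] at h2)
    (fun g => by linarith [(hXs g).2]) (fun g => by linarith [(hXs g).1])
  refine ⟨fun i => if h : (i : ℕ) < F then d ⟨i, h⟩ else ω, fun i => ?_, fun g => ?_⟩
  · dsimp only
    split_ifs
    · exact hd0 _
    · exact hω0
  · rw [← Finset.sum_filter_add_sum_filter_not Finset.univ (fun i : Fin I => (i : ℕ) < F)]
    have e1 : ∑ i ∈ Finset.univ.filter (fun i : Fin I => (i : ℕ) < F),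
        (if h : (i : ℕ) < F then d ⟨i, h⟩ else ω) * G i g =
        ∑ f, d f * G (Fin.castLE hFI f) g := by
      symm
      refine Finset.sum_bij (fun f _ => Fin.castLE hFI f) (fun f _ => by simp) ?_ ?_ ?_
      · intro a _ b _ hab
        exact Fin.castLE_injective hFI hab
      · intro i hi
        have hi' : (i : ℕ) < F := by simpa using hi
        exact ⟨⟨i, hi'⟩, Finset.mem_univ _, rfl⟩
      · intro f _
        simp
    have e2 : ∑ i ∈ X, (if h : (i : ℕ) < F then d ⟨i, h⟩ else ω) * G i g =
        ω * ∑ i ∈ X, G i g := by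
      rw [Finset.mul_sum]
      refine Finset.sum_congr rfl fun i hi => ?_
      have hi' : ¬ (i : ℕ) < F := by simpa [hX] using hi
      rw [dif_neg hi']
    rw [e1, e2, hd g]; ring

/-- A configuration that forces every scaling to contain a tiny factor: the rows `1, …, F - 1` are
close to a facet of a simplex around the barycenter, and all other rows lie on the far side. -/
theorem scalable_of_flat_configuration {I n : ℕ} (hFI : n + 1 + 1 ≤ I)
    {G : Fin I → Fin (n + 1 + 1) → ℝ} {τ : ℝ} (hτ0 : 0 < τ) (hτ : τ ≤ 1 / 8)
    (h0 : ∀ i f, 0 ≤ G i f) (h1 : ∀ i, ∑ f, G i f = 1)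
    (hfar : ∀ i : Fin I, (∀ f : Fin (n + 1), i ≠ Fin.castLE hFI f.succ) → 3 / 4 ≤ G i 0)
    (hflat1 : ∀ f : Fin (n + 1), (1 - 2 * τ) / (n + 2) ≤ G (Fin.castLE hFI f.succ) 0)
    (hflat2 : ∀ f : Fin (n + 1), G (Fin.castLE hFI f.succ) 0 ≤ (1 - τ) / (n + 2))
    (hoff : ∀ f g : Fin (n + 1), f ≠ g →
      |G (Fin.castLE hFI f.succ) g.succ| ≤ 1 / (16 * (n + 1 : ℕ))) :
    Scalable G ∧ ∀ d : Fin I → ℝ, (∀ i, 0 < d i) → (∀ f, ∑ i, d i * G i f = 1) →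
      d (Fin.castLE hFI 0) ≤ 8 * τ := by
  classical
  set X : Finset (Fin I) := Finset.univ.filter fun i => ∀ f : Fin (n + 1), i ≠ Fin.castLE hFI f.succ
    with hX
  have h0X : Fin.castLE hFI 0 ∈ X := by
    simp only [hX, Finset.mem_filter, Finset.mem_univ, true_and]
    intro f hf
    have := congrArg Fin.val hf
    simp at this
  have hn2 : (0 : ℝ) < n + 2 := by positivity
  have hsumsplit : ∀ u : Fin I → ℝ, ∑ i, u i =
      ∑ i ∈ X, u i + ∑ f : Fin (n + 1), u (Fin.castLE hFI f.succ) := by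
    intro u
    rw [← Finset.sum_filter_add_sum_filter_not Finset.univ
      (fun i : Fin I => ∀ f : Fin (n + 1), i ≠ Fin.castLE hFI f.succ)]
    congr 1
    symm
    refine Finset.sum_bij (fun f _ => Fin.castLE hFI f.succ) (fun f _ => by simp) ?_ ?_ ?_
    · intro a _ b _ hab
      exact Fin.succ_injective _ (Fin.castLE_injective hFI hab)
    · intro i hi
      simp only [Finset.mem_filter, Finset.mem_univ, true_and, not_forall, not_not] at hi
      obtain ⟨f, hf⟩ := hi
      exact ⟨f, Finset.mem_univ _, hf.symm⟩
    · intro f _; rfl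
  constructor
  · -- all far rows get the same weight, so that they act as a single row `gbar`
    set m : ℝ := (X.card : ℝ) with hm
    have hm0 : 0 < m := by
      rw [hm]; exact_mod_cast Finset.card_pos.2 ⟨_, h0X⟩
    set gbar : Fin (n + 1 + 1) → ℝ := fun f => (∑ i ∈ X, G i f) / m with hgbar
    have hgbar0 : ∀ f, 0 ≤ gbar f := fun f =>
      div_nonneg (Finset.sum_nonneg fun i _ => h0 i f) hm0.le
    have hgbar1 : ∑ f, gbar f = 1 := by
      rw [hgbar, ← Finset.sum_div, Finset.sum_comm, Finset.sum_congr rfl fun i _ => h1 i]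
      rw [Finset.sum_const, nsmul_eq_mul, mul_one, div_self hm0.ne']
    have hgbar34 : 3 / 4 ≤ gbar 0 := by
      rw [hgbar]; simp only
      rw [le_div_iff₀ hm0]
      have : ∑ i ∈ X, (3 / 4 : ℝ) ≤ ∑ i ∈ X, G i 0 := Finset.sum_le_sum fun i hi =>
        hfar i (by simpa [hX] using hi)
      rw [Finset.sum_const, nsmul_eq_mul] at this
      linarith
    have hgs : ∀ g : Fin (n + 1), gbar g.succ ≤ 1 / 4 := fun g => by
      have h2 : gbar g.succ ≤ ∑ g : Fin (n + 1), gbar g.succ :=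
        Finset.single_le_sum (f := fun g : Fin (n + 1) => gbar g.succ) (fun g _ => hgbar0 _)
          (Finset.mem_univ g)
      rw [Fin.sum_univ_succ] at hgbar1
      linarith
    have hrow : ∀ f : Fin (n + 1), ∑ g : Fin (n + 1), G (Fin.castLE hFI f.succ) g.succ =
        1 - G (Fin.castLE hFI f.succ) 0 := fun f => by
      have := h1 (Fin.castLE hFI f.succ)
      rw [Fin.sum_univ_succ] at this
      linarith
    have hdiag : ∀ f : Fin (n + 1), 1 / 4 ≤ G (Fin.castLE hFI f.succ) f.succ := fun f => by
      have h2 := hrow f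
      rw [← Finset.add_sum_erase _ _ (Finset.mem_univ f)] at h2
      have h3 : ∑ g ∈ Finset.univ.erase f, G (Fin.castLE hFI f.succ) g.succ ≤ 1 / 16 := by
        refine (Finset.sum_le_card_nsmul _ _ (1 / (16 * ((n + 1 : ℕ) : ℝ))) fun g hg =>
          (le_abs_self _).trans (hoff f g (Finset.ne_of_mem_erase hg).symm)).trans ?_
        rw [nsmul_eq_mul, mul_one_div, div_le_div_iff₀ (by positivity) (by norm_num)]
        have h4 : ((Finset.univ.erase f).card : ℝ) ≤ (n + 1 : ℕ) := by
          have := (Finset.univ.erase f).card_le_univ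
          rw [Fintype.card_fin] at this
          exact_mod_cast this
        linarith
      have h4 : (1 - τ) / (n + 2) ≤ 1 / 2 := by
        rw [div_le_div_iff₀ hn2 two_pos]
        have : (0 : ℝ) ≤ n := Nat.cast_nonneg n
        linarith
      linarith [hflat2 f]
    -- solve for the weights of the flat rows when the far rows have total weight `D`
    have hsolve : ∀ D : ℝ, 0 ≤ D → D ≤ 1 → ∃ d : Fin (n + 1) → ℝ, (∀ f, 0 < d f) ∧
        ∀ g : Fin (n + 1), ∑ f, d f * G (Fin.castLE hFI f.succ) g.succ = 1 - D * gbar g.succ :=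
      fun D hD0 hD1 => exists_pos_solution (fun f g => G (Fin.castLE hFI f.succ) g.succ) _ hdiag
        hoff (fun g => by nlinarith [hgs g, hgbar0 g.succ])
        (fun g => by nlinarith [hgs g, hgbar0 g.succ])
    have htot : ∀ (D : ℝ) (d : Fin (n + 1) → ℝ),
        (∀ g : Fin (n + 1), ∑ f, d f * G (Fin.castLE hFI f.succ) g.succ = 1 - D * gbar g.succ) →
        ∑ f, d f * (1 - G (Fin.castLE hFI f.succ) 0) = (n + 1) - D * (1 - gbar 0) := by
      intro D d hd
      have h2 : ∑ g : Fin (n + 1), ∑ f, d f * G (Fin.castLE hFI f.succ) g.succ =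
          ∑ f, d f * (1 - G (Fin.castLE hFI f.succ) 0) := by
        rw [Finset.sum_comm]
        refine Finset.sum_congr rfl fun f _ => ?_
        rw [← Finset.mul_sum, hrow]
      rw [← h2, Finset.sum_congr rfl fun g _ => hd g, Finset.sum_sub_distrib, ← Finset.mul_sum]
      have h3 : ∑ g : Fin (n + 1), gbar g.succ = 1 - gbar 0 := by
        rw [Fin.sum_univ_succ] at hgbar1; linarith
      rw [h3]; simp
    obtain ⟨u, hu0, hu⟩ := hsolve 0 le_rfl zero_le_one
    obtain ⟨w, hw0, hw⟩ := hsolve 1 zero_le_one le_rfl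
    have hcoef : ∀ f : Fin (n + 1), (n + 1 + τ) / (n + 2) ≤ 1 - G (Fin.castLE hFI f.succ) 0 ∧
        1 - G (Fin.castLE hFI f.succ) 0 ≤ (n + 1 + 2 * τ) / (n + 2) := by
      intro f
      have e1 : (n + 1 + τ) / ((n : ℝ) + 2) = 1 - (1 - τ) / (n + 2) := by field_simp; ring
      have e2 : (n + 1 + 2 * τ) / ((n : ℝ) + 2) = 1 - (1 - 2 * τ) / (n + 2) := by field_simp; ring
      rw [e1, e2]
      constructor <;> linarith [hflat1 f, hflat2 f]
    have hutot : ∑ f, u f < n + 2 := by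
      have h2 := htot 0 u hu
      have h3 : (∑ f, u f) * ((n + 1 + τ) / (n + 2)) ≤ n + 1 := by
        rw [Finset.sum_mul]
        refine (Finset.sum_le_sum fun f _ => mul_le_mul_of_nonneg_left (hcoef f).1
          (hu0 f).le).trans ?_
        rw [h2]; linarith
      rw [mul_div_assoc', div_le_iff₀ hn2] at h3
      by_contra hcon
      push Not at hcon
      nlinarith
    have hwtot : (n : ℝ) + 2 < 1 + ∑ f, w f := by
      have h2 := htot 1 w hw
      have h3 : (n + 1) - (1 - gbar 0) ≤ (∑ f, w f) * ((n + 1 + 2 * τ) / (n + 2)) := by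
        rw [Finset.sum_mul, ← one_mul (1 - gbar 0), ← h2]
        exact Finset.sum_le_sum fun f _ => mul_le_mul_of_nonneg_left (hcoef f).2 (hw0 f).le
      rw [mul_div_assoc', le_div_iff₀ hn2] at h3
      by_contra hcon
      push Not at hcon
      nlinarith
    set T := ∑ f, u f
    set T' := 1 + ∑ f, w f with hT'
    set D := (n + 2 - T) / (T' - T) with hD
    have hTT : 0 < T' - T := by linarith
    have hD0 : 0 < D := div_pos (by linarith) hTT
    have hD1 : D < 1 := by rw [hD, div_lt_one hTT]; linarith
    set v : Fin (n + 1) → ℝ := fun f => (1 - D) * u f + D * w f with hv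
    have hvpos : ∀ f, 0 < v f := fun f =>
      add_pos (mul_pos (by linarith) (hu0 f)) (mul_pos hD0 (hw0 f))
    have hvsol : ∀ g : Fin (n + 1), ∑ f, v f * G (Fin.castLE hFI f.succ) g.succ =
        1 - D * gbar g.succ := by
      intro g
      have : ∑ f, v f * G (Fin.castLE hFI f.succ) g.succ =
          (1 - D) * ∑ f, u f * G (Fin.castLE hFI f.succ) g.succ +
          D * ∑ f, w f * G (Fin.castLE hFI f.succ) g.succ := by
        rw [Finset.mul_sum, Finset.mul_sum, ← Finset.sum_add_distrib]
        exact Finset.sum_congr rfl fun f _ => by rw [hv]; ring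
      rw [this, hu g, hw g]; ring
    have hvtot : D + ∑ f, v f = n + 2 := by
      have h2 : ∑ f, v f = (1 - D) * T + D * (T' - 1) := by
        rw [hv, Finset.sum_add_distrib, ← Finset.mul_sum, ← Finset.mul_sum, hT']; ring
      have h3 : D * (T' - T) = n + 2 - T := div_mul_cancel₀ _ hTT.ne'
      rw [h2]; linarith
    set δ : Fin I → ℝ := fun i =>
      if h : ∃ f : Fin (n + 1), i = Fin.castLE hFI f.succ then v h.choose else D / m with hδ
    have hδf : ∀ f : Fin (n + 1), δ (Fin.castLE hFI f.succ) = v f := by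
      intro f
      have hex : ∃ f' : Fin (n + 1), Fin.castLE hFI f.succ = Fin.castLE hFI f'.succ := ⟨f, rfl⟩
      simp only [hδ]
      rw [dif_pos hex]
      congr 1
      exact (Fin.succ_injective _ (Fin.castLE_injective hFI hex.choose_spec)).symm
    have hδX : ∀ i ∈ X, δ i = D / m := by
      intro i hi
      have : ¬ ∃ f : Fin (n + 1), i = Fin.castLE hFI f.succ := by
        simpa [hX] using hi
      simp only [hδ]; rw [dif_neg this]
    have hδeq : ∀ f, ∑ i, δ i * G i f = D * gbar f + ∑ k, v k * G (Fin.castLE hFI k.succ) f := by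
      intro f
      rw [hsumsplit]
      congr 1
      · rw [Finset.sum_congr rfl fun i hi => by rw [hδX i hi], ← Finset.mul_sum, hgbar]
        field_simp
      · exact Finset.sum_congr rfl fun k _ => by rw [hδf]
    refine ⟨δ, fun i => ?_, fun f => ?_⟩
    · simp only [hδ]
      split_ifs
      · exact hvpos _
      · exact div_pos hD0 hm0
    · rw [hδeq]
      induction f using Fin.cases with
      | succ g => rw [hvsol g]; ring
      | zero =>
        have h2 : ∑ f, v f * (1 - G (Fin.castLE hFI f.succ) 0) = (n + 1) - D * (1 - gbar 0) :=
          htot D v hvsol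
        simp only [mul_sub, mul_one, Finset.sum_sub_distrib] at h2
        linarith
  · -- the far rows have too large a first entry to carry much weight
    intro d hd0 hd
    have htot : ∑ i, d i = n + 2 := by
      have : ∑ i, d i = ∑ f : Fin (n + 1 + 1), ∑ i, d i * G i f := by
        rw [Finset.sum_comm]
        exact Finset.sum_congr rfl fun i _ => by rw [← Finset.mul_sum, h1, mul_one]
      rw [this, Finset.sum_congr rfl fun f _ => hd f]
      simp; ring
    have h2 := hd 0
    rw [hsumsplit] at h2 htot
    have h3 : (∑ i ∈ X, d i) * (3 / 4) ≤ ∑ i ∈ X, d i * G i 0 := by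
      rw [Finset.sum_mul]
      exact Finset.sum_le_sum fun i hi =>
        mul_le_mul_of_nonneg_left (hfar i (by simpa [hX] using hi)) (hd0 i).le
    have h4 : (∑ f : Fin (n + 1), d (Fin.castLE hFI f.succ)) * ((1 - 2 * τ) / (n + 2)) ≤
        ∑ f : Fin (n + 1), d (Fin.castLE hFI f.succ) * G (Fin.castLE hFI f.succ) 0 := by
      rw [Finset.sum_mul]
      exact Finset.sum_le_sum fun f _ => mul_le_mul_of_nonneg_left (hflat1 f) (hd0 _).le
    have h5 : d (Fin.castLE hFI 0) ≤ ∑ i ∈ X, d i :=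
      Finset.single_le_sum (f := d) (fun i _ => (hd0 i).le) h0X
    set D := ∑ i ∈ X, d i with hD
    have hD0 : 0 ≤ D := Finset.sum_nonneg fun i _ => (hd0 i).le
    have h6 : ∑ f : Fin (n + 1), d (Fin.castLE hFI f.succ) = n + 2 - D := by linarith
    rw [h6] at h4
    have h7 : (n + 2 - D) * ((1 - 2 * τ) / (n + 2)) =
        (1 - 2 * τ) - D * ((1 - 2 * τ) / (n + 2)) := by
      field_simp
    nlinarith

end ScalableMatrices

/-! ### Probabilities of events for random matrices that admit a scaling -/

section ScalableUniform

variable {I F : ℕ}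

instance isProbabilityMeasure_uniformSimplex_of_neZero [NeZero F] :
    IsProbabilityMeasure (uniformSimplex F) := by
  obtain ⟨n, rfl⟩ := Nat.exists_eq_succ_of_ne_zero (NeZero.ne F)
  exact isProbabilityMeasure_uniformSimplex n

theorem Fin.prod_dite_lt {R : Type*} [CommMonoid R] (hFI : F ≤ I) (c : Fin F → R) :
    ∏ i : Fin I, (if h : (i : ℕ) < F then c ⟨i, h⟩ else 1) = ∏ f, c f := by
  obtain ⟨k, rfl⟩ := Nat.exists_eq_add_of_le hFI
  rw [Fin.prod_univ_add]
  simp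

theorem le_real_uniformSimplex_ball [NeZero F] {y : Fin F → ℝ} (h0 : ∀ f, 0 ≤ y f)
    (h1 : ∑ f, y f = 1) {t : ℝ} (ht0 : 0 ≤ t) (ht1 : t ≤ 1) :
    (t / F) ^ (F - 1) ≤ (uniformSimplex F).real {g | ∀ f, |g f - y f| ≤ t} := by
  obtain ⟨n, rfl⟩ := Nat.exists_eq_succ_of_ne_zero (NeZero.ne F)
  have := le_uniformSimplex_ball h0 h1 ht0 ht1
  rw [ENNReal.ofReal_le_iff_le_toReal (measure_ne_top _ _)] at this
  exact this

theorem ae_pi_uniformSimplex [NeZero F] :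
    ∀ᵐ G ∂Measure.pi (fun _ : Fin I => uniformSimplex F),
      ∀ i, (∀ f, 0 ≤ G i f) ∧ ∑ f, G i f = 1 := by
  obtain ⟨n, rfl⟩ := Nat.exists_eq_succ_of_ne_zero (NeZero.ne F)
  rw [ae_all_iff]
  intro i
  exact (Measure.quasiMeasurePreserving_eval (μ := fun _ : Fin I => uniformSimplex (n + 1)) i).ae
    (ae_uniformSimplex n)

theorem real_pi_univ_pi [NeZero F] (c : Fin I → Set (Fin F → ℝ)) :
    (Measure.pi fun _ : Fin I => uniformSimplex F).real (Set.univ.pi c) =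
      ∏ i, (uniformSimplex F).real (c i) := by
  simp only [Measure.real, Measure.pi_pi, ENNReal.toReal_prod]

/-- With fewer than `F` rows, the rows and the all-ones vector are almost surely linearly
independent. -/
theorem ae_linearIndependent_snoc {n k : ℕ} (hk : k < n + 1) :
    ∀ᵐ G ∂Measure.pi (fun _ : Fin k => uniformSimplex (n + 1)),
      LinearIndependent ℝ (Fin.snoc (α := fun _ => Fin (n + 1) → ℝ) G 1) := by
  induction k with
  | zero =>
    refine Filter.Eventually.of_forall fun G => ?_
    rw [linearIndependent_finSnoc]
    refine ⟨linearIndependent_empty_type, ?_⟩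
    rw [Set.range_eq_empty, Submodule.span_empty, Submodule.mem_bot]
    exact one_ne_zero
  | succ k ih =>
    have hm : MeasurableSet {G : Fin (k + 1) → Fin (n + 1) → ℝ |
        LinearIndependent ℝ (Fin.snoc (α := fun _ => Fin (n + 1) → ℝ) G 1)} := by
      have ho := isOpen_setOfPred_linearIndependent (𝕜 := ℝ) (E := Fin (n + 1) → ℝ)
        (ι := Fin (k + 1 + 1))
      refine (ho.preimage (f := fun G : Fin (k + 1) → Fin (n + 1) → ℝ =>
        Fin.snoc (α := fun _ => Fin (n + 1) → ℝ) G 1) ?_).measurableSet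
      refine continuous_pi fun i => ?_
      induction i using Fin.lastCases with
      | last => simp only [Fin.snoc_last]; exact continuous_const
      | cast j => simp only [Fin.snoc_castSucc]; exact continuous_apply j
    have hmp := (measurePreserving_piFinSuccAbove
      (fun _ : Fin (k + 1) => uniformSimplex (n + 1)) 0).symm
    rw [ae_iff]
    change (Measure.pi fun _ : Fin (k + 1) => uniformSimplex (n + 1)) {G |
      LinearIndependent ℝ (Fin.snoc (α := fun _ => Fin (n + 1) → ℝ) G 1)}ᶜ = 0
    rw [← hmp.measure_preimage hm.compl.nullMeasurableSet,
      Measure.prod_apply_symm (hmp.measurable hm.compl)]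
    rw [lintegral_eq_zero_iff (measurable_measure_prodMk_right (hmp.measurable hm.compl))]
    filter_upwards [ih (by omega)] with G hG
    set v : Fin (k + 1) → Fin (n + 1) → ℝ := Fin.snoc (α := fun _ => Fin (n + 1) → ℝ) G 1 with hv
    obtain ⟨x, hx, hx0⟩ : ∃ x ∈ LinearMap.ker (Matrix.toLin' (Matrix.of v)), x ≠ 0 := by
      have := LinearMap.ker_ne_bot_of_finrank_lt (f := Matrix.toLin' (Matrix.of v))
        (by simpa using by omega)
      exact (Submodule.ne_bot_iff _).1 this
    refine measure_mono_null ?_ (uniformSimplex_hyperplane hx0)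
    intro g hg
    by_contra hgx
    refine hg ?_
    have e : Fin.snoc (α := fun _ => Fin (n + 1) → ℝ) (Fin.cons (α := fun _ => Fin (n + 1) → ℝ) g G) 1
        = Fin.cons (α := fun _ => Fin (n + 1) → ℝ) g v := by
      rw [hv]; exact (Fin.cons_snoc_eq_snoc_cons _ _ _).symm
    change LinearIndependent ℝ (Fin.snoc (α := fun _ => Fin (n + 1) → ℝ)
      (Fin.insertNth (α := fun _ => Fin (n + 1) → ℝ) 0 g G) 1)
    rw [Fin.insertNth_zero]
    change LinearIndependent ℝ (Fin.snoc (α := fun _ => Fin (n + 1) → ℝ)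
      (Fin.cons (α := fun _ => Fin (n + 1) → ℝ) g G) 1)
    rw [e, linearIndependent_finCons]
    refine ⟨hG, fun hmem => hgx ?_⟩
    -- the span of the previous vectors lies in the hyperplane orthogonal to `x`
    have hle : Submodule.span ℝ (Set.range v) ≤
        LinearMap.ker (∑ f, (x f) • (LinearMap.proj f : (Fin (n + 1) → ℝ) →ₗ[ℝ] ℝ)) := by
      rw [Submodule.span_le]
      rintro _ ⟨i, rfl⟩
      have h1 := congrFun (LinearMap.mem_ker.1 hx) i
      simp only [Matrix.toLin'_apply, Matrix.mulVec, dotProduct, Matrix.of_apply,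
        Pi.zero_apply] at h1
      simp only [SetLike.mem_coe, LinearMap.mem_ker, LinearMap.sum_apply, LinearMap.smul_apply,
        LinearMap.proj_apply, smul_eq_mul]
      rw [← h1]; exact Finset.sum_congr rfl fun f _ => mul_comm _ _
    have h2 := hle hmem
    simp only [LinearMap.mem_ker, LinearMap.sum_apply, LinearMap.smul_apply,
        LinearMap.proj_apply, smul_eq_mul] at h2
    change ∑ f, g f * x f = 0
    rw [← h2]; exact Finset.sum_congr rfl fun f _ => mul_comm _ _

/-- A random matrix with fewer rows than columns almost surely has no scaling to unit column
sums. -/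
theorem pi_scalable_eq_zero [NeZero F] (hIF : I < F) :
    (Measure.pi fun _ : Fin I => uniformSimplex F) {G | Scalable G} = 0 := by
  obtain ⟨n, rfl⟩ := Nat.exists_eq_succ_of_ne_zero (NeZero.ne F)
  refine measure_mono_null ?_ (ae_iff.1 (ae_linearIndependent_snoc hIF))
  rintro G ⟨d, -, hd⟩ hli
  rw [linearIndependent_finSnoc] at hli
  refine hli.2 ?_
  have : (1 : Fin (n + 1) → ℝ) = ∑ i, d i • G i := by
    ext f
    simpa using (hd f).symm
  rw [this]
  exact Submodule.sum_mem _ fun i _ => Submodule.smul_mem _ _ (Submodule.subset_span ⟨i, rfl⟩)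

/-- The event that the first `F` rows are close to the `F` vertices. -/
def nearDiagonal (_hFI : F ≤ I) : Set (Fin I → Fin F → ℝ) :=
  Set.univ.pi fun i => if h : (i : ℕ) < F then
    {g | ∀ f, |g f - (Pi.single ⟨i, h⟩ 1 : Fin F → ℝ) f| ≤ 1 / (16 * F)} else Set.univ

/-- A lower bound for the probability that a random matrix can be scaled. -/
noncomputable def scalConst (F : ℕ) : ℝ := ((1 / (16 * F) / F) ^ (F - 1)) ^ F

theorem scalConst_pos [NeZero F] : 0 < scalConst F := by
  have : (0 : ℝ) < F := by exact_mod_cast Nat.pos_of_ne_zero (NeZero.ne F)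
  unfold scalConst; positivity

theorem nearDiagonal_ae_le [NeZero F] (hFI : F ≤ I) (t : Set (Fin I → Fin F → ℝ)) :
    (Measure.pi fun _ : Fin I => uniformSimplex F) (nearDiagonal hFI \ t) ≤
      (Measure.pi fun _ : Fin I => uniformSimplex F) ({G | Scalable G} \ t) := by
  refine measure_mono_ae ?_
  filter_upwards [ae_pi_uniformSimplex] with G hG hmem
  refine ⟨scalable_of_near_diagonal hFI (fun i => (hG i).1) (fun i => (hG i).2) fun f g => ?_,
    hmem.2⟩
  have := hmem.1 (Fin.castLE hFI f) (Set.mem_univ _)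
  simp only [Fin.val_castLE, Fin.is_lt, dif_pos] at this
  exact this g

theorem scalConst_le_nearDiagonal [NeZero F] (hFI : F ≤ I) :
    scalConst F ≤ (Measure.pi fun _ : Fin I => uniformSimplex F).real (nearDiagonal hFI) := by
  have hF : (1 : ℝ) ≤ F := by exact_mod_cast Nat.pos_of_ne_zero (NeZero.ne F)
  rw [nearDiagonal, real_pi_univ_pi]
  have h1 : ∏ i : Fin I, (if h : (i : ℕ) < F then (1 / (16 * (F : ℝ)) / F) ^ (F - 1) else 1) =
      scalConst F := by
    rw [Fin.prod_dite_lt hFI fun _ => (1 / (16 * (F : ℝ)) / F) ^ (F - 1)]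
    simp [scalConst]
  rw [← h1]
  refine Finset.prod_le_prod (fun i _ => ?_) fun i _ => ?_
  · split_ifs <;> positivity
  · split_ifs with h
    · refine le_real_uniformSimplex_ball (fun f => ?_) (by simp) (by positivity) ?_
      · by_cases hf : f = ⟨i, h⟩
        · rw [hf, Pi.single_eq_same]; exact zero_le_one
        · rw [Pi.single_eq_of_ne hf]
      · rw [div_le_one (by positivity)]; linarith
    · simp

theorem scalConst_le_scalable [NeZero F] (hFI : F ≤ I) :
    scalConst F ≤ (Measure.pi fun _ : Fin I => uniformSimplex F).real {G | Scalable G} := by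
  refine (scalConst_le_nearDiagonal hFI).trans ?_
  refine ENNReal.toReal_mono (measure_ne_top _ _) ?_
  simpa using nearDiagonal_ae_le hFI ∅

theorem scalableUniform_real_apply [NeZero F] {t : Set (Fin I → Fin F → ℝ)}
    (ht : MeasurableSet t) : (scalableUniform I F).real t =
      (Measure.pi fun _ : Fin I => uniformSimplex F).real (t ∩ {G | Scalable G}) /
        (Measure.pi fun _ : Fin I => uniformSimplex F).real {G | Scalable G} := by
  unfold scalableUniform ProbabilityTheory.cond
  simp only [Measure.real, Measure.smul_apply, smul_eq_mul, Measure.restrict_apply ht,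
    ENNReal.toReal_mul, ENNReal.toReal_inv]
  rw [div_eq_inv_mul]

theorem scalableUniform_real_le [NeZero F] (hFI : F ≤ I) {t : Set (Fin I → Fin F → ℝ)}
    (ht : MeasurableSet t) : (scalableUniform I F).real t ≤
      (Measure.pi fun _ : Fin I => uniformSimplex F).real t / scalConst F := by
  rw [scalableUniform_real_apply ht]
  have h0 := scalConst_pos (F := F)
  have h1 := scalConst_le_scalable hFI
  exact div_le_div₀ measureReal_nonneg (measureReal_mono Set.inter_subset_left) h0 h1

/-- The constant in the exponent of the bound for the probability that no row is close to a given
vertex. -/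
noncomputable def vertexConst (F : ℕ) : ℝ :=
  scalConst F / (2 * (1 + 2 * Real.log (1 / scalConst F))) / F

theorem scalConst_le_one [NeZero F] : scalConst F ≤ 1 :=
  (scalConst_le_nearDiagonal le_rfl).trans measureReal_le_one

theorem vertexConst_pos [NeZero F] : 0 < vertexConst F := by
  have h0 := scalConst_pos (F := F)
  have h1 := Real.log_nonneg (x := 1 / scalConst F) (by
    rw [le_div_iff₀ h0, one_mul]; exact scalConst_le_one)
  have : (0 : ℝ) < F := by exact_mod_cast Nat.pos_of_ne_zero (NeZero.ne F)
  unfold vertexConst; positivity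

/-- Two bounds for a probability, one useful for large `y` and one for small `y`. -/
theorem le_exp_of_le_of_le {x s y : ℝ} (hs0 : 0 < s) (hs1 : s ≤ 1) (hy : 0 ≤ y)
    (h1 : x ≤ Real.exp (-y) / s) (h2 : x ≤ 1 - s * (1 - Real.exp (-y))) :
    x ≤ Real.exp (-(s / (2 * (1 + 2 * Real.log (1 / s))) * y)) := by
  have hl : 0 ≤ Real.log (1 / s) := Real.log_nonneg (by rw [le_div_iff₀ hs0, one_mul]; exact hs1)
  set l := Real.log (1 / s)
  have hexp : Real.exp l = 1 / s := Real.exp_log (by positivity)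
  set c := s / (2 * (1 + 2 * l)) with hc
  have hc0 : 0 < c := by positivity
  have hcs : c ≤ s / (1 + 2 * l) := by
    rw [hc]; apply div_le_div_of_nonneg_left hs0.le <;> linarith
  have hc2 : c ≤ 1 / 2 := by
    rw [hc, div_le_div_iff₀ (by positivity) two_pos]; nlinarith
  rcases le_total (2 * l) y with hyl | hyl
  · refine h1.trans ?_
    rw [div_eq_mul_one_div, ← hexp, ← Real.exp_add, Real.exp_le_exp]
    nlinarith
  · refine h2.trans ?_
    have h3 : y / (1 + 2 * l) ≤ 1 - Real.exp (-y) := by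
      have h4 : y / (1 + 2 * l) ≤ y / (1 + y) := by
        apply div_le_div_of_nonneg_left hy <;> linarith
      have h5 : Real.exp (-y) ≤ 1 / (1 + y) := by
        rw [Real.exp_neg, ← one_div]
        apply one_div_le_one_div_of_le (by linarith)
        linarith [Real.add_one_le_exp y]
      have h6 : y / (1 + y) = 1 - 1 / (1 + y) := by field_simp; ring
      linarith
    have h7 := Real.add_one_le_exp (-(c * y))
    have h8 : c * y ≤ s * (y / (1 + 2 * l)) := by
      rw [mul_div_assoc', ← div_mul_eq_mul_div]
      exact mul_le_mul_of_nonneg_right hcs hy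
    nlinarith

theorem measurableSet_no_row (B : Set (Fin F → ℝ)) (hB : MeasurableSet B) :
    MeasurableSet {G : Fin I → Fin F → ℝ | ∀ i, G i ∉ B} := by
  have : {G : Fin I → Fin F → ℝ | ∀ i, G i ∉ B} = ⋂ i, (fun G => G i) ⁻¹' Bᶜ := by
    ext; simp
  rw [this]
  exact MeasurableSet.iInter fun i => (measurable_pi_apply i) hB.compl

/-- Given that a scaling exists, a random matrix very likely has a row close to any given
vertex. -/
theorem scalableUniform_no_row_near_vertex [NeZero F] (hFI : F ≤ I) (f : Fin F) {t : ℝ}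
    (ht0 : 0 ≤ t) (ht : t ≤ 1 / (16 * F)) :
    (scalableUniform I F).real {G | ∀ i, ¬ ∀ g, |G i g - (Pi.single f 1 : Fin F → ℝ) g| ≤ t} ≤
      Real.exp (-(vertexConst F * I * (t / F) ^ (F - 1))) := by
  classical
  have hF : (1 : ℝ) ≤ F := by exact_mod_cast Nat.pos_of_ne_zero (NeZero.ne F)
  set μ := uniformSimplex F with hμ
  set π := Measure.pi fun _ : Fin I => μ with hπ
  set B : Set (Fin F → ℝ) := {g | ∀ k, |g k - (Pi.single f 1 : Fin F → ℝ) k| ≤ t}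
  have hBm : MeasurableSet B := measurableSet_pi_ball _ _
  set N : Set (Fin I → Fin F → ℝ) := {G | ∀ i, G i ∉ B} with hN
  have hNm : MeasurableSet N := measurableSet_no_row B hBm
  change (scalableUniform I F).real N ≤ _
  set q := (t / F) ^ (F - 1)
  have ht1 : t ≤ 1 := ht.trans (by rw [div_le_one (by positivity)]; linarith)
  have hqB : q ≤ μ.real B := le_real_uniformSimplex_ball (fun k => by
      by_cases hk : k = f
      · rw [hk, Pi.single_eq_same]; exact zero_le_one
      · rw [Pi.single_eq_of_ne hk]) (by simp) ht0 ht1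
  have hq0 : 0 ≤ q := by positivity
  have hq1 : q ≤ 1 := hqB.trans measureReal_le_one
  have hBc : μ.real Bᶜ ≤ 1 - q := by
    rw [probReal_compl_eq_one_sub hBm]; linarith
  obtain ⟨k, hk⟩ := Nat.exists_eq_add_of_le hFI
  set e := Real.exp (-(q * (k + 1))) with he
  have hpow : (1 - q) ^ (k + 1) ≤ e := by
    have h1 : 1 - q ≤ Real.exp (-q) := by linarith [Real.add_one_le_exp (-q)]
    refine (pow_le_pow_left₀ (by linarith) h1 _).trans ?_
    rw [← Real.exp_nat_mul, he]
    apply le_of_eq; congr 1; push_cast; ring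
  -- the unconditional bound
  have hb1 : π.real N ≤ e := by
    have : N = Set.univ.pi fun _ => Bᶜ := by ext; simp [hN]
    rw [this, hπ, real_pi_univ_pi, Finset.prod_const, Finset.card_univ, Fintype.card_fin]
    refine (pow_le_pow_left₀ measureReal_nonneg hBc _).trans (le_trans ?_ hpow)
    apply pow_le_pow_of_le_one (by linarith) (by linarith)
    have := NeZero.pos F
    omega
  have hb2 : π.real (nearDiagonal hFI ∩ N) ≤ π.real (nearDiagonal hFI) * e := by
    refine le_trans ?_ (mul_le_mul_of_nonneg_left hpow measureReal_nonneg)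
    have : nearDiagonal hFI ∩ N = Set.univ.pi fun i : Fin I => (if h : (i : ℕ) < F then
        {g | ∀ f, |g f - (Pi.single ⟨i, h⟩ 1 : Fin F → ℝ) f| ≤ 1 / (16 * F)} else Set.univ) ∩ Bᶜ := by
      ext G
      simp only [nearDiagonal, hN, Set.mem_inter_iff, Set.mem_pi, Set.mem_univ, true_implies,
        Set.mem_compl_iff, forall_and]
      rfl
    rw [this, nearDiagonal, hπ, real_pi_univ_pi, real_pi_univ_pi]
    subst hk
    rw [Fin.prod_univ_add, Fin.prod_univ_add]
    simp only [Fin.val_castAdd, Fin.is_lt, dif_pos, Fin.eta, Fin.val_natAdd, add_lt_iff_neg_left,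
      not_lt_zero, dif_neg, not_false_eq_true, Set.univ_inter, probReal_univ, Finset.prod_const_one,
      mul_one]
    rw [pow_succ', ← mul_assoc]
    refine mul_le_mul ?_ ?_ (by positivity) (mul_nonneg (Finset.prod_nonneg fun _ _ =>
      measureReal_nonneg) (by linarith))
    · rw [← Finset.mul_prod_erase _ _ (Finset.mem_univ f), ← Finset.mul_prod_erase Finset.univ
        (fun g => μ.real {h : Fin F → ℝ | ∀ k, |h k - (Pi.single g 1 : Fin F → ℝ) k| ≤ 1 / (16 * F)})
        (Finset.mem_univ f), mul_right_comm]
      refine mul_le_mul ?_ (Finset.prod_le_prod (fun _ _ => measureReal_nonneg) fun _ _ =>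
        measureReal_mono Set.inter_subset_left) (Finset.prod_nonneg fun _ _ => measureReal_nonneg)
        (mul_nonneg measureReal_nonneg (by linarith))
      set B' : Set (Fin F → ℝ) :=
        {h : Fin F → ℝ | ∀ k, |h k - (Pi.single f 1 : Fin F → ℝ) k| ≤ 1 / (16 * F)}
      have hsub : B ⊆ B' := fun h hh k => (hh k).trans ht
      have h1 : μ.real (B' ∩ Bᶜ) = μ.real B' - μ.real B := by
        rw [← Set.sdiff_eq, measureReal_sdiff hsub hBm]
      rw [h1]
      have h2 : μ.real B' ≤ 1 := measureReal_le_one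
      nlinarith
    · rw [Finset.prod_const, Finset.card_univ, Fintype.card_fin]
      exact pow_le_pow_left₀ measureReal_nonneg hBc _
  have hs := scalConst_pos (F := F)
  have hsn := scalConst_le_nearDiagonal hFI
  have hsa := scalConst_le_scalable hFI
  rw [← hμ, ← hπ] at hsn hsa
  have he1 : e ≤ 1 := Real.exp_le_one_iff.2 (by
    have : 0 ≤ q * (k + 1) := by positivity
    linarith)
  set Sc := {G : Fin I → Fin F → ℝ | Scalable G} with hSc
  have key : (scalableUniform I F).real N ≤ Real.exp
      (-(scalConst F / (2 * (1 + 2 * Real.log (1 / scalConst F))) * (q * (k + 1)))) := by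
    refine le_exp_of_le_of_le hs scalConst_le_one (by positivity) ?_ ?_
    · refine (scalableUniform_real_le hFI hNm).trans ?_
      exact div_le_div_of_nonneg_right hb1 hs.le
    · rw [scalableUniform_real_apply hNm]
      rw [← hμ, ← hπ, ← hSc, div_le_iff₀ (hs.trans_le hsa)]
      have h1 : π.real (Sc ∩ N) + π.real (Sc \ N) = π.real Sc :=
        measureReal_inter_add_sdiff hNm
      have h2 : π.real (nearDiagonal hFI \ N) ≤ π.real (Sc \ N) :=
        ENNReal.toReal_mono (measure_ne_top _ _) (nearDiagonal_ae_le hFI N)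
      have h3 : π.real (nearDiagonal hFI ∩ N) + π.real (nearDiagonal hFI \ N) =
          π.real (nearDiagonal hFI) := measureReal_inter_add_sdiff hNm
      have h4 : π.real Sc ≤ 1 := measureReal_le_one
      rw [Set.inter_comm N Sc]
      have h5 : scalConst F * (1 - e) ≤ π.real (nearDiagonal hFI) * (1 - e) :=
        mul_le_mul_of_nonneg_right hsn (by linarith)
      have h6 : scalConst F * (1 - e) * π.real Sc ≤ scalConst F * (1 - e) :=
        mul_le_of_le_one_right (mul_nonneg hs.le (by linarith)) h4
      rw [he] at h5 h6 hb2
      linarith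
  refine key.trans (Real.exp_le_exp.2 (neg_le_neg ?_))
  have hc0 : 0 ≤ scalConst F / (2 * (1 + 2 * Real.log (1 / scalConst F))) := by
    have := vertexConst_pos (F := F)
    unfold vertexConst at this
    by_contra hcon
    push Not at hcon
    have := div_neg_of_neg_of_pos hcon (show (0 : ℝ) < F by linarith)
    linarith
  unfold vertexConst
  have hIk : (I : ℝ) / F ≤ k + 1 := by
    rw [div_le_iff₀ (by linarith), hk]
    push_cast
    have : (0 : ℝ) ≤ k := Nat.cast_nonneg k
    nlinarith
  calc _ = scalConst F / (2 * (1 + 2 * Real.log (1 / scalConst F))) * (q * (I / F)) := by ring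
    _ ≤ _ := mul_le_mul_of_nonneg_left (mul_le_mul_of_nonneg_left hIk hq0) hc0

end ScalableUniform

/-! ### The law of a random factor matrix -/

section FactorLaw

variable {I F : ℕ}

/-- The flat configuration: the rows `1, …, F - 1` are close to the points
`F⁻¹ (1 - 3 τ / 2) e₀ + (1 - F⁻¹ (1 - 3 τ / 2)) e_f`, and all other rows are close to `e₀`. -/
def flatConfiguration {n : ℕ} (τ : ℝ) (i : Fin I) : Set (Fin (n + 1 + 1) → ℝ) :=
  if h : (i : ℕ) < n + 1 + 1 ∧ (i : ℕ) ≠ 0 then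
    {g | ∀ k, |g k - ((1 - 3 / 2 * τ) / (n + 2) * (Pi.single 0 1 : Fin (n + 1 + 1) → ℝ) k +
      (1 - (1 - 3 / 2 * τ) / (n + 2)) * (Pi.single ⟨i, h.1⟩ 1 : Fin (n + 1 + 1) → ℝ) k)| ≤
        τ / (2 * (n + 2))}
  else {g | ∀ k, |g k - (Pi.single 0 1 : Fin (n + 1 + 1) → ℝ) k| ≤ 1 / 4}

theorem measurableSet_flatConfiguration {n : ℕ} (τ : ℝ) :
    MeasurableSet (Set.univ.pi fun i : Fin I => flatConfiguration (n := n) τ i) := by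
  refine MeasurableSet.univ_pi fun i => ?_
  unfold flatConfiguration
  split_ifs
  · exact measurableSet_pi_ball _ _
  · exact measurableSet_pi_ball _ _

/-- A matrix in the flat configuration can be scaled, and each scaling contains a small factor. -/
theorem scalable_of_mem_flatConfiguration {n : ℕ} (hFI : n + 1 + 1 ≤ I) {τ : ℝ} (hτ0 : 0 < τ)
    (hτ : τ ≤ 1 / 8) {G : Fin I → Fin (n + 1 + 1) → ℝ}
    (hG : ∀ i, (∀ f, 0 ≤ G i f) ∧ ∑ f, G i f = 1)
    (hmem : G ∈ Set.univ.pi fun i : Fin I => flatConfiguration (n := n) τ i) :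
    Scalable G ∧ ∀ d : Fin I → ℝ, (∀ i, 0 < d i) → (∀ f, ∑ i, d i * G i f = 1) →
      d (Fin.castLE hFI 0) ≤ 8 * τ := by
  have hflat : ∀ f : Fin (n + 1), ∀ k, |G (Fin.castLE hFI f.succ) k -
      ((1 - 3 / 2 * τ) / (n + 2) * (Pi.single 0 1 : Fin (n + 1 + 1) → ℝ) k +
      (1 - (1 - 3 / 2 * τ) / (n + 2)) * (Pi.single f.succ 1 : Fin (n + 1 + 1) → ℝ) k)| ≤
        τ / (2 * (n + 2)) := by
    intro f
    have := hmem (Fin.castLE hFI f.succ) (Set.mem_univ _)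
    have hc : ((Fin.castLE hFI f.succ : Fin I) : ℕ) < n + 1 + 1 ∧
        ((Fin.castLE hFI f.succ : Fin I) : ℕ) ≠ 0 := by simp; omega
    simp only [flatConfiguration] at this
    rw [dif_pos hc] at this
    exact this
  have hflat0 : ∀ f : Fin (n + 1), |G (Fin.castLE hFI f.succ) 0 - (1 - 3 / 2 * τ) / (n + 2)| ≤
      τ / (2 * (n + 2)) := by
    intro f
    have := hflat f 0
    rwa [Pi.single_eq_same, Pi.single_eq_of_ne (Fin.succ_ne_zero f).symm, mul_one, mul_zero,
      add_zero] at this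
  refine scalable_of_flat_configuration hFI hτ0 hτ (fun i => (hG i).1) (fun i => (hG i).2) ?_ ?_ ?_
    ?_
  · intro i hi
    have := hmem i (Set.mem_univ _)
    have hc : ¬ ((i : ℕ) < n + 1 + 1 ∧ (i : ℕ) ≠ 0) := by
      rintro ⟨h1, h2⟩
      refine hi ⟨(i : ℕ) - 1, by omega⟩ (Fin.ext ?_)
      simp; omega
    simp only [flatConfiguration] at this
    rw [dif_neg hc] at this
    have h2 := (abs_le.1 (this 0)).1
    rw [Pi.single_eq_same] at h2
    linarith
  · intro f
    have h2 := (abs_le.1 (hflat0 f)).1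
    have : (1 - 2 * τ) / ((n : ℝ) + 2) = (1 - 3 / 2 * τ) / (n + 2) - τ / (2 * (n + 2)) := by
      field_simp; ring
    linarith
  · intro f
    have h2 := (abs_le.1 (hflat0 f)).2
    have : (1 - τ) / ((n : ℝ) + 2) = (1 - 3 / 2 * τ) / (n + 2) + τ / (2 * (n + 2)) := by
      field_simp; ring
    linarith
  · intro f g hfg
    have h2 := hflat f g.succ
    rw [Pi.single_eq_of_ne (Fin.succ_ne_zero g), Pi.single_eq_of_ne (fun h =>
      hfg (Fin.succ_injective _ h).symm), mul_zero, mul_zero, add_zero, sub_zero] at h2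
    refine h2.trans ?_
    rw [div_le_div_iff₀ (by positivity) (by positivity)]
    push_cast
    have : (0 : ℝ) ≤ n := Nat.cast_nonneg n
    nlinarith

theorem le_pi_flatConfiguration {n : ℕ} (hFI : n + 1 + 1 ≤ I) {τ : ℝ} (hτ0 : 0 < τ)
    (hτ : τ ≤ 1 / 8) :
    ((τ / (2 * (n + 2) ^ 2)) ^ (n + 1)) ^ (n + 2) * ((1 / (4 * (n + 2 : ℝ))) ^ (n + 1)) ^ I ≤
      (Measure.pi fun _ : Fin I => uniformSimplex (n + 1 + 1)).real
        (Set.univ.pi fun i : Fin I => flatConfiguration (n := n) τ i) := by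
  have hn : (0 : ℝ) < n + 2 := by positivity
  rw [real_pi_univ_pi]
  have h1 : ∏ i : Fin I, (if h : (i : ℕ) < n + 1 + 1 then (τ / (2 * ((n : ℝ) + 2) ^ 2)) ^ (n + 1)
      else 1) = ((τ / (2 * (n + 2) ^ 2)) ^ (n + 1)) ^ (n + 2) := by
    rw [Fin.prod_dite_lt hFI fun _ => (τ / (2 * ((n : ℝ) + 2) ^ 2)) ^ (n + 1)]
    simp
  have h2 : ((1 / (4 * ((n : ℝ) + 2))) ^ (n + 1)) ^ I =
      ∏ i : Fin I, (1 / (4 * ((n : ℝ) + 2))) ^ (n + 1) := by simp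
  rw [← h1, h2, ← Finset.prod_mul_distrib]
  have hb : 1 / (4 * ((n : ℝ) + 2)) ≤ 1 := by
    rw [div_le_one (by positivity)]; linarith
  have hbt : τ / (2 * ((n : ℝ) + 2) ^ 2) ≤ 1 := by
    rw [div_le_one (by positivity)]; nlinarith
  refine Finset.prod_le_prod (fun i _ => ?_) fun i _ => ?_
  · split_ifs <;> positivity
  · unfold flatConfiguration
    by_cases h : (i : ℕ) < n + 1 + 1 ∧ (i : ℕ) ≠ 0
    · rw [dif_pos h, dif_pos h.1]
      set a := (1 - 3 / 2 * τ) / ((n : ℝ) + 2) with ha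
      have ha0 : 0 ≤ a := div_nonneg (by linarith) hn.le
      have ha1 : a ≤ 1 := by rw [ha, div_le_one hn]; linarith
      have hsingle : ∀ (j k : Fin (n + 1 + 1)), 0 ≤ (Pi.single j 1 : Fin (n + 1 + 1) → ℝ) k := by
        intro j k
        by_cases hk : k = j
        · rw [hk, Pi.single_eq_same]; exact zero_le_one
        · rw [Pi.single_eq_of_ne hk]
      have h3 := le_real_uniformSimplex_ball (F := n + 1 + 1)
        (y := fun k => a * (Pi.single 0 1 : Fin (n + 1 + 1) → ℝ) k +
          (1 - a) * (Pi.single ⟨i, h.1⟩ 1 : Fin (n + 1 + 1) → ℝ) k) (t := τ / (2 * (n + 2)))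
        (fun k => add_nonneg (mul_nonneg ha0 (hsingle _ _))
          (mul_nonneg (by linarith) (hsingle _ _)))
        (by rw [Finset.sum_add_distrib, ← Finset.mul_sum, ← Finset.mul_sum]; simp)
        (by positivity) (by rw [div_le_one (by positivity)]; linarith)
      have h4 : (τ / (2 * ((n : ℝ) + 2) ^ 2)) ^ (n + 1) * (1 / (4 * ((n : ℝ) + 2))) ^ (n + 1) ≤
          (τ / (2 * ((n : ℝ) + 2) ^ 2)) ^ (n + 1) :=
        mul_le_of_le_one_right (by positivity) (pow_le_one₀ (by positivity) hb)
      refine h4.trans (le_trans (le_of_eq ?_) h3)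
      simp only [Nat.add_sub_cancel]
      congr 1
      push_cast
      field_simp
      ring
    · rw [dif_neg h]
      have h3 := le_real_uniformSimplex_ball (F := n + 1 + 1)
        (y := (Pi.single 0 1 : Fin (n + 1 + 1) → ℝ)) (t := 1 / 4)
        (fun k => by
          by_cases hk : k = 0
          · rw [hk, Pi.single_eq_same]; exact zero_le_one
          · rw [Pi.single_eq_of_ne hk]) (by simp) (by norm_num) (by norm_num)
      refine le_trans ?_ h3
      have h4 : (if h : (i : ℕ) < n + 1 + 1 then (τ / (2 * ((n : ℝ) + 2) ^ 2)) ^ (n + 1) else 1)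
          ≤ 1 := by
        split_ifs
        · exact pow_le_one₀ (by positivity) hbt
        · exact le_rfl
      refine (mul_le_of_le_one_left (by positivity) h4).trans (le_of_eq ?_)
      simp only [Nat.add_sub_cancel]
      congr 1
      push_cast
      field_simp
      ring

/-- A matrix with nonnegative entries and unit column sums. -/
def IsColStochastic (a : Fin I → Fin F → ℝ) : Prop :=
  (∀ i f, 0 ≤ a i f) ∧ ∀ f, ∑ i, a i f = 1

theorem measurableSet_isColStochastic :
    MeasurableSet {a : Fin I → Fin F → ℝ | IsColStochastic a} := by
  have : {a : Fin I → Fin F → ℝ | IsColStochastic a} =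
      (⋂ i, ⋂ f, {a | 0 ≤ a i f}) ∩ ⋂ f, {a | ∑ i, a i f = 1} := by
    ext; simp [IsColStochastic]
  rw [this]
  refine (MeasurableSet.iInter fun i => MeasurableSet.iInter fun f =>
    measurableSet_le measurable_const (by fun_prop)).inter (MeasurableSet.iInter fun f =>
      measurableSet_eq_fun (by fun_prop) measurable_const)

variable {Ω : Type*} [MeasurableSpace Ω] {P : Measure Ω} {A : Ω → Fin I → Fin F → ℝ}

/-- The scaling model, with the almost sure properties of the simplex included. -/
theorem IsScaledSimplexFactor.exists_ae [NeZero F] (hA : IsScaledSimplexFactor P A) :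
    ∃ (G : Ω → Fin I → Fin F → ℝ) (d : Ω → Fin I → ℝ), Measurable G ∧
    P.map G = scalableUniform I F ∧
    ∀ᵐ ω ∂P, (∀ i, 0 < d ω i) ∧ (∀ i f, A ω i f = d ω i * G ω i f) ∧ (∀ f, ∑ i, A ω i f = 1) ∧
      ∀ i, (∀ f, 0 ≤ G ω i f) ∧ ∑ f, G ω i f = 1 := by
  obtain ⟨G, d, hG, -, hlaw, h⟩ := hA
  refine ⟨G, d, hG, hlaw, ?_⟩
  have h2 : ∀ᵐ x ∂P.map G, ∀ i, (∀ f, 0 ≤ x i f) ∧ ∑ f, x i f = 1 := by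
    rw [hlaw]
    exact (ProbabilityTheory.cond_absolutelyContinuous).ae_le ae_pi_uniformSimplex
  filter_upwards [h, ae_of_ae_map hG.aemeasurable h2] with ω h1 h2
  exact ⟨h1.1, h1.2.1, h1.2.2, h2⟩

theorem IsScaledSimplexFactor.ae_isColStochastic [NeZero F] (hA : IsScaledSimplexFactor P A) :
    ∀ᵐ ω ∂P, IsColStochastic (A ω) := by
  obtain ⟨G, d, -, -, h⟩ := hA.exists_ae
  filter_upwards [h] with ω ⟨h1, h2, h3, h4⟩
  exact ⟨fun i f => by rw [h2]; exact mul_nonneg (h1 i).le ((h4 i).1 f), h3⟩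

theorem real_preimage_eq_scalableUniform {G : Ω → Fin I → Fin F → ℝ}
    (hG : Measurable G) (hlaw : P.map G = scalableUniform I F)
    {t : Set (Fin I → Fin F → ℝ)} (ht : MeasurableSet t) :
    P.real (G ⁻¹' t) = (scalableUniform I F).real t := by
  rw [← hlaw, map_measureReal_apply hG ht]

variable [IsProbabilityMeasure P]

theorem IsScaledSimplexFactor.le [NeZero F] (hA : IsScaledSimplexFactor P A) : F ≤ I := by
  obtain ⟨G, d, hG, -, hlaw, -⟩ := hA
  by_contra hcon
  have h1 : P.map G Set.univ = 1 := by
    rw [Measure.map_apply hG MeasurableSet.univ]; simp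
  rw [hlaw] at h1
  unfold scalableUniform ProbabilityTheory.cond at h1
  rw [Measure.smul_apply, Measure.restrict_apply_univ, pi_scalable_eq_zero (by omega),
    smul_zero] at h1
  exact zero_ne_one h1

theorem real_mono_ae {s t : Set Ω} (h : ∀ᵐ ω ∂P, ω ∈ s → ω ∈ t) : P.real s ≤ P.real t :=
  ENNReal.toReal_mono (measure_ne_top _ _) (measure_mono_ae h)

/-- Rows with arbitrarily small entries have positive probability. -/
theorem IsScaledSimplexFactor.le_prob_small_row {n : ℕ} {A : Ω → Fin I → Fin (n + 1 + 1) → ℝ}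
    (hA : IsScaledSimplexFactor P A) {τ : ℝ} (hτ0 : 0 < τ) (hτ : τ ≤ 1 / 8) :
    ((τ / (2 * (n + 2) ^ 2)) ^ (n + 1)) ^ (n + 2) * ((1 / (4 * (n + 2 : ℝ))) ^ (n + 1)) ^ I ≤
      P.real {ω | ∃ i, ∀ f, A ω i f ≤ 8 * τ} := by
  have hFI := hA.le
  obtain ⟨G, d, hG, hlaw, h⟩ := hA.exists_ae
  set O := Set.univ.pi fun i : Fin I => flatConfiguration (n := n) τ i
  have hOm : MeasurableSet O := measurableSet_flatConfiguration τ
  have h1 : (Measure.pi fun _ : Fin I => uniformSimplex (n + 1 + 1)).real O ≤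
      (scalableUniform I (n + 1 + 1)).real O := by
    rw [scalableUniform_real_apply hOm]
    have h2 : (Measure.pi fun _ : Fin I => uniformSimplex (n + 1 + 1)).real O ≤
        (Measure.pi fun _ : Fin I => uniformSimplex (n + 1 + 1)).real (O ∩ {G | Scalable G}) := by
      refine real_mono_ae ?_
      filter_upwards [ae_pi_uniformSimplex] with g hg hgO
      exact ⟨hgO, (scalable_of_mem_flatConfiguration hFI hτ0 hτ hg hgO).1⟩
    refine h2.trans (le_div_self measureReal_nonneg ?_ measureReal_le_one)
    exact (scalConst_pos).trans_le (scalConst_le_scalable hFI)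
  refine (le_pi_flatConfiguration hFI hτ0 hτ).trans (h1.trans ?_)
  rw [← real_preimage_eq_scalableUniform hG hlaw hOm]
  refine real_mono_ae ?_
  filter_upwards [h] with ω ⟨h1, h2, h3, h4⟩ hω
  refine ⟨Fin.castLE hFI 0, fun f => ?_⟩
  have h5 := (scalable_of_mem_flatConfiguration hFI hτ0 hτ h4 hω).2 (d ω) h1
    (fun f => by rw [← h3 f]; exact Finset.sum_congr rfl fun i _ => (h2 i f).symm)
  have h6 : G ω (Fin.castLE hFI 0) f ≤ 1 := (h4 (Fin.castLE hFI 0)).2 ▸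
    Finset.single_le_sum (f := G ω (Fin.castLE hFI 0)) (fun i _ => (h4 _).1 i) (Finset.mem_univ f)
  rw [h2]
  exact (mul_le_of_le_one_right (h1 _).le h6).trans h5

/-- It is unlikely that no row of a random factor is dominated by its `f`-th entry. -/
theorem IsScaledSimplexFactor.prob_no_dominated_row [NeZero F] (hA : IsScaledSimplexFactor P A)
    {lam : Fin F → ℝ} (hlam : ∑ f, lam f = 1) {b : ℝ} (hb : 0 < b) (hbl : ∀ f, b ≤ lam f)
    (f : Fin F) {e : ℝ} (he0 : 0 ≤ e) (he : e ≤ 1 / 8) :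
    P.real {ω | ∀ i, ¬ ∑ g ∈ Finset.univ.erase f, lam g * A ω i g ≤ e * ∑ g, lam g * A ω i g} ≤
      Real.exp (-(vertexConst F * I * (e * b / 2 / F) ^ (F - 1))) := by
  classical
  have hFI := hA.le
  have hF : (0 : ℝ) < F := by exact_mod_cast NeZero.pos F
  obtain ⟨G, d, hG, hlaw, h⟩ := hA.exists_ae
  have hbF : b * F ≤ 1 := by
    have : ∑ _g : Fin F, b ≤ 1 := hlam ▸ Finset.sum_le_sum fun g _ => hbl g
    rw [Finset.sum_const, Finset.card_univ, Fintype.card_fin, nsmul_eq_mul] at this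
    linarith
  have hF1 : (1 : ℝ) ≤ F := by exact_mod_cast NeZero.pos F
  have hb1 : b ≤ 1 := by nlinarith
  have ht : e * b / 2 ≤ 1 / (16 * F) := by
    rw [le_div_iff₀ (by positivity)]; nlinarith
  refine le_trans ?_ (scalableUniform_no_row_near_vertex hFI f (t := e * b / 2) (by positivity) ht)
  change _ ≤ (scalableUniform I F).real {G | ∀ i, G i ∉
    {g : Fin F → ℝ | ∀ k, |g k - (Pi.single f 1 : Fin F → ℝ) k| ≤ e * b / 2}}
  rw [← real_preimage_eq_scalableUniform hG hlaw
    (measurableSet_no_row {g | ∀ k, |g k - (Pi.single f 1 : Fin F → ℝ) k| ≤ e * b / 2}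
      (measurableSet_pi_ball _ _))]
  refine real_mono_ae ?_
  filter_upwards [h] with ω ⟨h1, h2, h3, h4⟩ hω i hi
  refine hω i ?_
  have hGf : 1 / 2 ≤ G ω i f := by
    have := (abs_le.1 (hi f)).1
    rw [Pi.single_eq_same] at this
    have : e * b ≤ 1 := by nlinarith
    linarith
  have hGg : ∀ g ∈ Finset.univ.erase f, lam g * A ω i g ≤ lam g * (d ω i * (e * b / 2)) := by
    intro g hg
    have h5 := (abs_le.1 (hi g)).2
    rw [Pi.single_eq_of_ne (Finset.ne_of_mem_erase hg), sub_zero] at h5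
    rw [h2]
    exact mul_le_mul_of_nonneg_left (mul_le_mul_of_nonneg_left h5 (h1 i).le) (hb.le.trans (hbl g))
  have h6 : ∑ g ∈ Finset.univ.erase f, lam g * A ω i g ≤ d ω i * (e * b / 2) := by
    refine (Finset.sum_le_sum hGg).trans ?_
    rw [← Finset.sum_mul]
    refine mul_le_of_le_one_left (mul_nonneg (h1 i).le (by positivity)) ?_
    rw [← hlam]
    exact Finset.sum_le_sum_of_subset_of_nonneg (Finset.erase_subset _ _)
      fun g _ _ => hb.le.trans (hbl g)
  have h7 : b * (d ω i * (1 / 2)) ≤ ∑ g, lam g * A ω i g := by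
    refine le_trans ?_ (Finset.single_le_sum (f := fun g => lam g * A ω i g) (fun g _ =>
      mul_nonneg (hb.le.trans (hbl g)) ?_) (Finset.mem_univ f))
    · rw [h2]
      exact mul_le_mul (hbl f) (mul_le_mul_of_nonneg_left hGf (h1 i).le)
        (mul_nonneg (h1 i).le (by norm_num)) (hb.le.trans (hbl f))
    · rw [h2]; exact mul_nonneg (h1 i).le ((h4 i).1 g)
  calc _ ≤ d ω i * (e * b / 2) := h6
    _ = e * (b * (d ω i * (1 / 2))) := by ring
    _ ≤ _ := mul_le_mul_of_nonneg_left h7 he0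

/-- The small ball radius for the rows of a random factor with `I` rows is this constant
divided by `I`. -/
noncomputable def radiusConst (F : ℕ) : ℝ := scalConst F / (2 * smallBallConst F)

theorem radiusConst_pos [NeZero F] : 0 < radiusConst F :=
  div_pos scalConst_pos (mul_pos two_pos (smallBallConst_pos (NeZero.pos F)))

/-- A random factor does not contract a given vector too much, with probability at
least `1 / 2`. -/
theorem IsScaledSimplexFactor.prob_contraction_le [NeZero F] (hA : IsScaledSimplexFactor P A)
    {x : Fin F → ℝ} (hx : 1 / 4 ≤ ∑ f, x f ^ 2) :
    P.real {ω | ∑ i, (∑ f, A ω i f * x f) ^ 2 < (radiusConst F / I) ^ 2 * (F ^ 2 / I)} ≤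
      1 / 2 := by
  have hFI := hA.le
  have hFpos := NeZero.pos F
  have hI : (0 : ℝ) < I := by exact_mod_cast hFpos.trans_le hFI
  have hr := radiusConst_pos (F := F)
  obtain ⟨G, d, hG, hlaw, h⟩ := hA.exists_ae
  set t := radiusConst F / I with ht
  have ht0 : 0 < t := div_pos hr hI
  set B : Set (Fin F → ℝ) := {g | |∑ f, g f * x f| ≤ t} with hB
  have hBm : MeasurableSet B := measurableSet_le (by fun_prop) measurable_const
  have hNm := (measurableSet_no_row (I := I) B hBm).compl
  set N := {G : Fin I → Fin F → ℝ | ∀ i, G i ∉ B}ᶜ with hN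
  have h1 : (scalableUniform I F).real N ≤ 1 / 2 := by
    refine (scalableUniform_real_le hFI hNm).trans ?_
    rw [div_le_iff₀ scalConst_pos]
    have h2 : (Measure.pi fun _ : Fin I => uniformSimplex F).real N ≤
        ∑ _i : Fin I, smallBallConst F * t := by
      have e : N = ⋃ i : Fin I, (fun G => G i) ⁻¹' B := by ext; simp [hN]
      rw [e]
      refine (measureReal_iUnion_fintype_le _).trans (Finset.sum_le_sum fun i _ => ?_)
      have hmp := measurePreserving_eval (fun _ : Fin I => uniformSimplex F) i
      have h3 := hmp.measure_preimage hBm.nullMeasurableSet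
      have h4 : uniformSimplex F B ≤ ENNReal.ofReal (smallBallConst F * t) := by
        obtain ⟨n, rfl⟩ := Nat.exists_eq_succ_of_ne_zero (NeZero.ne F)
        exact uniformSimplex_small_ball hx ht0.le
      refine ENNReal.toReal_le_of_le_ofReal (mul_nonneg (smallBallConst_pos hFpos).le ht0.le) ?_
      exact (le_of_eq h3).trans h4
    refine h2.trans (le_of_eq ?_)
    rw [Finset.sum_const, Finset.card_univ, Fintype.card_fin, nsmul_eq_mul, ht, radiusConst]
    have := smallBallConst_pos hFpos
    field_simp
  refine le_trans ?_ h1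
  rw [← real_preimage_eq_scalableUniform hG hlaw hNm]
  refine real_mono_ae ?_
  filter_upwards [h] with ω ⟨h1, h2, h3, h4⟩ hω hcon
  refine absurd hω (not_lt.2 ?_)
  have hdsum : ∑ i, d ω i = F := by
    have : ∑ i, d ω i = ∑ f : Fin F, ∑ i, A ω i f := by
      rw [Finset.sum_comm]
      refine Finset.sum_congr rfl fun i _ => ?_
      rw [Finset.sum_congr rfl fun f _ => h2 i f, ← Finset.mul_sum, (h4 i).2, mul_one]
    rw [this, Finset.sum_congr rfl fun f _ => h3 f]
    simp
  have hcs := sq_sum_le_card_mul_sum_sq (s := Finset.univ) (f := d ω)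
  rw [hdsum, Finset.card_univ, Fintype.card_fin] at hcs
  calc t ^ 2 * (F ^ 2 / I) ≤ t ^ 2 * ∑ i, d ω i ^ 2 := by
        refine mul_le_mul_of_nonneg_left ?_ (by positivity)
        rw [div_le_iff₀ hI]; linarith
    _ = ∑ i, d ω i ^ 2 * t ^ 2 := by rw [Finset.mul_sum]; simp [mul_comm]
    _ ≤ ∑ i, (∑ f, A ω i f * x f) ^ 2 := by
        refine Finset.sum_le_sum fun i _ => ?_
        have h5 : ∑ f, A ω i f * x f = d ω i * ∑ f, G ω i f * x f := by
          rw [Finset.mul_sum]; exact Finset.sum_congr rfl fun f _ => by rw [h2]; ring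
        rw [h5, mul_pow]
        refine mul_le_mul_of_nonneg_left ?_ (sq_nonneg _)
        have h6 : t < |∑ f, G ω i f * x f| := not_le.1 (hcon i)
        rw [← sq_abs (∑ f, G ω i f * x f)]
        exact pow_le_pow_left₀ ht0.le h6.le 2

end FactorLaw

/-! ### The joint law of the factors and the samples -/

section JointLaw

open scoped ENNReal

variable {E T : Type*} [MeasurableSpace E] [Fintype T] [MeasurableSpace T]

/-- The law of a pair `(a, t)`, where `a` has law `μ` and the finite variable `t` has
probabilities `g t a` given `a`. -/
noncomputable def mixLaw (μ : Measure E) (g : T → E → ℝ≥0∞) : Measure (E × T) :=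
  ∑ t, (μ.withDensity (g t)).map fun a => (a, t)

theorem mixLaw_apply (μ : Measure E) (g : T → E → ℝ≥0∞) {s : Set (E × T)}
    (hs : MeasurableSet s) : mixLaw μ g s = ∑ t, ∫⁻ a in {a | (a, t) ∈ s}, g t a ∂μ := by
  unfold mixLaw
  rw [Measure.finsetSum_apply]
  refine Finset.sum_congr rfl fun t _ => ?_
  have hm : Measurable fun a : E => (a, t) := measurable_prodMk_right
  rw [Measure.map_apply hm hs, withDensity_apply _ (hm hs)]
  rfl

theorem mixLaw_univ {μ : Measure E} [IsProbabilityMeasure μ] {g : T → E → ℝ≥0∞}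
    (hg : ∀ t, Measurable (g t)) (h : ∀ᵐ a ∂μ, ∑ t, g t a = 1) :
    IsProbabilityMeasure (mixLaw μ g) := by
  refine ⟨?_⟩
  rw [mixLaw_apply _ _ MeasurableSet.univ]
  simp only [Set.mem_univ, Set.ofPred_true, Measure.restrict_univ]
  rw [← lintegral_finsetSum _ fun t _ => hg t, lintegral_congr_ae h]
  simp

variable {J : Type*} [Fintype J] [DecidableEq J]

/-- A product of mixed laws is the mixed law of the product. -/
theorem pi_mixLaw_apply (μ : J → Measure E) [∀ j, IsProbabilityMeasure (μ j)]
    (g : J → T → E → ℝ≥0∞) (hg : ∀ j t, Measurable (g j t))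
    [∀ j, IsProbabilityMeasure (mixLaw (μ j) (g j))] {s : Set (J → E × T)}
    (hs : MeasurableSet s) :
    Measure.pi (fun j => mixLaw (μ j) (g j)) s =
      ∑ d : J → T, ∫⁻ a in {a | (fun j => (a j, d j)) ∈ s}, ∏ j, g j (d j) (a j)
        ∂Measure.pi μ := by
  classical
  set ν : Measure (J → E × T) := ∑ d : J → T, ((Measure.pi μ).withDensity fun a =>
    ∏ j, g j (d j) (a j)).map fun a j => (a j, d j) with hν
  have hm : ∀ d : J → T, Measurable fun (a : J → E) (j : J) => (a j, d j) := fun d =>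
    measurable_pi_lambda _ fun j => (measurable_pi_apply j).prodMk measurable_const
  have hν' : ∀ t : Set (J → E × T), MeasurableSet t → ν t =
      ∑ d : J → T, ∫⁻ a in {a | (fun j => (a j, d j)) ∈ t}, ∏ j, g j (d j) (a j)
        ∂Measure.pi μ := by
    intro t ht
    rw [hν, Measure.finsetSum_apply]
    refine Finset.sum_congr rfl fun d _ => ?_
    rw [Measure.map_apply (hm d) ht, withDensity_apply _ (hm d ht)]
    rfl
  rw [← hν' s hs]
  congr 1
  refine Measure.pi_eq fun t ht => ?_
  rw [hν' _ (MeasurableSet.univ_pi ht)]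
  simp only [mixLaw_apply _ _ (ht _)]
  rw [Finset.prod_univ_sum, Fintype.piFinset_univ]
  refine Finset.sum_congr rfl fun d _ => ?_
  have hmt : ∀ j, MeasurableSet {a : E | (a, d j) ∈ t j} := fun j =>
    (measurable_prodMk_right (ht j))
  have hbox : {a : J → E | (fun j => (a j, d j)) ∈ Set.univ.pi t} =
      Set.univ.pi fun j => {a : E | (a, d j) ∈ t j} := by
    ext a; simp [Set.mem_pi]
  rw [hbox, Measure.restrict_pi_pi]
  rw [← Measure.restrict_pi_pi, ← lintegral_indicator (MeasurableSet.univ_pi hmt)]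
  have hind : (Set.univ.pi fun j => {a : E | (a, d j) ∈ t j}).indicator
      (fun a : J → E => ∏ j, g j (d j) (a j)) =
      fun a => ∏ j, ({a : E | (a, d j) ∈ t j}).indicator (g j (d j)) (a j) := by
    funext a
    by_cases ha : a ∈ Set.univ.pi fun j => {a : E | (a, d j) ∈ t j}
    · rw [Set.indicator_of_mem ha]
      exact Finset.prod_congr rfl fun j _ => (Set.indicator_of_mem (ha j (Set.mem_univ j)) _).symm
    · rw [Set.indicator_of_notMem ha]
      simp only [Set.mem_pi, Set.mem_univ, true_implies, not_forall] at ha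
      obtain ⟨j, hj⟩ := ha
      exact (Finset.prod_eq_zero (Finset.mem_univ j) (Set.indicator_of_notMem hj _)).symm
  have hmj : ∀ j, Measurable (({a : E | (a, d j) ∈ t j}).indicator (g j (d j))) := fun j =>
    (hg j (d j)).indicator (hmt j)
  rw [hind, ProbabilityTheory.lintegral_prod_eq_prod_lintegral_of_indepFun Finset.univ
    (fun j (a : J → E) => ({a : E | (a, d j) ∈ t j}).indicator (g j (d j)) (a j))
    (ProbabilityTheory.iIndepFun_pi fun j => (hmj j).aemeasurable)
    fun j => (hmj j).comp (measurable_pi_apply j)]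
  refine Finset.prod_congr rfl fun j _ => ?_
  rw [← lintegral_indicator (hmt j)]
  exact (measurePreserving_eval μ j).lintegral_comp (hmj j)

variable {I F S : ℕ}

/-- The probability, given the factor `a` and the latent variables `h`, that one of the variables
takes the values and has the observation pattern recorded in `d`. -/
def obsWeight (p : ℝ) (a : Fin I → Fin F → ℝ) (h : Fin S → Fin F) (d : Fin S → Fin I × Bool) : ℝ :=
  ∏ s, a (d s).1 (h s) * if (d s).2 = true then p else 1 - p

theorem obsWeight_nonneg {p : ℝ} (hp0 : 0 ≤ p) (hp1 : p ≤ 1) {a : Fin I → Fin F → ℝ}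
    (ha : IsColStochastic a) (h : Fin S → Fin F) (d : Fin S → Fin I × Bool) :
    0 ≤ obsWeight p a h d := by
  refine Finset.prod_nonneg fun s _ => mul_nonneg (ha.1 _ _) ?_
  split_ifs <;> linarith

theorem sum_cell {p : ℝ} {a : Fin I → Fin F → ℝ} (ha : IsColStochastic a) (f : Fin F) :
    ∑ c : Fin I × Bool, a c.1 f * (if c.2 = true then p else 1 - p) = 1 := by
  rw [Fintype.sum_prod_type]
  simp only [Fintype.sum_bool, if_true, Bool.false_eq_true, if_false]
  have : ∀ i, a i f * p + a i f * (1 - p) = a i f := fun i => by ring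
  simp only [this, ha.2]

theorem sum_obsWeight {p : ℝ} {a : Fin I → Fin F → ℝ} (ha : IsColStochastic a)
    (h : Fin S → Fin F) : ∑ d, obsWeight p a h d = 1 := by
  unfold obsWeight
  rw [← Fintype.prod_sum (fun s (c : Fin I × Bool) =>
    a c.1 (h s) * if c.2 = true then p else 1 - p)]
  exact Finset.prod_eq_one fun s _ => sum_cell ha _

theorem measurable_obsWeight (p : ℝ) (h : Fin S → Fin F) (d : Fin S → Fin I × Bool) :
    Measurable fun a : Fin I → Fin F → ℝ => obsWeight p a h d := by
  unfold obsWeight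
  fun_prop

/-- The joint law of a factor and the record of the corresponding variable, given the latent
variables. -/
noncomputable def recordLaw (p : ℝ) (h : Fin S → Fin F) (μ : Measure (Fin I → Fin F → ℝ)) :
    Measure ((Fin I → Fin F → ℝ) × (Fin S → Fin I × Bool)) :=
  mixLaw μ fun d a => ENNReal.ofReal (obsWeight p a h d)

theorem isProbabilityMeasure_recordLaw {p : ℝ} (hp0 : 0 ≤ p) (hp1 : p ≤ 1) (h : Fin S → Fin F)
    {μ : Measure (Fin I → Fin F → ℝ)} [IsProbabilityMeasure μ]
    (hμ : ∀ᵐ a ∂μ, IsColStochastic a) : IsProbabilityMeasure (recordLaw p h μ) := by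
  refine mixLaw_univ (fun d => (measurable_obsWeight p h d).ennreal_ofReal) ?_
  filter_upwards [hμ] with a ha
  rw [← ENNReal.ofReal_sum_of_nonneg fun d _ => obsWeight_nonneg hp0 hp1 ha h d,
    sum_obsWeight ha, ENNReal.ofReal_one]

theorem recordLaw_apply {p : ℝ} (hp0 : 0 ≤ p) (hp1 : p ≤ 1) (h : Fin S → Fin F)
    {μ : Measure (Fin I → Fin F → ℝ)}
    (hμ : ∀ᵐ a ∂μ, IsColStochastic a) {s : Set ((Fin I → Fin F → ℝ) × (Fin S → Fin I × Bool))}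
    (hs : MeasurableSet s) : recordLaw p h μ s = ∫⁻ a, ENNReal.ofReal
      (∑ d, obsWeight p a h d * s.indicator (fun _ => (1 : ℝ)) (a, d)) ∂μ := by
  classical
  unfold recordLaw
  rw [mixLaw_apply _ _ hs]
  have hmt : ∀ d, MeasurableSet {a : Fin I → Fin F → ℝ | (a, d) ∈ s} := fun d =>
    measurable_prodMk_right hs
  simp only [← lintegral_indicator (hmt _)]
  rw [← lintegral_finsetSum _ fun d _ => (measurable_obsWeight p h d).ennreal_ofReal.indicator
    (hmt d)]
  refine lintegral_congr_ae ?_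
  filter_upwards [hμ] with a ha
  rw [ENNReal.ofReal_sum_of_nonneg fun d _ => mul_nonneg (obsWeight_nonneg hp0 hp1 ha h d)
    (Set.indicator_nonneg (fun _ _ => zero_le_one) _)]
  refine Finset.sum_congr rfl fun d _ => ?_
  by_cases had : (a, d) ∈ s
  · rw [Set.indicator_of_mem had, Set.indicator_of_mem (show a ∈ {a | (a, d) ∈ s} from had),
      mul_one]
  · rw [Set.indicator_of_notMem had, Set.indicator_of_notMem
      (show a ∉ {a | (a, d) ∈ s} from had), mul_zero, ENNReal.ofReal_zero]

end JointLaw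

section Model

open scoped ENNReal

variable {Ω : Type*} [MeasurableSpace Ω] {P : Measure Ω} [IsProbabilityMeasure P]
  {N I F S : ℕ} {lam : Fin F → ℝ} {p : ℝ} {A : Fin N → Ω → Fin I → Fin F → ℝ}
  {H : Fin S → Ω → Fin F} {Z : Fin S → Fin N → Ω → Fin I} {V : Fin S → Fin N → Ω → Bool}

/-- The prior weight of a sequence of latent variables. -/
def priorWeight (lam : Fin F → ℝ) (h : Fin S → Fin F) : ℝ := ∏ s, lam (h s)

theorem sum_priorWeight (hlam : ∑ f, lam f = 1) :
    ∑ h : Fin S → Fin F, priorWeight lam h = 1 := by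
  unfold priorWeight
  rw [← Fintype.prod_sum (fun _ f => lam f)]
  simp [hlam]

/-- Conditionally on the latent variables, the factors with their records are independent. -/
theorem IsModel.measure_le [NeZero F] (hM : IsModel P lam p A H Z V) (hlam : ∀ f, 0 ≤ lam f)
    (hp0 : 0 ≤ p) (hp1 : p ≤ 1)
    {s : (Fin S → Fin F) → Set (Fin N → (Fin I → Fin F → ℝ) × (Fin S → Fin I × Bool))}
    (hs : ∀ h, MeasurableSet (s h)) :
    P {ω | (fun n => (A n ω, fun i => (Z i n ω, V i n ω))) ∈ s fun i => H i ω} ≤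
      ∑ h : Fin S → Fin F, ENNReal.ofReal (priorWeight lam h) *
        Measure.pi (fun n => recordLaw p h (P.map (A n))) (s h) := by
  classical
  have hAm := hM.measurable_factor
  have : ∀ n, IsProbabilityMeasure (P.map (A n)) := fun n =>
    Measure.isProbabilityMeasure_map (hAm n).aemeasurable
  have hcol : ∀ n, ∀ᵐ a ∂P.map (A n), IsColStochastic a := fun n => by
    rw [ae_map_iff (hAm n).aemeasurable measurableSet_isColStochastic]
    exact (hM.law_factor n).ae_isColStochastic
  have hcolP : ∀ᵐ ω ∂P, ∀ n, IsColStochastic (A n ω) :=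
    ae_all_iff.2 fun n => (hM.law_factor n).ae_isColStochastic
  have hpi := (ProbabilityTheory.iIndepFun_iff_map_fun_eq_pi_map
    fun n => (hAm n).aemeasurable).1 hM.indep_factor
  have hAmm : Measurable fun ω n => A n ω := measurable_pi_lambda _ hAm
  have hm : ∀ h, ∀ d : Fin N → Fin S → Fin I × Bool,
      MeasurableSet {a : Fin N → Fin I → Fin F → ℝ | (fun n => (a n, d n)) ∈ s h} := fun h d =>
    (measurable_pi_lambda _ fun n => (measurable_pi_apply n).prodMk measurable_const) (hs h)
  have hcover : {ω | (fun n => (A n ω, fun i => (Z i n ω, V i n ω))) ∈ s fun i => H i ω} ⊆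
      ⋃ x : (Fin S → Fin F) × (Fin N → Fin S → Fin I × Bool),
        {ω | (fun n => A n ω) ∈ {a : Fin N → Fin I → Fin F → ℝ | (fun n => (a n, x.2 n)) ∈ s x.1} ∧
          ∀ i, H i ω = x.1 i ∧ ∀ n, Z i n ω = (x.2 n i).1 ∧ V i n ω = (x.2 n i).2} := by
    intro ω hω
    rw [Set.mem_iUnion]
    exact ⟨(fun i => H i ω, fun n i => (Z i n ω, V i n ω)), hω, fun i => ⟨rfl, fun n => ⟨rfl, rfl⟩⟩⟩
  refine (measure_mono hcover).trans ((measure_iUnion_fintype_le _ _).trans ?_)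
  rw [Fintype.sum_prod_type]
  refine Finset.sum_le_sum fun h _ => ?_
  have : ∀ n, IsProbabilityMeasure (recordLaw p h (P.map (A n))) := fun n =>
    isProbabilityMeasure_recordLaw hp0 hp1 h (hcol n)
  unfold recordLaw at this ⊢
  rw [pi_mixLaw_apply (fun n => P.map (A n)) (fun _ d a => ENNReal.ofReal (obsWeight p a h d))
    (fun _ d => (measurable_obsWeight p h d).ennreal_ofReal) (hs h), Finset.mul_sum]
  refine Finset.sum_le_sum fun d _ => ?_
  rw [hM.law_sample _ (hm h d) h (fun i n => (d n i).1) (fun i n => (d n i).2), ← hpi,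
    setLIntegral_map (hm h d) (by
      refine Finset.measurable_prod _ fun n _ => ?_
      exact ((measurable_obsWeight p h (d n)).comp (measurable_pi_apply n)).ennreal_ofReal) hAmm,
    ← lintegral_const_mul' _ _ ENNReal.ofReal_ne_top]
  refine lintegral_mono_ae ?_
  filter_upwards [ae_restrict_of_ae hcolP] with ω hω
  rw [← ENNReal.ofReal_prod_of_nonneg fun n _ => obsWeight_nonneg hp0 hp1 (hω n) h (d n),
    ← ENNReal.ofReal_mul (show 0 ≤ priorWeight lam h from Finset.prod_nonneg fun i _ => hlam _)]
  refine ENNReal.ofReal_le_ofReal (le_of_eq ?_)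
  unfold priorWeight obsWeight
  rw [Finset.prod_comm, ← Finset.prod_mul_distrib]

end Model

section Splitting

open scoped ENNReal

variable {X : Type*} [MeasurableSpace X] {N M : ℕ}

/-- The family with the entries of `x` on `{0, …, M - 1}` and those of `y` on the rest. -/
def mergeParts (x : Part1 N M → X) (y : Part2 N M → X) : Fin N → X :=
  fun n => if h : (n : ℕ) < M then x ⟨n, h⟩ else y ⟨n, not_lt.1 h⟩

omit [MeasurableSpace X] in
theorem mergeParts_part1 (x : Part1 N M → X) (y : Part2 N M → X) (j : Part1 N M) :
    mergeParts x y j = x j := by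
  unfold mergeParts; rw [dif_pos j.2]

omit [MeasurableSpace X] in
theorem mergeParts_part2 (x : Part1 N M → X) (y : Part2 N M → X) (k : Part2 N M) :
    mergeParts x y k = y k := by
  unfold mergeParts; rw [dif_neg (not_lt.2 k.2)]

theorem measurable_mergeParts :
    Measurable fun z : (Part1 N M → X) × (Part2 N M → X) => mergeParts z.1 z.2 := by
  refine measurable_pi_lambda _ fun n => ?_
  unfold mergeParts
  split_ifs
  · exact (measurable_pi_apply _).comp measurable_fst
  · exact (measurable_pi_apply _).comp measurable_snd

theorem prod_parts {R : Type*} [CommMonoid R] (f : Fin N → R) :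
    (∏ j : Part1 N M, f j) * ∏ k : Part2 N M, f k = ∏ n, f n := by
  rw [← Fintype.prod_subtype_mul_prod_subtype (fun n : Fin N => (n : ℕ) < M) f]
  congr 1
  exact (Fintype.prod_equiv (Equiv.subtypeEquivRight fun _ => not_lt) _ _ fun _ => rfl).symm

theorem pi_eq_map_mergeParts (ν : Fin N → Measure X) [∀ n, IsProbabilityMeasure (ν n)] :
    Measure.pi ν = ((Measure.pi fun j : Part1 N M => ν j).prod
      (Measure.pi fun k : Part2 N M => ν k)).map fun z => mergeParts z.1 z.2 := by
  refine Measure.pi_eq fun t ht => ?_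
  rw [Measure.map_apply measurable_mergeParts (MeasurableSet.univ_pi ht)]
  have : (fun z : (Part1 N M → X) × (Part2 N M → X) => mergeParts z.1 z.2) ⁻¹' Set.univ.pi t =
      (Set.univ.pi fun j : Part1 N M => t j) ×ˢ (Set.univ.pi fun k : Part2 N M => t k) := by
    ext z
    simp only [Set.mem_preimage, Set.mem_pi, Set.mem_univ, true_implies, Set.mem_prod]
    constructor
    · intro h
      refine ⟨fun j => ?_, fun k => ?_⟩
      · have := h j; rwa [mergeParts_part1] at this
      · have := h k; rwa [mergeParts_part2] at this
    · rintro ⟨h1, h2⟩ n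
      by_cases hn : (n : ℕ) < M
      · have := h1 ⟨n, hn⟩; rwa [← mergeParts_part1 z.1 z.2] at this
      · have := h2 ⟨n, not_lt.1 hn⟩; rwa [← mergeParts_part2 z.1 z.2] at this
  rw [this, Measure.prod_prod, Measure.pi_pi, Measure.pi_pi, prod_parts fun n => ν n (t n)]

/-- All variables of the second part satisfy a condition of conditional probability at
most `ρ`. -/
theorem pi_forall_le (ν : Fin N → Measure X) [∀ n, IsProbabilityMeasure (ν n)]
    {G : Set (Part1 N M → X)} (hG : MeasurableSet G)
    {U : Part2 N M → Set ((Part1 N M → X) × X)} (hU : ∀ k, MeasurableSet (U k)) {ρ : ℝ≥0∞}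
    (hρ : ∀ x ∈ G, ∀ k : Part2 N M, ν k {y | (x, y) ∈ U k} ≤ ρ) :
    Measure.pi ν {x | (fun j : Part1 N M => x j) ∈ G ∧
      ∀ k : Part2 N M, ((fun j : Part1 N M => x j), x k) ∈ U k} ≤
      Measure.pi (fun j : Part1 N M => ν j) G * ρ ^ Fintype.card (Part2 N M) := by
  have hr : Measurable fun (x : Fin N → X) (j : Part1 N M) => x j :=
    measurable_pi_lambda _ fun j => measurable_pi_apply _
  have hs : MeasurableSet {x : Fin N → X | (fun j : Part1 N M => x j) ∈ G ∧
      ∀ k : Part2 N M, ((fun j : Part1 N M => x j), x k) ∈ U k} := by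
    have : {x : Fin N → X | (fun j : Part1 N M => x j) ∈ G ∧
      ∀ k : Part2 N M, ((fun j : Part1 N M => x j), x k) ∈ U k} =
      (fun x (j : Part1 N M) => x j) ⁻¹' G ∩ ⋂ k : Part2 N M,
        (fun x : Fin N → X => ((fun j : Part1 N M => x j), x k)) ⁻¹' U k := by ext; simp
    rw [this]
    exact (hr hG).inter (MeasurableSet.iInter fun k => (hr.prodMk (measurable_pi_apply _)) (hU k))
  rw [pi_eq_map_mergeParts (M := M) ν, Measure.map_apply measurable_mergeParts hs,
    Measure.prod_apply (measurable_mergeParts hs)]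
  rw [mul_comm, ← setLIntegral_const, ← lintegral_indicator hG]
  refine lintegral_mono fun x => ?_
  by_cases hx : x ∈ G
  · rw [Set.indicator_of_mem hx]
    have hsub : Prod.mk x ⁻¹' ((fun z : (Part1 N M → X) × (Part2 N M → X) => mergeParts z.1 z.2) ⁻¹'
        {x : Fin N → X | (fun j : Part1 N M => x j) ∈ G ∧
          ∀ k : Part2 N M, ((fun j : Part1 N M => x j), x k) ∈ U k}) ⊆
        Set.univ.pi fun k => {y | (x, y) ∈ U k} := by
      rintro y ⟨-, hy⟩ k -
      have := hy k
      change (x, y k) ∈ U k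
      simpa only [mergeParts_part1, mergeParts_part2] using this
    refine (measure_mono hsub).trans ?_
    rw [Measure.pi_pi]
    exact Finset.prod_le_pow_card _ _ _ fun k _ => hρ x hx k
  · rw [Set.indicator_of_notMem hx]
    refine le_of_eq (measure_mono_null ?_ measure_empty)
    rintro y ⟨hy, -⟩
    refine hx ?_
    simpa only [mergeParts_part1] using hy

/-- In addition, one of the variables of the second part satisfies another condition. -/
theorem pi_forall_exists_le (ν : Fin N → Measure X) [∀ n, IsProbabilityMeasure (ν n)]
    {G : Set (Part1 N M → X)}
    {U T : Part2 N M → Set ((Part1 N M → X) × X)} (hU : ∀ k, MeasurableSet (U k))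
    (hG : MeasurableSet G) (hT : ∀ k, MeasurableSet (T k)) {ρ : ℝ≥0∞}
    (hρ : ∀ x ∈ G, ∀ k : Part2 N M, ν k {y | (x, y) ∈ U k} ≤ ρ) :
    Measure.pi ν {x | (fun j : Part1 N M => x j) ∈ G ∧
      (∀ k : Part2 N M, ((fun j : Part1 N M => x j), x k) ∈ U k) ∧
      ∃ k : Part2 N M, ((fun j : Part1 N M => x j), x k) ∈ T k} ≤
      ∑ k : Part2 N M, ρ ^ (Fintype.card (Part2 N M) - 1) *
        ((Measure.pi fun j : Part1 N M => ν j).prod (ν k)) {z | z.1 ∈ G ∧ z ∈ T k} := by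
  classical
  have hr : Measurable fun (x : Fin N → X) (j : Part1 N M) => x j :=
    measurable_pi_lambda _ fun j => measurable_pi_apply _
  set s : Part2 N M → Set (Fin N → X) := fun k => {x | (fun j : Part1 N M => x j) ∈ G ∧
      (∀ l : Part2 N M, ((fun j : Part1 N M => x j), x l) ∈ U l) ∧
      ((fun j : Part1 N M => x j), x k) ∈ T k} with hsd
  have hs : ∀ k, MeasurableSet (s k) := by
    intro k
    have : s k = ((fun x (j : Part1 N M) => x j) ⁻¹' G ∩ ⋂ l : Part2 N M,
        (fun x : Fin N → X => ((fun j : Part1 N M => x j), x l)) ⁻¹' U l) ∩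
        (fun x : Fin N → X => ((fun j : Part1 N M => x j), x k)) ⁻¹' T k := by
      ext; simp [hsd, and_assoc]
    rw [this]
    exact ((hr hG).inter (MeasurableSet.iInter fun k =>
      (hr.prodMk (measurable_pi_apply _)) (hU k))).inter ((hr.prodMk (measurable_pi_apply _)) (hT k))
  have hcov : {x : Fin N → X | (fun j : Part1 N M => x j) ∈ G ∧
      (∀ k : Part2 N M, ((fun j : Part1 N M => x j), x k) ∈ U k) ∧
      ∃ k : Part2 N M, ((fun j : Part1 N M => x j), x k) ∈ T k} ⊆ ⋃ k, s k := by
    rintro x ⟨h1, h2, k, h3⟩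
    exact Set.mem_iUnion.2 ⟨k, h1, h2, h3⟩
  refine (measure_mono hcov).trans ((measure_iUnion_fintype_le _ _).trans ?_)
  refine Finset.sum_le_sum fun k _ => ?_
  have hTm : MeasurableSet {z : (Part1 N M → X) × X | z.1 ∈ G ∧ z ∈ T k} :=
    (measurable_fst hG).inter (hT k)
  rw [pi_eq_map_mergeParts (M := M) ν, Measure.map_apply measurable_mergeParts (hs k),
    Measure.prod_apply (measurable_mergeParts (hs k)), Measure.prod_apply hTm]
  rw [← lintegral_const_mul _ (measurable_measure_prodMk_left hTm)]
  refine lintegral_mono fun x => ?_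
  by_cases hx : x ∈ G
  · have hsub : Prod.mk x ⁻¹' ((fun z : (Part1 N M → X) × (Part2 N M → X) => mergeParts z.1 z.2) ⁻¹'
        s k) ⊆ Set.univ.pi fun l => if l = k then {y | (x, y) ∈ T k} else {y | (x, y) ∈ U l} := by
      rintro y ⟨-, hy, hy'⟩ l -
      dsimp only
      split_ifs with h
      · subst h
        change (x, y l) ∈ T l
        simpa only [mergeParts_part1, mergeParts_part2] using hy'
      · have := hy l
        change (x, y l) ∈ U l
        simpa only [mergeParts_part1, mergeParts_part2] using this
    refine (measure_mono hsub).trans ?_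
    rw [Measure.pi_pi, ← Finset.mul_prod_erase _ _ (Finset.mem_univ k), if_pos rfl, mul_comm]
    refine mul_le_mul' ?_ (measure_mono fun y hy => ⟨hx, hy⟩)
    rw [← Finset.card_univ, ← Finset.card_erase_of_mem (Finset.mem_univ k)]
    refine Finset.prod_le_pow_card _ _ _ fun l hl => ?_
    rw [if_neg (Finset.ne_of_mem_erase hl)]
    exact hρ x hx l
  · refine le_trans (le_of_eq (measure_mono_null ?_ measure_empty)) zero_le
    rintro y ⟨hy, -⟩
    refine hx ?_
    simpa only [mergeParts_part1] using hy

theorem card_part1 (hMN : M ≤ N) : Fintype.card (Part1 N M) = M := by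
  rw [Fintype.card_subtype]
  have : (Finset.univ.filter fun n : Fin N => (n : ℕ) < M) =
      Finset.univ.image (Fin.castLE hMN) := by
    ext n
    simp only [Finset.mem_filter, Finset.mem_univ, true_and, Finset.mem_image]
    constructor
    · intro hn; exact ⟨⟨n, hn⟩, rfl⟩
    · rintro ⟨i, rfl⟩; exact i.2
  rw [this, Finset.card_image_of_injective _ (Fin.castLE_injective hMN)]
  simp

theorem card_part2 (hMN : M ≤ N) : Fintype.card (Part2 N M) = N - M := by
  have h1 := Fintype.card_subtype_compl (fun n : Fin N => (n : ℕ) < M)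
  rw [card_part1 hMN, Fintype.card_fin] at h1
  rw [← h1]
  exact Fintype.card_congr (Equiv.subtypeEquivRight fun n => not_lt.symm)

end Splitting

/-! ### Probabilities of events for the samples, given the factors -/

section SampleCounts

variable {I F S : ℕ}

/-- A sum over families, weighted by a product of probability weights, of a function of one
entry. -/
theorem sum_prod_mul_single {J T : Type*} [Fintype J] [DecidableEq J] [Fintype T]
    (w : J → T → ℝ) (hw : ∀ j, ∑ t, w j t = 1) (φ : T → ℝ) (i : J) :
    ∑ d : J → T, (∏ j, w j (d j)) * φ (d i) = ∑ t, w i t * φ t := by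
  have h1 : ∀ d : J → T, (∏ j, w j (d j)) * φ (d i) =
      ∏ j, w j (d j) * (if j = i then φ (d j) else 1) := by
    intro d
    rw [Finset.prod_mul_distrib]
    congr 1
    simp
  simp only [h1]
  rw [← Fintype.prod_sum fun j t => w j t * (if j = i then φ t else 1)]
  rw [← Finset.mul_prod_erase _ _ (Finset.mem_univ i), Finset.prod_eq_one, mul_one]
  · simp
  · intro j hj
    simp [Finset.ne_of_mem_erase hj, hw]

/-- Lower tail of a sum of independent indicators. -/
theorem sum_prod_count_lt_le {T : Type*} [Fintype T] (w : Fin S → T → ℝ)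
    (hw0 : ∀ s t, 0 ≤ w s t) (hw : ∀ s, ∑ t, w s t = 1) (B : T → Prop) [DecidablePred B] {p : ℝ}
    (hp0 : 0 ≤ p) (hp1 : p ≤ 1) (hB : ∀ s, ∑ t, w s t * (if B t then 1 else 0) = p)
    (U : Finset (Fin S)) :
    ∑ d : Fin S → T, (∏ s, w s (d s)) *
      (if ((U.filter fun s => B (d s)).card : ℝ) < p * U.card / 2 then 1 else 0) ≤
        Real.exp (-(p * U.card / 8)) := by
  classical
  set c := p * U.card / 2 with hc
  have hlog := Real.log_two_lt_d9
  have h1 : ∀ d : Fin S → T, (if ((U.filter fun s => B (d s)).card : ℝ) < c then (1 : ℝ) else 0) ≤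
      Real.exp (c * Real.log 2) * ∏ s, (if s ∈ U ∧ B (d s) then 1 / 2 else 1) := by
    intro d
    have hprod : ∏ s, (if s ∈ U ∧ B (d s) then (1 : ℝ) / 2 else 1) =
        Real.exp (-(((U.filter fun s => B (d s)).card : ℝ) * Real.log 2)) := by
      have e : (Finset.univ.filter fun s => s ∈ U ∧ B (d s)) = U.filter fun s => B (d s) := by
        ext s; simp
      rw [Finset.prod_ite, Finset.prod_const, Finset.prod_const_one, mul_one, e, Real.exp_neg,
        mul_comm, Real.exp_mul, Real.exp_log two_pos, Real.rpow_natCast]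
      simp
    rw [hprod, ← Real.exp_add]
    split_ifs with h
    · rw [← Real.exp_zero]
      apply Real.exp_le_exp.2
      have : 0 < Real.log 2 := Real.log_pos one_lt_two
      nlinarith
    · exact (Real.exp_pos _).le
  calc _ ≤ ∑ d : Fin S → T, (∏ s, w s (d s)) *
        (Real.exp (c * Real.log 2) * ∏ s, (if s ∈ U ∧ B (d s) then 1 / 2 else 1)) :=
        Finset.sum_le_sum fun d _ => mul_le_mul_of_nonneg_left (h1 d)
          (Finset.prod_nonneg fun s _ => hw0 _ _)
    _ = Real.exp (c * Real.log 2) * ∏ s, ∑ t, w s t * (if s ∈ U ∧ B t then 1 / 2 else 1) := by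
        rw [Fintype.prod_sum, Finset.mul_sum]
        refine Finset.sum_congr rfl fun d _ => ?_
        rw [Finset.prod_mul_distrib]; ring
    _ = Real.exp (c * Real.log 2) * (1 - p / 2) ^ U.card := by
        congr 1
        have h2 : ∀ s, ∑ t, w s t * (if s ∈ U ∧ B t then 1 / 2 else 1) =
            if s ∈ U then 1 - p / 2 else 1 := by
          intro s
          by_cases hs : s ∈ U
          · simp only [hs, true_and, if_true]
            have : ∀ t, w s t * (if B t then 1 / 2 else 1) =
                w s t - 1 / 2 * (w s t * (if B t then 1 else 0)) := by
              intro t; split_ifs <;> ring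
            simp only [this, Finset.sum_sub_distrib, ← Finset.mul_sum, hw, hB]
            ring
          · simp [hs, hw]
        simp only [h2]
        rw [Finset.prod_ite, Finset.prod_const, Finset.prod_const_one, mul_one]
        simp
    _ ≤ Real.exp (c * Real.log 2) * Real.exp (-(p / 2)) ^ U.card := by
        refine mul_le_mul_of_nonneg_left (pow_le_pow_left₀ ?_ ?_ _) (Real.exp_pos _).le
        · linarith
        · linarith [Real.add_one_le_exp (-(p / 2))]
    _ ≤ Real.exp (-(p * U.card / 8)) := by
        rw [← Real.exp_nat_mul, ← Real.exp_add, Real.exp_le_exp, hc]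
        have : 0 ≤ p * U.card := mul_nonneg hp0 (Nat.cast_nonneg _)
        nlinarith

/-- The samples in which a variable is observed. -/
def viewSet (d : Fin S → Fin I × Bool) : Finset (Fin S) :=
  Finset.univ.filter fun s => (d s).2 = true

/-- The samples in which a variable is observed with value `q`. -/
def levelSet (d : Fin S → Fin I × Bool) (q : Fin I) : Finset (Fin S) :=
  Finset.univ.filter fun s => d s = (q, true)

/-- The number of samples in which both variables are observed. -/
def pairCount (d d' : Fin S → Fin I × Bool) : ℕ :=
  ((viewSet d').filter fun s => (d s).2 = true).card

/-- The number of samples in which both variables are observed, with values `z` and `q`. -/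
def cellCount (d d' : Fin S → Fin I × Bool) (z q : Fin I) : ℕ :=
  ((levelSet d' q).filter fun s => d s = (z, true)).card

theorem levelSet_subset_viewSet (d : Fin S → Fin I × Bool) (q : Fin I) :
    levelSet d q ⊆ viewSet d := by
  intro s hs
  simp only [levelSet, viewSet, Finset.mem_filter, Finset.mem_univ, true_and] at hs ⊢
  rw [hs]

/-- The weight of one cell of a record. -/
theorem cell_nonneg {p : ℝ} (hp0 : 0 ≤ p) (hp1 : p ≤ 1) {a : Fin I → Fin F → ℝ}
    (ha : IsColStochastic a) (f : Fin F) (c : Fin I × Bool) :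
    0 ≤ a c.1 f * (if c.2 = true then p else 1 - p) := by
  refine mul_nonneg (ha.1 _ _) ?_
  split_ifs <;> linarith

theorem sum_cell_mul {p : ℝ} (a : Fin I → Fin F → ℝ) (f : Fin F) (φ : Fin I × Bool → ℝ) :
    ∑ c : Fin I × Bool, a c.1 f * (if c.2 = true then p else 1 - p) * φ c =
      ∑ z, a z f * (p * φ (z, true) + (1 - p) * φ (z, false)) := by
  rw [Fintype.sum_prod_type]
  refine Finset.sum_congr rfl fun z _ => ?_
  simp only [Fintype.sum_bool, if_true, Bool.false_eq_true, if_false]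
  ring

theorem sum_cell_observed {p : ℝ} {a : Fin I → Fin F → ℝ} (ha : IsColStochastic a) (f : Fin F) :
    ∑ c : Fin I × Bool, a c.1 f * (if c.2 = true then p else 1 - p) *
      (if c.2 = true then 1 else 0) = p := by
  rw [sum_cell_mul]
  simp only [if_true, Bool.false_eq_true, if_false, mul_one, mul_zero, add_zero]
  rw [← Finset.sum_mul, ha.2, one_mul]

/-- A variable is observed in about `p S` samples. -/
theorem prob_viewSet_small {p : ℝ} (hp0 : 0 ≤ p) (hp1 : p ≤ 1) {a : Fin I → Fin F → ℝ}
    (ha : IsColStochastic a) (h : Fin S → Fin F) :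
    ∑ d, obsWeight p a h d * (if ((viewSet d).card : ℝ) < p * S / 2 then 1 else 0) ≤
      Real.exp (-(p * S / 8)) := by
  have := sum_prod_count_lt_le (fun s (c : Fin I × Bool) =>
    a c.1 (h s) * if c.2 = true then p else 1 - p) (fun s c => cell_nonneg hp0 hp1 ha _ c)
    (fun s => sum_cell ha _) (fun c => c.2 = true) hp0 hp1 (fun s => sum_cell_observed ha _)
    Finset.univ
  simp only [Finset.card_univ, Fintype.card_fin] at this
  exact this

/-- Among the samples in which one variable is observed, about a fraction `p` shows another. -/
theorem prob_pairCount_small {p : ℝ} (hp0 : 0 ≤ p) (hp1 : p ≤ 1) {a : Fin I → Fin F → ℝ}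
    (ha : IsColStochastic a) (h : Fin S → Fin F) (d' : Fin S → Fin I × Bool) :
    ∑ d, obsWeight p a h d *
      (if (pairCount d d' : ℝ) < p * (viewSet d').card / 2 then 1 else 0) ≤
      Real.exp (-(p * (viewSet d').card / 8)) :=
  sum_prod_count_lt_le (fun s (c : Fin I × Bool) =>
    a c.1 (h s) * if c.2 = true then p else 1 - p) (fun _ c => cell_nonneg hp0 hp1 ha _ c)
    (fun _ => sum_cell ha _) (fun c => c.2 = true) hp0 hp1 (fun _ => sum_cell_observed ha _)
    (viewSet d')

/-- If a row of the factor is small, then the frequency of the corresponding value is small with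
probability at least `1 / 2`. -/
theorem prob_frequency_large {p : ℝ} (hp0 : 0 ≤ p) (hp1 : p ≤ 1) {a : Fin I → Fin F → ℝ}
    (ha : IsColStochastic a) (h : Fin S → Fin F) (d : Fin S → Fin I × Bool) {η : ℝ} (hη : 0 < η)
    {q : Fin I} (hq : ∀ f, a q f ≤ η / 2) :
    ∑ d', obsWeight p a h d' * (if 0 < pairCount d d' ∧ η * pairCount d d' ≤
      ((levelSet d' q).filter fun s => (d s).2 = true).card then 1 else 0) ≤ 1 / 2 := by
  classical
  set U : (Fin S → Bool) → Finset (Fin S) := fun v =>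
    Finset.univ.filter fun s => v s = true ∧ (d s).2 = true with hU
  rw [← (Equiv.arrowProdEquivProdArrow (Fin S) (fun _ => Fin I) (fun _ => Bool)).symm.sum_comp,
    Fintype.sum_prod_type_right]
  have hterm : ∀ (z : Fin S → Fin I) (v : Fin S → Bool), obsWeight p a h
      ((Equiv.arrowProdEquivProdArrow (Fin S) (fun _ => Fin I) (fun _ => Bool)).symm (z, v)) *
      (if 0 < pairCount d ((Equiv.arrowProdEquivProdArrow (Fin S) (fun _ => Fin I)
        (fun _ => Bool)).symm (z, v)) ∧ η * pairCount d ((Equiv.arrowProdEquivProdArrow (Fin S)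
        (fun _ => Fin I) (fun _ => Bool)).symm (z, v)) ≤
      ((levelSet ((Equiv.arrowProdEquivProdArrow (Fin S) (fun _ => Fin I)
        (fun _ => Bool)).symm (z, v)) q).filter fun s => (d s).2 = true).card then 1 else 0) ≤
      (∏ s, if v s = true then p else 1 - p) * ∑ s ∈ U v, (∏ s, a (z s) (h s)) *
        ((if z s = q then 1 else 0) / (η * (U v).card)) := by
    intro z v
    have e1 : pairCount d ((Equiv.arrowProdEquivProdArrow (Fin S) (fun _ => Fin I)
        (fun _ => Bool)).symm (z, v)) = (U v).card := by
      unfold pairCount viewSet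
      rw [Finset.filter_filter]
      rfl
    have e2 : (((levelSet ((Equiv.arrowProdEquivProdArrow (Fin S) (fun _ => Fin I)
        (fun _ => Bool)).symm (z, v)) q).filter fun s => (d s).2 = true).card : ℝ) =
        ∑ s ∈ U v, if z s = q then 1 else 0 := by
      rw [← Finset.sum_filter, Finset.sum_const, nsmul_eq_mul, mul_one]
      congr 2
      ext s
      simp only [levelSet, hU, Finset.mem_filter, Finset.mem_univ, true_and,
        Equiv.arrowProdEquivProdArrow_symm_apply, Prod.mk.injEq]
      tauto
    have e3 : obsWeight p a h ((Equiv.arrowProdEquivProdArrow (Fin S) (fun _ => Fin I)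
        (fun _ => Bool)).symm (z, v)) = (∏ s, if v s = true then p else 1 - p) *
        ∏ s, a (z s) (h s) := by
      unfold obsWeight
      rw [Finset.prod_mul_distrib, mul_comm]
      rfl
    rw [e1, e2, e3, mul_assoc]
    have hv0 : 0 ≤ ∏ s, if v s = true then p else 1 - p :=
      Finset.prod_nonneg fun s _ => by split_ifs <;> linarith
    refine mul_le_mul_of_nonneg_left ?_ hv0
    rw [← Finset.mul_sum]
    refine mul_le_mul_of_nonneg_left ?_ (Finset.prod_nonneg fun s _ => ha.1 _ _)
    rw [← Finset.sum_div]
    split_ifs with hcase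
    · rw [le_div_iff₀ (mul_pos hη (by exact_mod_cast hcase.1)), one_mul]
      exact hcase.2
    · exact div_nonneg (Finset.sum_nonneg fun s _ => by split_ifs <;> norm_num) (by positivity)
  refine (Finset.sum_le_sum fun v _ => Finset.sum_le_sum fun z _ => hterm z v).trans ?_
  have hv : ∀ v : Fin S → Bool, ∑ z : Fin S → Fin I,
      (∏ s, if v s = true then p else 1 - p) * ∑ s ∈ U v, (∏ s, a (z s) (h s)) *
        ((if z s = q then 1 else 0) / (η * (U v).card)) ≤
      (∏ s, if v s = true then p else 1 - p) * (1 / 2) := by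
    intro v
    rw [← Finset.mul_sum]
    refine mul_le_mul_of_nonneg_left ?_
      (Finset.prod_nonneg fun s _ => by split_ifs <;> linarith)
    rw [Finset.sum_comm]
    have h1 : ∀ s ∈ U v, ∑ z : Fin S → Fin I, (∏ s, a (z s) (h s)) *
        ((if z s = q then 1 else 0) / (η * (U v).card)) ≤ η / 2 / (η * (U v).card) := by
      intro s _
      rw [sum_prod_mul_single (fun s z => a z (h s)) (fun s => ha.2 _)
        (fun z => (if z = q then 1 else 0) / (η * (U v).card)) s]
      simp only [mul_div_assoc', ← Finset.sum_div]
      refine div_le_div_of_nonneg_right ?_ (by positivity)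
      simpa using hq (h s)
    refine (Finset.sum_le_sum h1).trans ?_
    rw [Finset.sum_const, nsmul_eq_mul]
    rcases Nat.eq_zero_or_pos (U v).card with h0 | h0
    · rw [h0]; norm_num
    · have : (0 : ℝ) < (U v).card := by exact_mod_cast h0
      apply le_of_eq; field_simp
  refine (Finset.sum_le_sum fun v _ => hv v).trans ?_
  rw [← Finset.sum_mul, ← Fintype.prod_sum fun _ (b : Bool) => if b = true then p else 1 - p]
  simp

/-- For a row that is dominated by its entry `f`, it is unlikely that many of the samples with this
value come from other latent values. -/
theorem prob_mixed_level {p : ℝ} (hp0 : 0 ≤ p) (hp1 : p ≤ 1) {lam : Fin F → ℝ}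
    (hlam0 : ∀ f, 0 ≤ lam f) (hlam : ∑ f, lam f = 1) {a : Fin I → Fin F → ℝ}
    (ha : IsColStochastic a) {e x : ℝ} (he0 : 0 ≤ e) (q : Fin I) (f : Fin F)
    (hdom : ∑ g ∈ Finset.univ.erase f, lam g * a q g ≤ e / 8 * ∑ g, lam g * a q g) :
    ∑ h : Fin S → Fin F, priorWeight lam h * ∑ d, obsWeight p a h d *
      (if x ≤ (levelSet d q).card ∧ e * (levelSet d q).card <
        ((levelSet d q).filter fun s => h s ≠ f).card then 1 else 0) ≤ Real.exp (-(e * x / 2)) := by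
  classical
  set φ : Fin F → Fin I × Bool → ℝ := fun g c =>
    if c = (q, true) then (if g ≠ f then Real.exp (1 - e / 2) else Real.exp (-(e / 2))) else 1 with hφ
  have h1 : ∀ (h : Fin S → Fin F) (d : Fin S → Fin I × Bool),
      (if x ≤ (levelSet d q).card ∧ e * (levelSet d q).card <
        ((levelSet d q).filter fun s => h s ≠ f).card then (1 : ℝ) else 0) ≤
      Real.exp (-(e * x / 2)) * ∏ s, φ (h s) (d s) := by
    intro h d
    have e1 : ∏ s, φ (h s) (d s) = Real.exp (((levelSet d q).filter fun s => h s ≠ f).card -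
        e / 2 * (levelSet d q).card) := by
      have h2 : ∀ s, φ (h s) (d s) = Real.exp ((if s ∈ levelSet d q then
          ((if h s ≠ f then 1 else 0) - e / 2) else 0)) := by
        intro s
        simp only [hφ, levelSet, Finset.mem_filter, Finset.mem_univ, true_and]
        split_ifs <;> simp
      simp only [h2]
      rw [← Real.exp_sum, Finset.sum_ite_mem, Finset.univ_inter, Finset.sum_sub_distrib,
        ← Finset.sum_filter]
      simp [mul_comm]
    rw [e1, ← Real.exp_add]
    split_ifs with hc
    · apply Real.one_le_exp
      have := mul_le_mul_of_nonneg_left hc.1 he0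
      linarith [hc.2]
    · exact (Real.exp_pos _).le
  calc _ ≤ ∑ h : Fin S → Fin F, priorWeight lam h * ∑ d, obsWeight p a h d *
        (Real.exp (-(e * x / 2)) * ∏ s, φ (h s) (d s)) := by
        refine Finset.sum_le_sum fun h _ => mul_le_mul_of_nonneg_left ?_
          (Finset.prod_nonneg fun s _ => hlam0 _)
        exact Finset.sum_le_sum fun d _ => mul_le_mul_of_nonneg_left (h1 h d)
          (obsWeight_nonneg hp0 hp1 ha h d)
    _ = Real.exp (-(e * x / 2)) * ∏ _s : Fin S, ∑ g, lam g * ∑ c : Fin I × Bool,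
        a c.1 g * (if c.2 = true then p else 1 - p) * φ g c := by
        rw [Fintype.prod_sum, Finset.mul_sum]
        refine Finset.sum_congr rfl fun h _ => ?_
        rw [Finset.prod_mul_distrib, Fintype.prod_sum, Finset.mul_sum, Finset.mul_sum,
          Finset.mul_sum]
        refine Finset.sum_congr rfl fun d _ => ?_
        unfold priorWeight obsWeight
        rw [Finset.prod_mul_distrib (f := fun s => a (d s).1 (h s) * _)]
        ring
    _ ≤ Real.exp (-(e * x / 2)) * 1 := by
        refine mul_le_mul_of_nonneg_left ?_ (Real.exp_pos _).le
        refine Finset.prod_le_one (fun _ _ => Finset.sum_nonneg fun g _ => mul_nonneg (hlam0 g)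
          (Finset.sum_nonneg fun c _ => mul_nonneg (cell_nonneg hp0 hp1 ha g c) ?_)) fun _ _ => ?_
        · simp only [hφ]; split_ifs <;> positivity
        have h2 : ∀ g, ∑ c : Fin I × Bool, a c.1 g * (if c.2 = true then p else 1 - p) * φ g c =
            1 + p * (a q g * ((if g ≠ f then Real.exp (1 - e / 2) else Real.exp (-(e / 2))) - 1)) := by
          intro g
          rw [sum_cell_mul]
          have h3 : ∀ z, a z g * (p * φ g (z, true) + (1 - p) * φ g (z, false)) = a z g +
              if z = q then p * (a q g * ((if g ≠ f then Real.exp (1 - e / 2) else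
                Real.exp (-(e / 2))) - 1)) else 0 := by
            intro z
            simp only [hφ, Prod.mk.injEq, and_true, Bool.false_eq_true, and_false, if_false]
            by_cases hz : z = q
            · rw [if_pos hz, if_pos hz, hz]; ring
            · rw [if_neg hz, if_neg hz]; ring
          simp only [h3, Finset.sum_add_distrib, ha.2]
          simp
        simp only [h2, mul_add, mul_one, Finset.sum_add_distrib, hlam]
        have h4 : ∑ g, lam g * (p * (a q g * ((if g ≠ f then Real.exp (1 - e / 2) else
            Real.exp (-(e / 2))) - 1))) ≤ 0 := by
          set Q := ∑ g, lam g * a q g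
          set R := ∑ g ∈ Finset.univ.erase f, lam g * a q g with hR
          have hQR : Q = lam f * a q f + R := (Finset.add_sum_erase _ _ (Finset.mem_univ f)).symm
          have hQ0 : 0 ≤ Q := Finset.sum_nonneg fun g _ => mul_nonneg (hlam0 g) (ha.1 _ _)
          have h5 : ∑ g, lam g * (p * (a q g * ((if g ≠ f then Real.exp (1 - e / 2) else
              Real.exp (-(e / 2))) - 1))) = p * (lam f * a q f * (Real.exp (-(e / 2)) - 1) +
              R * (Real.exp (1 - e / 2) - 1)) := by
            rw [← Finset.add_sum_erase _ _ (Finset.mem_univ f), hR, Finset.sum_mul, mul_add,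
              Finset.mul_sum]
            congr 1
            · simp; ring
            · refine Finset.sum_congr rfl fun g hg => ?_
              rw [if_pos (Finset.ne_of_mem_erase hg)]; ring
          rw [h5]
          refine mul_nonpos_of_nonneg_of_nonpos hp0 ?_
          have e1 : Real.exp (1 - e / 2) = Real.exp 1 * Real.exp (-(e / 2)) := by
            rw [← Real.exp_add]; congr 1
          have e2 : lam f * a q f = Q - R := by linarith
          have e3 : Real.exp 1 ≤ 3 := by linarith [Real.exp_one_lt_d9]
          -- `exp (-e / 2) ≤ 1 / (1 + e / 2)`
          set y := Real.exp (-(e / 2)) with hy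
          have hy0 : 0 < y := Real.exp_pos _
          have e4 : y * (1 + e / 2) ≤ 1 := by
            have h6 := Real.add_one_le_exp (e / 2)
            have h7 : y * Real.exp (e / 2) = 1 := by rw [hy, ← Real.exp_add]; simp
            nlinarith
          rw [e1, e2]
          have h8 : (Q - R) * (y - 1) + R * (Real.exp 1 * y - 1) =
              Q * (y - 1) + R * (y * (Real.exp 1 - 1)) := by ring
          rw [h8]
          have h9 : R * (y * (Real.exp 1 - 1)) ≤ (e / 8 * Q) * (y * 2) := by
            refine mul_le_mul hdom (mul_le_mul_of_nonneg_left (by linarith) hy0.le)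
              (mul_nonneg hy0.le (by linarith [Real.add_one_le_exp (1 : ℝ)])) (by positivity)
          have h10 : Q * (y - 1) + (e / 8 * Q) * (y * 2) ≤ Q * (y * (1 + e / 2) - 1) := by
            have : 0 ≤ Q * (y * e) := by positivity
            nlinarith
          have h11 : Q * (y * (1 + e / 2) - 1) ≤ 0 :=
            mul_nonpos_of_nonneg_of_nonpos hQ0 (by linarith)
          linarith
        linarith
    _ = _ := mul_one _

end SampleCounts

/-! ### Noise in a column of the empirical marginals -/

section ColumnNoise

variable {I F S : ℕ}

/-- A vector, extended by the sum of its entries. -/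
noncomputable def withSum (I : ℕ) : (Fin I → ℝ) →ₗ[ℝ] EuclideanSpace ℝ (Option (Fin I)) where
  toFun u := WithLp.toLp 2 fun o => o.elim (∑ z, u z) u
  map_add' u v := by
    ext o
    cases o with
    | none => simp [Finset.sum_add_distrib]
    | some z => simp
  map_smul' c u := by
    ext o
    cases o with
    | none => simp [Finset.mul_sum]
    | some z => simp

theorem norm_withSum_sq (u : Fin I → ℝ) : ‖withSum I u‖ ^ 2 = ∑ z, u z ^ 2 + (∑ z, u z) ^ 2 := by
  rw [EuclideanSpace.norm_sq_eq, Fintype.sum_option]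
  simp [withSum, add_comm]

theorem norm_withSum_sq_le (u : Fin I → ℝ) : ‖withSum I u‖ ^ 2 ≤ 2 * (∑ z, |u z|) ^ 2 := by
  rw [norm_withSum_sq]
  have h1 : ∑ z, u z ^ 2 ≤ (∑ z, |u z|) ^ 2 := by
    simp only [← sq_abs (u _)]
    exact Finset.sum_sq_le_sq_sum_of_nonneg fun z _ => abs_nonneg _
  have h2 : (∑ z, u z) ^ 2 ≤ (∑ z, |u z|) ^ 2 := by
    rw [← sq_abs (∑ z, u z)]
    exact pow_le_pow_left₀ (abs_nonneg _) (Finset.abs_sum_le_sum_abs _ _) 2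
  linarith

/-- The second moment of a random vector is at least that of its deviation from the mean. -/
theorem sum_mul_norm_sub_sq_le {E α : Type*} [NormedAddCommGroup E] [InnerProductSpace ℝ E]
    [Fintype α] (w : α → ℝ) (hw1 : ∑ c, w c = 1) (u : α → E) :
    ∑ c, w c * ‖u c - ∑ c', w c' • u c'‖ ^ 2 ≤ ∑ c, w c * ‖u c‖ ^ 2 := by
  set m := ∑ c', w c' • u c' with hm
  have h1 : ∀ c, w c * ‖u c - m‖ ^ 2 = w c * ‖u c‖ ^ 2 - 2 * inner ℝ (w c • u c) m +
      w c * ‖m‖ ^ 2 := by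
    intro c
    rw [norm_sub_sq_real, inner_smul_left]
    simp only [conj_trivial]
    ring
  simp only [h1, Finset.sum_add_distrib, Finset.sum_sub_distrib, ← Finset.mul_sum, ← Finset.sum_mul,
    hw1]
  rw [← sum_inner, ← hm, real_inner_self_eq_norm_sq]
  nlinarith [sq_nonneg ‖m‖]

/-- The part of the frequency vector of `z` among the samples with value `q` of the variable with
record `d'` that is not explained by the latent variables. It is multiplied by the number of common
samples. -/
noncomputable def columnNoise (a : Fin I → Fin F → ℝ) (h : Fin S → Fin F)
    (d d' : Fin S → Fin I × Bool) (q z : Fin I) : ℝ :=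
  cellCount d d' z q - pairCount d d' * ((∑ s ∈ levelSet d' q, a z (h s)) / (viewSet d').card)

/-- The squared norm of the noise vector, extended by the sum of its entries. -/
noncomputable def noiseSq (a : Fin I → Fin F → ℝ) (h : Fin S → Fin F)
    (d d' : Fin S → Fin I × Bool) (q : Fin I) : ℝ :=
  ∑ z, columnNoise a h d d' q z ^ 2 + (∑ z, columnNoise a h d d' q z) ^ 2

theorem prob_noise_large {J : Type*} [Fintype J] [DecidableEq J] {p : ℝ} (hp0 : 0 ≤ p)
    (hp1 : p ≤ 1) {a : J → Fin I → Fin F → ℝ} (ha : ∀ j, IsColStochastic (a j))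
    (h : Fin S → Fin F) (d' : Fin S → Fin I × Bool) (q : Fin I) {V K : ℝ}
    (hV : 8 * p * (levelSet d' q).card ≤ V) (hV6 : 6 ≤ V) (hVK : 96 * K ≤ V) :
    ∑ d : J → Fin S → Fin I × Bool, (∏ j, obsWeight p (a j) h (d j)) *
      (if 24 * V * K ≤ ∑ j, noiseSq (a j) h (d j) d' q then 1 else 0) ≤
        Real.exp (-K + Fintype.card J / 6) := by
  classical
  set U := viewSet d' with hU
  set L := levelSet d' q with hL
  set n : ℝ := (U.card : ℝ) with hn
  set m : ℝ := L.card / n with hm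
  have hLU : L ⊆ U := levelSet_subset_viewSet d' q
  have hcard : (L.card : ℝ) ≤ n := by rw [hn]; exact_mod_cast Finset.card_le_card hLU
  have hn0 : 0 ≤ n := Nat.cast_nonneg _
  have hm0 : 0 ≤ m := div_nonneg (Nat.cast_nonneg _) hn0
  have hm1 : m ≤ 1 := div_le_one_of_le₀ hcard hn0
  have hmn : n * m = L.card := by
    rcases hn0.lt_or_eq with h0 | h0
    · rw [hm]; field_simp
    · have : (L.card : ℝ) = 0 := le_antisymm (by rw [h0]; exact hcard) (Nat.cast_nonneg _)
      rw [← h0, this]; simp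
  -- the explained part `g`, the contribution `x` of a common sample, and its mean
  set g : J → Fin I → ℝ := fun j z => (∑ s ∈ L, a j z (h s)) / n with hg
  set x : J → Fin S → Fin I → Fin I → ℝ := fun j s z =>
    (if s ∈ L then Pi.single z 1 else 0) - g j with hx
  set μ : J → Fin S → Fin I → ℝ := fun j s =>
    (if s ∈ L then (fun z => a j z (h s)) else 0) - g j with hμ
  have hg0 : ∀ j z, 0 ≤ g j z := fun j z =>
    div_nonneg (Finset.sum_nonneg fun s _ => (ha j).1 _ _) hn0
  have hg1 : ∀ j, ∑ z, |g j z| = m := by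
    intro j
    simp only [abs_of_nonneg (hg0 j _)]
    rw [hg, ← Finset.sum_div, Finset.sum_comm, Finset.sum_congr rfl fun s _ => (ha j).2 (h s)]
    simp [hm]
  have hx1 : ∀ j s z, ∑ z', |x j s z z'| ≤ (if s ∈ L then 1 else 0) + m := by
    intro j s z
    rw [← hg1 j]
    have h1 : ∑ z', |(if s ∈ L then (Pi.single z 1 : Fin I → ℝ) else 0) z'| =
        if s ∈ L then 1 else 0 := by
      split_ifs
      · rw [Finset.sum_eq_single z]
        · simp
        · intro b _ hb; rw [Pi.single_eq_of_ne hb, abs_zero]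
        · simp
      · simp
    rw [← h1, ← Finset.sum_add_distrib]
    exact Finset.sum_le_sum fun z' _ => abs_sub _ _
  have hμ1 : ∀ j s, ∑ z', |μ j s z'| ≤ (if s ∈ L then 1 else 0) + m := by
    intro j s
    rw [← hg1 j]
    have h1 : ∑ z', |(if s ∈ L then (fun z => a j z (h s)) else 0 : Fin I → ℝ) z'| =
        if s ∈ L then 1 else 0 := by
      split_ifs
      · simp only [abs_of_nonneg ((ha j).1 _ _), (ha j).2]
      · simp
    rw [← h1, ← Finset.sum_add_distrib]
    exact Finset.sum_le_sum fun z' _ => abs_sub _ _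
  have hxμ : ∀ j s, ∑ z, a j z (h s) • x j s z = μ j s := by
    intro j s
    simp only [hx, hμ, smul_sub, Finset.sum_sub_distrib, ← Finset.sum_smul, (ha j).2, one_smul]
    congr 1
    split_ifs
    · ext z'
      simp [Finset.sum_apply, Pi.single_apply]
    · simp
  have h2norm : ∀ u : Fin I → ℝ, ∑ z, |u z| ≤ 2 → ‖withSum I u‖ ≤ 3 := by
    intro u hu
    have h1 := norm_withSum_sq_le u
    have h2 : (∑ z, |u z|) ^ 2 ≤ 2 ^ 2 :=
      pow_le_pow_left₀ (Finset.sum_nonneg fun _ _ => abs_nonneg _) hu 2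
    nlinarith [norm_nonneg (withSum I u)]
  set w : J → Fin S → Fin I × Bool → ℝ := fun j s c =>
    a j c.1 (h s) * if c.2 = true then p else 1 - p with hw
  set u : J → Fin S → Fin I × Bool → EuclideanSpace ℝ (Option (Fin I)) := fun j s c =>
    if s ∈ U ∧ c.2 = true then withSum I (x j s c.1) else 0 with hu
  have humean : ∀ j s, ∑ c, w j s c • u j s c = if s ∈ U then p • withSum I (μ j s) else 0 := by
    intro j s
    rw [Fintype.sum_prod_type]
    simp only [Fintype.sum_bool, hw, hu, if_true, Bool.false_eq_true, if_false, and_false,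
      and_true, smul_zero, add_zero]
    by_cases hs : s ∈ U
    · simp only [hs, if_true]
      rw [← hxμ, map_sum, Finset.smul_sum]
      refine Finset.sum_congr rfl fun z _ => ?_
      rw [map_smul, smul_smul, mul_comm]
    · simp [hs]
  set y : J → Fin S → Fin I × Bool → EuclideanSpace ℝ (Option (Fin I)) := fun j s c =>
    u j s c - ∑ c', w j s c' • u j s c' with hy
  have hw1 : ∀ j s, ∑ c, w j s c = 1 := fun j s => sum_cell (ha j) _
  have hle2 : ∀ s, (if s ∈ L then (1 : ℝ) else 0) + m ≤ 2 := fun s => by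
    split_ifs <;> linarith
  have hyb : ∀ j s c, ‖y j s c‖ ≤ 6 := by
    intro j s c
    simp only [hy]
    rw [humean]
    refine (norm_sub_le _ _).trans ?_
    have h1 : ‖u j s c‖ ≤ 3 := by
      simp only [hu]
      split_ifs
      · exact h2norm _ ((hx1 j s _).trans (hle2 s))
      · simp
    have h2 : ‖if s ∈ U then p • withSum I (μ j s) else 0‖ ≤ 3 := by
      split_ifs
      · rw [norm_smul, Real.norm_of_nonneg hp0]
        have := h2norm _ ((hμ1 j s).trans (hle2 s))
        nlinarith [norm_nonneg (withSum I (μ j s))]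
      · simp
    linarith
  have hyv : ∀ j s, ∑ c, w j s c * ‖y j s c‖ ^ 2 ≤
      if s ∈ U then 4 * p * ((if s ∈ L then 1 else 0) + m ^ 2) else 0 := by
    intro j s
    refine (sum_mul_norm_sub_sq_le (w j s) (hw1 j s) (u j s)).trans ?_
    simp only [hw]
    rw [sum_cell_mul]
    simp only [hu, and_true, Bool.false_eq_true, and_false, if_false, norm_zero]
    by_cases hs : s ∈ U
    · simp only [hs, if_true]
      have h1 : ∀ z, ‖withSum I (x j s z)‖ ^ 2 ≤ 4 * ((if s ∈ L then 1 else 0) + m ^ 2) := by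
        intro z
        refine (norm_withSum_sq_le _).trans ?_
        have h2 := pow_le_pow_left₀ (Finset.sum_nonneg fun _ _ => abs_nonneg _) (hx1 j s z) 2
        split_ifs at h2 ⊢ <;> nlinarith [sq_nonneg (1 - m)]
      have h2 : ∑ z, a j z (h s) * (p * ‖withSum I (x j s z)‖ ^ 2 + (1 - p) * 0 ^ 2) ≤
          ∑ z, a j z (h s) * (p * (4 * ((if s ∈ L then 1 else 0) + m ^ 2))) := by
        refine Finset.sum_le_sum fun z _ => mul_le_mul_of_nonneg_left ?_ ((ha j).1 _ _)
        have := mul_le_mul_of_nonneg_left (h1 z) hp0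
        linarith
      rw [← Finset.sum_mul, (ha j).2] at h2
      linarith
    · simp [hs]
  have hsumv : ∀ _j : J, ∑ s, (if s ∈ U then 4 * p * ((if s ∈ L then 1 else 0) + m ^ 2) else 0) ≤
      V := by
    intro _
    rw [Finset.sum_ite_mem, Finset.univ_inter, ← Finset.mul_sum, Finset.sum_add_distrib,
      Finset.sum_ite_mem, Finset.inter_eq_right.2 hLU]
    simp only [Finset.sum_const, nsmul_eq_mul, mul_one]
    have h1 : (U.card : ℝ) * m ^ 2 ≤ L.card := by
      rw [← hn, sq, ← mul_assoc, hmn]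
      exact mul_le_of_le_one_right (Nat.cast_nonneg _) hm1
    have h2 := mul_le_mul_of_nonneg_left h1 (mul_nonneg (by norm_num : (0 : ℝ) ≤ 4) hp0)
    linarith
  have hsum : ∀ (d : J → Fin S → Fin I × Bool) (j : J),
      ‖∑ s, y j s (d j s)‖ ^ 2 = noiseSq (a j) h (d j) d' q := by
    intro d j
    have h1 : ∑ s, y j s (d j s) = withSum I (columnNoise (a j) h (d j) d' q) := by
      simp only [hy, humean, Finset.sum_sub_distrib]
      have h2 : ∑ s, (if s ∈ U then p • withSum I (μ j s) else 0) = 0 := by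
        rw [Finset.sum_ite_mem, Finset.univ_inter, ← Finset.smul_sum, ← map_sum]
        have h3 : ∑ s ∈ U, μ j s = 0 := by
          simp only [hμ, Finset.sum_sub_distrib]
          rw [Finset.sum_ite_mem, Finset.inter_eq_right.2 hLU]
          ext z
          simp only [Pi.sub_apply, Finset.sum_apply, Finset.sum_const, nsmul_eq_mul, Pi.zero_apply, hg,
            Pi.mul_apply, Pi.natCast_apply]
          rcases hn0.lt_or_eq with h0 | h0
          · rw [← hn]; field_simp; ring
          · have hL0 : L = ∅ := by
              rw [← Finset.card_eq_zero]
              have : (L.card : ℝ) = 0 := le_antisymm (by rw [h0]; exact hcard) (Nat.cast_nonneg _)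
              exact_mod_cast this
            rw [hL0]; simp
        rw [h3, map_zero, smul_zero]
      rw [h2, sub_zero]
      have h4 : ∑ s, u j s (d j s) = withSum I (∑ s ∈ U.filter fun s => (d j s).2 = true,
          x j s (d j s).1) := by
        rw [map_sum, Finset.sum_filter, ← Finset.univ_inter U, ← Finset.sum_ite_mem]
        refine Finset.sum_congr rfl fun s _ => ?_
        simp only [hu]
        split_ifs <;> first | rfl | tauto
      rw [h4]
      congr 1
      ext z
      simp only [hx, columnNoise, Finset.sum_apply, Pi.sub_apply, Finset.sum_sub_distrib,
        Finset.sum_const, nsmul_eq_mul]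
      congr 1
      have h5 : ∀ s ∈ U.filter fun s => (d j s).2 = true,
          (if s ∈ L then (Pi.single (d j s).1 1 : Fin I → ℝ) else 0) z =
          if s ∈ L ∧ d j s = (z, true) then 1 else 0 := by
        intro s hs
        have hs2 := (Finset.mem_filter.1 hs).2
        by_cases hsL : s ∈ L
        · simp only [hsL, if_true, true_and, Pi.single_apply]
          have : z = (d j s).1 ↔ d j s = (z, true) := by
            constructor
            · intro hz; exact Prod.ext hz.symm hs2
            · intro hz; rw [hz]
          simp only [this]
        · simp [hsL]
      rw [Finset.sum_congr rfl h5, ← Finset.sum_filter, Finset.sum_const, nsmul_eq_mul, mul_one]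
      unfold cellCount
      congr 2
      ext s
      simp only [Finset.mem_filter]
      constructor
      · rintro ⟨-, h6, h7⟩; exact ⟨h6, h7⟩
      · rintro ⟨h6, h7⟩; exact ⟨⟨hLU h6, by rw [h7]⟩, h6, h7⟩
    rw [h1, norm_withSum_sq]
    rfl
  have hfinal := sum_prod_indicator_norm_sq_le (b := 6) (V := V) (K := K) w y
    (fun _ s => if s ∈ U then 4 * p * ((if s ∈ L then 1 else 0) + m ^ 2) else 0)
    (fun j s c => cell_nonneg hp0 hp1 (ha j) _ c) hw1 (fun j s => by
      simp only [hy, smul_sub, Finset.sum_sub_distrib, ← Finset.sum_smul, hw1, one_smul, sub_self])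
    hyb hyv hsumv (by norm_num) (by linarith) (by linarith) (by linarith)
  simp only [hsum] at hfinal
  exact hfinal

end ColumnNoise

/-! ### Recovery when all columns carry little noise -/

section Recovery

/-- Normalization of a noisy column whose `ℓ¹` masses in all blocks are at least `η`. -/
theorem normalized_column_error {J : Type*} [Fintype J] [Nonempty J] {I F : ℕ}
    {a : J → Fin I → Fin F → ℝ} (ha : ∀ j, IsColStochastic (a j)) {h : Fin F → ℝ}
    (h0 : ∀ f, 0 ≤ h f) (h1 : ∑ f, h f = 1) {X : J → Fin I → ℝ} {m η ν : ℝ} (hη : 0 < η)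
    (hν0 : 0 ≤ ν) (hν : ν ≤ 1 / 8)
    (hX : ∀ j, η ≤ ∑ z, X j z)
    (hE : ∑ j, (∑ z, (X j z - m * ∑ f, a j z f * h f) ^ 2 +
      (∑ z, (X j z - m * ∑ f, a j z f * h f)) ^ 2) ≤ (max m η * ν) ^ 2) :
    7 / 8 * η ≤ m ∧
    (∑ j, ∑ z, (X j z / (∑ j', ∑ z', X j' z') - (∑ f, a j z f * h f) / Fintype.card J) ^ 2 ≤
      (4 * ν / Fintype.card J) ^ 2) ∧
    ∀ j, ∑ z, (X j z / (∑ z', X j z') - ∑ f, a j z f * h f) ^ 2 ≤ (4 * ν) ^ 2 := by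
  set u : J → Fin I → ℝ := fun j z => ∑ f, a j z f * h f with hu
  set e : J → Fin I → ℝ := fun j z => X j z - m * u j z with he
  set R := max m η * ν with hR
  set c : ℝ := (Fintype.card J : ℝ) with hc
  have hc1 : 1 ≤ c := by rw [hc]; exact_mod_cast Fintype.card_pos
  have hmax0 : 0 < max m η := lt_max_of_lt_right hη
  have hR0 : 0 ≤ R := mul_nonneg hmax0.le hν0
  have hu0 : ∀ j z, 0 ≤ u j z := fun j z =>
    Finset.sum_nonneg fun f _ => mul_nonneg ((ha j).1 _ _) (h0 f)
  have hu1 : ∀ j, ∑ z, u j z = 1 := by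
    intro j
    simp only [hu]
    rw [Finset.sum_comm]
    simp only [← Finset.sum_mul, (ha j).2, one_mul, h1]
  have husq : ∀ j, ∑ z, u j z ^ 2 ≤ 1 := by
    intro j
    refine (Finset.sum_sq_le_sq_sum_of_nonneg fun z _ => hu0 j z).trans ?_
    rw [hu1, one_pow]
  have hXe : ∀ j z, X j z = m * u j z + e j z := fun j z => by simp only [he]; ring
  have hmass : ∀ j, ∑ z, X j z = m + ∑ z, e j z := by
    intro j
    simp only [hXe, Finset.sum_add_distrib, ← Finset.mul_sum, hu1, mul_one]
  have hEj : ∀ j, ∑ z, e j z ^ 2 + (∑ z, e j z) ^ 2 ≤ R ^ 2 := fun j =>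
    le_trans (Finset.single_le_sum (f := fun j => ∑ z, e j z ^ 2 + (∑ z, e j z) ^ 2)
      (fun j _ => by positivity) (Finset.mem_univ j)) hE
  have hse : ∀ j, |∑ z, e j z| ≤ R := fun j => by
    refine abs_le_of_sq_le_sq ?_ hR0
    have : 0 ≤ ∑ z, e j z ^ 2 := Finset.sum_nonneg fun z _ => sq_nonneg _
    linarith [hEj j]
  obtain ⟨j₀⟩ := ‹Nonempty J›
  have hRmax : R ≤ max m η / 8 := by
    rw [hR, div_eq_mul_one_div]; exact mul_le_mul_of_nonneg_left hν hmax0.le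
  have hηm : 7 / 8 * η ≤ m := by
    have h2 := hX j₀
    rw [hmass] at h2
    have h3 := (abs_le.1 (hse j₀)).2
    rcases le_total η m with h4 | h4
    · linarith
    · rw [max_eq_right h4] at hRmax
      linarith
  have hm0 : 0 < m := by linarith
  have hmaxm : max m η ≤ 8 / 7 * m := max_le (by linarith) (by linarith)
  have hRm : R ≤ 8 / 7 * m * ν := mul_le_mul_of_nonneg_right hmaxm hν0
  have hRm' : R ≤ m / 7 := by linarith
  refine ⟨hηm, ?_, fun j => ?_⟩
  · set T := ∑ j', ∑ z', X j' z' with hT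
    have hTe : T = c * m + ∑ j, ∑ z, e j z := by
      rw [hT, Finset.sum_congr rfl fun j _ => hmass j, Finset.sum_add_distrib]
      simp [hc]
    set t := ∑ j, ∑ z, e j z with ht
    have htR : |t| ≤ c * R := by
      refine (Finset.abs_sum_le_sum_abs _ _).trans ((Finset.sum_le_sum fun j _ => hse j).trans ?_)
      simp [hc]
    have htsq : t ^ 2 ≤ c * ∑ j, (∑ z, e j z) ^ 2 := by
      have := sq_sum_le_card_mul_sum_sq (s := Finset.univ) (f := fun j => ∑ z, e j z)
      simpa [hc] using this
    have hTlow : 6 / 7 * (c * m) ≤ T := by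
      have h2 := (abs_le.1 htR).1
      have h3 : c * R ≤ c * (m / 7) := mul_le_mul_of_nonneg_left hRm' (by linarith)
      rw [hTe]; linarith
    have hT0 : 0 < T := lt_of_lt_of_le (by positivity) hTlow
    have hpt : ∀ j z, (X j z / T - u j z / c) ^ 2 ≤
        (2 * (t / c) ^ 2 * u j z ^ 2 + 2 * e j z ^ 2) / T ^ 2 := by
      intro j z
      have h2 : X j z / T - u j z / c = (e j z - t / c * u j z) / T := by
        rw [hXe, eq_div_iff hT0.ne']
        have hc0 : c ≠ 0 := by linarith
        field_simp
        rw [hTe]; ring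
      rw [h2, div_pow]
      refine div_le_div_of_nonneg_right ?_ (by positivity)
      nlinarith [sq_nonneg (e j z + t / c * u j z)]
    calc ∑ j, ∑ z, (X j z / T - u j z / c) ^ 2
        ≤ ∑ j, ∑ z, (2 * (t / c) ^ 2 * u j z ^ 2 + 2 * e j z ^ 2) / T ^ 2 :=
          Finset.sum_le_sum fun j _ => Finset.sum_le_sum fun z _ => hpt j z
      _ = (2 * (t / c) ^ 2 * ∑ j, ∑ z, u j z ^ 2 + 2 * ∑ j, ∑ z, e j z ^ 2) / T ^ 2 := by
          simp only [← Finset.sum_div, Finset.sum_add_distrib, ← Finset.mul_sum]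
      _ ≤ (2 * R ^ 2) / T ^ 2 := by
          refine div_le_div_of_nonneg_right ?_ (by positivity)
          have h2 : ∑ j, ∑ z, u j z ^ 2 ≤ c := by
            refine (Finset.sum_le_sum fun j _ => husq j).trans ?_
            simp [hc]
          have h3 : (t / c) ^ 2 * ∑ j, ∑ z, u j z ^ 2 ≤ ∑ j, (∑ z, e j z) ^ 2 := by
            calc (t / c) ^ 2 * ∑ j, ∑ z, u j z ^ 2 ≤ (t / c) ^ 2 * c :=
                  mul_le_mul_of_nonneg_left h2 (sq_nonneg _)
              _ = t ^ 2 / c := by have : c ≠ 0 := by linarith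
                                  field_simp
              _ ≤ _ := by rw [div_le_iff₀ (by linarith)]; linarith
          rw [Finset.sum_add_distrib] at hE
          linarith
      _ ≤ (4 * ν / c) ^ 2 := by
          rw [div_pow, div_le_div_iff₀ (by positivity) (by positivity)]
          have h2 : R * c ≤ 8 / 7 * (c * m) * ν := by
            have := mul_le_mul_of_nonneg_right hRm (show 0 ≤ c by linarith)
            linarith
          have h3 : R * c ≤ 4 / 3 * ν * T := by
            have := mul_le_mul_of_nonneg_left hTlow hν0
            linarith
          have h4 : (R * c) ^ 2 ≤ (4 / 3 * ν * T) ^ 2 :=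
            pow_le_pow_left₀ (mul_nonneg hR0 (by linarith)) h3 2
          have h5 : 0 ≤ (ν * T) ^ 2 := sq_nonneg _
          calc 2 * R ^ 2 * c ^ 2 = 2 * (R * c) ^ 2 := by ring
            _ ≤ 2 * (4 / 3 * ν * T) ^ 2 := by linarith
            _ = 32 / 9 * (ν * T) ^ 2 := by ring
            _ ≤ 16 * (ν * T) ^ 2 := by linarith
            _ = _ := by ring
  · set T := ∑ z', X j z'
    set t := ∑ z, e j z
    have hTe : T = m + t := hmass j
    have hTlow : 6 / 7 * m ≤ T := by
      have h2 := (abs_le.1 (hse j)).1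
      rw [hTe]; linarith
    have hT0 : 0 < T := lt_of_lt_of_le (by positivity) hTlow
    have hpt : ∀ z, (X j z / T - u j z) ^ 2 ≤ (2 * t ^ 2 * u j z ^ 2 + 2 * e j z ^ 2) / T ^ 2 := by
      intro z
      have h2 : X j z / T - u j z = (e j z - t * u j z) / T := by
        rw [hXe, eq_div_iff hT0.ne']
        field_simp
        rw [hTe]; ring
      rw [h2, div_pow]
      refine div_le_div_of_nonneg_right ?_ (by positivity)
      nlinarith [sq_nonneg (e j z + t * u j z)]
    calc ∑ z, (X j z / T - u j z) ^ 2
        ≤ ∑ z, (2 * t ^ 2 * u j z ^ 2 + 2 * e j z ^ 2) / T ^ 2 :=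
          Finset.sum_le_sum fun z _ => hpt z
      _ = (2 * t ^ 2 * ∑ z, u j z ^ 2 + 2 * ∑ z, e j z ^ 2) / T ^ 2 := by
          simp only [← Finset.sum_div, Finset.sum_add_distrib, ← Finset.mul_sum]
      _ ≤ (2 * R ^ 2) / T ^ 2 := by
          refine div_le_div_of_nonneg_right ?_ (by positivity)
          have h3 : t ^ 2 * ∑ z, u j z ^ 2 ≤ t ^ 2 * 1 :=
            mul_le_mul_of_nonneg_left (husq j) (sq_nonneg _)
          linarith [hEj j]
      _ ≤ (4 * ν) ^ 2 := by
          rw [div_le_iff₀ (by positivity)]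
          have h3 : R ≤ 4 / 3 * ν * T := by
            have := mul_le_mul_of_nonneg_left hTlow hν0
            linarith
          have h4 : R ^ 2 ≤ (4 / 3 * ν * T) ^ 2 := pow_le_pow_left₀ hR0 h3 2
          have h5 : 0 ≤ (ν * T) ^ 2 := sq_nonneg _
          calc 2 * R ^ 2 ≤ 2 * (4 / 3 * ν * T) ^ 2 := by linarith
            _ = 32 / 9 * (ν * T) ^ 2 := by ring
            _ ≤ 16 * (ν * T) ^ 2 := by linarith
            _ = _ := by ring

variable {N M I F S : ℕ}

theorem sum_stackedFactor_mul_sq_le (A : Fin N → Fin I → Fin F → ℝ) (x : Fin F → ℝ) :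
    ∑ j : Part1 N M, ∑ z, (∑ f, A j z f * x f) ^ 2 ≤
      sigmaMax (stackedFactor M A) ^ 2 * ∑ f, x f ^ 2 := by
  have h1 := norm_toEuclideanLin_le (stackedFactor M A) (WithLp.toLp 2 x)
  have h2 := pow_le_pow_left₀ (norm_nonneg _) h1 2
  rw [norm_toEuclideanLin_sq, mul_pow, EuclideanSpace.norm_sq_eq, Fintype.sum_prod_type] at h2
  simpa [stackedFactor] using h2

theorem sq_sigmaMin_mul_sum_sq_le (A : Fin N → Fin I → Fin F → ℝ) (x : Fin F → ℝ) :
    sigmaMin (stackedFactor M A) ^ 2 * ∑ f, x f ^ 2 ≤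
      ∑ j : Part1 N M, ∑ z, (∑ f, A j z f * x f) ^ 2 := by
  have h1 := sigmaMin_mul_norm_le (stackedFactor M A) (WithLp.toLp 2 x)
  have h2 := pow_le_pow_left₀ (mul_nonneg (sigmaMin_nonneg _) (norm_nonneg _)) h1 2
  rw [norm_toEuclideanLin_sq, mul_pow, EuclideanSpace.norm_sq_eq, Fintype.sum_prod_type] at h2
  simpa [stackedFactor] using h2

theorem empMarginal_nonneg (D : Fin S → Fin N → Option (Fin I)) (j k : Fin N) (z q : Fin I) :
    0 ≤ empMarginal D j k z q := by
  unfold empMarginal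
  rw [Matrix.of_apply]
  positivity

/-- Distance of a probability vector from a vertex. -/
theorem sum_sub_single_sq_le {h : Fin F → ℝ} (h0 : ∀ f, 0 ≤ h f) (h1 : ∑ f, h f = 1)
    (f : Fin F) : ∑ g, (h g - (Pi.single f 1 : Fin F → ℝ) g) ^ 2 ≤ 2 * (1 - h f) ^ 2 := by
  rw [← Finset.add_sum_erase _ _ (Finset.mem_univ f), Pi.single_eq_same]
  have h2 : ∑ g ∈ Finset.univ.erase f, (h g - (Pi.single f 1 : Fin F → ℝ) g) ^ 2 ≤
      (∑ g ∈ Finset.univ.erase f, h g) ^ 2 := by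
    refine le_trans (le_of_eq ?_) (Finset.sum_sq_le_sq_sum_of_nonneg fun g _ => h0 g)
    refine Finset.sum_congr rfl fun g hg => ?_
    rw [Pi.single_eq_of_ne (Finset.ne_of_mem_erase hg), sub_zero]
  have h3 : ∑ g ∈ Finset.univ.erase f, h g = 1 - h f := by
    rw [← h1, ← Finset.add_sum_erase _ _ (Finset.mem_univ f)]; ring
  rw [h3] at h2
  nlinarith

/-- The trivial error bound. -/
theorem spaErrorAtMost_of_two_mul_sqrt_le [NeZero F] {D : Fin S → Fin N → Option (Fin I)}
    {A : Fin N → Fin I → Fin F → ℝ} (hA : ∀ n, IsColStochastic (A n)) {b : ℝ}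
    (hb : 2 * Real.sqrt F ≤ b) : SPAErrorAtMost M D A b := by
  intro Λ _ m
  refine ⟨1, le_trans ?_ hb⟩
  have := sigmaMax_le_sqrt_card_mul ((spaEstimate D Λ m).submatrix id (1 : Equiv.Perm (Fin F)) -
    Matrix.of (A m)) (c := 2) zero_le_two (fun f => ?_)
  · rw [Fintype.card_fin] at this; linarith
  · have hpt : ∀ z, ((spaEstimate D Λ m).submatrix id (1 : Equiv.Perm (Fin F)) -
        Matrix.of (A m)) z f = spaEstimate D Λ m z f - A m z f := fun z => rfl
    simp only [hpt]
    set u : Fin I → ℝ := fun z => spaEstimate D Λ m z f with hu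
    have hu0 : ∀ z, 0 ≤ u z := fun z => by
      simp only [hu, spaEstimate, colNormalize, Matrix.of_apply, empVirtual]
      exact div_nonneg (empMarginal_nonneg _ _ _ _ _) (Finset.sum_nonneg fun _ _ => abs_nonneg _)
    have hu1 : ∑ z, u z ≤ 1 := by
      simp only [hu, spaEstimate, colNormalize, Matrix.of_apply, empVirtual, ← Finset.sum_div]
      refine div_le_one_of_le₀ (Finset.sum_le_sum fun z _ => le_abs_self _)
        (Finset.sum_nonneg fun _ _ => abs_nonneg _)
    have h1 : ∑ z, u z ^ 2 ≤ 1 := by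
      refine (Finset.sum_sq_le_sq_sum_of_nonneg fun z _ => hu0 z).trans ?_
      exact pow_le_one₀ (Finset.sum_nonneg fun z _ => hu0 z) hu1
    have h2 : ∑ z, A m z f ^ 2 ≤ 1 := by
      refine (Finset.sum_sq_le_sq_sum_of_nonneg fun z _ => (hA m).1 z f).trans ?_
      rw [(hA m).2, one_pow]
    calc ∑ z, (u z - A m z f) ^ 2 ≤ ∑ z, (2 * u z ^ 2 + 2 * A m z f ^ 2) :=
          Finset.sum_le_sum fun z _ => by nlinarith [sq_nonneg (u z + A m z f)]
      _ ≤ 2 ^ 2 := by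
          rw [Finset.sum_add_distrib, ← Finset.mul_sum, ← Finset.mul_sum]; linarith

/-- Separability level that suffices for successive projection at condition number `κ`. -/
noncomputable def nearLevel (F : ℕ) (κ : ℝ) : ℝ := 1 / (864 * F) / (2 * κ ^ 3)

/-- The factor `min(1 / (2 √(F - 1)), 1 / 4)` in the definition of `ε`. -/
noncomputable def sepFactor (F : ℕ) : ℝ := min (1 / (2 * Real.sqrt (F - 1))) (1 / 4)

theorem le_sepFactor (hF : 2 ≤ F) : 1 / (4 * Real.sqrt F) ≤ sepFactor F := by
  have hF' : (2 : ℝ) ≤ F := by exact_mod_cast hF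
  have h1 : 1 ≤ Real.sqrt F := Real.one_le_sqrt.2 (by linarith)
  have h2 : 0 < Real.sqrt ((F : ℝ) - 1) := Real.sqrt_pos.2 (by linarith)
  have h3 : Real.sqrt ((F : ℝ) - 1) ≤ Real.sqrt F := Real.sqrt_le_sqrt (by linarith)
  refine le_min ?_ ?_
  · apply one_div_le_one_div_of_le <;> linarith
  · apply one_div_le_one_div_of_le <;> linarith

theorem sepFactor_pos (hF : 2 ≤ F) : 0 < sepFactor F := by
  have : (0 : ℝ) < F := by exact_mod_cast (by omega : 0 < F)
  exact lt_of_lt_of_le (by positivity) (le_sepFactor hF)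

theorem sepFactor_le : sepFactor F ≤ 1 / 4 := min_le_right _ _

theorem sepEps_eq (F M : ℕ) (κ : ℝ) :
    sepEps F M κ = M * (sepFactor F / (2 * κ * (1 + 80 * κ ^ 2))) := by
  unfold sepEps sepFactor; rw [mul_div_assoc]

theorem le_sepEps (hF : 2 ≤ F) {κ : ℝ} (hκ : 1 ≤ κ) :
    M * (1 / (648 * Real.sqrt F * κ ^ 3)) ≤ sepEps F M κ := by
  rw [sepEps_eq]
  refine mul_le_mul_of_nonneg_left ?_ (Nat.cast_nonneg _)
  have : (0 : ℝ) < F := by exact_mod_cast (by omega : 0 < F)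
  have h1 : 1 / (648 * Real.sqrt F * κ ^ 3) = 1 / (4 * Real.sqrt F) / (162 * κ ^ 3) := by
    field_simp; norm_num
  rw [h1]
  refine div_le_div₀ (sepFactor_pos hF).le (le_sepFactor hF) (by positivity) ?_
  have h2 : κ ≤ κ ^ 3 := by nlinarith [sq_nonneg (κ - 1)]
  nlinarith

theorem sepEps_le {κ : ℝ} (hκ : 1 ≤ κ) :
    sepEps F M κ ≤ M * (1 / (640 * κ ^ 3)) := by
  rw [sepEps_eq]
  refine mul_le_mul_of_nonneg_left ?_ (Nat.cast_nonneg _)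
  have h1 : 1 / (640 * κ ^ 3) = 1 / 4 / (160 * κ ^ 3) := by
    field_simp; norm_num
  rw [h1]
  refine div_le_div₀ (by norm_num) sepFactor_le (by positivity) ?_
  nlinarith

end Recovery

section Recovery

variable {N M I F S : ℕ}

/-- The error of one column of an estimate in terms of the mixing weights `h` of the selected column
of the data. -/
theorem block_column_error {A : Fin N → Fin I → Fin F → ℝ} {h : Fin F → ℝ} (h0 : ∀ f, 0 ≤ h f)
    (h1 : ∑ f, h f = 1) {X : Fin I → ℝ} {ν β : ℝ} (j : Part1 N M) (hν : 0 ≤ ν) (hβ : 0 ≤ β)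
    (hX : ∑ z, (X z - ∑ f, A j z f * h f) ^ 2 ≤ (4 * ν) ^ 2) {f : Fin F} (hf : 1 - β ≤ h f) :
    ∑ z, (X z - A j z f) ^ 2 ≤ (6 * ν + 2 * sigmaMax (stackedFactor M A) * β) ^ 2 := by
  set σ := sigmaMax (stackedFactor M A)
  have hσ0 : 0 ≤ σ := sigmaMax_nonneg _
  have hf1 : h f ≤ 1 := h1 ▸ Finset.single_le_sum (f := h) (fun g _ => h0 g) (Finset.mem_univ f)
  have h2 : ∑ z, (∑ g, A j z g * (h g - (Pi.single f 1 : Fin F → ℝ) g)) ^ 2 ≤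
      σ ^ 2 * (2 * β ^ 2) := by
    refine (Finset.single_le_sum (f := fun j : Part1 N M => ∑ z, (∑ g, A j z g *
      (h g - (Pi.single f 1 : Fin F → ℝ) g)) ^ 2) (fun j _ => Finset.sum_nonneg fun z _ =>
        sq_nonneg _) (Finset.mem_univ j)).trans ?_
    refine (sum_stackedFactor_mul_sq_le A _).trans (mul_le_mul_of_nonneg_left ?_ (sq_nonneg _))
    refine (sum_sub_single_sq_le h0 h1 f).trans ?_
    have : (1 - h f) ^ 2 ≤ β ^ 2 := pow_le_pow_left₀ (by linarith) (by linarith) 2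
    linarith
  have h3 : ∀ z, ∑ g, A j z g * (h g - (Pi.single f 1 : Fin F → ℝ) g) =
      ∑ g, A j z g * h g - A j z f := by
    intro z
    simp only [mul_sub, Finset.sum_sub_distrib]
    congr 1
    simp [Pi.single_apply]
  simp only [h3] at h2
  calc ∑ z, (X z - A j z f) ^ 2 ≤ ∑ z, (2 * (X z - ∑ g, A j z g * h g) ^ 2 +
        2 * (∑ g, A j z g * h g - A j z f) ^ 2) := Finset.sum_le_sum fun z _ => by
        nlinarith [sq_nonneg ((X z - ∑ g, A j z g * h g) - (∑ g, A j z g * h g - A j z f))]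
    _ ≤ 2 * (4 * ν) ^ 2 + 2 * (σ ^ 2 * (2 * β ^ 2)) := by
        rw [Finset.sum_add_distrib, ← Finset.mul_sum, ← Finset.mul_sum]; linarith
    _ ≤ _ := by
        have : 0 ≤ ν * (σ * β) := mul_nonneg hν (mul_nonneg hσ0 hβ)
        nlinarith [sq_nonneg ν]

/-- A constant which bounds the admissible noise in the columns, relative to `σ ε / M`. -/
noncomputable def noiseLevel (F : ℕ) : ℝ := 1 / (6 * F)

set_option maxHeartbeats 1000000 in
/-- **Deterministic recovery.** If the columns are close to mixtures of the columns of the stacked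
factor, and all vertices are almost attained, then the successive projection estimates are
accurate. If `κ² ε ≥ 1 / 4`, then the asserted accuracy is weaker than `σ_max`, and each choice of
columns will do. -/
theorem spaErrorAtMost_of_columns [NeZero F] (hF : 2 ≤ F) (hM : 0 < M) (hMN : M ≤ N)
    {D : Fin S → Fin N → Option (Fin I)} {A : Fin N → Fin I → Fin F → ℝ}
    (hA : ∀ n, IsColStochastic (A n)) (hs : 0 < sigmaMin (stackedFactor M A)) {κ σ ε η : ℝ}
    (hσ : σ = sigmaMax (stackedFactor M A)) (hκ : κ = condNumber (stackedFactor M A))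
    (hε : ε = sepEps F M κ) (hη : 0 < η)
    (hT : 1000 * (κ ^ 2 * (σ * ε)) < 2)
    {h : Part2 N M × Fin I → Fin F → ℝ} {m : Part2 N M × Fin I → ℝ}
    (h0 : ∀ c f, 0 ≤ h c f) (h1 : ∀ c, ∑ f, h c f = 1)
    (hmass : MassAtLeast M η D)
    (hE : ∀ c : Part2 N M × Fin I, ∑ j : Part1 N M,
      (∑ z, (empVirtual M D (j, z) c - m c * ∑ f, A j z f * h c f) ^ 2 +
      (∑ z, (empVirtual M D (j, z) c - m c * ∑ f, A j z f * h c f)) ^ 2) ≤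
        (max (m c) η * (noiseLevel F * (σ * ε / M))) ^ 2)
    (hnear : 1 / 4 ≤ κ ^ 2 * ε ∨ ∀ f, ∃ c, 1 - nearLevel F κ ≤ h c f) {b : ℝ}
    (hb : 1000 * (κ ^ 2 * Real.sqrt F * (σ * ε)) ≤ b) : SPAErrorAtMost M D A b := by
  set s := sigmaMin (stackedFactor M A)
  have hF0 : (2 : ℝ) ≤ F := by exact_mod_cast hF
  have hM1 : (1 : ℝ) ≤ M := by exact_mod_cast hM
  have hsσ : s ≤ σ := by rw [hσ]; exact sigmaMin_le_sigmaMax _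
  have hσ0 : 0 < σ := hs.trans_le hsσ
  have hκs : κ * s = σ := by rw [hκ, hσ]; exact div_mul_cancel₀ _ hs.ne'
  have hκ1 : 1 ≤ κ := by
    by_contra hcon
    push Not at hcon
    nlinarith
  have hκ0 : 0 < κ := by linarith
  have hsqF : 1 ≤ Real.sqrt F := Real.one_le_sqrt.2 (by linarith)
  have hsqF2 : Real.sqrt F * Real.sqrt F = F := Real.mul_self_sqrt (by linarith)
  have hεlow : M * (1 / (648 * Real.sqrt F * κ ^ 3)) ≤ ε := by rw [hε]; exact le_sepEps hF hκ1
  have hεup : ε ≤ M * (1 / (640 * κ ^ 3)) := by rw [hε]; exact sepEps_le hκ1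
  have hε0 : 0 < ε := lt_of_lt_of_le (by positivity) hεlow
  have hcard : Fintype.card (Part1 N M) = M := card_part1 hMN
  have hne : Nonempty (Part1 N M) := Fintype.card_pos_iff.1 (by omega)
  set ν := noiseLevel F * (σ * ε / M) with hν
  have hg0 : 0 < noiseLevel F := by unfold noiseLevel; positivity
  have hg1 : noiseLevel F ≤ 1 / 12 := by
    unfold noiseLevel; apply one_div_le_one_div_of_le <;> linarith
  have hσε : 1000 * (σ * ε) < 2 := by
    have h2 : 1 ≤ κ ^ 2 := one_le_pow₀ hκ1
    nlinarith
  have hσεM : σ * ε / M ≤ σ * ε := div_le_self (by positivity) hM1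
  have hν0 : 0 < ν := by positivity
  have hνle : ν ≤ 1 / 12 * (σ * ε) := by
    rw [hν]; exact mul_le_mul hg1 hσεM (by positivity) (by norm_num)
  have hν8 : ν ≤ 1 / 8 := by linarith
  have hX0 : ∀ c (j : Part1 N M) z, 0 ≤ empVirtual M D (j, z) c := fun c j z =>
    empMarginal_nonneg _ _ _ _ _
  have hXη : ∀ c (j : Part1 N M), η ≤ ∑ z, empVirtual M D (j, z) c := by
    intro c j
    refine (hmass j c.1 c.2).trans (le_of_eq (Finset.sum_congr rfl fun z _ => ?_))
    exact abs_of_nonneg (hX0 c j z)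
  have hcol := fun c => normalized_column_error (a := fun j : Part1 N M => A j) (fun j => hA j)
    (h0 c) (h1 c) (X := fun j z => empVirtual M D (j, z) c) hη hν0.le hν8 (hXη c) (hE c)
  have hblock : ∀ c (j : Part1 N M), ∑ z, (empVirtual M D (j, z) c /
      (∑ z', |empVirtual M D (j, z') c|) - ∑ f, A j z f * h c f) ^ 2 ≤ (4 * ν) ^ 2 := by
    intro c j
    have := (hcol c).2.2 j
    simp only [abs_of_nonneg (hX0 c j _)]
    exact this
  -- the conclusion from the concentration of the weights of the selected columns
  have hconcl : ∀ (Λ : Fin F → Part2 N M × Fin I) (π : Equiv.Perm (Fin F)) (β : ℝ), 0 ≤ β →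
      (∀ f, 1 - β ≤ h (Λ f) (π f)) → 2 * σ * β ≤ 999 * (κ ^ 2 * (σ * ε)) →
      ∀ j : Part1 N M, ∃ π : Equiv.Perm (Fin F),
        sigmaMax ((spaEstimate D Λ j).submatrix id π - Matrix.of (A j)) ≤ b := by
    intro Λ π β hβ hΛ hβσ j
    refine ⟨π.symm, ?_⟩
    have h2 := sigmaMax_le_sqrt_card_mul ((spaEstimate D Λ j).submatrix id π.symm -
      Matrix.of (A j)) (c := 6 * ν + 2 * σ * β) (by positivity) (fun f => by
        have h3 := block_column_error (A := A) (h0 (Λ (π.symm f))) (h1 _)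
          (X := fun z => empVirtual M D (j, z) (Λ (π.symm f)) /
            (∑ z', |empVirtual M D (j, z') (Λ (π.symm f))|)) j hν0.le hβ
          (hblock (Λ (π.symm f)) j) (f := f) (by
            have := hΛ (π.symm f); rwa [Equiv.apply_symm_apply] at this)
        rw [hσ]
        exact h3)
    rw [Fintype.card_fin] at h2
    refine h2.trans (le_trans ?_ hb)
    have h3 : 6 * ν ≤ κ ^ 2 * (σ * ε) := by
      have h4 : 1 ≤ κ ^ 2 := one_le_pow₀ hκ1
      nlinarith
    have h4 : 6 * ν + 2 * σ * β ≤ 1000 * (κ ^ 2 * (σ * ε)) := by linarith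
    calc Real.sqrt F * (6 * ν + 2 * σ * β) ≤ Real.sqrt F * (1000 * (κ ^ 2 * (σ * ε))) :=
          mul_le_mul_of_nonneg_left h4 (Real.sqrt_nonneg _)
      _ = _ := by ring
  intro Λ hΛ
  rcases hnear with hbig | hnear
  · refine hconcl Λ 1 1 zero_le_one (fun f => by simpa using h0 _ _) ?_
    have : σ * (1 / 4) ≤ σ * (κ ^ 2 * ε) := mul_le_mul_of_nonneg_left hbig hσ0.le
    nlinarith
  -- successive projection with the columns of the stacked factor, divided by `M`
  set w : Fin F → EuclideanSpace ℝ (Part1 N M × Fin I) := fun f =>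
    WithLp.toLp 2 fun r => A r.1 r.2 f / M with hw
  have hcomb : ∀ x : Fin F → ℝ, ∑ f, x f • w f =
      WithLp.toLp 2 fun r => (∑ f, A r.1 r.2 f * x f) / M := by
    intro x
    ext r
    simp only [hw, WithLp.ofLp_sum, WithLp.ofLp_smul, Finset.sum_apply, Pi.smul_apply, smul_eq_mul,
      Finset.sum_div]
    exact Finset.sum_congr rfl fun f _ => by ring
  have hcombsq : ∀ x : Fin F → ℝ, ‖∑ f, x f • w f‖ ^ 2 =
      (∑ j : Part1 N M, ∑ z, (∑ f, A j z f * x f) ^ 2) / M ^ 2 := by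
    intro x
    rw [hcomb, EuclideanSpace.norm_sq_eq, Fintype.sum_prod_type, Finset.sum_div]
    refine Finset.sum_congr rfl fun j _ => ?_
    rw [Finset.sum_div]
    refine Finset.sum_congr rfl fun z _ => ?_
    simp only [Real.norm_eq_abs, sq_abs, div_pow]
  have hupper : ∀ x : Fin F → ℝ, ‖∑ f, x f • w f‖ ^ 2 ≤ (σ / M) ^ 2 * ∑ f, x f ^ 2 := by
    intro x
    rw [hcombsq, div_pow, div_mul_eq_mul_div]
    refine div_le_div_of_nonneg_right ?_ (by positivity)
    rw [hσ]
    exact sum_stackedFactor_mul_sq_le A x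
  have hlower : ∀ x : Fin F → ℝ, (s / M) ^ 2 * ∑ f, x f ^ 2 ≤ ‖∑ f, x f • w f‖ ^ 2 := by
    intro x
    rw [hcombsq, div_pow, div_mul_eq_mul_div]
    exact div_le_div_of_nonneg_right (sq_sigmaMin_mul_sum_sq_le A x) (by positivity)
  have hsingle : ∀ f, w f = ∑ g, (Pi.single f 1 : Fin F → ℝ) g • w g := by
    intro f
    rw [Finset.sum_eq_single f]
    · simp
    · intro g _ hg; rw [Pi.single_eq_of_ne hg, zero_smul]
    · simp
  set c₀ : ℝ := 1 / (864 * F) with hc₀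
  set τ := σ / M * (c₀ / κ ^ 3) with hτ
  have hτ0 : 0 < τ := by positivity
  have hντ : 4 * ν / M ≤ τ := by
    have h3 : ε / M ≤ 1 / (640 * κ ^ 3) := by
      rw [div_le_iff₀ (by linarith)]; linarith
    have h4 : 4 * noiseLevel F * (ε / M) ≤ c₀ / κ ^ 3 := by
      refine (mul_le_mul_of_nonneg_left h3 (by positivity)).trans ?_
      rw [hc₀, noiseLevel]
      have e1 : 4 * (1 / (6 * (F : ℝ))) * (1 / (640 * κ ^ 3)) = 1 / (960 * (F * κ ^ 3)) := by
        field_simp; norm_num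
      have e2 : 1 / (864 * (F : ℝ)) / κ ^ 3 = 1 / (864 * (F * κ ^ 3)) := by field_simp
      rw [e1, e2]
      have : 0 < (F : ℝ) * κ ^ 3 := by positivity
      apply one_div_le_one_div_of_le <;> linarith
    calc 4 * ν / M = σ / M * (4 * noiseLevel F * (ε / M)) := by rw [hν]; ring
      _ ≤ τ := mul_le_mul_of_nonneg_left h4 (by positivity)
  have hy : ∀ c, ‖euclCol (colNormalize (empVirtual M D)) c - ∑ f, h c f • w f‖ ≤ τ := by
    intro c
    refine le_trans ?_ hντ
    refine le_of_sq_le_sq ?_ (by positivity)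
    rw [hcomb, EuclideanSpace.norm_sq_eq, Fintype.sum_prod_type]
    have h2 := (hcol c).2.1
    rw [hcard] at h2
    refine le_trans (le_of_eq ?_) h2
    refine Finset.sum_congr rfl fun j _ => Finset.sum_congr rfl fun z _ => ?_
    have e1 : ∑ r : Part1 N M × Fin I, |empVirtual M D r c| =
        ∑ j : Part1 N M, ∑ z, empVirtual M D (j, z) c := by
      rw [Fintype.sum_prod_type]
      exact Finset.sum_congr rfl fun j _ => Finset.sum_congr rfl fun z _ => abs_of_nonneg (hX0 c j z)
    simp only [euclCol, colNormalize, Matrix.of_apply, PiLp.sub_apply, e1, Real.norm_eq_abs, sq_abs]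
  obtain ⟨π, hπ⟩ := exists_perm_of_successive_projection (w := w) (h := h)
    (y := euclCol (colNormalize (empVirtual M D))) (s := s / M) (K := σ / M) (ν := τ) (by positivity)
    hlower (fun f => by
      refine le_of_sq_le_sq ?_ (by positivity)
      rw [hsingle f]
      refine (hupper _).trans (le_of_eq ?_)
      rw [Finset.sum_eq_single f]
      · simp
      · intro g _ hg; rw [Pi.single_eq_of_ne hg]; simp
      · simp) h0 h1 hτ0.le (by
      apply le_of_eq
      rw [hτ, hc₀, ← hκs]
      field_simp) hy (fun f => by
      obtain ⟨c, hc⟩ := hnear f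
      refine ⟨c, ?_⟩
      have h2 : ‖∑ g, h c g • w g - w f‖ ≤ τ := by
        rw [hsingle f, ← Finset.sum_sub_distrib]
        simp only [← sub_smul]
        refine le_of_sq_le_sq ?_ hτ0.le
        refine (hupper _).trans ?_
        rw [hτ, mul_pow]
        refine mul_le_mul_of_nonneg_left ?_ (sq_nonneg _)
        refine (sum_sub_single_sq_le (h0 c) (h1 c) f).trans ?_
        have hf1 : h c f ≤ 1 :=
          h1 c ▸ Finset.single_le_sum (f := h c) (fun g _ => h0 c g) (Finset.mem_univ f)
        have h3 : (1 - h c f) ^ 2 ≤ nearLevel F κ ^ 2 :=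
          pow_le_pow_left₀ (by linarith) (by linarith) 2
        have h4 : nearLevel F κ = c₀ / κ ^ 3 / 2 := by rw [nearLevel, hc₀]; field_simp
        rw [h4, div_pow] at h3
        have : 0 ≤ (c₀ / κ ^ 3) ^ 2 := sq_nonneg _
        linarith
      calc _ = ‖(euclCol (colNormalize (empVirtual M D)) c - ∑ g, h c g • w g) +
            (∑ g, h c g • w g - w f)‖ := by rw [sub_add_sub_cancel]
        _ ≤ _ := (norm_add_le _ _).trans (by linarith [hy c])) Λ hΛ
  have hβ : 72 * (σ / M) * τ / (s / M) ^ 2 = 72 * c₀ / κ := by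
    rw [hτ, ← hκs]; field_simp
  refine hconcl Λ π (72 * c₀ / κ) (by positivity) (fun f => by rw [← hβ]; exact hπ f) ?_
  have h2 : 2 * σ * (72 * c₀ / κ) = σ * (1 / (6 * F * κ)) := by
    rw [hc₀]; field_simp; norm_num
  rw [h2]
  have h3 : 1 / (6 * F * κ) ≤ 999 * (κ ^ 2 * ε) := by
    have h4 : 1 / (648 * Real.sqrt F * κ ^ 3) ≤ ε :=
      (le_mul_of_one_le_left (by positivity) hM1).trans hεlow
    have h5 : κ ^ 2 * (1 / (648 * Real.sqrt F * κ ^ 3)) = 1 / (648 * (Real.sqrt F * κ)) := by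
      field_simp
    have h6 := mul_le_mul_of_nonneg_left h4 (sq_nonneg κ)
    rw [h5] at h6
    have h7 : 1 / (F * κ) ≤ 1 / (Real.sqrt F * κ) := by
      apply one_div_le_one_div_of_le (by positivity)
      refine mul_le_mul_of_nonneg_right ?_ hκ0.le
      nlinarith
    have e1 : 1 / (6 * F * κ) = 1 / 6 * (1 / (F * κ)) := by field_simp
    have e2 : 1 / (648 * (Real.sqrt F * κ)) = 1 / 648 * (1 / (Real.sqrt F * κ)) := by field_simp
    have h8 : 0 < 1 / (Real.sqrt F * κ) := by positivity
    rw [e1]; rw [e2] at h6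
    linarith
  calc σ * (1 / (6 * F * κ)) ≤ σ * (999 * (κ ^ 2 * ε)) := mul_le_mul_of_nonneg_left h3 hσ0.le
    _ = _ := by ring

end Recovery

/-! ### The stacked factor is rarely ill-conditioned -/

section IllConditioned

variable {N M I F : ℕ}

theorem sigmaMax_stackedFactor_le [NeZero F] (hMN : M ≤ N) {A : Fin N → Fin I → Fin F → ℝ}
    (hA : ∀ n, IsColStochastic (A n)) :
    sigmaMax (stackedFactor M A) ≤ Real.sqrt (M * F) := by
  refine (sigmaMax_le_frobenius _).trans (Real.sqrt_le_sqrt ?_)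
  rw [Fintype.sum_prod_type]
  have h1 : ∀ j : Part1 N M, ∑ z, ∑ f, stackedFactor M A (j, z) f ^ 2 ≤ F := by
    intro j
    rw [Finset.sum_comm]
    have h2 : ∀ f, ∑ z, stackedFactor M A (j, z) f ^ 2 ≤ 1 := by
      intro f
      refine (Finset.sum_sq_le_sq_sum_of_nonneg fun z _ => (hA j).1 z f).trans ?_
      rw [(hA j).2 f, one_pow]
    refine (Finset.sum_le_sum fun f _ => h2 f).trans ?_
    simp
  refine (Finset.sum_le_sum fun j _ => h1 j).trans ?_
  rw [Finset.sum_const, Finset.card_univ, card_part1 hMN, nsmul_eq_mul]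

theorem le_sigmaMax_stackedFactor [NeZero F] (hMN : M ≤ N) {A : Fin N → Fin I → Fin F → ℝ}
    (hA : ∀ n, IsColStochastic (A n)) :
    Real.sqrt (M * F / I) ≤ sigmaMax (stackedFactor M A) := by
  have hF : (0 : ℝ) < F := by exact_mod_cast NeZero.pos F
  refine Real.sqrt_le_iff.2 ⟨sigmaMax_nonneg _, ?_⟩
  have h1 := sum_stackedFactor_mul_sq_le (M := M) A fun _ => 1
  simp only [one_pow, mul_one, Finset.sum_const, Finset.card_univ, Fintype.card_fin,
    nsmul_eq_mul] at h1
  have h2 : ∀ j : Part1 N M, (F : ℝ) ^ 2 / I ≤ ∑ z, (∑ f, A j z f) ^ 2 := by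
    intro j
    have h3 := sq_sum_le_card_mul_sum_sq (s := Finset.univ) (f := fun z => ∑ f, A j z f)
    have h4 : ∑ z, ∑ f, A j z f = F := by
      rw [Finset.sum_comm]
      simp [(hA j).2]
    rw [h4, Finset.card_univ, Fintype.card_fin] at h3
    exact div_le_of_le_mul₀ (Nat.cast_nonneg _) (Finset.sum_nonneg fun _ _ => sq_nonneg _)
      (by linarith)
  have h3 := (Finset.sum_le_sum fun j (_ : j ∈ Finset.univ) => h2 j).trans h1
  rw [Finset.sum_const, Finset.card_univ, card_part1 hMN, nsmul_eq_mul] at h3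
  have h4 : (M : ℝ) * F / I * F = M * (F ^ 2 / I) := by ring
  rw [← h4] at h3
  exact le_of_mul_le_mul_right h3 hF

/-- The points of a grid in the unit cube. -/
noncomputable def gridPoint {n : ℕ} (k : Fin F → Fin (2 * n + 1)) (f : Fin F) : ℝ :=
  ((k f : ℝ) - n) / n

theorem exists_gridPoint {n : ℕ} (hn : 0 < n) {x : Fin F → ℝ} (hx : ∀ f, |x f| ≤ 1) :
    ∃ k : Fin F → Fin (2 * n + 1), ∀ f, |x f - gridPoint k f| ≤ 1 / n := by
  have hn0 : (0 : ℝ) < n := by exact_mod_cast hn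
  have h1 : ∀ f, ∃ k : Fin (2 * n + 1), |x f - ((k : ℝ) - n) / n| ≤ 1 / n := by
    intro f
    have h2 := abs_le.1 (hx f)
    have h3 : 0 ≤ (x f + 1) * n := mul_nonneg (by linarith) hn0.le
    refine ⟨⟨⌊(x f + 1) * n⌋₊, ?_⟩, ?_⟩
    · rw [Nat.floor_lt h3]
      push_cast
      nlinarith
    · have h4 := Nat.floor_le h3
      have h5 := Nat.lt_floor_add_one ((x f + 1) * n)
      have e : x f - ((⌊(x f + 1) * n⌋₊ : ℝ) - n) / n =
          ((x f + 1) * n - ⌊(x f + 1) * n⌋₊) / n := by field_simp; ring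
      simp only
      rw [e, abs_of_nonneg (div_nonneg (by linarith) hn0.le)]
      exact div_le_div_of_nonneg_right (by linarith) hn0.le
  choose k hk using h1
  exact ⟨k, hk⟩

/-- A lower bound for the smallest singular value from the values on a grid. -/
theorem le_sigmaMin_of_grid [NeZero F] {ρ : Type*} [Fintype ρ] (B : Matrix ρ (Fin F) ℝ) {n : ℕ}
    (hn : 2 * Real.sqrt F ≤ n) {b : ℝ}
    (hb : ∀ k : Fin F → Fin (2 * n + 1), 1 / 4 ≤ ∑ f, gridPoint k f ^ 2 →
      b ≤ ‖Matrix.toEuclideanLin B (WithLp.toLp 2 (gridPoint k))‖) :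
    b - sigmaMax B * (Real.sqrt F / n) ≤ sigmaMin B := by
  have hF : (0 : ℝ) < F := by exact_mod_cast NeZero.pos F
  have hsF : 0 < Real.sqrt F := Real.sqrt_pos.2 hF
  have hn0 : (0 : ℝ) < n := by linarith
  refine le_sigmaMin_of_forall B fun x hx => ?_
  have hx2 : ∑ f, x f ^ 2 = 1 := by
    have := EuclideanSpace.norm_sq_eq x
    rw [hx, one_pow] at this
    simpa using this.symm
  obtain ⟨k, hk⟩ := exists_gridPoint (n := n) (by exact_mod_cast hn0) (x := x) (fun f => by
    have : x f ^ 2 ≤ 1 := hx2 ▸ Finset.single_le_sum (f := fun f => x f ^ 2)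
      (fun f _ => sq_nonneg _) (Finset.mem_univ f)
    exact abs_le_one_iff_mul_self_le_one.2 (by linarith [sq (x f)]))
  set y : EuclideanSpace ℝ (Fin F) := WithLp.toLp 2 (gridPoint k)
  have hxy : ‖x - y‖ ≤ Real.sqrt F / n := by
    refine le_of_sq_le_sq ?_ (by positivity)
    rw [EuclideanSpace.norm_sq_eq, div_pow, Real.sq_sqrt hF.le]
    have : ∀ f, ‖(x - y) f‖ ^ 2 ≤ (1 / n) ^ 2 := fun f =>
      pow_le_pow_left₀ (norm_nonneg _) (hk f) 2
    refine (Finset.sum_le_sum fun f _ => this f).trans (le_of_eq ?_)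
    simp; ring
  have hy2 : 1 / 4 ≤ ∑ f, gridPoint k f ^ 2 := by
    have h1 : 1 / 2 ≤ ‖y‖ := by
      have h2 := norm_sub_norm_le x y
      have h3 : Real.sqrt F / n ≤ 1 / 2 := by rw [div_le_div_iff₀ hn0 two_pos]; linarith
      linarith
    have h2 := EuclideanSpace.norm_sq_eq y
    simp only [Real.norm_eq_abs, sq_abs] at h2
    have h3 : ∑ f, gridPoint k f ^ 2 = ‖y‖ ^ 2 := h2.symm
    rw [h3]; nlinarith
  have h1 := hb k hy2
  have h2 := norm_toEuclideanLin_le B (x - y)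
  rw [map_sub] at h2
  have h3 := norm_sub_norm_le (Matrix.toEuclideanLin B y) (Matrix.toEuclideanLin B x)
  rw [norm_sub_rev] at h3
  have h4 := mul_le_mul_of_nonneg_left hxy (sigmaMax_nonneg B)
  linarith

variable {Ω : Type*} [MeasurableSpace Ω] {P : Measure Ω} [IsProbabilityMeasure P]
  {A : Fin N → Ω → Fin I → Fin F → ℝ}

/-- The stacked factor is unlikely to contract a given vector. -/
theorem prob_image_small [NeZero F] (hMN : M ≤ N) (hAm : ∀ n, Measurable (A n))
    (hind : ProbabilityTheory.iIndepFun A P) (hlaw : ∀ n, IsScaledSimplexFactor P (A n))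
    {x : Fin F → ℝ} (hx : 1 / 4 ≤ ∑ f, x f ^ 2) {c : ℝ} (hc0 : 0 < c)
    (hc : c ≤ (radiusConst F / I) ^ 2 * (F ^ 2 / I)) :
    P.real {ω | ∑ j : Part1 N M, ∑ i, (∑ f, A j ω i f * x f) ^ 2 < M * c / 8} ≤ (3 / 4) ^ M := by
  classical
  set Y : Part1 N M → Ω → ℝ := fun j ω => ∑ i, (∑ f, A j ω i f * x f) ^ 2
  set φ : (Fin I → Fin F → ℝ) → ENNReal := fun a =>
    if ∑ i, (∑ f, a i f * x f) ^ 2 < c then 1 else ENNReal.ofReal (1 / 4) with hφ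
  have hφm : Measurable φ := by
    refine Measurable.ite ?_ measurable_const measurable_const
    exact measurableSet_lt (by fun_prop) measurable_const
  set X : Part1 N M → Ω → ENNReal := fun j ω => φ (A j ω) with hX
  have hXm : ∀ j, Measurable (X j) := fun j => hφm.comp (hAm j)
  have hXind : ProbabilityTheory.iIndepFun X P :=
    (hind.precomp Subtype.val_injective).comp _ fun _ => hφm
  have hE : ∀ j, ∫⁻ ω, X j ω ∂P ≤ ENNReal.ofReal (5 / 8) := by
    intro j
    set B := {ω | Y j ω < c}
    have hBm : MeasurableSet B := by
      have hm : Measurable fun a : Fin I → Fin F → ℝ => ∑ i, (∑ f, a i f * x f) ^ 2 := by fun_prop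
      exact measurableSet_lt (hm.comp (hAm j)) measurable_const
    have h1 : ∀ ω, X j ω = ENNReal.ofReal (1 / 4) +
        B.indicator (fun _ => ENNReal.ofReal (3 / 4)) ω := by
      intro ω
      by_cases hω : ω ∈ B
      · rw [Set.indicator_of_mem hω, ← ENNReal.ofReal_add (by norm_num) (by norm_num)]
        have : Y j ω < c := hω
        simp only [hX, hφ]
        rw [if_pos this]; norm_num
      · rw [Set.indicator_of_notMem hω, add_zero]
        have : ¬ Y j ω < c := hω
        simp only [hX, hφ]
        rw [if_neg this]
    simp only [h1]
    rw [lintegral_add_left measurable_const, lintegral_const, measure_univ, mul_one,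
      lintegral_indicator hBm, setLIntegral_const]
    have h2 : P B ≤ ENNReal.ofReal (1 / 2) := by
      have h3 := (hlaw j).prob_contraction_le hx
      rw [← ENNReal.ofReal_toReal (measure_ne_top P B)]
      refine ENNReal.ofReal_le_ofReal (le_trans (measureReal_mono fun ω hω => ?_) h3)
      exact lt_of_lt_of_le hω hc
    calc _ ≤ ENNReal.ofReal (1 / 4) + ENNReal.ofReal (3 / 4) * ENNReal.ofReal (1 / 2) := by gcongr
      _ = ENNReal.ofReal (5 / 8) := by
        rw [← ENNReal.ofReal_mul (by norm_num), ← ENNReal.ofReal_add (by norm_num) (by norm_num)]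
        norm_num
  have hprod : ∫⁻ ω, ∏ j, X j ω ∂P ≤ ENNReal.ofReal ((5 / 8) ^ M) := by
    rw [ProbabilityTheory.lintegral_prod_eq_prod_lintegral_of_indepFun Finset.univ X hXind hXm]
    refine (Finset.prod_le_pow_card _ _ _ fun j _ => hE j).trans (le_of_eq ?_)
    rw [Finset.card_univ, card_part1 hMN, ENNReal.ofReal_pow (by norm_num)]
  -- on the event, at most `M / 8` of the blocks are large
  have hev : ∀ ω, ∑ j, Y j ω < M * c / 8 → ENNReal.ofReal ((5 / 6) ^ M) ≤ ∏ j, X j ω := by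
    intro ω hω
    set L := Finset.univ.filter fun j => ¬ Y j ω < c
    have h1 : (L.card : ℝ) * c ≤ ∑ j, Y j ω := by
      rw [← nsmul_eq_mul]
      refine (Finset.card_nsmul_le_sum L (fun j => Y j ω) c fun j hj => ?_).trans
        (Finset.sum_le_sum_of_subset_of_nonneg (Finset.filter_subset _ _) fun j _ _ =>
          Finset.sum_nonneg fun i _ => sq_nonneg _)
      exact not_lt.1 (Finset.mem_filter.1 hj).2
    have h2 : 8 * L.card ≤ M := by
      have h3 : (8 * L.card : ℝ) * c ≤ M * c := by linarith
      exact_mod_cast le_of_mul_le_mul_right h3 hc0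
    have h3 : ∏ j, X j ω = ENNReal.ofReal ((1 / 4) ^ L.card) := by
      simp only [hX, hφ]
      rw [Finset.prod_ite, Finset.prod_const_one, one_mul, Finset.prod_const,
        ENNReal.ofReal_pow (by norm_num)]
    rw [h3]
    refine ENNReal.ofReal_le_ofReal ?_
    calc ((5 : ℝ) / 6) ^ M ≤ (5 / 6) ^ (8 * L.card) :=
          pow_le_pow_of_le_one (by norm_num) (by norm_num) h2
      _ = ((5 / 6) ^ 8) ^ L.card := pow_mul _ _ _
      _ ≤ (1 / 4) ^ L.card := pow_le_pow_left₀ (by norm_num) (by norm_num) _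
  have hmarkov := mul_meas_ge_le_lintegral (μ := P)
    (Finset.measurable_prod Finset.univ fun j _ => hXm j) (ENNReal.ofReal ((5 / 6) ^ M))
  have h1 : ENNReal.ofReal ((5 / 6) ^ M) * P {ω | ∑ j, Y j ω < M * c / 8} ≤
      ENNReal.ofReal ((5 / 8) ^ M) := by
    refine le_trans (mul_le_mul_right (measure_mono fun ω hω => hev ω hω) _) (hmarkov.trans hprod)
  rw [← ENNReal.ofReal_toReal (measure_ne_top P _), ← ENNReal.ofReal_mul (by positivity),
    ENNReal.ofReal_le_ofReal_iff (by positivity)] at h1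
  change P.real {ω | ∑ j, Y j ω < M * c / 8} ≤ _
  have h2 : ((5 : ℝ) / 8) ^ M = (5 / 6) ^ M * (3 / 4) ^ M := by rw [← mul_pow]; norm_num
  rw [h2] at h1
  exact le_of_mul_le_mul_left h1 (by positivity)

/-- The smallest singular value of the stacked factor is rarely small. -/
theorem prob_sigmaMin_small [NeZero F] (hMN : M ≤ N) (hAm : ∀ n, Measurable (A n))
    (hind : ProbabilityTheory.iIndepFun A P) (hlaw : ∀ n, IsScaledSimplexFactor P (A n))
    {c : ℝ} (hc0 : 0 < c) (hc : c ≤ (radiusConst F / I) ^ 2 * (F ^ 2 / I)) {n : ℕ}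
    (hn : 2 * Real.sqrt F ≤ n) (hnc : 32 * F ^ 2 ≤ c * n ^ 2) :
    P.real {ω | sigmaMin (stackedFactor M fun n => A n ω) < Real.sqrt (M * c / 32)} ≤
      (2 * n + 1) ^ F * (3 / 4) ^ M := by
  classical
  have hF : (0 : ℝ) < F := by exact_mod_cast NeZero.pos F
  have hn0 : (0 : ℝ) < n := by have := Real.sqrt_pos.2 hF; linarith
  set E : (Fin F → Fin (2 * n + 1)) → Set Ω := fun k =>
    {ω | 1 / 4 ≤ ∑ f, gridPoint k f ^ 2 ∧
      ∑ j : Part1 N M, ∑ i, (∑ f, A j ω i f * gridPoint k f) ^ 2 < M * c / 8}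
  have hEk : ∀ k, P.real (E k) ≤ (3 / 4) ^ M := by
    intro k
    by_cases hk : 1 / 4 ≤ ∑ f, gridPoint k f ^ 2
    · exact (measureReal_mono fun ω hω => hω.2).trans
        (prob_image_small hMN hAm hind hlaw hk hc0 hc)
    · have : E k = ∅ := Set.eq_empty_of_forall_notMem fun ω hω => hk hω.1
      rw [this, measureReal_empty]; positivity
  have hcol : ∀ᵐ ω ∂P, ∀ n, IsColStochastic (A n ω) :=
    ae_all_iff.2 fun n => (hlaw n).ae_isColStochastic
  have hcov : P.real {ω | sigmaMin (stackedFactor M fun n => A n ω) < Real.sqrt (M * c / 32)} ≤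
      P.real (⋃ k, E k) := by
    refine real_mono_ae ?_
    filter_upwards [hcol] with ω hω hsmall
    by_contra hcon
    simp only [Set.mem_iUnion, not_exists] at hcon
    refine absurd hsmall (not_lt.2 ?_)
    have h1 := le_sigmaMin_of_grid (stackedFactor M fun n => A n ω) hn
      (b := Real.sqrt (M * c / 8)) (fun k hk => by
        refine Real.sqrt_le_iff.2 ⟨norm_nonneg _, ?_⟩
        rw [norm_toEuclideanLin_sq, Fintype.sum_prod_type]
        by_contra hlt
        exact hcon k ⟨hk, not_le.1 hlt⟩)
    have h2 := sigmaMax_stackedFactor_le hMN hω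
    have h3 : Real.sqrt (M * F) * (Real.sqrt F / n) ≤ Real.sqrt (M * c / 32) := by
      refine Real.le_sqrt_of_sq_le ?_
      rw [mul_pow, div_pow, Real.sq_sqrt (by positivity), Real.sq_sqrt hF.le, mul_div_assoc',
        div_le_div_iff₀ (by positivity) (by norm_num)]
      have := mul_le_mul_of_nonneg_left hnc (Nat.cast_nonneg (α := ℝ) M)
      linarith
    have h4 : Real.sqrt (M * c / 8) = 2 * Real.sqrt (M * c / 32) := by
      rw [show (M : ℝ) * c / 8 = 2 ^ 2 * (M * c / 32) by ring, Real.sqrt_mul (by norm_num),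
        Real.sqrt_sq (by norm_num)]
    have h5 := mul_le_mul_of_nonneg_right h2 (show 0 ≤ Real.sqrt F / n by positivity)
    linarith
  refine hcov.trans ((measureReal_iUnion_fintype_le _).trans ((Finset.sum_le_sum fun k _ =>
    hEk k).trans (le_of_eq ?_)))
  simp

end IllConditioned

section IllConditioned

variable {N M I F S : ℕ}

theorem one_le_condNumber {ρ γ : Type*} [Fintype ρ] [Fintype γ] [DecidableEq γ]
    {B : Matrix ρ γ ℝ} (hB : 0 < sigmaMin B) : 1 ≤ condNumber B := by
  unfold condNumber
  rw [le_div_iff₀ hB, one_mul]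
  exact sigmaMin_le_sigmaMax B

/-- `σ_max ε` in terms of the smallest singular value. -/
theorem sigmaMax_mul_sepEps {ρ : Type*} [Fintype ρ] {B : Matrix ρ (Fin F) ℝ}
    (hB : 0 < sigmaMin B) : sigmaMax B * sepEps F M (condNumber B) =
      M * sepFactor F * sigmaMin B / (2 * (1 + 80 * condNumber B ^ 2)) := by
  have h1 := one_le_condNumber hB
  have h2 : sigmaMax B = condNumber B * sigmaMin B := (div_mul_cancel₀ _ hB.ne').symm
  rw [sepEps_eq, h2]
  set κ := condNumber B
  field_simp

theorem sepEps_pos (hF : 2 ≤ F) (hM : 0 < M) {κ : ℝ} (hκ : 0 < κ) : 0 < sepEps F M κ := by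
  have := sepFactor_pos hF
  have : (0 : ℝ) < M := by exact_mod_cast hM
  rw [sepEps_eq]; positivity

theorem spaDenominator_mono {x y : ℝ} (hx : 0 ≤ x) (hxy : x ≤ y) :
    1 + 80 * x ^ 2 ≤ 1 + 80 * y ^ 2 := by
  have := pow_le_pow_left₀ hx hxy 2
  linarith

theorem sepEps_antitone (hF : 2 ≤ F) {x y : ℝ} (hx : 0 < x) (hxy : x ≤ y) :
    sepEps F M y ≤ sepEps F M x := by
  have hθ := sepFactor_pos hF
  have hy : 0 < y := hx.trans_le hxy
  rw [sepEps_eq, sepEps_eq]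
  refine mul_le_mul_of_nonneg_left ?_ (Nat.cast_nonneg M)
  exact div_le_div_of_nonneg_left hθ.le (by positivity)
    (mul_le_mul (by linarith) (spaDenominator_mono hx.le hxy) (by positivity) (by positivity))

/-- The size requirements hold for all factors whose smallest singular value is larger by a factor
`√I` than that of some factor which satisfies them: the condition number is then smaller. -/
theorem sizeConditions_mono [NeZero F] (hF : 2 ≤ F) (hM : 0 < M) (hMN : M ≤ N) (hI : 0 < I)
    {CS CN p δ η : ℝ} (hCS : 0 ≤ CS) (hCN : 0 ≤ CN) (hp : 0 < p) (hδ : 0 < δ) (hδ1 : δ ≤ 1)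
    (hη : 0 < η) {A B : Fin N → Fin I → Fin F → ℝ}
    (hA : ∀ n, IsColStochastic (A n)) (hB : ∀ n, IsColStochastic (B n))
    (hAB : Real.sqrt I * sigmaMin (stackedFactor M A) ≤ sigmaMin (stackedFactor M B))
    (h : SizeConditions CS CN N M I S p δ η (stackedFactor M A)) :
    SizeConditions CS CN N M I S p δ η (stackedFactor M B) := by
  have hI1 : (1 : ℝ) ≤ I := by exact_mod_cast hI
  have hF0 : (1 : ℝ) ≤ F := by exact_mod_cast NeZero.pos F
  have hsI : 1 ≤ Real.sqrt I := Real.one_le_sqrt.2 hI1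
  obtain ⟨hs, h1, h2⟩ := h
  set sA := sigmaMin (stackedFactor M A)
  set sB := sigmaMin (stackedFactor M B)
  have hsAB : sA ≤ sB := le_trans (le_mul_of_one_le_left hs.le hsI) hAB
  have hs' : 0 < sB := hs.trans_le hsAB
  have hκB1 := one_le_condNumber (B := stackedFactor M B) hs'
  have hκ : condNumber (stackedFactor M B) ≤ condNumber (stackedFactor M A) := by
    have h3 := sigmaMax_stackedFactor_le hMN hB
    have h4 := le_sigmaMax_stackedFactor hMN hA
    unfold condNumber
    rw [div_le_div_iff₀ hs' hs]
    have h5 : Real.sqrt (M * F) = Real.sqrt (M * F / I) * Real.sqrt I := by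
      rw [← Real.sqrt_mul (by positivity)]
      congr 1; field_simp
    calc sigmaMax (stackedFactor M B) * sA ≤ Real.sqrt (M * F / I) * Real.sqrt I * sA := by
          rw [← h5]; exact mul_le_mul_of_nonneg_right h3 hs.le
      _ = Real.sqrt (M * F / I) * (Real.sqrt I * sA) := by ring
      _ ≤ sigmaMax (stackedFactor M A) * sB :=
          mul_le_mul h4 hAB (by positivity) (sigmaMax_nonneg _)
  set κA := condNumber (stackedFactor M A)
  set κB := condNumber (stackedFactor M B)
  have hθ := sepFactor_pos hF
  have hε : sepEps F M κA ≤ sepEps F M κB :=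
    sepEps_antitone hF (by linarith) hκ
  have hεA := sepEps_pos hF hM (show 0 < κA by linarith)
  have hσε : sigmaMax (stackedFactor M A) * sepEps F M κA ≤
      sigmaMax (stackedFactor M B) * sepEps F M κB := by
    rw [sigmaMax_mul_sepEps hs, sigmaMax_mul_sepEps hs']
    refine div_le_div₀ (by positivity) (mul_le_mul_of_nonneg_left hsAB (by positivity))
      (by positivity) ?_
    exact mul_le_mul_of_nonneg_left (spaDenominator_mono (by linarith) hκ) zero_le_two
  have hσA : 0 < sigmaMax (stackedFactor M A) := hs.trans_le (sigmaMin_le_sigmaMax _)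
  have hL : 0 ≤ Real.log (1 / δ) := Real.log_nonneg (by rw [le_div_iff₀ hδ]; linarith)
  refine ⟨hs', le_trans (mul_le_mul_of_nonneg_left ?_ hCS) h1,
    le_trans (add_le_add le_rfl (mul_le_mul_of_nonneg_left ?_ hCN)) h2⟩
  · refine div_le_div_of_nonneg_left (by positivity) (by positivity) ?_
    have h3 := pow_le_pow_left₀ (by positivity) hσε 2
    calc _ = (sigmaMax (stackedFactor M A) * sepEps F M κA) ^ 2 * (η ^ 2 * p ^ 2) := by ring
      _ ≤ (sigmaMax (stackedFactor M B) * sepEps F M κB) ^ 2 * (η ^ 2 * p ^ 2) :=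
          mul_le_mul_of_nonneg_right h3 (by positivity)
      _ = _ := by ring
  · have h3 : 1 / sepEps F M κB ≤ 1 / sepEps F M κA := one_div_le_one_div_of_le hεA hε
    have h4 : 0 ≤ 1 / sepEps F M κB := one_div_nonneg.2 (hεA.le.trans hε)
    have h5 : (1 / sepEps F M κB) ^ (2 * (F - 1)) ≤ (1 / sepEps F M κA) ^ (2 * (F - 1)) :=
      pow_le_pow_left₀ h4 h3 _
    have h6 : 0 ≤ (I * F : ℝ) := by positivity
    refine mul_le_mul_of_nonneg_right (div_le_div_of_nonneg_right h5 h6) (Real.log_nonneg ?_)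
    rw [le_div_iff₀ hδ]; linarith

variable {Ω : Type*} [MeasurableSpace Ω] {P : Measure Ω} [IsProbabilityMeasure P]
  {A : Fin N → Ω → Fin I → Fin F → ℝ}

set_option maxHeartbeats 1000000 in
/-- With many blocks, the smallest singular value of the stacked factor is hardly ever as small as
`2 √(F I) / M`. -/
theorem exists_prob_sigmaMin_le (F : ℕ) [NeZero F] : ∃ K : ℝ, 1 ≤ K ∧
    ∀ {Ω : Type*} [MeasurableSpace Ω] {P : Measure Ω} [IsProbabilityMeasure P] {N M I : ℕ}
      {A : Fin N → Ω → Fin I → Fin F → ℝ} {δ : ℝ}, M ≤ N → 0 < I → 0 < δ → δ ≤ 1 / 2 →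
      (∀ n, Measurable (A n)) → ProbabilityTheory.iIndepFun A P →
      (∀ n, IsScaledSimplexFactor P (A n)) → K * (I * Real.sqrt I * Real.log (1 / δ)) ≤ M →
      P.real {ω | sigmaMin (stackedFactor M fun n => A n ω) <
        Real.sqrt I * (2 * Real.sqrt F / M)} ≤ δ / 2 := by
  set r := radiusConst F
  have hr0 : 0 < r := radiusConst_pos
  have hF : (1 : ℝ) ≤ F := by exact_mod_cast NeZero.pos F
  obtain ⟨q, hq⟩ := exists_nat_ge (max (2 * (F : ℝ)) (6 / r))
  have hq1 : 2 * (F : ℝ) ≤ q := (le_max_left _ _).trans hq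
  have hq2 : 6 ≤ q * r := by
    have := (le_max_right _ _).trans hq
    rwa [div_le_iff₀ hr0] at this
  set K : ℝ := (24 * q + 16) * F + 1024 + 1 / r
  have hK1 : 1024 ≤ K := by
    have : 0 ≤ (24 * (q : ℝ) + 16) * F + 1 / r := by positivity
    linarith
  have hKr : 1 ≤ K * r := by
    have h1 : 1 / r ≤ K := by
      have : 0 ≤ (24 * (q : ℝ) + 16) * F + 1024 := by positivity
      linarith
    rwa [div_le_iff₀ hr0] at h1
  refine ⟨K, by linarith, ?_⟩
  intro Ω _ P _ N M I A δ hMN hI hδ0 hδ hAm hind hlaw hKM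
  have hI1 : (1 : ℝ) ≤ I := by exact_mod_cast hI
  set L := Real.log (1 / δ) with hL
  have hL1 : 1 / 2 ≤ L := by
    have h1 : Real.log 2 ≤ L := Real.log_le_log two_pos (by rw [le_div_iff₀ hδ0]; linarith)
    have := Real.log_two_gt_d9
    linarith
  have hsI : 1 ≤ Real.sqrt I := Real.one_le_sqrt.2 hI1
  have hsI2 : Real.sqrt I ^ 2 = I := Real.sq_sqrt (by positivity)
  have hI2 : (1 : ℝ) ≤ I ^ 2 := one_le_pow₀ hI1
  have hM : K * (I * Real.sqrt I) / 2 ≤ M := by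
    refine le_trans ?_ hKM
    have := mul_le_mul_of_nonneg_left hL1 (show 0 ≤ K * (I * Real.sqrt I) by positivity)
    linarith
  have hM0 : (0 : ℝ) < M := lt_of_lt_of_le (by positivity) hM
  set c := (r / I) ^ 2 * (F ^ 2 / I) with hc
  have hc0 : 0 < c := by positivity
  set n := q * I ^ 2 with hn
  have hncast : (n : ℝ) = q * I ^ 2 := by rw [hn]; push_cast; ring
  have hsF : Real.sqrt F ≤ F := Real.sqrt_le_iff.2 ⟨by linarith, by nlinarith⟩
  have hn1 : 2 * Real.sqrt F ≤ n := by
    rw [hncast]; nlinarith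
  have hnc : 32 * (F : ℝ) ^ 2 ≤ c * n ^ 2 := by
    have e : c * n ^ 2 = (q * r) ^ 2 * F ^ 2 * I := by rw [hc, hncast]; field_simp
    rw [e]
    have h1 : (36 : ℝ) ≤ (q * r) ^ 2 := by nlinarith
    have h2 : 0 < (F : ℝ) ^ 2 := by positivity
    nlinarith [mul_le_mul h1 hI1 zero_le_one (by positivity)]
  have h1 := prob_sigmaMin_small hMN hAm hind hlaw hc0 (le_of_eq hc) hn1 hnc
  have hsub : Real.sqrt I * (2 * Real.sqrt F / M) ≤ Real.sqrt (M * c / 32) := by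
    refine Real.le_sqrt_of_sq_le ?_
    rw [mul_pow, div_pow, mul_pow, Real.sq_sqrt (by positivity), Real.sq_sqrt (by positivity),
      mul_div_assoc', div_le_div_iff₀ (by positivity) (by norm_num)]
    have h2 : (K * (I * Real.sqrt I) / 2) ^ 3 ≤ (M : ℝ) ^ 3 := pow_le_pow_left₀ (by positivity) hM 3
    have h3 : M * c * M ^ 2 = (M : ℝ) ^ 3 * c := by ring
    rw [h3]
    refine le_trans ?_ (mul_le_mul_of_nonneg_right h2 hc0.le)
    have e : (K * (I * Real.sqrt I) / 2) ^ 3 * c =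
        K * (K * r) ^ 2 * (F ^ 2 * (I * Real.sqrt I)) / 8 := by
      have e' : (K * (I * Real.sqrt I) / 2) ^ 3 * c =
          K ^ 3 * I ^ 3 * (Real.sqrt I ^ 2 * Real.sqrt I) / 8 * c := by ring
      rw [e', hsI2, hc]; field_simp
    rw [e]
    have h4 : (1024 : ℝ) ≤ K * (K * r) ^ 2 := by
      have : (1 : ℝ) ≤ (K * r) ^ 2 := one_le_pow₀ hKr
      exact hK1.trans (le_mul_of_one_le_right (by linarith) this)
    have h5 : (F : ℝ) * I ≤ F ^ 2 * (I * Real.sqrt I) := by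
      have h6 : (F : ℝ) ≤ F ^ 2 := le_self_pow₀ hF two_ne_zero
      have h7 : (I : ℝ) ≤ I * Real.sqrt I := le_mul_of_one_le_right (by positivity) hsI
      exact mul_le_mul h6 h7 (by positivity) (by positivity)
    have h6 := mul_le_mul h4 h5 (by positivity) (by positivity)
    linarith
  refine le_trans (measureReal_mono fun ω (hω : sigmaMin _ < _) => lt_of_lt_of_le hω hsub)
    (h1.trans ?_)
  · have h2 : ((2 * n + 1 : ℝ)) ≤ Real.exp ((3 * q + 2) * I) := by
      have hq0 : (1 : ℝ) ≤ q := by linarith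
      have h3 : 3 * (q : ℝ) ≤ Real.exp (3 * q) := by
        have := Real.add_one_le_exp (3 * (q : ℝ)); linarith
      have h4 : (I : ℝ) ^ 2 ≤ Real.exp I ^ 2 := by
        have := Real.add_one_le_exp (I : ℝ)
        exact pow_le_pow_left₀ (by positivity) (by linarith) 2
      have h5 : (2 * n + 1 : ℝ) ≤ 3 * q * I ^ 2 := by
        rw [hncast]
        have := mul_le_mul hq0 hI2 zero_le_one (by positivity)
        linarith
      refine h5.trans ((mul_le_mul h3 h4 (by positivity) (by positivity)).trans ?_)
      rw [← Real.exp_nat_mul, ← Real.exp_add]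
      apply Real.exp_le_exp.2
      have := mul_le_mul_of_nonneg_left hI1 (show (0 : ℝ) ≤ 3 * q by positivity)
      push_cast
      linarith
    have h3 : (3 / 4 : ℝ) ≤ Real.exp (-(1 / 4)) := by
      have := Real.add_one_le_exp (-(1 / 4 : ℝ)); linarith
    have h4 : δ / 2 = Real.exp (-L - Real.log 2) := by
      rw [Real.exp_sub, Real.exp_log two_pos, hL, one_div, Real.log_inv, neg_neg, Real.exp_log hδ0]
    rw [h4]
    calc (2 * (n : ℝ) + 1) ^ F * (3 / 4) ^ M ≤
          Real.exp ((3 * q + 2) * I) ^ F * Real.exp (-(1 / 4)) ^ M := by gcongr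
      _ = Real.exp (F * ((3 * q + 2) * I) - M / 4) := by
          rw [← Real.exp_nat_mul, ← Real.exp_nat_mul, ← Real.exp_add]; congr 1; ring
      _ ≤ Real.exp (-L - Real.log 2) := by
          apply Real.exp_le_exp.2
          have h5 : Real.log 2 ≤ 1 := by have := Real.log_two_lt_d9; linarith
          have h6 : ((24 * q + 16) * F + 1024) * (I * L) ≤ M := by
            have h9 : I * L ≤ I * Real.sqrt I * L := by
              have := le_mul_of_one_le_right (show (0 : ℝ) ≤ I * L by positivity) hsI
              linarith
            refine le_trans (mul_le_mul ?_ h9 (by positivity) (by linarith)) hKM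
            have : 0 < 1 / r := by positivity
            linarith
          have h7 : (F : ℝ) * ((3 * q + 2) * I) * (1 / 2) ≤ F * ((3 * q + 2) * I) * L :=
            mul_le_mul_of_nonneg_left hL1 (by positivity)
          have h8 : L ≤ I * L := le_mul_of_one_le_left (by linarith) hI1
          linarith

/-- The factors that satisfy the size requirements are rarely ill-conditioned. -/
theorem prob_size_and_sigmaMin_le [NeZero F] (hF : 2 ≤ F) (hM : 0 < M) (hMN : M ≤ N) (hI : 1 < I)
    {CS CN p δ η : ℝ} (hCS : 0 ≤ CS) (hCN : 0 ≤ CN) (hp : 0 < p) (hδ : 0 < δ) (hδ1 : δ ≤ 1 / 2)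
    (hη : 0 < η) (hlaw : ∀ n, IsScaledSimplexFactor P (A n)) {s₀ : ℝ} (hs₀ : 0 < s₀)
    (hsmall : P.real {ω | sigmaMin (stackedFactor M fun n => A n ω) < Real.sqrt I * s₀} ≤ δ / 2) :
    P {ω | SizeConditions CS CN N M I S p δ η (stackedFactor M fun n => A n ω) ∧
      sigmaMin (stackedFactor M fun n => A n ω) ≤ s₀} ≤
    ENNReal.ofReal δ *
      P {ω | SizeConditions CS CN N M I S p δ η (stackedFactor M fun n => A n ω)} := by
  have hcol : ∀ᵐ ω ∂P, ∀ n, IsColStochastic (A n ω) :=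
    ae_all_iff.2 fun n => (hlaw n).ae_isColStochastic
  set Z := {ω | SizeConditions CS CN N M I S p δ η (stackedFactor M fun n => A n ω)}
  by_cases hex : ∃ ω₀, (∀ n, IsColStochastic (A n ω₀)) ∧ ω₀ ∈ Z ∧
      sigmaMin (stackedFactor M fun n => A n ω₀) ≤ s₀
  · obtain ⟨ω₀, hω₀, hZ₀, hs⟩ := hex
    set B := {ω | sigmaMin (stackedFactor M fun n => A n ω) < Real.sqrt I * s₀}
    have h1 : P.real Z ≥ 1 / 2 := by
      have h2 : P.real Set.univ ≤ P.real (Z ∪ B) := by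
        refine real_mono_ae ?_
        filter_upwards [hcol] with ω hω _
        by_cases hωB : ω ∈ B
        · exact Or.inr hωB
        · left
          have h3 : Real.sqrt I * s₀ ≤ sigmaMin (stackedFactor M fun n => A n ω) := not_lt.1 hωB
          exact sizeConditions_mono hF hM hMN (by omega) hCS hCN hp hδ (by linarith) hη hω₀ hω
            ((mul_le_mul_of_nonneg_left hs (Real.sqrt_nonneg _)).trans h3) hZ₀
      have h3 := measureReal_union_le (μ := P) Z B
      rw [probReal_univ] at h2
      linarith
    have h2 : P.real {ω | ω ∈ Z ∧ sigmaMin (stackedFactor M fun n => A n ω) ≤ s₀} ≤ P.real B := by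
      refine measureReal_mono fun ω hω => ?_
      refine lt_of_le_of_lt hω.2 ?_
      have h3 : 1 < Real.sqrt I := by
        rw [Real.lt_sqrt zero_le_one, one_pow]; exact_mod_cast hI
      exact lt_mul_of_one_lt_left hs₀ h3
    have h3 : P.real {ω | ω ∈ Z ∧ sigmaMin (stackedFactor M fun n => A n ω) ≤ s₀} ≤
        δ * P.real Z := by nlinarith
    change P {ω | ω ∈ Z ∧ sigmaMin (stackedFactor M fun n => A n ω) ≤ s₀} ≤ _
    rw [← ENNReal.ofReal_toReal (measure_ne_top P Z), ← ENNReal.ofReal_mul hδ.le,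
      ← ENNReal.ofReal_toReal (measure_ne_top P {ω | ω ∈ Z ∧ _})]
    exact ENNReal.ofReal_le_ofReal h3
  · refine le_trans (le_of_eq ?_) zero_le
    rw [measure_eq_zero_iff_ae_notMem]
    filter_upwards [hcol] with ω hω hωs
    exact hex ⟨ω, hω, hωs.1, hωs.2⟩

end IllConditioned

/-! ### Recovery from records with typical counts -/

section Records

variable {N M I F S : ℕ}

/-- The data that the algorithm sees, from the values and observation indicators `d n s` of all
variables `n` in all samples `s`. -/
def recordSamples (d : Fin N → Fin S → Fin I × Bool) : Fin S → Fin N → Option (Fin I) :=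
  fun s n => if (d n s).2 = true then some (d n s).1 else none

theorem empMarginal_recordSamples (d : Fin N → Fin S → Fin I × Bool) (j k : Fin N) (z q : Fin I) :
    empMarginal (recordSamples d) j k z q = cellCount (d j) (d k) z q / pairCount (d j) (d k) := by
  have hsome : ∀ (s : Fin S) (n : Fin N) (i : Fin I),
      recordSamples d s n = some i ↔ d n s = (i, true) := by
    intro s n i
    rcases hd : d n s with ⟨i', v⟩
    cases v <;> simp [recordSamples, hd]
  have hnone : ∀ (s : Fin S) (n : Fin N), recordSamples d s n ≠ none ↔ (d n s).2 = true := by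
    intro s n
    rcases hd : d n s with ⟨i', v⟩
    cases v <;> simp [recordSamples, hd]
  unfold empMarginal cellCount pairCount levelSet viewSet
  simp only [Matrix.of_apply, hsome, hnone, Finset.filter_filter]
  congr 3
  all_goals simp only [and_comm]

theorem sum_cellCount (d d' : Fin S → Fin I × Bool) (q : Fin I) :
    ∑ z, cellCount d d' z q = ((levelSet d' q).filter fun s => (d s).2 = true).card := by
  unfold cellCount
  rw [Finset.card_eq_sum_card_fiberwise (f := fun s => (d s).1) (t := Finset.univ)
    fun _ _ => Finset.mem_coe.2 (Finset.mem_univ _)]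
  refine Finset.sum_congr rfl fun z _ => ?_
  rw [Finset.filter_filter]
  refine congrArg _ (Finset.filter_congr fun s _ => ?_)
  rw [Prod.ext_iff]
  exact and_comm

/-- What the mass condition says about the counts. -/
theorem MassAtLeast.counts {η : ℝ} (hη : 0 < η) {d : Fin N → Fin S → Fin I × Bool}
    (h : MassAtLeast M η (recordSamples d)) (j : Part1 N M) (k : Part2 N M) (q : Fin I) :
    0 < pairCount (d j) (d k) ∧ η * pairCount (d j) (d k) ≤
      ((levelSet (d k) q).filter fun s => (d j s).2 = true).card := by
  have h1 := h j k q
  have h2 : ∑ a, |empMarginal (recordSamples d) j k a q| =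
      (((levelSet (d k) q).filter fun s => (d j s).2 = true).card : ℝ) /
        pairCount (d j) (d k) := by
    rw [← sum_cellCount]
    push_cast
    rw [Finset.sum_div]
    refine Finset.sum_congr rfl fun z _ => ?_
    rw [abs_of_nonneg (empMarginal_nonneg _ _ _ _ _), empMarginal_recordSamples]
  rw [h2] at h1
  have h3 : 0 < pairCount (d j) (d k) := by
    rcases Nat.eq_zero_or_pos (pairCount (d j) (d k)) with h0 | h0
    · rw [h0, Nat.cast_zero, div_zero] at h1; linarith
    · exact h0
  exact ⟨h3, (le_div_iff₀ (by exact_mod_cast h3)).1 h1⟩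

/-- Frequency of the latent value `f` among the samples in which a variable is observed with
value `q`; a unit vector if there are none. -/
noncomputable def latentFrequency [NeZero F] (h : Fin S → Fin F) (d : Fin S → Fin I × Bool)
    (q : Fin I) (f : Fin F) : ℝ :=
  if (levelSet d q).card = 0 then (Pi.single 0 1 : Fin F → ℝ) f else
    ((levelSet d q).filter fun s => h s = f).card / (levelSet d q).card

theorem latentFrequency_nonneg [NeZero F] (h : Fin S → Fin F) (d : Fin S → Fin I × Bool)
    (q : Fin I) (f : Fin F) : 0 ≤ latentFrequency h d q f := by
  unfold latentFrequency
  split_ifs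
  · rw [Pi.single_apply]; split_ifs <;> norm_num
  · positivity

theorem card_mul_sum_latentFrequency [NeZero F] (h : Fin S → Fin F) (d : Fin S → Fin I × Bool)
    (q : Fin I) (c : Fin F → ℝ) :
    (levelSet d q).card * ∑ f, c f * latentFrequency h d q f = ∑ s ∈ levelSet d q, c (h s) := by
  unfold latentFrequency
  split_ifs with h0
  · rw [h0, Finset.card_eq_zero.1 h0]; simp
  · have h1 : ((levelSet d q).card : ℝ) ≠ 0 := by exact_mod_cast h0
    rw [← Finset.sum_fiberwise (levelSet d q) h, Finset.mul_sum]
    refine Finset.sum_congr rfl fun f _ => ?_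
    rw [Finset.sum_congr rfl (g := fun _ => c f) fun s hs => by rw [(Finset.mem_filter.1 hs).2],
      Finset.sum_const, nsmul_eq_mul]
    field_simp

theorem sum_latentFrequency [NeZero F] (h : Fin S → Fin F) (d : Fin S → Fin I × Bool)
    (q : Fin I) : ∑ f, latentFrequency h d q f = 1 := by
  by_cases h0 : (levelSet d q).card = 0
  · unfold latentFrequency
    simp [h0]
  · have h1 : ((levelSet d q).card : ℝ) ≠ 0 := by exact_mod_cast h0
    have h2 := card_mul_sum_latentFrequency h d q fun _ => 1
    simp only [one_mul, Finset.sum_const, nsmul_eq_mul, mul_one] at h2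
    exact mul_left_cancel₀ h1 (by rw [h2, mul_one])

/-- **Recovery from typical records.** If all counts are as large as expected and the noise in
the columns is not larger than expected, then the algorithm succeeds. -/
theorem spaErrorAtMost_of_records [NeZero F] (hF : 2 ≤ F) (hM : 0 < M) (hMN : M ≤ N)
    {A : Fin N → Fin I → Fin F → ℝ} (hA : ∀ n, IsColStochastic (A n))
    {d : Fin N → Fin S → Fin I × Bool} {h : Fin S → Fin F} {p η K e b κ σ ε : ℝ} (hp0 : 0 < p)
    (hp1 : p ≤ 1) (hη : 0 < η) (hs : 0 < sigmaMin (stackedFactor M A))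
    (hσ : σ = sigmaMax (stackedFactor M A)) (hκ : κ = condNumber (stackedFactor M A))
    (hε : ε = sepEps F M κ) (hT : 1000 * (κ ^ 2 * (σ * ε)) < 2) (hK0 : 0 ≤ K)
    (hK : 3072 * K ≤ η * (p ^ 2 * S) * (noiseLevel F * (σ * ε / M)) ^ 2)
    (hmass : MassAtLeast M η (recordSamples d))
    (hview : ∀ k : Part2 N M, p * S / 2 ≤ (viewSet (d k)).card)
    (hpair : ∀ (k : Part2 N M) (j : Part1 N M),
      p * (viewSet (d k)).card / 2 ≤ pairCount (d j) (d k))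
    (hnoise : ∀ (k : Part2 N M) (q : Fin I), ∑ j : Part1 N M, noiseSq (A j) h (d j) (d k) q ≤
      24 * (8 * p * ((levelSet (d k) q).card + η * (viewSet (d k)).card)) * K)
    (he : e ≤ nearLevel F κ)
    (hnear : 1 / 4 ≤ κ ^ 2 * ε ∨ ∀ f, ∃ (k : Part2 N M) (q : Fin I),
      η * p ^ 2 * S / 4 ≤ (levelSet (d k) q).card →
        (((levelSet (d k) q).filter fun s => h s ≠ f).card : ℝ) ≤ e * (levelSet (d k) q).card)
    (hb : 1000 * (κ ^ 2 * Real.sqrt F * (σ * ε)) ≤ b) :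
    SPAErrorAtMost M (recordSamples d) A b := by
  have hM0 : (0 : ℝ) < M := by exact_mod_cast hM
  have hM1 : (1 : ℝ) ≤ M := by exact_mod_cast hM
  have hF2 : (2 : ℝ) ≤ F := by exact_mod_cast hF
  have : Nonempty (Part1 N M) := ⟨⟨⟨0, hM.trans_le hMN⟩, hM⟩⟩
  have hj : Part1 N M := ⟨⟨0, hM.trans_le hMN⟩, hM⟩
  have hκ1 : 1 ≤ κ := hκ ▸ one_le_condNumber hs
  have hε0 : 0 < ε := hε ▸ sepEps_pos hF hM (by linarith)
  have hσ0 : 0 < σ := hσ ▸ hs.trans_le (sigmaMin_le_sigmaMax _)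
  set ν := noiseLevel F * (σ * ε / M) with hν
  have hν0 : 0 ≤ ν := by unfold noiseLevel at hν; rw [hν]; positivity
  have hσε : σ * ε ≤ 1 / 500 := by
    have h1 : σ * ε ≤ κ ^ 2 * (σ * ε) := le_mul_of_one_le_left (by positivity) (one_le_pow₀ hκ1)
    linarith
  have hν8 : ν ≤ 1 / 8 := by
    have h1 : noiseLevel F ≤ 1 := by
      unfold noiseLevel
      rw [div_le_one (by positivity)]; linarith
    have h2 : σ * ε / M ≤ 1 / 8 := by
      rw [div_le_iff₀ hM0]; linarith
    calc ν ≤ 1 * (1 / 8) := mul_le_mul h1 h2 (by positivity) zero_le_one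
      _ = 1 / 8 := one_mul _
  have hview0 : ∀ k : Part2 N M, Fin I → 0 < ((viewSet (d k)).card : ℝ) := by
    intro k q
    have h1 := (hmass.counts hη hj k q).1
    have h2 : pairCount (d hj) (d k) ≤ (viewSet (d k)).card := Finset.card_filter_le _ _
    exact_mod_cast h1.trans_le h2
  set m : Part2 N M × Fin I → ℝ := fun c => (levelSet (d c.1) c.2).card / (viewSet (d c.1)).card
    with hm
  set g : Part2 N M × Fin I → Fin F → ℝ := fun c => latentFrequency h (d c.1) c.2 with hg
  have hres : ∀ (c : Part2 N M × Fin I) (j : Part1 N M) (z : Fin I),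
      empVirtual M (recordSamples d) (j, z) c - m c * ∑ f, A j z f * g c f =
        columnNoise (A j) h (d j) (d c.1) c.2 z / pairCount (d j) (d c.1) := by
    intro c j z
    have h1 : (0 : ℝ) < pairCount (d j) (d c.1) := by
      exact_mod_cast (hmass.counts hη j c.1 c.2).1
    have h2 : m c * ∑ f, A j z f * g c f =
        (∑ s ∈ levelSet (d c.1) c.2, A j z (h s)) / (viewSet (d c.1)).card := by
      rw [hm, hg]
      dsimp only
      rw [div_mul_eq_mul_div, card_mul_sum_latentFrequency h (d c.1) c.2 (A j z)]
    rw [h2]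
    unfold empVirtual columnNoise
    rw [Matrix.of_apply, empMarginal_recordSamples]
    field_simp
  have hE : ∀ c : Part2 N M × Fin I, ∑ j : Part1 N M,
      (∑ z, (empVirtual M (recordSamples d) (j, z) c - m c * ∑ f, A j z f * g c f) ^ 2 +
      (∑ z, (empVirtual M (recordSamples d) (j, z) c - m c * ∑ f, A j z f * g c f)) ^ 2) ≤
        (max (m c) η * ν) ^ 2 := by
    intro c
    set v : ℝ := ((viewSet (d c.1)).card : ℝ) with hv
    have hv0 : 0 < v := hview0 c.1 c.2
    have hS0 : 0 < p * (v / 2) := by positivity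
    have hmv : m c * v = (levelSet (d c.1) c.2).card := div_mul_cancel₀ _ hv0.ne'
    have h1 : ∀ j : Part1 N M,
        (∑ z, (empVirtual M (recordSamples d) (j, z) c - m c * ∑ f, A j z f * g c f) ^ 2 +
        (∑ z, (empVirtual M (recordSamples d) (j, z) c - m c * ∑ f, A j z f * g c f)) ^ 2) ≤
        noiseSq (A j) h (d j) (d c.1) c.2 / (p * v / 2) ^ 2 := by
      intro j
      have h2 : (0 : ℝ) < pairCount (d j) (d c.1) := by
        exact_mod_cast (hmass.counts hη j c.1 c.2).1
      simp only [hres, div_pow, ← Finset.sum_div]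
      rw [← add_div]
      refine div_le_div_of_nonneg_left (by positivity) (by positivity) ?_
      rw [← div_pow]
      exact pow_le_pow_left₀ (by positivity) (hpair c.1 j) 2
    refine (Finset.sum_le_sum fun j _ => h1 j).trans ?_
    rw [← Finset.sum_div, div_le_iff₀ (by positivity)]
    refine (hnoise c.1 c.2).trans ?_
    rw [← hmv]
    set μ := max (m c) η with hμ
    have hμη : η ≤ μ := le_max_right _ _
    have hμm : m c ≤ μ := le_max_left _ _
    have hμ0 : 0 < μ := hη.trans_le hμη
    have h3 : p * S / 2 ≤ v := hview c.1
    have h4 : 3072 * K ≤ μ * (2 * p * v) * ν ^ 2 := by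
      refine hK.trans (mul_le_mul_of_nonneg_right (mul_le_mul hμη ?_ (by positivity) hμ0.le)
        (sq_nonneg _))
      calc p ^ 2 * S = 2 * p * (p * S / 2) := by ring
        _ ≤ 2 * p * v := mul_le_mul_of_nonneg_left h3 (by positivity)
    have h5 : m c * v + η * v ≤ 2 * μ * v := by
      have := mul_le_mul_of_nonneg_right (add_le_add hμm hμη) hv0.le
      linarith
    calc 24 * (8 * p * (m c * v + η * v)) * K = 192 * p * K * (m c * v + η * v) := by ring
      _ ≤ 192 * p * K * (2 * μ * v) := mul_le_mul_of_nonneg_left h5 (by positivity)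
      _ = (p * μ * v / 8) * (3072 * K) := by ring
      _ ≤ (p * μ * v / 8) * (μ * (2 * p * v) * ν ^ 2) :=
          mul_le_mul_of_nonneg_left h4 (by positivity)
      _ = (μ * ν) ^ 2 * (p * v / 2) ^ 2 := by ring
  refine spaErrorAtMost_of_columns hF hM hMN hA hs hσ hκ hε hη hT (h := g) (m := m)
    (fun c f => latentFrequency_nonneg _ _ _ _) (fun c => sum_latentFrequency _ _ _) hmass hE
    (hnear.imp_right fun hn f => ?_) hb
  obtain ⟨k, q, hkq⟩ := hn f
  refine ⟨(k, q), ?_⟩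
  have hv0 := hview0 k q
  have h1 : 7 / 8 * η ≤ m (k, q) := by
    refine (normalized_column_error (fun j : Part1 N M => hA j)
      (fun f => latentFrequency_nonneg h (d k) q f) (sum_latentFrequency h (d k) q)
      (X := fun j z => empVirtual M (recordSamples d) (j, z) (k, q)) hη hν0 hν8 (fun j => ?_)
      (hE (k, q))).1
    refine (hmass j k q).trans (le_of_eq (Finset.sum_congr rfl fun a _ => ?_))
    exact abs_of_nonneg (empMarginal_nonneg _ _ _ _ _)
  have h2 : η * p ^ 2 * S / 4 ≤ (levelSet (d k) q).card := by
    have h3 : m (k, q) * (viewSet (d k)).card = (levelSet (d k) q).card :=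
      div_mul_cancel₀ _ hv0.ne'
    rw [← h3]
    calc η * p ^ 2 * S / 4 = (η / 2) * (p * (p * S / 2)) := by ring
      _ ≤ (η / 2) * (1 * (p * S / 2)) := by
          refine mul_le_mul_of_nonneg_left ?_ (by positivity)
          exact mul_le_mul_of_nonneg_right hp1 (by positivity)
      _ ≤ m (k, q) * (viewSet (d k)).card := by
          rw [one_mul]
          exact mul_le_mul (by linarith) (hview k) (by positivity) (by linarith)
  have h3 := hkq h2
  have hl0 : 0 < (levelSet (d k) q).card := by
    have h4 := hmass.counts hη hj k q
    have h5 : (0 : ℝ) < ((levelSet (d k) q).filter fun s => (d hj s).2 = true).card := by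
      refine lt_of_lt_of_le ?_ h4.2
      have : (0 : ℝ) < pairCount (d hj) (d k) := by exact_mod_cast h4.1
      positivity
    exact (by exact_mod_cast h5 : 0 < _).trans_le (Finset.card_filter_le _ _)
  have hl0' : (0 : ℝ) < (levelSet (d k) q).card := by exact_mod_cast hl0
  have h4 : (((levelSet (d k) q).filter fun s => h s = f).card : ℝ) +
      ((levelSet (d k) q).filter fun s => h s ≠ f).card = (levelSet (d k) q).card := by
    exact_mod_cast Finset.card_filter_add_card_filter_not _
  have h5 : g (k, q) f = ((levelSet (d k) q).filter fun s => h s = f).card /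
      (levelSet (d k) q).card := by
    rw [hg]; exact if_neg hl0.ne'
  rw [h5, le_div_iff₀ hl0']
  have h6 := mul_le_mul_of_nonneg_right he hl0'.le
  linarith

end Records

/-! ### Events for the factors and records of one variable and a family of other variables -/

section RecordEvents

open scoped ENNReal

variable {I F S : ℕ}

/-- Measurability can be checked on the fibres of a discrete variable. -/
theorem measurableSet_of_fiber {X T : Type*} [MeasurableSpace X] [MeasurableSpace T] [Countable T]
    [MeasurableSingletonClass T] {τ : X → T} (hτ : Measurable τ) {s : Set X} (u : T → Set X)
    (hu : ∀ t, MeasurableSet (u t)) (h : ∀ x, x ∈ s ↔ x ∈ u (τ x)) : MeasurableSet s := by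
  have : s = ⋃ t, τ ⁻¹' {t} ∩ u t := by ext x; simp [h]
  rw [this]
  exact .iUnion fun t => (hτ (measurableSet_singleton t)).inter (hu t)

theorem indicator_one_le_one {X : Type*} (s : Set X) (x : X) :
    s.indicator (fun _ => (1 : ℝ)) x ≤ 1 := by
  classical
  rw [Set.indicator_apply]
  split_ifs <;> norm_num

/-- A factor together with the record of the corresponding variable. -/
abbrev FactorRecord (I F S : ℕ) : Type := (Fin I → Fin F → ℝ) × (Fin S → Fin I × Bool)

variable {p : ℝ} {h : Fin S → Fin F}

theorem recordLaw_le (hp0 : 0 ≤ p) (hp1 : p ≤ 1) {μ : Measure (Fin I → Fin F → ℝ)}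
    (hμ : ∀ᵐ a ∂μ, IsColStochastic a) {B : Set (Fin I → Fin F → ℝ)} (hB : MeasurableSet B) :
    recordLaw p h μ {y | y.1 ∈ B} ≤ μ B := by
  have hB' : MeasurableSet {y : FactorRecord I F S | y.1 ∈ B} := measurable_fst hB
  rw [recordLaw_apply hp0 hp1 h hμ hB', ← lintegral_indicator_one hB]
  refine lintegral_mono_ae ?_
  filter_upwards [hμ] with a ha
  by_cases haB : a ∈ B
  · rw [Set.indicator_of_mem haB]
    have : ∀ d : Fin S → Fin I × Bool,
        ({y : FactorRecord I F S | y.1 ∈ B}).indicator (fun _ => (1 : ℝ)) (a, d) = 1 := fun d =>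
      Set.indicator_of_mem (show (a, d) ∈ {y : FactorRecord I F S | y.1 ∈ B} from haB) _
    simp only [this, mul_one, sum_obsWeight ha, ENNReal.ofReal_one]
    exact le_rfl
  · have : ∀ d : Fin S → Fin I × Bool,
        ({y : FactorRecord I F S | y.1 ∈ B}).indicator (fun _ => (1 : ℝ)) (a, d) = 0 := fun d =>
      Set.indicator_of_notMem (show (a, d) ∉ {y : FactorRecord I F S | y.1 ∈ B} from haB) _
    simp [this]

/-- If some row of a random factor is small with positive probability, then the frequencies of all
values exceed the threshold with probability bounded away from `1`. -/
theorem recordLaw_frequencies_le (hp0 : 0 ≤ p) (hp1 : p ≤ 1) {μ : Measure (Fin I → Fin F → ℝ)}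
    [IsProbabilityMeasure μ] (hμ : ∀ᵐ a ∂μ, IsColStochastic a) {η : ℝ} (hη : 0 < η)
    (d : Fin S → Fin I × Bool) :
    recordLaw p h μ {y | ∀ q, 0 < pairCount d y.2 ∧ η * pairCount d y.2 ≤
      ((levelSet y.2 q).filter fun s => (d s).2 = true).card} ≤
      ENNReal.ofReal (1 - μ.real {a | ∃ q, ∀ f, a q f ≤ η / 2} / 2) := by
  classical
  set t := {a : Fin I → Fin F → ℝ | ∃ q, ∀ f, a q f ≤ η / 2} with ht
  have htm : MeasurableSet t := by
    have : t = ⋃ q, ⋂ f, {a : Fin I → Fin F → ℝ | a q f ≤ η / 2} := by ext; simp [ht]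
    rw [this]
    exact .iUnion fun q => .iInter fun f => measurableSet_le (by fun_prop) measurable_const
  have hs : MeasurableSet {y : FactorRecord I F S | ∀ q, 0 < pairCount d y.2 ∧
      η * pairCount d y.2 ≤ ((levelSet y.2 q).filter fun s => (d s).2 = true).card} :=
    measurable_snd (Set.toFinite {d' : Fin S → Fin I × Bool | ∀ q, 0 < pairCount d d' ∧
      η * pairCount d d' ≤ ((levelSet d' q).filter fun s => (d s).2 = true).card}).measurableSet
  rw [recordLaw_apply hp0 hp1 h hμ hs]
  have hint : Integrable (fun a => 1 - t.indicator (fun _ => (1 / 2 : ℝ)) a) μ :=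
    (integrable_const _).sub ((integrable_const _).indicator htm)
  have h1 : ENNReal.ofReal (1 - μ.real t / 2) =
      ∫⁻ a, ENNReal.ofReal (1 - t.indicator (fun _ => (1 / 2 : ℝ)) a) ∂μ := by
    rw [← ofReal_integral_eq_lintegral_ofReal hint (ae_of_all _ fun a => ?_),
      integral_sub (integrable_const _) ((integrable_const _).indicator htm),
      integral_indicator_const _ htm]
    · congr 1; simp; ring
    · by_cases ha : a ∈ t
      · simp only [Set.indicator_of_mem ha, Pi.zero_apply]; norm_num
      · simp [Set.indicator_of_notMem ha]
  rw [h1]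
  refine lintegral_mono_ae ?_
  filter_upwards [hμ] with a ha
  refine ENNReal.ofReal_le_ofReal ?_
  by_cases hat : a ∈ t
  · obtain ⟨q, hq⟩ := id hat
    rw [Set.indicator_of_mem hat]
    refine le_trans (Finset.sum_le_sum fun d' _ => mul_le_mul_of_nonneg_left ?_
      (obsWeight_nonneg hp0 hp1 ha h d')) ((prob_frequency_large hp0 hp1 ha h d hη hq).trans
        (by norm_num))
    rw [Set.indicator_apply]
    split_ifs with h2 h3
    · exact le_rfl
    · exact absurd (h2 q) h3
    · exact zero_le_one
    · exact le_rfl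
  · rw [Set.indicator_of_notMem hat, sub_zero]
    refine (Finset.sum_le_sum fun d' _ => ?_).trans (sum_obsWeight (p := p) ha h).le
    refine mul_le_of_le_one_right (obsWeight_nonneg hp0 hp1 ha h d') ?_
    exact indicator_one_le_one _ _

variable {J : Type*} [Fintype J] [DecidableEq J]

/-- An event for the records has at most the probability that the factors are in a given set, times
the largest conditional probability. -/
theorem pi_recordLaw_le (hp0 : 0 ≤ p) (hp1 : p ≤ 1) (μ : J → Measure (Fin I → Fin F → ℝ))
    [∀ j, IsProbabilityMeasure (μ j)] (hμ : ∀ j, ∀ᵐ a ∂μ j, IsColStochastic a)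
    {G : Set (J → Fin I → Fin F → ℝ)} (hG : MeasurableSet G)
    (hGs : ∀ a ∈ G, ∀ j, IsColStochastic (a j)) {s : Set (J → FactorRecord I F S)}
    (hs : MeasurableSet s) (hsG : ∀ x ∈ s, (fun j => (x j).1) ∈ G) {ρ : ℝ}
    (hρ : ∀ a ∈ G, ∑ d : J → Fin S → Fin I × Bool, (∏ j, obsWeight p (a j) h (d j)) *
      s.indicator (fun _ => (1 : ℝ)) (fun j => (a j, d j)) ≤ ρ) :
    Measure.pi (fun j => recordLaw p h (μ j)) s ≤ Measure.pi μ G * ENNReal.ofReal ρ := by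
  have : ∀ j, IsProbabilityMeasure (recordLaw p h (μ j)) := fun j =>
    isProbabilityMeasure_recordLaw hp0 hp1 h (hμ j)
  unfold recordLaw at this ⊢
  rw [pi_mixLaw_apply μ (fun _ d a => ENNReal.ofReal (obsWeight p a h d))
    (fun _ d => (measurable_obsWeight p h d).ennreal_ofReal) hs]
  have hm : ∀ d : J → Fin S → Fin I × Bool,
      MeasurableSet {a : J → Fin I → Fin F → ℝ | (fun j => (a j, d j)) ∈ s} := fun d =>
    (measurable_pi_lambda _ fun j => (measurable_pi_apply j).prodMk measurable_const) hs
  have hg : ∀ d : J → Fin S → Fin I × Bool, Measurable fun a : J → Fin I → Fin F → ℝ =>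
      ∏ j, ENNReal.ofReal (obsWeight p (a j) h (d j)) := fun d =>
    Finset.measurable_prod _ fun j _ =>
      ((measurable_obsWeight p h (d j)).comp (measurable_pi_apply j)).ennreal_ofReal
  simp only [← lintegral_indicator (hm _)]
  rw [← lintegral_finsetSum _ fun d _ => (hg d).indicator (hm d), mul_comm,
    ← setLIntegral_const, ← lintegral_indicator hG]
  refine lintegral_mono fun a => ?_
  by_cases ha : a ∈ G
  · rw [Set.indicator_of_mem ha]
    refine le_trans (le_of_eq ?_) (ENNReal.ofReal_le_ofReal (hρ a ha))
    have h0 : ∀ d : J → Fin S → Fin I × Bool, 0 ≤ ∏ j, obsWeight p (a j) h (d j) := fun d =>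
      Finset.prod_nonneg fun j _ => obsWeight_nonneg hp0 hp1 (hGs a ha j) h (d j)
    rw [ENNReal.ofReal_sum_of_nonneg fun d _ => mul_nonneg (h0 d)
      (Set.indicator_nonneg (fun _ _ => zero_le_one) _)]
    refine Finset.sum_congr rfl fun d _ => ?_
    by_cases had : (fun j => (a j, d j)) ∈ s
    · rw [Set.indicator_of_mem had,
        Set.indicator_of_mem (show a ∈ {a | (fun j => (a j, d j)) ∈ s} from had), mul_one,
        ENNReal.ofReal_prod_of_nonneg fun j _ => obsWeight_nonneg hp0 hp1 (hGs a ha j) h (d j)]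
    · rw [Set.indicator_of_notMem had,
        Set.indicator_of_notMem (show a ∉ {a | (fun j => (a j, d j)) ∈ s} from had), mul_zero,
        ENNReal.ofReal_zero]
  · rw [Set.indicator_of_notMem ha]
    refine le_of_eq (Finset.sum_eq_zero fun d _ => Set.indicator_of_notMem ?_ _)
    exact fun had => ha (hsG _ had)

theorem pi_recordLaw_fst_le (hp0 : 0 ≤ p) (hp1 : p ≤ 1) (μ : J → Measure (Fin I → Fin F → ℝ))
    [∀ j, IsProbabilityMeasure (μ j)] (hμ : ∀ j, ∀ᵐ a ∂μ j, IsColStochastic a)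
    {G : Set (J → Fin I → Fin F → ℝ)} (hG : MeasurableSet G)
    (hGs : ∀ a ∈ G, ∀ j, IsColStochastic (a j)) :
    Measure.pi (fun j => recordLaw p h (μ j)) {x | (fun j => (x j).1) ∈ G} ≤ Measure.pi μ G := by
  refine (pi_recordLaw_le hp0 hp1 μ hμ hG hGs (ρ := 1) ?_ (fun x hx => hx) fun a ha => ?_).trans ?_
  · exact (measurable_pi_lambda _ fun j => (measurable_pi_apply j).fst) hG
  · refine (Finset.sum_le_sum fun (d : J → Fin S → Fin I × Bool) _ =>
      mul_le_of_le_one_right (Finset.prod_nonneg fun j _ => obsWeight_nonneg hp0 hp1 (hGs a ha j) h (d j))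
      (indicator_one_le_one _ _)).trans (le_of_eq ?_)
    rw [← Fintype.prod_sum fun j (t : Fin S → Fin I × Bool) => obsWeight p (a j) h t]
    exact Finset.prod_eq_one fun j _ => sum_obsWeight (hGs a ha j) h
  · rw [ENNReal.ofReal_one, mul_one]

/-- The row `q` is dominated by its entry `f`: given the value `q`, the latent variable differs
from `f` with probability at most `t`. -/
def IsDominated (lam : Fin F → ℝ) (t : ℝ) (a : Fin I → Fin F → ℝ) (q : Fin I) (f : Fin F) : Prop :=
  ∑ g ∈ Finset.univ.erase f, lam g * a q g ≤ t * ∑ g, lam g * a q g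

theorem measurableSet_isDominated (lam : Fin F → ℝ) (t : ℝ) (q : Fin I) (f : Fin F) :
    MeasurableSet {a : Fin I → Fin F → ℝ | IsDominated lam t a q f} := by
  unfold IsDominated
  exact measurableSet_le (by fun_prop) (by fun_prop)

/-- The record of a variable is atypical on its own: the variable is hardly observed, or one of its
dominated values is often caused by other latent values. -/
def AtypicalRecord (lam : Fin F → ℝ) (p e x : ℝ) (h : Fin S → Fin F) :
    Set (FactorRecord I F S) :=
  {y | ((viewSet y.2).card : ℝ) < p * S / 2 ∨ ∃ q f, IsDominated lam (e / 8) y.1 q f ∧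
    x ≤ (levelSet y.2 q).card ∧
    e * (levelSet y.2 q).card < ((levelSet y.2 q).filter fun s => h s ≠ f).card}

/-- The record of a variable is atypical in relation to a family of others: there are few common
observations, or there is too much noise in a column of the empirical marginals. -/
def AtypicalPair (p η K : ℝ) (h : Fin S → Fin F) :
    Set ((J → FactorRecord I F S) × FactorRecord I F S) :=
  {z | p * S / 2 ≤ (viewSet z.2.2).card ∧
    ((∃ j, (pairCount (z.1 j).2 z.2.2 : ℝ) < p * (viewSet z.2.2).card / 2) ∨
      ∃ q, 24 * (8 * p * ((levelSet z.2.2 q).card + η * (viewSet z.2.2).card)) * K ≤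
        ∑ j, noiseSq (z.1 j).1 h (z.1 j).2 z.2.2 q)}

theorem measurableSet_atypicalRecord (lam : Fin F → ℝ) (p e x : ℝ) (h : Fin S → Fin F) :
    MeasurableSet (AtypicalRecord (I := I) lam p e x h) := by
  refine measurableSet_of_fiber (τ := fun y : FactorRecord I F S => y.2) measurable_snd
    (fun d => {y | ((viewSet d).card : ℝ) < p * S / 2 ∨ ∃ q f, IsDominated lam (e / 8) y.1 q f ∧
      x ≤ (levelSet d q).card ∧
      e * (levelSet d q).card < ((levelSet d q).filter fun s => h s ≠ f).card}) (fun d => ?_)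
    fun y => Iff.rfl
  refine measurableSet_setOfPred.2 (measurable_const.or (Measurable.exists fun q =>
    Measurable.exists fun f => Measurable.and ?_ measurable_const))
  exact (measurableSet_setOfPred.1 (measurableSet_isDominated lam (e / 8) q f)).comp measurable_fst

omit [DecidableEq J] in
theorem measurableSet_atypicalPair (p η K : ℝ) (h : Fin S → Fin F) :
    MeasurableSet (AtypicalPair (I := I) (J := J) p η K h) := by
  refine measurableSet_of_fiber (τ := fun z : (J → FactorRecord I F S) × FactorRecord I F S =>
    ((fun j => (z.1 j).2), z.2.2)) (by fun_prop)
    (fun t => {z | p * S / 2 ≤ (viewSet t.2).card ∧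
    ((∃ j, (pairCount (t.1 j) t.2 : ℝ) < p * (viewSet t.2).card / 2) ∨
      ∃ q, 24 * (8 * p * ((levelSet t.2 q).card + η * (viewSet t.2).card)) * K ≤
        ∑ j, noiseSq (z.1 j).1 h (t.1 j) t.2 q)}) (fun d => ?_)
    fun y => Iff.rfl
  refine measurableSet_setOfPred.2 (measurable_const.and (measurable_const.or
    (Measurable.exists fun q => measurableSet_setOfPred.1 (measurableSet_le measurable_const ?_))))
  unfold noiseSq columnNoise
  fun_prop

/-- Given the factors, records that are atypical on their own are unlikely. -/
theorem sum_recordLaw_atypicalRecord_le (hp0 : 0 ≤ p) (hp1 : p ≤ 1) {lam : Fin F → ℝ}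
    (hlam0 : ∀ f, 0 ≤ lam f) (hlam : ∑ f, lam f = 1) {μ : Measure (Fin I → Fin F → ℝ)}
    [IsProbabilityMeasure μ] (hμ : ∀ᵐ a ∂μ, IsColStochastic a) {e x : ℝ} (he : 0 ≤ e) :
    ∑ h : Fin S → Fin F, ENNReal.ofReal (priorWeight lam h) *
      recordLaw p h μ (AtypicalRecord lam p e x h) ≤
        ENNReal.ofReal (Real.exp (-(p * S / 8)) + I * F * Real.exp (-(e * x / 2))) := by
  classical
  have hw0 : ∀ h : Fin S → Fin F, 0 ≤ priorWeight lam h := fun h =>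
    Finset.prod_nonneg fun s _ => hlam0 _
  have hmeas : ∀ h : Fin S → Fin F, Measurable fun a : Fin I → Fin F → ℝ => ENNReal.ofReal
      (∑ d, obsWeight p a h d * (AtypicalRecord lam p e x h).indicator (fun _ => (1 : ℝ)) (a, d)) := fun h =>
    (Finset.measurable_sum _ fun d _ => (measurable_obsWeight p h d).mul
      ((measurable_const.indicator (measurableSet_atypicalRecord lam p e x h)).comp
        measurable_prodMk_right)).ennreal_ofReal
  simp only [recordLaw_apply hp0 hp1 _ hμ (measurableSet_atypicalRecord lam p e x _)]
  simp only [← lintegral_const_mul _ (hmeas _)]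
  rw [← lintegral_finsetSum _ fun h _ => (hmeas h).const_mul _]
  set C := ENNReal.ofReal (Real.exp (-(p * S / 8)) + I * F * Real.exp (-(e * x / 2)))
  have hCint : C = ∫⁻ _, C ∂μ := by simp
  rw [hCint]
  refine lintegral_mono_ae ?_
  filter_upwards [hμ] with a ha
  have ho : ∀ (h : Fin S → Fin F) d, 0 ≤ obsWeight p a h d := obsWeight_nonneg hp0 hp1 ha
  simp only [← ENNReal.ofReal_mul (hw0 _)]
  rw [← ENNReal.ofReal_sum_of_nonneg fun h _ => mul_nonneg (hw0 h) (Finset.sum_nonneg fun d _ =>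
    mul_nonneg (ho h d) (Set.indicator_nonneg (fun _ _ => zero_le_one) _))]
  refine ENNReal.ofReal_le_ofReal ?_
  set i1 : (Fin S → Fin I × Bool) → ℝ := fun d =>
    if ((viewSet d).card : ℝ) < p * S / 2 then 1 else 0 with hi1
  set i2 : (Fin S → Fin F) → Fin I → Fin F → (Fin S → Fin I × Bool) → ℝ := fun h q f d =>
    if IsDominated lam (e / 8) a q f then (if x ≤ (levelSet d q).card ∧
      e * (levelSet d q).card < ((levelSet d q).filter fun s => h s ≠ f).card then 1 else 0)
    else 0 with hi2
  have hi1n : ∀ d, 0 ≤ i1 d := fun d => by rw [hi1]; dsimp only; split_ifs <;> norm_num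
  have hi2n : ∀ h q f d, 0 ≤ i2 h q f d := fun h q f d => by
    rw [hi2]; dsimp only; split_ifs <;> norm_num
  have hle : ∀ h d, (AtypicalRecord lam p e x h).indicator (fun _ => (1 : ℝ)) (a, d) ≤
      i1 d + ∑ q, ∑ f, i2 h q f d := by
    intro h d
    have hsum : 0 ≤ ∑ q, ∑ f, i2 h q f d :=
      Finset.sum_nonneg fun q _ => Finset.sum_nonneg fun f _ => hi2n h q f d
    rw [Set.indicator_apply]
    split_ifs with hmem
    · rcases hmem with h1 | ⟨q, f, h1, h2⟩
      · have : i1 d = 1 := if_pos h1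
        linarith
      · have h3 : i2 h q f d = 1 := (if_pos h1).trans (if_pos h2)
        have h4 : i2 h q f d ≤ ∑ f, i2 h q f d :=
          Finset.single_le_sum (fun f _ => hi2n h q f d) (Finset.mem_univ f)
        have h5 : ∑ f, i2 h q f d ≤ ∑ q, ∑ f, i2 h q f d :=
          Finset.single_le_sum (f := fun q => ∑ f, i2 h q f d)
            (fun q _ => Finset.sum_nonneg fun f _ => hi2n h q f d) (Finset.mem_univ q)
        have := hi1n d
        linarith
    · exact add_nonneg (hi1n d) hsum
  calc ∑ h, priorWeight lam h * ∑ d, obsWeight p a h d *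
        (AtypicalRecord lam p e x h).indicator (fun _ => (1 : ℝ)) (a, d)
      ≤ ∑ h, priorWeight lam h * ∑ d, obsWeight p a h d * (i1 d + ∑ q, ∑ f, i2 h q f d) :=
        Finset.sum_le_sum fun h _ => mul_le_mul_of_nonneg_left (Finset.sum_le_sum fun d _ =>
          mul_le_mul_of_nonneg_left (hle h d) (ho h d)) (hw0 h)
    _ = ∑ h, priorWeight lam h * ∑ d, obsWeight p a h d * i1 d +
        ∑ q, ∑ f, ∑ h, priorWeight lam h * ∑ d, obsWeight p a h d * i2 h q f d := by
        simp only [mul_add, Finset.sum_add_distrib, Finset.mul_sum]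
        congr 1
        rw [Finset.sum_congr rfl fun h _ => Finset.sum_comm, Finset.sum_comm]
        refine Finset.sum_congr rfl fun q _ => ?_
        rw [Finset.sum_congr rfl fun h _ => Finset.sum_comm, Finset.sum_comm]
    _ ≤ Real.exp (-(p * S / 8)) + ∑ _q : Fin I, ∑ _f : Fin F, Real.exp (-(e * x / 2)) := by
        refine add_le_add ?_ (Finset.sum_le_sum fun q _ => Finset.sum_le_sum fun f _ => ?_)
        · calc _ ≤ ∑ h : Fin S → Fin F, priorWeight lam h * Real.exp (-(p * S / 8)) :=
              Finset.sum_le_sum fun h _ => mul_le_mul_of_nonneg_left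
                (prob_viewSet_small hp0 hp1 ha h) (hw0 h)
            _ = _ := by rw [← Finset.sum_mul, sum_priorWeight hlam, one_mul]
        · by_cases hd : IsDominated lam (e / 8) a q f
          · simp only [hi2, if_pos hd]
            exact prob_mixed_level hp0 hp1 hlam0 hlam ha he q f hd
          · simp only [hi2, if_neg hd, mul_zero, Finset.sum_const_zero]
            positivity
    _ = _ := by simp [mul_assoc]

/-- Given the factors, records that are atypical in relation to others are unlikely. -/
theorem pi_recordLaw_atypicalPair_le (hp0 : 0 ≤ p) (hp1 : p ≤ 1)
    (μ : J → Measure (Fin I → Fin F → ℝ)) [∀ j, IsProbabilityMeasure (μ j)]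
    (hμ : ∀ j, ∀ᵐ a ∂μ j, IsColStochastic a) {G : Set (J → Fin I → Fin F → ℝ)}
    (hG : MeasurableSet G) (hGs : ∀ a ∈ G, ∀ j, IsColStochastic (a j)) {η K : ℝ} (hη : 0 ≤ η)
    (h6 : 6 ≤ 4 * η * (p ^ 2 * S)) (hK : 96 * K ≤ 4 * η * (p ^ 2 * S)) (y : FactorRecord I F S) :
    Measure.pi (fun j => recordLaw p h (μ j))
      {x | (fun j => (x j).1) ∈ G ∧ (x, y) ∈ AtypicalPair p η K h} ≤
      Measure.pi μ G * ENNReal.ofReal (Fintype.card J * Real.exp (-(p ^ 2 * S / 16)) +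
        I * Real.exp (-K + Fintype.card J / 6)) := by
  classical
  have hfst : Measurable fun (x : J → FactorRecord I F S) (j : J) => (x j).1 :=
    measurable_pi_lambda _ fun j => (measurable_pi_apply j).fst
  refine pi_recordLaw_le hp0 hp1 μ hμ hG hGs ((hfst hG).inter
    (measurable_prodMk_right (measurableSet_atypicalPair p η K h))) (fun x hx => hx.1)
    fun a ha => ?_
  have ho : ∀ d : J → Fin S → Fin I × Bool, 0 ≤ ∏ j, obsWeight p (a j) h (d j) := fun d =>
    Finset.prod_nonneg fun j _ => obsWeight_nonneg hp0 hp1 (hGs a ha j) h (d j)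
  by_cases hv : p * S / 2 ≤ (viewSet y.2).card
  swap
  · refine le_trans (le_of_eq (Finset.sum_eq_zero fun d _ => ?_)) (show (0 : ℝ) ≤ _ by positivity)
    rw [Set.indicator_of_notMem fun hx => hv hx.2.1, mul_zero]
  set i1 : J → (Fin S → Fin I × Bool) → ℝ := fun _ d =>
    if (pairCount d y.2 : ℝ) < p * (viewSet y.2).card / 2 then 1 else 0 with hi1
  set i2 : Fin I → (J → Fin S → Fin I × Bool) → ℝ := fun q d =>
    if 24 * (8 * p * ((levelSet y.2 q).card + η * (viewSet y.2).card)) * K ≤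
        ∑ j, noiseSq (a j) h (d j) y.2 q then 1 else 0 with hi2
  have hi1n : ∀ j d, 0 ≤ i1 j d := fun j d => by rw [hi1]; dsimp only; split_ifs <;> norm_num
  have hi2n : ∀ q d, 0 ≤ i2 q d := fun q d => by rw [hi2]; dsimp only; split_ifs <;> norm_num
  calc ∑ d : J → Fin S → Fin I × Bool, (∏ j, obsWeight p (a j) h (d j)) *
        Set.indicator {x : J → FactorRecord I F S | (fun j => (x j).1) ∈ G ∧
          (x, y) ∈ AtypicalPair p η K h} (fun _ => (1 : ℝ)) (fun j => (a j, d j))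
      ≤ ∑ d : J → Fin S → Fin I × Bool, (∏ j, obsWeight p (a j) h (d j)) *
        (∑ j, i1 j (d j) + ∑ q, i2 q d) := by
        refine Finset.sum_le_sum fun d _ => mul_le_mul_of_nonneg_left ?_ (ho d)
        have s1 : 0 ≤ ∑ j, i1 j (d j) := Finset.sum_nonneg fun j _ => hi1n j (d j)
        have s2 : 0 ≤ ∑ q, i2 q d := Finset.sum_nonneg fun q _ => hi2n q d
        rw [Set.indicator_apply]
        split_ifs with hmem
        · rcases hmem.2.2 with ⟨j, hj⟩ | ⟨q, hq⟩
          · have h3 : i1 j (d j) = 1 := if_pos hj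
            have h4 : i1 j (d j) ≤ ∑ j, i1 j (d j) :=
              Finset.single_le_sum (f := fun j => i1 j (d j)) (fun j _ => hi1n j (d j))
                (Finset.mem_univ j)
            linarith
          · have h3 : i2 q d = 1 := if_pos hq
            have h4 : i2 q d ≤ ∑ q, i2 q d :=
              Finset.single_le_sum (fun q _ => hi2n q d) (Finset.mem_univ q)
            linarith
        · exact add_nonneg s1 s2
    _ = ∑ j, ∑ d : J → Fin S → Fin I × Bool, (∏ j, obsWeight p (a j) h (d j)) * i1 j (d j) +
        ∑ q, ∑ d : J → Fin S → Fin I × Bool, (∏ j, obsWeight p (a j) h (d j)) * i2 q d := by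
        simp only [mul_add, Finset.sum_add_distrib, Finset.mul_sum]
        rw [Finset.sum_comm, Finset.sum_comm (γ := Fin I)]
    _ ≤ ∑ _j : J, Real.exp (-(p ^ 2 * S / 16)) +
        ∑ _q : Fin I, Real.exp (-K + Fintype.card J / 6) := by
        refine add_le_add (Finset.sum_le_sum fun j _ => ?_) (Finset.sum_le_sum fun q _ => ?_)
        · rw [sum_prod_mul_single (fun j t => obsWeight p (a j) h t)
            (fun j => sum_obsWeight (hGs a ha j) h) (i1 j) j]
          refine (prob_pairCount_small hp0 hp1 (hGs a ha j) h y.2).trans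
            (Real.exp_le_exp.2 (neg_le_neg ?_))
          have := mul_le_mul_of_nonneg_left hv hp0
          linarith [sq p]
        · have h3 : 4 * η * (p ^ 2 * S) ≤ 8 * p * (η * (viewSet y.2).card) := by
            have := mul_le_mul_of_nonneg_left hv (show 0 ≤ 8 * p * η by positivity)
            linarith
          have h4 : 0 ≤ 8 * p * ((levelSet y.2 q).card : ℝ) := by positivity
          refine prob_noise_large hp0 hp1 (hGs a ha) h y.2 q ?_ ?_ ?_
          all_goals linarith
    _ = _ := by simp

/-- Atypical records are unlikely, also on events for the factors of the other variables. -/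
theorem sum_prod_recordLaw_atypical_le (hp0 : 0 ≤ p) (hp1 : p ≤ 1) {lam : Fin F → ℝ}
    (hlam0 : ∀ f, 0 ≤ lam f) (hlam : ∑ f, lam f = 1)
    (μ : J → Measure (Fin I → Fin F → ℝ)) [∀ j, IsProbabilityMeasure (μ j)]
    (hμ : ∀ j, ∀ᵐ a ∂μ j, IsColStochastic a) (μ' : Measure (Fin I → Fin F → ℝ))
    [IsProbabilityMeasure μ'] (hμ' : ∀ᵐ a ∂μ', IsColStochastic a)
    {G : Set (J → Fin I → Fin F → ℝ)}
    (hG : MeasurableSet G) (hGs : ∀ a ∈ G, ∀ j, IsColStochastic (a j)) {η K e x : ℝ} (hη : 0 ≤ η)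
    (h6 : 6 ≤ 4 * η * (p ^ 2 * S)) (hK : 96 * K ≤ 4 * η * (p ^ 2 * S)) (he : 0 ≤ e) :
    ∑ h : Fin S → Fin F, ENNReal.ofReal (priorWeight lam h) *
      ((Measure.pi fun j => recordLaw p h (μ j)).prod (recordLaw p h μ')) {z |
        z.1 ∈ {x : J → FactorRecord I F S | (fun j => (x j).1) ∈ G} ∧
        z ∈ {z | z.2 ∈ AtypicalRecord lam p e x h} ∪ AtypicalPair p η K h} ≤
      Measure.pi μ G * ENNReal.ofReal ((Real.exp (-(p * S / 8)) +
        I * F * Real.exp (-(e * x / 2))) + (Fintype.card J * Real.exp (-(p ^ 2 * S / 16)) +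
        I * Real.exp (-K + Fintype.card J / 6))) := by
  classical
  have hw0 : ∀ h : Fin S → Fin F, 0 ≤ priorWeight lam h := fun h =>
    Finset.prod_nonneg fun s _ => hlam0 _
  have hfst : Measurable fun (x : J → FactorRecord I F S) (j : J) => (x j).1 :=
    measurable_pi_lambda _ fun j => (measurable_pi_apply j).fst
  set G' : Set (J → FactorRecord I F S) := {x | (fun j => (x j).1) ∈ G}
  set β1 : ℝ := Real.exp (-(p * S / 8)) + I * F * Real.exp (-(e * x / 2))
  set β2 : ℝ := Fintype.card J * Real.exp (-(p ^ 2 * S / 16)) +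
    I * Real.exp (-K + Fintype.card J / 6)
  have hone : ∀ h : Fin S → Fin F,
      ((Measure.pi fun j => recordLaw p h (μ j)).prod (recordLaw p h μ')) {z |
        z.1 ∈ G' ∧ z ∈ {z | z.2 ∈ AtypicalRecord lam p e x h} ∪ AtypicalPair p η K h} ≤
      Measure.pi μ G * recordLaw p h μ' (AtypicalRecord lam p e x h) +
        Measure.pi μ G * ENNReal.ofReal β2 := by
    intro h
    have : ∀ j, IsProbabilityMeasure (recordLaw p h (μ j)) := fun j =>
      isProbabilityMeasure_recordLaw hp0 hp1 h (hμ j)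
    have : IsProbabilityMeasure (recordLaw p h μ') :=
      isProbabilityMeasure_recordLaw hp0 hp1 h hμ'
    have hsub : {z : (J → FactorRecord I F S) × FactorRecord I F S |
        z.1 ∈ G' ∧ z ∈ {z | z.2 ∈ AtypicalRecord lam p e x h} ∪ AtypicalPair p η K h} ⊆
        G' ×ˢ AtypicalRecord lam p e x h ∪ {z | z.1 ∈ G' ∧ z ∈ AtypicalPair p η K h} := by
      rintro z ⟨h1, h2 | h2⟩
      · exact Or.inl ⟨h1, h2⟩
      · exact Or.inr ⟨h1, h2⟩
    refine (measure_mono hsub).trans ((measure_union_le _ _).trans (add_le_add ?_ ?_))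
    · rw [Measure.prod_prod]
      exact mul_le_mul' (pi_recordLaw_fst_le hp0 hp1 μ hμ hG hGs) le_rfl
    · have hm : MeasurableSet {z : (J → FactorRecord I F S) × FactorRecord I F S |
          z.1 ∈ G' ∧ z ∈ AtypicalPair p η K h} :=
        (measurable_fst (hfst hG)).inter (measurableSet_atypicalPair p η K h)
      rw [Measure.prod_apply_symm hm]
      refine (lintegral_mono fun y => pi_recordLaw_atypicalPair_le hp0 hp1 μ hμ hG hGs hη h6 hK
        y).trans (le_of_eq ?_)
      rw [lintegral_const, measure_univ, mul_one]
  refine (Finset.sum_le_sum fun h _ => mul_le_mul' le_rfl (hone h)).trans ?_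
  simp only [mul_add, Finset.sum_add_distrib]
  rw [ENNReal.ofReal_add (p := β1) (q := β2) (by positivity) (by positivity), mul_add]
  refine add_le_add ?_ ?_
  · refine le_trans (le_of_eq ?_) (mul_le_mul' le_rfl
      (sum_recordLaw_atypicalRecord_le hp0 hp1 hlam0 hlam hμ' he))
    rw [Finset.mul_sum]
    exact Finset.sum_congr rfl fun h _ => by ring
  · rw [← Finset.sum_mul, ← ENNReal.ofReal_sum_of_nonneg fun h _ => hw0 h, sum_priorWeight hlam,
      ENNReal.ofReal_one, one_mul]

end RecordEvents

/-! ### Probabilities of the exceptional events in the model -/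

section ModelEvents

open scoped ENNReal

variable {Ω : Type*} [MeasurableSpace Ω] {P : Measure Ω} [IsProbabilityMeasure P]
  {N M I F S : ℕ} {lam : Fin F → ℝ} {p : ℝ} {A : Fin N → Ω → Fin I → Fin F → ℝ}
  {H : Fin S → Ω → Fin F} {Z : Fin S → Fin N → Ω → Fin I} {V : Fin S → Fin N → Ω → Bool}

/-- Factor and record of the variable `n`. -/
def factorRecord (A : Fin N → Ω → Fin I → Fin F → ℝ) (Z : Fin S → Fin N → Ω → Fin I)
    (V : Fin S → Fin N → Ω → Bool) (n : Fin N) (ω : Ω) : FactorRecord I F S :=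
  (A n ω, fun i => (Z i n ω, V i n ω))

theorem IsModel.isProbabilityMeasure_map (hM : IsModel P lam p A H Z V) (n : Fin N) :
    IsProbabilityMeasure (P.map (A n)) :=
  Measure.isProbabilityMeasure_map (hM.measurable_factor n).aemeasurable

omit [IsProbabilityMeasure P] in
theorem IsModel.ae_map_isColStochastic [NeZero F] (hM : IsModel P lam p A H Z V) (n : Fin N) :
    ∀ᵐ a ∂P.map (A n), IsColStochastic a := by
  rw [ae_map_iff (hM.measurable_factor n).aemeasurable measurableSet_isColStochastic]
  exact (hM.law_factor n).ae_isColStochastic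

theorem IsModel.measure_le_of_forall [NeZero F] (hM : IsModel P lam p A H Z V)
    (hlam : ∀ f, 0 ≤ lam f) (hlam1 : ∑ f, lam f = 1) (hp0 : 0 ≤ p) (hp1 : p ≤ 1)
    {s : Set (Fin N → FactorRecord I F S)} (hs : MeasurableSet s) {c : ℝ≥0∞}
    (hc : ∀ h : Fin S → Fin F, Measure.pi (fun n => recordLaw p h (P.map (A n))) s ≤ c) :
    P {ω | (fun n => factorRecord A Z V n ω) ∈ s} ≤ c := by
  refine (hM.measure_le hlam hp0 hp1 (s := fun _ => s) fun _ => hs).trans ?_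
  refine (Finset.sum_le_sum fun h _ => mul_le_mul' le_rfl (hc h)).trans (le_of_eq ?_)
  have hw0 : ∀ h : Fin S → Fin F, 0 ≤ priorWeight lam h := fun h =>
    Finset.prod_nonneg fun s _ => hlam _
  rw [← Finset.sum_mul, ← ENNReal.ofReal_sum_of_nonneg fun h _ => hw0 h, sum_priorWeight hlam1,
    ENNReal.ofReal_one, one_mul]

/-- The factors of the first part have a product law. -/
theorem IsModel.pi_part1_apply (hM : IsModel P lam p A H Z V)
    {G : Set (Part1 N M → Fin I → Fin F → ℝ)} (hG : MeasurableSet G) :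
    Measure.pi (fun j : Part1 N M => P.map (A j)) G = P {ω | (fun j : Part1 N M => A j ω) ∈ G} := by
  have hind : ProbabilityTheory.iIndepFun (fun j : Part1 N M => A j) P :=
    hM.indep_factor.precomp Subtype.val_injective
  rw [← (ProbabilityTheory.iIndepFun_iff_map_fun_eq_pi_map
    fun j : Part1 N M => (hM.measurable_factor j).aemeasurable).1 hind,
    Measure.map_apply (measurable_pi_lambda (fun ω (j : Part1 N M) => A j ω)
      fun j => hM.measurable_factor j) hG]
  rfl

/-- All values of the variable with record `d'` are frequent among the samples in which the variable
with record `d` is observed, too. -/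
def FrequentValues (η : ℝ) (d : Fin S → Fin I × Bool) : Set (FactorRecord I F S) :=
  {y | ∀ q, 0 < pairCount d y.2 ∧ η * pairCount d y.2 ≤
      ((levelSet y.2 q).filter fun s => (d s).2 = true).card}

theorem measurableSet_frequentValues (η : ℝ) (j : Part1 N M) :
    MeasurableSet {z : (Part1 N M → FactorRecord I F S) × FactorRecord I F S |
      z.2 ∈ FrequentValues η (z.1 j).2} :=
  measurableSet_of_fiber (τ := fun z : (Part1 N M → FactorRecord I F S) × FactorRecord I F S =>
    ((z.1 j).2, z.2.2)) (by fun_prop)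
    (fun t => {_z | ∀ q, 0 < pairCount t.1 t.2 ∧ η * pairCount t.1 t.2 ≤
      ((levelSet t.2 q).filter fun s => (t.1 s).2 = true).card}) (fun _ => .const _)
    fun _ => Iff.rfl

theorem IsModel.recordLaw_frequentValues_le [NeZero F] (hM : IsModel P lam p A H Z V)
    (hp0 : 0 ≤ p) (hp1 : p ≤ 1) {η r : ℝ} (hη : 0 < η)
    (hr : ∀ n, r ≤ P.real {ω | ∃ q, ∀ f, A n ω q f ≤ η / 2}) (h : Fin S → Fin F)
    (d : Fin S → Fin I × Bool) (n : Fin N) :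
    recordLaw p h (P.map (A n)) (FrequentValues η d) ≤ ENNReal.ofReal (1 - r / 2) := by
  have := hM.isProbabilityMeasure_map n
  refine (recordLaw_frequencies_le hp0 hp1 (hM.ae_map_isColStochastic n) hη d).trans
    (ENNReal.ofReal_le_ofReal ?_)
  have h1 := hr n
  have h2 : MeasurableSet {a : Fin I → Fin F → ℝ | ∃ q, ∀ f, a q f ≤ η / 2} :=
    measurableSet_setOfPred.2 (Measurable.exists fun q => Measurable.forall fun f =>
      measurableSet_setOfPred.1 (measurableSet_le (by fun_prop) measurable_const))
  rw [map_measureReal_apply (hM.measurable_factor n) h2]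
  change r ≤ P.real (A n ⁻¹' {a : Fin I → Fin F → ℝ | ∃ q, ∀ f, a q f ≤ η / 2}) at h1
  linarith

/-- The mass condition is improbable if there are many variables in the second part, whatever is
known about the factors of the first part. -/
theorem IsModel.prob_mass_le [NeZero F] (hM : IsModel P lam p A H Z V)
    (hlam : ∀ f, 0 ≤ lam f) (hlam1 : ∑ f, lam f = 1) (hp0 : 0 ≤ p) (hp1 : p ≤ 1)
    (hMN : M ≤ N) {G : Set (Part1 N M → Fin I → Fin F → ℝ)} (hG : MeasurableSet G)
    (hGs : ∀ a ∈ G, ∀ j, IsColStochastic (a j)) {η r : ℝ} (hη : 0 < η)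
    (hr : ∀ n, r ≤ P.real {ω | ∃ q, ∀ f, A n ω q f ≤ η / 2}) (j₀ : Part1 N M) :
    P {ω | (fun j : Part1 N M => A j ω) ∈ G ∧ MassAtLeast M η (samples Z V ω)} ≤
      P {ω | (fun j : Part1 N M => A j ω) ∈ G} * ENNReal.ofReal (1 - r / 2) ^ (N - M) := by
  have := hM.isProbabilityMeasure_map
  have hfst : Measurable fun (x : Part1 N M → FactorRecord I F S) j => (x j).1 :=
    measurable_pi_lambda _ fun j => (measurable_pi_apply j).fst
  have hpart : Measurable fun (x : Fin N → FactorRecord I F S) (j : Part1 N M) => x j :=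
    measurable_pi_lambda _ fun j => measurable_pi_apply _
  set s : Set (Fin N → FactorRecord I F S) := {x | (fun j : Part1 N M => x j) ∈
    {x : Part1 N M → FactorRecord I F S | (fun j => (x j).1) ∈ G} ∧
      ∀ k : Part2 N M, ((fun j : Part1 N M => x j), x k) ∈
        {z : (Part1 N M → FactorRecord I F S) × FactorRecord I F S |
          z.2 ∈ FrequentValues η (z.1 j₀).2}}
  have hsm : MeasurableSet s := by
    refine measurableSet_setOfPred.2 ((measurableSet_setOfPred.1 (hpart (hfst hG))).and
      (Measurable.forall fun k => measurableSet_setOfPred.1 ?_))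
    exact (hpart.prodMk (measurable_pi_apply _)) (measurableSet_frequentValues η j₀)
  refine (measure_mono (t := {ω | (fun n => factorRecord A Z V n ω) ∈ s}) ?_).trans
    (hM.measure_le_of_forall hlam hlam1 hp0 hp1 hsm fun h => ?_)
  · rintro ω ⟨h1, h2⟩
    exact ⟨h1, fun k q => MassAtLeast.counts hη (d := fun n i => (Z i n ω, V i n ω)) h2 j₀ k q⟩
  · have : ∀ n, IsProbabilityMeasure (recordLaw p h (P.map (A n))) := fun n =>
      isProbabilityMeasure_recordLaw hp0 hp1 h (hM.ae_map_isColStochastic n)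
    refine (pi_forall_le _ (hfst hG) (fun _ => measurableSet_frequentValues η j₀)
      (ρ := ENNReal.ofReal (1 - r / 2)) fun x _ k => ?_).trans ?_
    · exact hM.recordLaw_frequentValues_le hp0 hp1 hη hr h (x j₀).2 k
    · rw [card_part2 hMN, ← hM.pi_part1_apply hG]
      exact mul_le_mul' (pi_recordLaw_fst_le hp0 hp1 _
        (fun j => hM.ae_map_isColStochastic _) hG hGs) le_rfl

/-- Given the factors of the first part, it is improbable that the mass condition holds and
the record of some variable of the second part is atypical. -/
theorem IsModel.prob_mass_atypical_le [NeZero F] (hM : IsModel P lam p A H Z V)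
    (hlam : ∀ f, 0 ≤ lam f) (hlam1 : ∑ f, lam f = 1) (hp0 : 0 ≤ p) (hp1 : p ≤ 1)
    (hMN : M ≤ N) {G : Set (Part1 N M → Fin I → Fin F → ℝ)} (hG : MeasurableSet G)
    (hGs : ∀ a ∈ G, ∀ j, IsColStochastic (a j)) {η r K e x : ℝ} (hη : 0 < η)
    (hr : ∀ n, r ≤ P.real {ω | ∃ q, ∀ f, A n ω q f ≤ η / 2}) (j₀ : Part1 N M)
    (h6 : 6 ≤ 4 * η * (p ^ 2 * S)) (hK : 96 * K ≤ 4 * η * (p ^ 2 * S)) (he : 0 ≤ e) :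
    P {ω | (fun j : Part1 N M => A j ω) ∈ G ∧ MassAtLeast M η (samples Z V ω) ∧
      ∃ k : Part2 N M, ((fun j : Part1 N M => factorRecord A Z V j ω), factorRecord A Z V k ω) ∈
        {z | z.2 ∈ AtypicalRecord lam p e x fun i => H i ω} ∪ AtypicalPair p η K fun i => H i ω} ≤
      (N - M : ℕ) * ENNReal.ofReal (1 - r / 2) ^ (N - M - 1) *
        (P {ω | (fun j : Part1 N M => A j ω) ∈ G} * ENNReal.ofReal ((Real.exp (-(p * S / 8)) +
        I * F * Real.exp (-(e * x / 2))) + (M * Real.exp (-(p ^ 2 * S / 16)) +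
        I * Real.exp (-K + M / 6)))) := by
  have := hM.isProbabilityMeasure_map
  have hfst : Measurable fun (x : Part1 N M → FactorRecord I F S) j => (x j).1 :=
    measurable_pi_lambda _ fun j => (measurable_pi_apply j).fst
  have hpart : Measurable fun (x : Fin N → FactorRecord I F S) (j : Part1 N M) => x j :=
    measurable_pi_lambda _ fun j => measurable_pi_apply _
  set G' : Set (Part1 N M → FactorRecord I F S) := {x | (fun j => (x j).1) ∈ G}
  set U : Set ((Part1 N M → FactorRecord I F S) × FactorRecord I F S) :=
    {z | z.2 ∈ FrequentValues η (z.1 j₀).2}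
  set T : (Fin S → Fin F) → Set ((Part1 N M → FactorRecord I F S) × FactorRecord I F S) :=
    fun h => {z | z.2 ∈ AtypicalRecord lam p e x h} ∪ AtypicalPair p η K h
  have hTm : ∀ h, MeasurableSet (T h) := fun h =>
    (measurable_snd (measurableSet_atypicalRecord lam p e x h)).union
      (measurableSet_atypicalPair p η K h)
  have hUm : MeasurableSet U := measurableSet_frequentValues η j₀
  set s : (Fin S → Fin F) → Set (Fin N → FactorRecord I F S) := fun h =>
    {x | (fun j : Part1 N M => x j) ∈ G' ∧ (∀ k : Part2 N M, ((fun j : Part1 N M => x j), x k) ∈ U) ∧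
      ∃ k : Part2 N M, ((fun j : Part1 N M => x j), x k) ∈ T h}
  have hpair : ∀ k : Part2 N M, Measurable fun x : Fin N → FactorRecord I F S =>
      ((fun j : Part1 N M => x j), x k) := fun k => hpart.prodMk (measurable_pi_apply _)
  have hsm : ∀ h, MeasurableSet (s h) := fun h =>
    measurableSet_setOfPred.2 ((measurableSet_setOfPred.1 (hpart (hfst hG))).and
      ((Measurable.forall fun k => measurableSet_setOfPred.1 (hpair k hUm)).and
        (Measurable.exists fun k => measurableSet_setOfPred.1 (hpair k (hTm h)))))
  refine (measure_mono (t := {ω | (fun n => (A n ω, fun i => (Z i n ω, V i n ω))) ∈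
    s fun i => H i ω}) ?_).trans ((hM.measure_le hlam hp0 hp1 hsm).trans ?_)
  · rintro ω ⟨h1, h2, h3⟩
    exact ⟨h1, fun k q => MassAtLeast.counts hη (d := fun n i => (Z i n ω, V i n ω)) h2 j₀ k q, h3⟩
  have hone : ∀ h, Measure.pi (fun n => recordLaw p h (P.map (A n))) (s h) ≤
      ∑ k : Part2 N M, ENNReal.ofReal (1 - r / 2) ^ (N - M - 1) *
        ((Measure.pi fun j : Part1 N M => recordLaw p h (P.map (A j))).prod
          (recordLaw p h (P.map (A k)))) {z | z.1 ∈ G' ∧ z ∈ T h} := by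
    intro h
    have : ∀ n, IsProbabilityMeasure (recordLaw p h (P.map (A n))) := fun n =>
      isProbabilityMeasure_recordLaw hp0 hp1 h (hM.ae_map_isColStochastic n)
    have h1 := pi_forall_exists_le (fun n => recordLaw p h (P.map (A n))) (fun _ => hUm)
      (hfst hG) (fun _ => hTm h) (ρ := ENNReal.ofReal (1 - r / 2)) fun x _ k =>
        hM.recordLaw_frequentValues_le hp0 hp1 hη hr h (x j₀).2 k
    rwa [card_part2 hMN] at h1
  refine (Finset.sum_le_sum fun h _ => mul_le_mul' le_rfl (hone h)).trans ?_
  simp only [Finset.mul_sum]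
  rw [Finset.sum_comm]
  have htwo := fun k : Part2 N M => sum_prod_recordLaw_atypical_le (x := x) hp0 hp1 hlam hlam1
    (fun j : Part1 N M => P.map (A j)) (fun j => hM.ae_map_isColStochastic _) (P.map (A k))
    (hM.ae_map_isColStochastic _) hG hGs hη.le h6 hK he
  rw [hM.pi_part1_apply hG, card_part1 hMN] at htwo
  refine (Finset.sum_le_sum fun k _ => (le_of_eq ?_).trans (mul_le_mul' (le_refl
    (ENNReal.ofReal (1 - r / 2) ^ (N - M - 1))) (htwo k))).trans (le_of_eq ?_)
  · rw [Finset.mul_sum]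
    exact Finset.sum_congr rfl fun h _ => by ring
  · rw [Finset.sum_const, Finset.card_univ, card_part2 hMN, nsmul_eq_mul, ← mul_assoc]

/-- Given the factors of the first part, it is improbable that no factor of the second part has a
row dominated by its entry `f`. -/
theorem IsModel.prob_no_dominated_le [NeZero F] (hM : IsModel P lam p A H Z V)
    (hlam : ∀ f, 0 ≤ lam f) (hlam1 : ∑ f, lam f = 1) (hp0 : 0 ≤ p) (hp1 : p ≤ 1)
    (hMN : M ≤ N) {G : Set (Part1 N M → Fin I → Fin F → ℝ)} (hG : MeasurableSet G)
    (hGs : ∀ a ∈ G, ∀ j, IsColStochastic (a j)) {t γ : ℝ} (f : Fin F)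
    (hγ : ∀ n, P.real {ω | ∀ q, ¬ IsDominated lam t (A n ω) q f} ≤ γ) :
    P {ω | (fun j : Part1 N M => A j ω) ∈ G ∧
      ∀ (k : Part2 N M) (q : Fin I), ¬ IsDominated lam t (A k ω) q f} ≤
      P {ω | (fun j : Part1 N M => A j ω) ∈ G} * ENNReal.ofReal γ ^ (N - M) := by
  have := hM.isProbabilityMeasure_map
  have hfst : Measurable fun (x : Part1 N M → FactorRecord I F S) j => (x j).1 :=
    measurable_pi_lambda _ fun j => (measurable_pi_apply j).fst
  have hpart : Measurable fun (x : Fin N → FactorRecord I F S) (j : Part1 N M) => x j :=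
    measurable_pi_lambda _ fun j => measurable_pi_apply _
  set B : Set (Fin I → Fin F → ℝ) := {a | ∀ q, ¬ IsDominated lam t a q f}
  have hBm : MeasurableSet B :=
    measurableSet_setOfPred.2 (Measurable.forall fun q =>
      (measurableSet_setOfPred.1 (measurableSet_isDominated lam t q f)).not)
  have hUm : MeasurableSet {z : (Part1 N M → FactorRecord I F S) × FactorRecord I F S |
      z.2.1 ∈ B} := measurable_snd (measurable_fst hBm)
  set s : Set (Fin N → FactorRecord I F S) := {x | (fun j : Part1 N M => x j) ∈
    {x : Part1 N M → FactorRecord I F S | (fun j => (x j).1) ∈ G} ∧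
      ∀ k : Part2 N M, ((fun j : Part1 N M => x j), x k) ∈
        {z : (Part1 N M → FactorRecord I F S) × FactorRecord I F S | z.2.1 ∈ B}}
  have hsm : MeasurableSet s := by
    refine measurableSet_setOfPred.2 ((measurableSet_setOfPred.1 (hpart (hfst hG))).and
      (Measurable.forall fun k => measurableSet_setOfPred.1 ?_))
    exact (hpart.prodMk (measurable_pi_apply _)) hUm
  refine (measure_mono (t := {ω | (fun n => factorRecord A Z V n ω) ∈ s}) ?_).trans
    (hM.measure_le_of_forall hlam hlam1 hp0 hp1 hsm fun h => ?_)
  · rintro ω ⟨h1, h2⟩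
    exact ⟨h1, fun k => h2 k⟩
  · have : ∀ n, IsProbabilityMeasure (recordLaw p h (P.map (A n))) := fun n =>
      isProbabilityMeasure_recordLaw hp0 hp1 h (hM.ae_map_isColStochastic n)
    refine (pi_forall_le _ (hfst hG) (fun _ => hUm)
      (ρ := ENNReal.ofReal γ) fun x _ k => ?_).trans ?_
    · refine (recordLaw_le hp0 hp1 (hM.ae_map_isColStochastic k) hBm).trans ?_
      rw [Measure.map_apply (hM.measurable_factor k) hBm,
        ← ENNReal.ofReal_toReal (measure_ne_top P (A k ⁻¹' B))]
      exact ENNReal.ofReal_le_ofReal (hγ k)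
    · rw [card_part2 hMN, ← hM.pi_part1_apply hG]
      exact mul_le_mul' (pi_recordLaw_fst_le hp0 hp1 _
        (fun j => hM.ae_map_isColStochastic _) hG hGs) le_rfl

end ModelEvents

/-! ### Bounds for the probabilities of the exceptional events -/

section Numerics

/-- A lower bound for the probability that a random factor has a row with entries at
most `η / 2`. -/
noncomputable def smallRowConst (F I : ℕ) (η : ℝ) : ℝ :=
  ((η / (32 * F ^ 2)) ^ (F - 1)) ^ F * ((1 / (4 * F)) ^ (F - 1)) ^ I

theorem smallRowConst_pos {F I : ℕ} (hF : 0 < F) {η : ℝ} (hη : 0 < η) :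
    0 < smallRowConst F I η := by
  have : (0 : ℝ) < F := by exact_mod_cast hF
  unfold smallRowConst
  positivity

theorem IsScaledSimplexFactor.smallRowConst_le {Ω : Type*} [MeasurableSpace Ω] {P : Measure Ω}
    [IsProbabilityMeasure P] {I F : ℕ} {A : Ω → Fin I → Fin F → ℝ}
    (hA : IsScaledSimplexFactor P A) (hF : 2 ≤ F) {η : ℝ} (hη0 : 0 < η) (hη : η ≤ 1) :
    smallRowConst F I η ≤ P.real {ω | ∃ q, ∀ f, A ω q f ≤ η / 2} := by
  obtain ⟨n, rfl⟩ : ∃ n, F = n + 1 + 1 := ⟨F - 2, by omega⟩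
  have h := hA.le_prob_small_row (τ := η / 16) (by positivity) (by linarith)
  have e : 8 * (η / 16) = η / 2 := by ring
  rw [e] at h
  refine le_trans (le_of_eq ?_) h
  unfold smallRowConst
  have e1 : n + 1 + 1 - 1 = n + 1 := rfl
  have e2 : ((n + 1 + 1 : ℕ) : ℝ) = n + 2 := by push_cast; ring
  rw [e1, e2, div_div, show (16 : ℝ) * (2 * (n + 2) ^ 2) = 32 * (n + 2) ^ 2 by ring]

theorem smallRowConst_le_one {F I : ℕ} (hF : 0 < F) {η : ℝ} (hη0 : 0 < η) (hη : η ≤ 1) :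
    smallRowConst F I η ≤ 1 := by
  have hF1 : (1 : ℝ) ≤ F := by exact_mod_cast hF
  have hF2 : (1 : ℝ) ≤ F ^ 2 := one_le_pow₀ hF1
  refine mul_le_one₀ (pow_le_one₀ (by positivity) (pow_le_one₀ (by positivity) ?_)) (by positivity)
    (pow_le_one₀ (by positivity) (pow_le_one₀ (by positivity) ?_))
  · rw [div_le_one (by positivity)]; linarith
  · rw [div_le_one (by positivity)]; linarith

/-- The bound for the rows is monotone in `η` and antitone in the number of rows. -/
theorem smallRowConst_mono {F I J : ℕ} (hF : 0 < F) (hIJ : I ≤ J) {η η' : ℝ} (hη0 : 0 < η)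
    (hη : η ≤ η') : smallRowConst F J η ≤ smallRowConst F I η' := by
  have hF1 : (1 : ℝ) ≤ F := by exact_mod_cast hF
  unfold smallRowConst
  refine mul_le_mul (pow_le_pow_left₀ (by positivity) (pow_le_pow_left₀ (by positivity)
    (div_le_div_of_nonneg_right hη (by positivity)) _) _) ?_ (by positivity)
    (pow_nonneg (pow_nonneg (div_nonneg (hη0.le.trans hη) (by positivity)) _) _)
  refine pow_le_pow_of_le_one (by positivity) (pow_le_one₀ (by positivity) ?_) hIJ
  rw [div_le_one (by positivity)]; linarith

/-- A term `(1 - r) ^ (n - 1)` beats a union bound over `n` variables, whatever `n` is. -/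
theorem natCast_mul_pow_le {r : ℝ} (hr0 : 0 < r) (hr1 : r ≤ 1) (n : ℕ) :
    n * (1 - r) ^ (n - 1) ≤ 1 / r := by
  rw [le_div_iff₀ hr0]
  have h1 : (n : ℝ) * (1 - r) ^ (n - 1) ≤ ∑ i ∈ Finset.range n, (1 - r) ^ i := by
    calc (n : ℝ) * (1 - r) ^ (n - 1) = ∑ _i ∈ Finset.range n, (1 - r) ^ (n - 1) := by simp
      _ ≤ _ := Finset.sum_le_sum fun i hi => pow_le_pow_of_le_one (by linarith) (by linarith) (by
          have := Finset.mem_range.1 hi; omega)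
  have h2 := mul_neg_geom_sum (1 - r) n
  have h3 : 0 ≤ (1 - r) ^ n := pow_nonneg (by linarith) _
  have h4 := mul_le_mul_of_nonneg_right h1 hr0.le
  have e : 1 - (1 - r) = r := by ring
  rw [e] at h2
  linarith

theorem one_half_le_log_one_div {δ : ℝ} (hδ0 : 0 < δ) (hδ : δ ≤ 1 / 2) :
    1 / 2 ≤ Real.log (1 / δ) := by
  have h1 : Real.log 2 ≤ Real.log (1 / δ) :=
    Real.log_le_log two_pos (by rw [le_div_iff₀ hδ0]; linarith)
  have := Real.log_two_gt_d9
  linarith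

/-- The constant in the exponent of the bounds for the probabilities of atypical records. -/
noncomputable def recordConst (F : ℕ) : ℝ := 3072 * (36 * F ^ 2)

/-- For small `η`, the probability of atypical records is negligible compared with the probability
that a random factor has a row so small that the mass condition is likely to fail. -/
theorem exists_exceptional_le {F : ℕ} (hF : 2 ≤ F) : ∃ s₀ : ℝ, 0 < s₀ ∧ s₀ ≤ 1 ∧
    ∀ {I M : ℕ} {δ η K : ℝ}, 0 < I → 0 < δ → δ ≤ 1 / 2 → 0 < η → Real.sqrt η ≤ s₀ →
      K = I * Real.log (1 / δ) / η / recordConst F → M ≤ K →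
      4 / smallRowConst F I η * ((1 + I * F + M + I) * Real.exp (-(5 / 6 * K))) ≤ δ := by
  have hF2 : (2 : ℝ) ≤ F := by exact_mod_cast hF
  have hFF : ((F : ℝ) - 1) ≤ F := by linarith
  set c : ℝ := 64 * F ^ 4 + 12 * F ^ 2 + 2 * F + 11 with hc
  have hΦ : 0 < recordConst F := by unfold recordConst; positivity
  refine ⟨min 1 (2 / (3 * (recordConst F * c))), by positivity, min_le_left _ _, ?_⟩
  intro I M δ η K hI hδ0 hδ hη hs hK hMK
  have hI1 : (1 : ℝ) ≤ I := by exact_mod_cast hI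
  set L := Real.log (1 / δ) with hL
  have hL1 : 1 / 2 ≤ L := one_half_le_log_one_div hδ0 hδ
  set s := Real.sqrt η
  have hs0 : 0 < s := Real.sqrt_pos.2 hη
  have hs1 : s ≤ 1 := hs.trans (min_le_left _ _)
  have hs2 : s ^ 2 = η := Real.sq_sqrt hη.le
  set Y := I * L / η with hY
  set X := s * Y with hX
  have hsX : s * X = I * L := by
    rw [hX, hY, ← hs2]; field_simp
  have hX0 : 0 ≤ X := by positivity
  have hsXX : s * X ≤ X := mul_le_of_le_one_left hX0 hs1
  have hIL : (I : ℝ) / 2 ≤ I * L := by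
    have := mul_le_mul_of_nonneg_left hL1 (show (0 : ℝ) ≤ I by linarith)
    linarith
  have hLX : L ≤ X := by
    have : L ≤ I * L := le_mul_of_one_le_left (by linarith) hI1
    linarith
  have hIX : (I : ℝ) ≤ 2 * X := by linarith
  have hsX' : 1 / s ≤ 2 * X := by
    rw [div_le_iff₀ hs0]; linarith
  have h1X : 1 ≤ 2 * X := by linarith
  have hKX : c * X ≤ 2 / 3 * K := by
    have h1 : s ≤ 2 / (3 * (recordConst F * c)) := hs.trans (min_le_right _ _)
    rw [le_div_iff₀ (by positivity)] at h1
    have hY0 : 0 ≤ Y := by positivity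
    have h2 := mul_le_mul_of_nonneg_right h1 hY0
    rw [hK]
    have e : 2 / 3 * (Y / recordConst F) = 2 * Y / 3 / recordConst F := by ring
    rw [e, le_div_iff₀ hΦ, hX]
    linarith
  have hexp : ∀ x : ℝ, x ≤ Real.exp x := fun x => by
    have := Real.add_one_le_exp x; linarith
  have hr0 := smallRowConst_pos (F := F) (I := I) (by omega) hη
  -- reciprocals of the two factors of `smallRowConst`
  have h1 : 1 / ((η / (32 * (F : ℝ) ^ 2)) ^ (F - 1)) ^ F ≤
      Real.exp ((64 * F ^ 4 + 4 * F ^ 2) * X) := by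
    have h2 : 1 / η ≤ Real.exp (4 * X) := by
      rw [← hs2, ← one_div_pow]
      refine (pow_le_pow_left₀ (by positivity) ((hexp _).trans (Real.exp_le_exp.2 hsX')) 2).trans
        (le_of_eq ?_)
      rw [← Real.exp_nat_mul]; congr 1; push_cast; ring
    have h3 : 32 * (F : ℝ) ^ 2 ≤ Real.exp (64 * F ^ 2 * X) := by
      refine (hexp _).trans (Real.exp_le_exp.2 ?_)
      have := mul_le_mul_of_nonneg_left h1X (show (0 : ℝ) ≤ 32 * F ^ 2 by positivity)
      linarith
    have h4 : 1 / (η / (32 * (F : ℝ) ^ 2)) ≤ Real.exp ((64 * F ^ 2 + 4) * X) := by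
      have e : 1 / (η / (32 * (F : ℝ) ^ 2)) = 32 * F ^ 2 * (1 / η) := by field_simp
      rw [e]
      refine (mul_le_mul h3 h2 (by positivity) (by positivity)).trans (le_of_eq ?_)
      rw [← Real.exp_add]; congr 1; ring
    rw [← one_div_pow, ← one_div_pow, ← pow_mul]
    refine (pow_le_pow_left₀ (by positivity) h4 _).trans ?_
    rw [← Real.exp_nat_mul]
    apply Real.exp_le_exp.2
    have h5 : (((F - 1) * F : ℕ) : ℝ) ≤ F ^ 2 := by
      rw [Nat.cast_mul, Nat.cast_pred (by omega)]
      nlinarith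
    refine (mul_le_mul_of_nonneg_right h5 (by positivity)).trans (le_of_eq ?_)
    ring
  have h2 : 1 / ((1 / (4 * (F : ℝ))) ^ (F - 1)) ^ I ≤ Real.exp (8 * F ^ 2 * X) := by
    rw [← one_div_pow, ← one_div_pow, ← pow_mul, one_div_one_div]
    refine (pow_le_pow_left₀ (by positivity) (hexp _) _).trans ?_
    rw [← Real.exp_nat_mul]
    apply Real.exp_le_exp.2
    have h5 : (((F - 1) * I : ℕ) : ℝ) ≤ F * (2 * X) := by
      rw [Nat.cast_mul, Nat.cast_pred (by omega)]
      exact mul_le_mul hFF hIX (by positivity) (by positivity)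
    refine (mul_le_mul_of_nonneg_right h5 (by positivity)).trans (le_of_eq ?_)
    ring
  have h3 : 1 / smallRowConst F I η ≤ Real.exp ((64 * F ^ 4 + 12 * F ^ 2) * X) := by
    unfold smallRowConst
    rw [one_div, mul_inv, ← one_div, ← one_div]
    refine (mul_le_mul h1 h2 (by positivity) (by positivity)).trans (le_of_eq ?_)
    rw [← Real.exp_add]; congr 1; ring
  have he2 : (6 : ℝ) ≤ Real.exp (4 * X) := by
    have h4 : (6 : ℝ) ≤ Real.exp 2 := by
      have h5 := Real.exp_one_gt_d9
      have h6 : Real.exp 2 = Real.exp 1 ^ 2 := by rw [← Real.exp_nat_mul]; norm_num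
      rw [h6]; nlinarith
    exact h4.trans (Real.exp_le_exp.2 (by linarith))
  have hK0 : 0 ≤ K := le_trans (Nat.cast_nonneg M) hMK
  have h4 : (1 + I * F + M + I : ℝ) ≤ Real.exp (4 * X + K / 6 + 2 * (F + 1) * X) := by
    have h5 : (1 + M : ℝ) ≤ Real.exp (4 * X) * Real.exp (K / 6) := by
      have h6 := Real.add_one_le_exp (K / 6)
      have h7 := mul_le_mul he2 h6 (by positivity) (by positivity)
      linarith
    have h6 : (1 + I * (F + 1) : ℝ) ≤ Real.exp (2 * (F + 1) * X) := by
      have h7 := Real.add_one_le_exp ((I : ℝ) * (F + 1))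
      have h8 := mul_le_mul_of_nonneg_right hIX (show (0 : ℝ) ≤ F + 1 by positivity)
      have h9 : Real.exp ((I : ℝ) * (F + 1)) ≤ Real.exp (2 * (F + 1) * X) :=
        Real.exp_le_exp.2 (by linarith)
      linarith
    rw [Real.exp_add, Real.exp_add]
    refine le_trans ?_ (mul_le_mul h5 h6 (by positivity) (by positivity))
    have : (0 : ℝ) ≤ M * (I * (F + 1)) := by positivity
    linarith
  have h5 : (4 : ℝ) ≤ Real.exp (4 * X) := by linarith
  have hδe : δ = Real.exp (-L) := by
    rw [hL, one_div, Real.log_inv, neg_neg, Real.exp_log hδ0]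
  calc 4 / smallRowConst F I η * ((1 + I * F + M + I) * Real.exp (-(5 / 6 * K)))
      = 4 * (1 / smallRowConst F I η) * ((1 + I * F + M + I) * Real.exp (-(5 / 6 * K))) := by ring
    _ ≤ Real.exp (4 * X) * Real.exp ((64 * F ^ 4 + 12 * F ^ 2) * X) *
        (Real.exp (4 * X + K / 6 + 2 * (F + 1) * X) * Real.exp (-(5 / 6 * K))) :=
        mul_le_mul (mul_le_mul h5 h3 (by positivity) (by positivity))
          (mul_le_mul_of_nonneg_right h4 (by positivity)) (by positivity) (by positivity)
    _ = Real.exp ((c - 1) * X - 2 / 3 * K) := by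
        rw [← Real.exp_add, ← Real.exp_add, ← Real.exp_add, hc]; congr 1; ring
    _ ≤ δ := by
        rw [hδe]
        apply Real.exp_le_exp.2
        linarith

/-- The bound for the probability of atypical records, from lower bounds for the exponents. -/
theorem atypical_bound_le {F I M S : ℕ} {p η K e x : ℝ} (hp0 : 0 ≤ p) (hp1 : p ≤ 1)
    (hη : η ≤ 1) (hK : 16 * K ≤ η * (p ^ 2 * S)) (hMK : M ≤ K) (hx : K ≤ e * x / 2) :
    (Real.exp (-(p * S / 8)) + I * F * Real.exp (-(e * x / 2))) +
      (M * Real.exp (-(p ^ 2 * S / 16)) + I * Real.exp (-K + M / 6)) ≤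
      (1 + I * F + M + I) * Real.exp (-(5 / 6 * K)) := by
  have h1 : p ^ 2 * S ≤ p * S :=
    mul_le_mul_of_nonneg_right (by nlinarith) (Nat.cast_nonneg S)
  have h0 : 0 ≤ p ^ 2 * S := by positivity
  have h2 : η * (p ^ 2 * S) ≤ p ^ 2 * S := mul_le_of_le_one_left h0 hη
  have e1 : Real.exp (-(p * S / 8)) ≤ Real.exp (-(5 / 6 * K)) := Real.exp_le_exp.2 (by linarith)
  have e2 : Real.exp (-(e * x / 2)) ≤ Real.exp (-(5 / 6 * K)) := Real.exp_le_exp.2 (by linarith)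
  have e3 : Real.exp (-(p ^ 2 * S / 16)) ≤ Real.exp (-(5 / 6 * K)) :=
    Real.exp_le_exp.2 (by linarith)
  have e4 : Real.exp (-K + M / 6) ≤ Real.exp (-(5 / 6 * K)) := Real.exp_le_exp.2 (by linarith)
  have f2 := mul_le_mul_of_nonneg_left e2 (show (0 : ℝ) ≤ I * F by positivity)
  have f3 := mul_le_mul_of_nonneg_left e3 (Nat.cast_nonneg (α := ℝ) M)
  have f4 := mul_le_mul_of_nonneg_left e4 (Nat.cast_nonneg (α := ℝ) I)
  linarith

end Numerics

/-! ### Factors for which the asserted bound is not trivial -/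

section CriticalFactors

variable {N M I F S : ℕ} {CN p δ η : ℝ}

theorem MassAtLeast.mul_le_one (hη : 0 < η) {d : Fin N → Fin S → Fin I × Bool}
    (h : MassAtLeast M η (recordSamples d)) (j : Part1 N M) (k : Part2 N M) (hI : 0 < I) :
    I * η ≤ 1 := by
  have h1 : (0 : ℝ) < pairCount (d j) (d k) := by
    exact_mod_cast (h.counts hη j k ⟨0, hI⟩).1
  have h2 : ∑ q : Fin I, ((levelSet (d k) q).filter fun s => (d j s).2 = true).card =
      pairCount (d j) (d k) := by
    unfold pairCount
    rw [Finset.card_eq_sum_card_fiberwise (f := fun s => (d k s).1) (t := Finset.univ)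
      fun _ _ => Finset.mem_coe.2 (Finset.mem_univ _)]
    refine Finset.sum_congr rfl fun q _ => congrArg _ ?_
    ext s
    simp only [levelSet, viewSet, Finset.mem_filter, Finset.mem_univ, true_and, Prod.ext_iff]
    tauto
  have h3 : ∑ _q : Fin I, η * pairCount (d j) (d k) ≤ pairCount (d j) (d k) := by
    calc _ ≤ ∑ q : Fin I, (((levelSet (d k) q).filter fun s => (d j s).2 = true).card : ℝ) :=
          Finset.sum_le_sum fun q _ => (h.counts hη j k q).2
      _ = pairCount (d j) (d k) := by exact_mod_cast h2
  rw [Finset.sum_const, Finset.card_univ, Fintype.card_fin, nsmul_eq_mul, ← mul_assoc] at h3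
  exact le_of_mul_le_mul_right (by linarith) h1

/-- The factors of the first part, stacked on top of each other. -/
def stackedPart (a : Part1 N M → Fin I → Fin F → ℝ) : Matrix (Part1 N M × Fin I) (Fin F) ℝ :=
  Matrix.of fun r f => a r.1 r.2 f

/-- The factors of the first part which satisfy the size requirements with constants `1` and `CN`,
and for which the error bound with constant `1000` is smaller than the trivial bound `2 √F`. -/
def CriticalFactors (CN : ℝ) (N M I F S : ℕ) (p δ η : ℝ) :
    Set (Part1 N M → Fin I → Fin F → ℝ) :=
  {a | (∀ j, IsColStochastic (a j)) ∧ SizeConditions 1 CN N M I S p δ η (stackedPart a) ∧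
    1000 * (condNumber (stackedPart a) ^ 2 * (sigmaMax (stackedPart a) *
      sepEps F M (condNumber (stackedPart a)))) < 2 ∧
    250000 * (condNumber (stackedPart a) ^ 4 * (M ^ 2 * (I * Real.log (1 / δ)))) ≤
      η ^ 2 * (p ^ 2 * S)}

theorem measurable_sigmaMax_stackedPart [NeZero F] :
    Measurable fun a : Part1 N M → Fin I → Fin F → ℝ => sigmaMax (stackedPart a) := by
  refine Continuous.measurable (continuous_sigmaMax.comp ?_)
  unfold stackedPart
  exact continuous_pi fun r => continuous_pi fun f => by
    change Continuous fun a : Part1 N M → Fin I → Fin F → ℝ => a r.1 r.2 f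
    fun_prop

theorem measurable_sigmaMin_stackedPart [NeZero F] :
    Measurable fun a : Part1 N M → Fin I → Fin F → ℝ => sigmaMin (stackedPart a) := by
  refine Continuous.measurable (continuous_sigmaMin.comp ?_)
  unfold stackedPart
  exact continuous_pi fun r => continuous_pi fun f => by
    change Continuous fun a : Part1 N M → Fin I → Fin F → ℝ => a r.1 r.2 f
    fun_prop

theorem measurable_condNumber_stackedPart [NeZero F] :
    Measurable fun a : Part1 N M → Fin I → Fin F → ℝ => condNumber (stackedPart a) :=
  measurable_sigmaMax_stackedPart.div measurable_sigmaMin_stackedPart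

theorem measurable_sepEps (F M : ℕ) : Measurable (sepEps F M) := by
  unfold sepEps
  fun_prop

theorem measurableSet_criticalFactors [NeZero F] :
    MeasurableSet (CriticalFactors CN N M I F S p δ η) := by
  have h1 := measurable_sigmaMax_stackedPart (N := N) (M := M) (I := I) (F := F)
  have h2 := measurable_sigmaMin_stackedPart (N := N) (M := M) (I := I) (F := F)
  have h3 := measurable_condNumber_stackedPart (N := N) (M := M) (I := I) (F := F)
  have h4 := (measurable_sepEps F M).comp h3
  refine measurableSet_setOfPred.2 (.and ?_ (.and (.and ?_ (.and ?_ ?_)) (.and ?_ ?_)))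
  · exact Measurable.forall fun j =>
      (measurableSet_setOfPred.1 measurableSet_isColStochastic).comp (measurable_pi_apply j)
  · exact measurableSet_setOfPred.1 (measurableSet_lt measurable_const h2)
  · exact measurableSet_setOfPred.1 (measurableSet_le ((measurable_const.div
      ((((h1.pow_const 2).mul_const _).mul (h4.pow_const 2)).mul_const _)).const_mul 1)
      measurable_const)
  · exact measurableSet_setOfPred.1 (measurableSet_le (((((measurable_const.div h4).pow_const
      _).div_const _).mul_const _).const_mul CN |>.const_add _) measurable_const)
  · exact measurableSet_setOfPred.1 (measurableSet_lt
      (((h3.pow_const 2).mul (h1.mul h4)).const_mul 1000) measurable_const)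
  · exact measurableSet_setOfPred.1 (measurableSet_le
      (((h3.pow_const 4).mul_const _).const_mul 250000) measurable_const)

/-- If the asserted bound fails, then the factors are critical. -/
theorem mem_criticalFactors [NeZero F] {A : Fin N → Fin I → Fin F → ℝ}
    (hA : ∀ n, IsColStochastic (A n)) (hp : 0 < p) (hη : 0 < η) (hS : 0 < S)
    {D : Fin S → Fin N → Option (Fin I)} (hδ0 : 0 < δ) (hδ : δ ≤ 1)
    (hsize : SizeConditions 1 CN N M I S p δ η (stackedFactor M A))
    (hbad : ¬ SPAErrorAtMost M D A (1000 * (condNumber (stackedFactor M A) ^ 2 * Real.sqrt F *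
      spaZeta M I S p δ η (sigmaMax (stackedFactor M A))
        (sepEps F M (condNumber (stackedFactor M A)))))) :
    (fun j : Part1 N M => A j) ∈ CriticalFactors CN N M I F S p δ η := by
  have hF0 : (0 : ℝ) < F := by exact_mod_cast NeZero.pos F
  have hsF : 0 < Real.sqrt F := Real.sqrt_pos.2 hF0
  have hS0 : (0 : ℝ) < S := by exact_mod_cast hS
  have hL : 0 ≤ Real.log (1 / δ) := Real.log_nonneg (by rw [le_div_iff₀ hδ0]; linarith)
  have hκ := one_le_condNumber hsize.1
  set κ := condNumber (stackedFactor M A)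
  set σ := sigmaMax (stackedFactor M A)
  set ζ := spaZeta M I S p δ η σ (sepEps F M κ)
  have h1 : 1000 * (κ ^ 2 * ζ) < 2 := by
    by_contra hcon
    refine hbad (spaErrorAtMost_of_two_mul_sqrt_le hA ?_)
    have := mul_le_mul_of_nonneg_right (not_lt.1 hcon) hsF.le
    linarith
  refine ⟨fun j => hA j, hsize, ?_, ?_⟩
  · refine lt_of_le_of_lt ?_ h1
    exact mul_le_mul_of_nonneg_left (mul_le_mul_of_nonneg_left (le_max_left _ _) (by positivity))
      (by norm_num)
  · change 250000 * (κ ^ 4 * (M ^ 2 * (I * Real.log (1 / δ)))) ≤ η ^ 2 * (p ^ 2 * S)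
    have h2 : 1000 * (κ ^ 2 * (M * Real.sqrt (I * Real.log (1 / δ)) / (η * p * Real.sqrt S))) ≤ 2 :=
      le_trans (mul_le_mul_of_nonneg_left (mul_le_mul_of_nonneg_left (le_max_right _ _)
        (by positivity)) (by norm_num)) h1.le
    have h3 : 0 < η * p * Real.sqrt S := mul_pos (mul_pos hη hp) (Real.sqrt_pos.2 hS0)
    rw [mul_div_assoc', mul_div_assoc', div_le_iff₀ h3] at h2
    have h4 : 500 * (κ ^ 2 * (M * Real.sqrt (I * Real.log (1 / δ)))) ≤ η * p * Real.sqrt S := by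
      linarith
    have h5 := pow_le_pow_left₀ (by positivity) h4 2
    rw [mul_pow, mul_pow, mul_pow, mul_pow, mul_pow, Real.sq_sqrt (by positivity),
      Real.sq_sqrt hS0.le] at h5
    linarith

/-- Critical factors are ill-conditioned. -/
theorem sigmaMin_le_of_critical (hF : 2 ≤ F) (hM : 0 < M)
    {B : Matrix (Part1 N M × Fin I) (Fin F) ℝ} (hs : 0 < sigmaMin B)
    (hT : 1000 * (condNumber B ^ 2 * (sigmaMax B * sepEps F M (condNumber B))) < 2) :
    sigmaMin B ≤ 2 * Real.sqrt F / M := by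
  have hM0 : (0 : ℝ) < M := by exact_mod_cast hM
  have hF0 : (2 : ℝ) ≤ F := by exact_mod_cast hF
  have hsF : 0 < Real.sqrt F := Real.sqrt_pos.2 (by linarith)
  have hκ := one_le_condNumber hs
  rw [sigmaMax_mul_sepEps hs] at hT
  set κ := condNumber B with hκd
  have hκ2 : 1 ≤ κ ^ 2 := one_le_pow₀ hκ
  have h1 : M * sepFactor F * sigmaMin B < 1 / 2 := by
    rw [mul_div_assoc', mul_div_assoc', div_lt_iff₀ (by positivity)] at hT
    have h2 : κ ^ 2 * (1000 * (M * sepFactor F * sigmaMin B)) < κ ^ 2 * (1000 * (1 / 2)) := by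
      linarith
    have h3 := lt_of_mul_lt_mul_left h2 (by positivity)
    linarith
  have h2 := le_sepFactor hF
  have h3 : M * (1 / (4 * Real.sqrt F)) * sigmaMin B ≤ M * sepFactor F * sigmaMin B :=
    mul_le_mul_of_nonneg_right (mul_le_mul_of_nonneg_left h2 hM0.le) hs.le
  have h4 : M * (1 / (4 * Real.sqrt F)) * sigmaMin B = M * sigmaMin B / (4 * Real.sqrt F) := by
    field_simp
  rw [h4] at h3
  have h5 := lt_of_le_of_lt h3 h1
  rw [div_lt_iff₀ (by positivity)] at h5
  rw [le_div_iff₀ hM0]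
  linarith

/-- The condition numbers of a family of critical factors can be replaced by a common upper bound
that satisfies the same requirements. -/
theorem exists_common_condNumber (hF : 2 ≤ F) (hM : 0 < M) (hI : 0 < I) (hδ0 : 0 < δ)
    (hδ : δ ≤ 1 / 2) {T : Set ℝ} (hT : T.Nonempty) (h1 : ∀ k ∈ T, 1 ≤ k)
    (h2 : ∀ k ∈ T, k ^ 2 * sepEps F M k ≤ 1 / 4)
    (h3 : ∀ k ∈ T, 250000 * (k ^ 4 * (M ^ 2 * (I * Real.log (1 / δ)))) ≤ η ^ 2 * (p ^ 2 * S))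
    (h4 : ∀ k ∈ T, M + CN * ((1 / sepEps F M k) ^ (2 * (F - 1)) / (I * F) * Real.log (F / δ)) ≤ N) :
    ∃ k₀, 1 ≤ k₀ ∧ (∀ k ∈ T, k ≤ k₀) ∧ k₀ ^ 2 * sepEps F M k₀ ≤ 1 / 4 ∧
      250000 * (k₀ ^ 4 * (M ^ 2 * (I * Real.log (1 / δ)))) ≤ η ^ 2 * (p ^ 2 * S) ∧
      M + CN * ((1 / sepEps F M k₀) ^ (2 * (F - 1)) / (I * F) * Real.log (F / δ)) ≤ N := by
  have hL := one_half_le_log_one_div hδ0 hδ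
  have hcont : ContinuousOn (sepEps F M) (Set.Ici 1) := by
    unfold sepEps
    refine ContinuousOn.div (by fun_prop) (by fun_prop) fun k hk => ?_
    have : (1 : ℝ) ≤ k := hk
    positivity
  have hcont' : ContinuousOn (fun k => 1 / sepEps F M k) (Set.Ici 1) :=
    ContinuousOn.div continuousOn_const hcont fun k hk =>
      (sepEps_pos hF hM (lt_of_lt_of_le one_pos hk)).ne'
  have hbdd : BddAbove T := by
    refine ⟨1 + η ^ 2 * (p ^ 2 * S) / (250000 * (M ^ 2 * (I * Real.log (1 / δ)))), fun k hk => ?_⟩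
    have h5 := h3 k hk
    have h6 : k ≤ k ^ 4 := le_self_pow₀ (h1 k hk) (by norm_num)
    have h7 : k ^ 4 ≤ η ^ 2 * (p ^ 2 * S) / (250000 * (M ^ 2 * (I * Real.log (1 / δ)))) := by
      rw [le_div_iff₀ (by positivity)]
      linarith
    linarith
  have hclosed : ∀ {g : ℝ → ℝ}, ContinuousOn g (Set.Ici 1) → ∀ {c : ℝ}, (∀ k ∈ T, g k ≤ c) →
      g (sSup T) ≤ c := by
    intro g hg c hgc
    have h5 : IsClosed (Set.Ici 1 ∩ g ⁻¹' Set.Iic c) :=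
      hg.preimage_isClosed_of_isClosed isClosed_Ici isClosed_Iic
    have h6 : T ⊆ Set.Ici 1 ∩ g ⁻¹' Set.Iic c := fun k hk => ⟨h1 k hk, hgc k hk⟩
    exact (closure_minimal h6 h5 (csSup_mem_closure hT hbdd)).2
  refine ⟨sSup T, ?_, fun k hk => le_csSup hbdd hk, hclosed ?_ h2, hclosed ?_ h3, hclosed ?_ h4⟩
  · obtain ⟨k, hk⟩ := hT
    exact (h1 k hk).trans (le_csSup hbdd hk)
  · exact (continuousOn_id.pow 2).mul hcont
  · fun_prop
  · exact continuousOn_const.add (continuousOn_const.mul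
      (((hcont'.pow _).div_const _).mul continuousOn_const))

end CriticalFactors

/-! ### The failure probability -/

section FailureProbability

open scoped ENNReal

/-- The number of variables in the second part makes it unlikely that, for some `f`, none of the
factors has a row dominated by its entry `f`. -/
theorem card_mul_no_dominated_le {N M I F : ℕ} {CN δ b k : ℝ} (hF : 2 ≤ F) (hM : 0 < M)
    (hMN : M ≤ N) (hI : 0 < I) (hδ0 : 0 < δ) (hδ : δ ≤ 1 / 2) (hb : 0 < b)
    (hCN : 2 * F / vertexConst F * (1728 * F ^ 2 / b) ^ (F - 1) ≤ CN) (hk : 1 ≤ k)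
    (hkε : k ^ 2 * sepEps F M k ≤ 1 / 4)
    (hN : M + CN * ((1 / sepEps F M k) ^ (2 * (F - 1)) / (I * F) * Real.log (F / δ)) ≤ N) :
    F * Real.exp (-(vertexConst F * I * (nearLevel F k / 8 * b / 2 / F) ^ (F - 1))) ^ (N - M) ≤
      δ / 2 := by
  have : NeZero F := ⟨by omega⟩
  have hF0 : (2 : ℝ) ≤ F := by exact_mod_cast hF
  have hv := vertexConst_pos (F := F)
  set ε := sepEps F M k
  have hε0 : 0 < ε := sepEps_pos hF hM (by linarith)
  set ℓ := Real.log (F / δ) with hℓ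
  have hℓ0 : 0 ≤ ℓ := Real.log_nonneg (by rw [le_div_iff₀ hδ0]; linarith)
  have hk3 : 16 * k ^ 3 ≤ (1 / ε) ^ 2 := by
    have h1 : 4 * k ^ 2 ≤ 1 / ε := by
      rw [le_div_iff₀ hε0]; linarith
    have h2 := pow_le_pow_left₀ (by positivity) h1 2
    have h3 : k ^ 3 ≤ k ^ 4 := pow_le_pow_right₀ hk (by norm_num)
    linarith
  set y := nearLevel F k / 8 * b / 2 / F with hy
  have hy0 : 0 < y := by
    rw [hy]; unfold nearLevel; positivity
  have hyk : b / (1728 * F ^ 2) ≤ (1 / ε) ^ 2 * y := by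
    refine le_trans (le_of_eq ?_) (mul_le_mul_of_nonneg_right hk3 hy0.le)
    rw [hy]; unfold nearLevel
    field_simp
    norm_num
  have hNM : CN * ((1 / ε) ^ (2 * (F - 1)) / (I * F) * ℓ) ≤ ((N - M : ℕ) : ℝ) := by
    rw [Nat.cast_sub hMN]; linarith
  have hexp : 2 * ℓ ≤ ((N - M : ℕ) : ℝ) * (vertexConst F * I * y ^ (F - 1)) := by
    refine le_trans ?_ (mul_le_mul_of_nonneg_right hNM (by positivity))
    have e : CN * ((1 / ε) ^ (2 * (F - 1)) / (I * F) * ℓ) * (vertexConst F * I * y ^ (F - 1)) =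
        CN * (vertexConst F / F * ((1 / ε) ^ 2 * y) ^ (F - 1)) * ℓ := by
      rw [pow_mul, mul_pow]
      field_simp
    rw [e]
    refine mul_le_mul_of_nonneg_right ?_ hℓ0
    have h1 : vertexConst F / F * (b / (1728 * F ^ 2)) ^ (F - 1) ≤
        vertexConst F / F * ((1 / ε) ^ 2 * y) ^ (F - 1) :=
      mul_le_mul_of_nonneg_left (pow_le_pow_left₀ (by positivity) hyk _) (by positivity)
    have h2 : 0 < vertexConst F / F * (b / (1728 * (F : ℝ) ^ 2)) ^ (F - 1) := by positivity
    refine le_trans (le_of_eq ?_) (mul_le_mul hCN h1 h2.le (le_trans (by positivity) hCN))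
    have h3 : (1728 * (F : ℝ) ^ 2 / b) ^ (F - 1) * (b / (1728 * F ^ 2)) ^ (F - 1) = 1 := by
      rw [← mul_pow, div_mul_div_cancel₀' (by positivity), div_self (by positivity), one_pow]
    have e2 : 2 * F / vertexConst F * (1728 * (F : ℝ) ^ 2 / b) ^ (F - 1) *
        (vertexConst F / F * (b / (1728 * F ^ 2)) ^ (F - 1)) =
        2 * F / vertexConst F * (vertexConst F / F) *
        ((1728 * (F : ℝ) ^ 2 / b) ^ (F - 1) * (b / (1728 * F ^ 2)) ^ (F - 1)) := by ring
    rw [e2, h3]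
    field_simp
  rw [← Real.exp_nat_mul]
  have h1 : Real.exp (((N - M : ℕ) : ℝ) * -(vertexConst F * I * y ^ (F - 1))) ≤
      Real.exp (-(2 * ℓ)) := Real.exp_le_exp.2 (by linarith)
  have h2 : Real.exp (-(2 * ℓ)) = (δ / F) ^ 2 := by
    rw [show -(2 * ℓ) = (2 : ℕ) * (-ℓ) by push_cast; ring, Real.exp_nat_mul, hℓ, ← Real.log_inv,
      Real.exp_log (by positivity), inv_div]
  rw [h2] at h1
  refine (mul_le_mul_of_nonneg_left h1 (by positivity)).trans ?_
  rw [show (F : ℝ) * (δ / F) ^ 2 = δ * (δ / F) by field_simp]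
  have h3 : δ / F ≤ 1 / 2 := by
    rw [div_le_iff₀ (by positivity)]; linarith
  have := mul_le_mul_of_nonneg_left h3 hδ0.le
  linarith

variable {Ω : Type*} [MeasurableSpace Ω] {P : Measure Ω} [IsProbabilityMeasure P]
  {N M I F S : ℕ} {lam : Fin F → ℝ} {p δ η CN : ℝ} {A : Fin N → Ω → Fin I → Fin F → ℝ}
  {H : Fin S → Ω → Fin F} {Z : Fin S → Fin N → Ω → Fin I} {V : Fin S → Fin N → Ω → Bool}

/-- If `η` is bounded below, then the number `I` of rows is bounded by the mass condition, and the
size requirements for `N` make the mass condition improbable. -/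
theorem IsModel.prob_critical_mass_le [NeZero F] (hM : IsModel P lam p A H Z V) (hF : 2 ≤ F)
    (hlam : ∀ f, 0 ≤ lam f) (hlam1 : ∑ f, lam f = 1) (hp0 : 0 ≤ p) (hp1 : p ≤ 1) (hM0 : 0 < M)
    (hMN : M ≤ N) (hI : 0 < I) (hδ0 : 0 < δ) (hδ : δ ≤ 1 / 2) {η₀ : ℝ} (hη₀ : 0 < η₀)
    (hη : η₀ ≤ η) (hIη : I * η ≤ 1)
    (hCN : 2 * F / (η₀ ^ F * smallRowConst F ⌈1 / η₀⌉₊ η₀) ≤ CN) :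
    P {ω | (fun j : Part1 N M => A j ω) ∈ CriticalFactors CN N M I F S p δ η ∧
      MassAtLeast M η (samples Z V ω)} ≤ ENNReal.ofReal δ *
        P {ω | (fun j : Part1 N M => A j ω) ∈ CriticalFactors CN N M I F S p δ η} := by
  set G : Set (Part1 N M → Fin I → Fin F → ℝ) := CriticalFactors CN N M I F S p δ η
  rcases G.eq_empty_or_nonempty with h0 | ⟨a, ha⟩
  · rw [h0]; simp
  have hF0 : (2 : ℝ) ≤ F := by exact_mod_cast hF
  have hI1 : (1 : ℝ) ≤ I := by exact_mod_cast hI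
  have hM1 : (1 : ℝ) ≤ M := by exact_mod_cast hM0
  have hη0 : 0 < η := hη₀.trans_le hη
  have hη1 : η ≤ 1 := le_trans (le_mul_of_one_le_left hη0.le hI1) hIη
  set j₀ : Part1 N M := ⟨⟨0, hM0.trans_le hMN⟩, hM0⟩
  set r := smallRowConst F ⌈1 / η₀⌉₊ η₀
  have hr0 : 0 < r := smallRowConst_pos (by omega) hη₀
  have hr1 : r ≤ 1 := smallRowConst_le_one (by omega) hη₀ (hη.trans hη1)
  have hIceil : I ≤ ⌈1 / η₀⌉₊ := by
    have h1 : (I : ℝ) ≤ 1 / η₀ := by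
      rw [le_div_iff₀ hη₀]
      exact le_trans (mul_le_mul_of_nonneg_left hη (by positivity)) hIη
    exact_mod_cast h1.trans (Nat.le_ceil _)
  have hrow : ∀ n, r ≤ P.real {ω | ∃ q, ∀ f, A n ω q f ≤ η / 2} := fun n =>
    (smallRowConst_mono (by omega) hIceil hη₀ hη).trans
      ((hM.law_factor n).smallRowConst_le hF hη0 hη1)
  refine (hM.prob_mass_le hlam hlam1 hp0 hp1 hMN measurableSet_criticalFactors
    (fun a ha => ha.1) hη0 hrow j₀).trans ?_
  rw [mul_comm]
  refine mul_le_mul' ?_ le_rfl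
  rw [← ENNReal.ofReal_pow (by linarith)]
  refine ENNReal.ofReal_le_ofReal ?_
  obtain ⟨hcol, ⟨hs, -, hN⟩, hT, -⟩ := ha
  have hκ := one_le_condNumber hs
  set κ := condNumber (stackedPart a)
  set ε := sepEps F M κ
  have hε0 : 0 < ε := sepEps_pos hF hM0 (by linarith)
  have hεη : η₀ ≤ (1 / ε) ^ 2 := by
    have h1 : Real.sqrt (M * F / I) ≤ sigmaMax (stackedPart a) := by
      set a' : Fin N → Fin I → Fin F → ℝ := fun n => if h : (n : ℕ) < M then a ⟨n, h⟩ else a j₀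
        with ha'
      have h2 : stackedPart a = stackedFactor M a' := by
        ext r f
        simp only [stackedPart, stackedFactor, Matrix.of_apply, ha']
        rw [dif_pos r.1.2]
      rw [h2]
      refine le_sigmaMax_stackedFactor hMN fun n => ?_
      rw [ha']
      dsimp only
      split_ifs <;> exact hcol _
    have h2 : Real.sqrt η₀ ≤ Real.sqrt (M * F / I) := by
      refine Real.sqrt_le_sqrt ?_
      rw [le_div_iff₀ (by positivity)]
      have h3 : η₀ * I ≤ 1 := by
        have := mul_le_mul_of_nonneg_right hη (show (0 : ℝ) ≤ I by positivity)
        linarith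
      nlinarith
    have h3 : Real.sqrt η₀ * ε ≤ 1 := by
      have h4 := mul_le_mul_of_nonneg_right (h2.trans h1) hε0.le
      have h5 : sigmaMax (stackedPart a) * ε ≤ κ ^ 2 * (sigmaMax (stackedPart a) * ε) :=
        le_mul_of_one_le_left (mul_nonneg (sigmaMax_nonneg _) hε0.le) (one_le_pow₀ hκ)
      linarith
    have h4 : Real.sqrt η₀ ≤ 1 / ε := by rwa [le_div_iff₀ hε0]
    have h5 := pow_le_pow_left₀ (Real.sqrt_nonneg _) h4 2
    rwa [Real.sq_sqrt hη₀.le] at h5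
  set L := Real.log (1 / δ) with hL
  have hL0 := one_half_le_log_one_div hδ0 hδ
  have hℓ : L ≤ Real.log (F / δ) :=
    Real.log_le_log (by positivity) (div_le_div_of_nonneg_right (by linarith) hδ0.le)
  have hNM : 2 / r * L ≤ ((N - M : ℕ) : ℝ) := by
    have h1 : η₀ ^ F / F ≤ (1 / ε) ^ (2 * (F - 1)) / (I * F) := by
      have h2 : η₀ ^ (F - 1) ≤ (1 / ε) ^ (2 * (F - 1)) := by
        rw [pow_mul]; exact pow_le_pow_left₀ hη₀.le hεη _
      have h3 : η₀ ≤ 1 / I := by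
        rw [le_div_iff₀ (by positivity)]
        have := mul_le_mul_of_nonneg_right hη (show (0 : ℝ) ≤ I by positivity)
        linarith
      have h4 := mul_le_mul h2 h3 hη₀.le (by positivity)
      rw [← pow_succ, Nat.sub_add_cancel (by omega)] at h4
      refine (div_le_div_of_nonneg_right h4 (show (0 : ℝ) ≤ F by positivity)).trans (le_of_eq ?_)
      field_simp
    have hCN0 : 0 < CN := lt_of_lt_of_le (by positivity) hCN
    have h2 : 2 / r ≤ CN * (η₀ ^ F / F) := by
      refine le_trans (le_of_eq ?_) (mul_le_mul_of_nonneg_right hCN (by positivity))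
      field_simp
    rw [Nat.cast_sub hMN]
    have h3 : 2 / r * L ≤ CN * ((1 / ε) ^ (2 * (F - 1)) / (I * F) * Real.log (F / δ)) := by
      calc 2 / r * L ≤ CN * (η₀ ^ F / F) * L := mul_le_mul_of_nonneg_right h2 (by linarith)
        _ = CN * (η₀ ^ F / F * L) := by ring
        _ ≤ _ := mul_le_mul_of_nonneg_left (mul_le_mul h1 hℓ (by linarith) (by positivity)) hCN0.le
    linarith
  calc (1 - r / 2) ^ (N - M) ≤ Real.exp (-(r / 2)) ^ (N - M) :=
        pow_le_pow_left₀ (by linarith) (Real.one_sub_le_exp_neg _) _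
    _ = Real.exp (-(r / 2 * ((N - M : ℕ) : ℝ))) := by
        rw [← Real.exp_nat_mul]; congr 1; ring
    _ ≤ Real.exp (-L) := by
        apply Real.exp_le_exp.2
        have h1 := mul_le_mul_of_nonneg_left hNM (show 0 ≤ r / 2 by positivity)
        have e : r / 2 * (2 / r * L) = L := by field_simp
        linarith
    _ = δ := by rw [hL, one_div, Real.log_inv, neg_neg, Real.exp_log hδ0]

/-- For small `η`, atypical records are improbable given critical factors. -/
theorem IsModel.prob_critical_atypical_le [NeZero F] (hM : IsModel P lam p A H Z V) (hF : 2 ≤ F)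
    (hlam : ∀ f, 0 ≤ lam f) (hlam1 : ∑ f, lam f = 1) (hp0 : 0 ≤ p) (hp1 : p ≤ 1) (hM0 : 0 < M)
    (hMN : M ≤ N) {G : Set (Part1 N M → Fin I → Fin F → ℝ)} (hG : MeasurableSet G)
    (hGs : ∀ a ∈ G, ∀ j, IsColStochastic (a j)) (hη0 : 0 < η) (hη : η ≤ 1)
    {K e x : ℝ} (h6 : 6 ≤ 4 * η * (p ^ 2 * S)) (hK : 96 * K ≤ 4 * η * (p ^ 2 * S))
    (he : 0 ≤ e) (hMK : M ≤ K) (hx : K ≤ e * x / 2)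
    (hexc : 4 / smallRowConst F I η * ((1 + I * F + M + I) * Real.exp (-(5 / 6 * K))) ≤ δ) :
    P {ω | (fun j : Part1 N M => A j ω) ∈ G ∧ MassAtLeast M η (samples Z V ω) ∧
      ∃ k : Part2 N M, ((fun j : Part1 N M => factorRecord A Z V j ω), factorRecord A Z V k ω) ∈
        {z | z.2 ∈ AtypicalRecord lam p e x fun i => H i ω} ∪ AtypicalPair p η K fun i => H i ω} ≤
      ENNReal.ofReal (δ / 2) * P {ω | (fun j : Part1 N M => A j ω) ∈ G} := by
  set r := smallRowConst F I η
  have hr0 : 0 < r := smallRowConst_pos (by omega) hη0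
  have hr1 : r ≤ 1 := smallRowConst_le_one (by omega) hη0 hη
  refine (hM.prob_mass_atypical_le hlam hlam1 hp0 hp1 hMN hG hGs hη0
    (fun n => (hM.law_factor n).smallRowConst_le hF hη0 hη)
    ⟨⟨0, hM0.trans_le hMN⟩, hM0⟩ h6 hK he (x := x)).trans ?_
  rw [mul_comm (P _), ← mul_assoc]
  refine mul_le_mul' ?_ le_rfl
  rw [← ENNReal.ofReal_pow (by linarith), ← ENNReal.ofReal_natCast (N - M),
    ← ENNReal.ofReal_mul (by positivity), ← ENNReal.ofReal_mul (mul_nonneg (by positivity)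
      (pow_nonneg (by linarith) _))]
  refine ENNReal.ofReal_le_ofReal ?_
  have h1 := natCast_mul_pow_le (r := r / 2) (by positivity) (by linarith) (N - M)
  have h2 := atypical_bound_le (I := I) (F := F) (S := S) hp0 hp1 hη (by linarith) hMK hx
  refine (mul_le_mul h1 h2 (by positivity) (by positivity)).trans ?_
  have e1 : 1 / (r / 2) * ((1 + I * F + M + I) * Real.exp (-(5 / 6 * K))) =
      4 / r * ((1 + I * F + M + I) * Real.exp (-(5 / 6 * K))) / 2 := by
    field_simp; norm_num
  rw [e1]
  linarith

end FailureProbability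

section SmallMass

open scoped ENNReal

variable {Ω : Type*} [MeasurableSpace Ω] {P : Measure Ω} [IsProbabilityMeasure P]
  {N M I F S : ℕ} {lam : Fin F → ℝ} {p δ η CN : ℝ} {A : Fin N → Ω → Fin I → Fin F → ℝ}
  {H : Fin S → Ω → Fin F} {Z : Fin S → Fin N → Ω → Fin I} {V : Fin S → Fin N → Ω → Bool}

/-- The asserted error bound, with constant `1000`, holds for the factors `a` and the
data `D`. -/
def BoundHolds (M : ℕ) (p δ η : ℝ) (D : Fin S → Fin N → Option (Fin I))
    (a : Fin N → Fin I → Fin F → ℝ) : Prop :=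
  SPAErrorAtMost M D a (1000 * (condNumber (stackedFactor M a) ^ 2 * Real.sqrt F *
    spaZeta M I S p δ η (sigmaMax (stackedFactor M a))
      (sepEps F M (condNumber (stackedFactor M a)))))

/-- **Recovery for critical factors.** The bound holds if all records are typical and, unless the
bound is weak anyway, all vertices are approximated by a row of some factor. -/
theorem boundHolds_of_typical [NeZero F] (hF : 2 ≤ F) (hM : 0 < M) (hMN : M ≤ N) (hp0 : 0 < p)
    (hp1 : p ≤ 1) (hη : 0 < η) (hI : 0 < I) (hδ0 : 0 < δ) (hδ : δ ≤ 1 / 2)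
    {a : Fin N → Fin I → Fin F → ℝ} (ha : ∀ n, IsColStochastic (a n))
    {d : Fin N → Fin S → Fin I × Bool} {h : Fin S → Fin F}
    (hcrit : (fun j : Part1 N M => a j) ∈ CriticalFactors CN N M I F S p δ η)
    (hmass : MassAtLeast M η (recordSamples d)) {K e : ℝ}
    (hK : K = I * Real.log (1 / δ) / η / recordConst F)
    (htyp : ∀ k : Part2 N M, ((fun j : Part1 N M => (a j, d j)), (a k, d k)) ∉
      {z : (Part1 N M → FactorRecord I F S) × FactorRecord I F S |
        z.2 ∈ AtypicalRecord lam p e (η * p ^ 2 * S / 4) h} ∪ AtypicalPair p η K h)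
    (hnear : condNumber (stackedFactor M a) ^ 2 * sepEps F M (condNumber (stackedFactor M a)) <
        1 / 4 → e ≤ nearLevel F (condNumber (stackedFactor M a)) ∧
        ∀ f, ∃ (k : Part2 N M) (q : Fin I), IsDominated lam (e / 8) (a k) q f) :
    BoundHolds M p δ η (recordSamples d) a := by
  obtain ⟨-, hsize, hT, -⟩ := hcrit
  change SizeConditions 1 CN N M I S p δ η (stackedFactor M a) at hsize
  change 1000 * (condNumber (stackedFactor M a) ^ 2 * (sigmaMax (stackedFactor M a) *
    sepEps F M (condNumber (stackedFactor M a)))) < 2 at hT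
  have hL := one_half_le_log_one_div hδ0 hδ
  have hs := hsize.1
  have hκ := one_le_condNumber hs
  have hS1 := hsize.2.1
  unfold BoundHolds
  set κ := condNumber (stackedFactor M a) with hκd
  set σ := sigmaMax (stackedFactor M a) with hσd
  set ε := sepEps F M κ with hε
  have hε0 : 0 < ε := sepEps_pos hF hM (by linarith)
  have hσ0 : 0 < σ := hs.trans_le (sigmaMin_le_sigmaMax _)
  simp only [Set.mem_union, not_or] at htyp
  have hview : ∀ k : Part2 N M, p * S / 2 ≤ (viewSet (d k)).card := fun k =>
    not_lt.1 fun hlt => (htyp k).1 (Or.inl hlt)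
  have hK0 : 0 < K := by
    rw [hK]; unfold recordConst
    positivity
  have hbound : 3072 * K ≤ η * (p ^ 2 * S) * (noiseLevel F * (σ * ε / M)) ^ 2 := by
    rw [one_mul, div_le_iff₀ (by positivity)] at hS1
    have h1 : I * Real.log (1 / δ) / η ≤ η * (p ^ 2 * S) * (σ * ε / M) ^ 2 := by
      rw [div_le_iff₀ hη, div_pow, mul_div_assoc', div_mul_eq_mul_div, le_div_iff₀ (by positivity)]
      calc I * Real.log (1 / δ) * M ^ 2 = M ^ 2 * I * Real.log (1 / δ) := by ring
        _ ≤ S * (σ ^ 2 * η ^ 2 * ε ^ 2 * p ^ 2) := hS1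
        _ = η * (p ^ 2 * S) * (σ * ε) ^ 2 * η := by ring
    have h2 : 3072 * K = I * Real.log (1 / δ) / η * noiseLevel F ^ 2 := by
      rw [hK]; unfold recordConst noiseLevel; field_simp; norm_num
    rw [h2, mul_pow]
    calc _ ≤ η * (p ^ 2 * S) * (σ * ε / M) ^ 2 * noiseLevel F ^ 2 :=
          mul_le_mul_of_nonneg_right h1 (sq_nonneg _)
      _ = _ := by ring
  have hpair : ∀ (k : Part2 N M) (j : Part1 N M),
      p * (viewSet (d k)).card / 2 ≤ pairCount (d j) (d k) := fun k j =>
    not_lt.1 fun hlt => (htyp k).2 ⟨hview k, Or.inl ⟨j, hlt⟩⟩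
  have hnoise : ∀ (k : Part2 N M) (q : Fin I), ∑ j : Part1 N M, noiseSq (a j) h (d j) (d k) q ≤
      24 * (8 * p * ((levelSet (d k) q).card + η * (viewSet (d k)).card)) * K := fun k q =>
    (not_le.1 fun hle => (htyp k).2 ⟨hview k, Or.inr ⟨q, hle⟩⟩).le
  have hb : 1000 * (κ ^ 2 * Real.sqrt F * (σ * ε)) ≤
      1000 * (κ ^ 2 * Real.sqrt F * spaZeta M I S p δ η σ ε) :=
    mul_le_mul_of_nonneg_left (mul_le_mul_of_nonneg_left (le_max_left _ _) (by positivity))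
      (by norm_num)
  rcases lt_or_ge (κ ^ 2 * ε) (1 / 4) with hlt | hge
  · obtain ⟨he, hdom⟩ := hnear hlt
    refine spaErrorAtMost_of_records hF hM hMN ha hp0 hp1 hη hs hσd hκd hε hT hK0.le hbound hmass
      hview hpair hnoise he (Or.inr fun f => ?_) hb
    obtain ⟨k, q, hkq⟩ := hdom f
    refine ⟨k, q, fun hx => not_lt.1 fun hlt => (htyp k).1 (Or.inr ⟨q, f, hkq, hx, hlt⟩)⟩
  · exact spaErrorAtMost_of_records hF hM hMN ha hp0 hp1 hη hs hσd hκd hε hT hK0.le hbound hmass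
      hview hpair hnoise le_rfl (Or.inl hge) hb

/-- The probability that some vertex is approximated by no row of the factors in the second
part. -/
theorem IsModel.prob_exists_no_dominated_le [NeZero F] (hM : IsModel P lam p A H Z V)
    (hlam : ∀ f, 0 ≤ lam f) (hlam1 : ∑ f, lam f = 1) {b : ℝ} (hb0 : 0 < b) (hb : ∀ f, b ≤ lam f)
    (hp0 : 0 ≤ p) (hp1 : p ≤ 1) (hMN : M ≤ N) {G : Set (Part1 N M → Fin I → Fin F → ℝ)}
    (hG : MeasurableSet G) (hGs : ∀ a ∈ G, ∀ j, IsColStochastic (a j)) {t : ℝ} (ht0 : 0 ≤ t)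
    (ht : t ≤ 1 / 8) :
    P (⋃ f, {ω | (fun j : Part1 N M => A j ω) ∈ G ∧
      ∀ (k : Part2 N M) (q : Fin I), ¬ IsDominated lam t (A k ω) q f}) ≤
    ENNReal.ofReal (F * Real.exp (-(vertexConst F * I * (t * b / 2 / F) ^ (F - 1))) ^ (N - M)) *
      P {ω | (fun j : Part1 N M => A j ω) ∈ G} := by
  set γ := Real.exp (-(vertexConst F * I * (t * b / 2 / F) ^ (F - 1)))
  have hrow : ∀ f n, P.real {ω | ∀ q, ¬ IsDominated lam t (A n ω) q f} ≤ γ := fun f n =>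
    (hM.law_factor n).prob_no_dominated_row hlam1 hb0 hb f ht0 ht
  have hone : ∀ f, P {ω | (fun j : Part1 N M => A j ω) ∈ G ∧
      ∀ (k : Part2 N M) (q : Fin I), ¬ IsDominated lam t (A k ω) q f} ≤
      P {ω | (fun j : Part1 N M => A j ω) ∈ G} * ENNReal.ofReal γ ^ (N - M) := fun f =>
    hM.prob_no_dominated_le hlam hlam1 hp0 hp1 hMN hG hGs f (hrow f)
  refine (measure_iUnion_fintype_le _ _).trans ((Finset.sum_le_sum fun f _ => hone f).trans ?_)
  rw [Finset.sum_const, Finset.card_univ, Fintype.card_fin, nsmul_eq_mul,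
    ENNReal.ofReal_mul (Nat.cast_nonneg F), ENNReal.ofReal_natCast,
    ENNReal.ofReal_pow (Real.exp_pos _).le, mul_assoc,
    mul_comm (P _)]

set_option maxHeartbeats 400000 in
/-- The failure probability for small `η` and few variables in the first part. -/
theorem IsModel.prob_critical_failure_le [NeZero F] (hM : IsModel P lam p A H Z V) (hF : 2 ≤ F)
    (hlam : ∀ f, 0 ≤ lam f) (hlam1 : ∑ f, lam f = 1) {b : ℝ} (hb0 : 0 < b) (hb : ∀ f, b ≤ lam f)
    (hp0 : 0 < p) (hp1 : p ≤ 1) (hM0 : 0 < M) (hMN : M ≤ N) (hI : 0 < I) (hS : 0 < S)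
    (hδ0 : 0 < δ) (hδ : δ ≤ 1 / 2) (hη0 : 0 < η) (hη : η ≤ 1) {K : ℝ}
    (hK : K = I * Real.log (1 / δ) / η / recordConst F) (hMK : M ≤ K)
    (hexc : 4 / smallRowConst F I η * ((1 + I * F + M + I) * Real.exp (-(5 / 6 * K))) ≤ δ)
    (hCN : 2 * F / vertexConst F * (1728 * F ^ 2 / b) ^ (F - 1) ≤ CN) :
    P {ω | (fun j : Part1 N M => A j ω) ∈ CriticalFactors CN N M I F S p δ η ∧
      MassAtLeast M η (samples Z V ω) ∧
      ¬ BoundHolds M p δ η (samples Z V ω) fun n => A n ω} ≤ ENNReal.ofReal δ *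
        P {ω | (fun j : Part1 N M => A j ω) ∈ CriticalFactors CN N M I F S p δ η} := by
  have hF0 : (2 : ℝ) ≤ F := by exact_mod_cast hF
  have hI0 : (1 : ℝ) ≤ I := by exact_mod_cast hI
  have hM1 : (1 : ℝ) ≤ M := by exact_mod_cast hM0
  have hL := one_half_le_log_one_div hδ0 hδ
  set L := Real.log (1 / δ)
  set G : Set (Part1 N M → Fin I → Fin F → ℝ) := CriticalFactors CN N M I F S p δ η
  have hGm : MeasurableSet G := measurableSet_criticalFactors
  rcases G.eq_empty_or_nonempty with h0 | ⟨a₀, ha₀⟩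
  · rw [h0]; simp
  set κ : (Part1 N M → Fin I → Fin F → ℝ) → ℝ := fun a => condNumber (stackedPart a)
  have hκ1 : ∀ a ∈ G, 1 ≤ κ a := fun a ha => one_le_condNumber ha.2.1.1
  set Y := I * L / η with hY
  have hY0 : 0 < Y := by positivity
  have hYK : K * recordConst F = Y := by
    rw [hK]; exact div_mul_cancel₀ _ (by unfold recordConst; positivity)
  have hKY : 442368 * K ≤ Y := by
    have h1 : 442368 ≤ recordConst F := by unfold recordConst; nlinarith
    have h2 : 0 ≤ K := le_trans (by linarith) hMK
    rw [← hYK, mul_comm K]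
    exact mul_le_mul_of_nonneg_right h1 h2
  -- the number of samples, in terms of a condition number
  have hSY : ∀ k : ℝ, 1 ≤ k → 250000 * (k ^ 4 * (M ^ 2 * (I * L))) ≤ η ^ 2 * (p ^ 2 * S) →
      250000 * (k ^ 4 * Y) ≤ η * (p ^ 2 * S) := by
    intro k hk h1
    have h2 : k ^ 4 * (I * L) ≤ k ^ 4 * (M ^ 2 * (I * L)) :=
      mul_le_mul_of_nonneg_left (le_mul_of_one_le_left (by positivity) (one_le_pow₀ hM1))
        (by positivity)
    have e : 250000 * (k ^ 4 * Y) = 250000 * (k ^ 4 * (I * L)) / η := by rw [hY]; ring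
    rw [e, div_le_iff₀ hη0]
    linarith
  have hSY1 : 250000 * Y ≤ η * (p ^ 2 * S) := by
    have h1 := hSY _ (hκ1 a₀ ha₀) ha₀.2.2.2
    have h2 : Y ≤ κ a₀ ^ 4 * Y := le_mul_of_one_le_left hY0.le (one_le_pow₀ (hκ1 a₀ ha₀))
    linarith
  set G' : Set (Part1 N M → Fin I → Fin F → ℝ) :=
    {a | a ∈ G ∧ κ a ^ 2 * sepEps F M (κ a) < 1 / 4}
  have hκm : Measurable κ := measurable_condNumber_stackedPart
  have hG'm : MeasurableSet G' :=
    hGm.inter (measurableSet_lt ((hκm.pow_const 2).mul ((measurable_sepEps F M).comp hκm))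
      measurable_const)
  -- a common separation level for all critical factors
  obtain ⟨e, he0, hex, he1, hdom⟩ : ∃ e : ℝ, 0 ≤ e ∧ K ≤ e * (η * p ^ 2 * S / 4) / 2 ∧
      (∀ a ∈ G', e ≤ nearLevel F (κ a)) ∧ (G'.Nonempty → e / 8 ≤ 1 / 8 ∧
        F * Real.exp (-(vertexConst F * I * (e / 8 * b / 2 / F) ^ (F - 1))) ^ (N - M) ≤ δ / 2) := by
    rcases G'.eq_empty_or_nonempty with h0 | hne
    · refine ⟨1, zero_le_one, ?_, fun a ha => absurd ha (h0 ▸ Set.notMem_empty a), fun hne =>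
        absurd h0 hne.ne_empty⟩
      linarith
    · obtain ⟨k, hk1, hkG, hkε, hkS, hkN⟩ := exists_common_condNumber (T := κ '' G') (N := N)
        (S := S) (p := p) (η := η) (CN := CN) hF hM0 hI hδ0 hδ (hne.image κ)
        (by rintro _ ⟨a, ha, rfl⟩; exact hκ1 a ha.1) (by rintro _ ⟨a, ha, rfl⟩; exact ha.2.le)
        (by rintro _ ⟨a, ha, rfl⟩; exact ha.1.2.2.2) (by rintro _ ⟨a, ha, rfl⟩; exact ha.1.2.1.2.2)
      refine ⟨nearLevel F k, by unfold nearLevel; positivity, ?_, fun a ha => ?_, fun _ =>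
        ⟨?_, card_mul_no_dominated_le hF hM0 hMN hI hδ0 hδ hb0 hCN hk1 hkε hkN⟩⟩
      · have h1 := hSY k hk1 hkS
        have h2 : K ≤ 250000 / (13824 * F) * (k * Y) := by
          have h3 : Y ≤ k * Y := le_mul_of_one_le_left hY0.le hk1
          have h4 : K = Y / recordConst F := hK
          rw [h4, div_mul_eq_mul_div, div_le_div_iff₀ (by unfold recordConst; positivity)
            (by positivity)]
          have h5 : 13824 * (F : ℝ) ≤ 250000 * recordConst F := by unfold recordConst; nlinarith
          calc Y * (13824 * F) ≤ (k * Y) * (250000 * recordConst F) :=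
                mul_le_mul h3 h5 (by positivity) (by positivity)
            _ = _ := by ring
        refine h2.trans ?_
        have h3 : nearLevel F k * (η * p ^ 2 * S / 4) / 2 =
            1 / (13824 * F * k ^ 3) * (η * (p ^ 2 * S)) := by
          unfold nearLevel; field_simp; norm_num
        rw [h3]
        refine le_trans (le_of_eq ?_) (mul_le_mul_of_nonneg_left h1 (by positivity))
        field_simp
      · have h1 : κ a ≤ k := hkG _ ⟨a, ha, rfl⟩
        have h2 := hκ1 a ha.1
        unfold nearLevel
        refine div_le_div_of_nonneg_left (by positivity) (by positivity) ?_
        exact mul_le_mul_of_nonneg_left (pow_le_pow_left₀ (by linarith) h1 3) zero_le_two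
      · have h1 : nearLevel F k ≤ 1 := by
          unfold nearLevel
          have h2 : (1 : ℝ) ≤ k ^ 3 := one_le_pow₀ hk1
          rw [div_div, div_le_one (by positivity)]
          have := mul_le_mul (show (1 : ℝ) ≤ 864 * F by linarith)
            (show (1 : ℝ) ≤ 2 * k ^ 3 by linarith) zero_le_one (by positivity)
          linarith
        linarith
  set x := η * p ^ 2 * S / 4
  set E₁ := {ω | (fun j : Part1 N M => A j ω) ∈ G ∧ MassAtLeast M η (samples Z V ω) ∧
      ∃ k : Part2 N M, ((fun j : Part1 N M => factorRecord A Z V j ω), factorRecord A Z V k ω) ∈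
        {z | z.2 ∈ AtypicalRecord lam p e x fun i => H i ω} ∪ AtypicalPair p η K fun i => H i ω}
  set E₂ : Fin F → Set Ω := fun f => {ω | (fun j : Part1 N M => A j ω) ∈ G' ∧
    ∀ (k : Part2 N M) (q : Fin I), ¬ IsDominated lam (e / 8) (A k ω) q f} with hE₂
  have hE₁le : P E₁ ≤ ENNReal.ofReal (δ / 2) * P {ω | (fun j : Part1 N M => A j ω) ∈ G} :=
    hM.prob_critical_atypical_le hF hlam hlam1 hp0.le hp1 hM0 hMN hGm (fun a ha => ha.1) hη0 hη
      (by linarith) (by linarith) he0 hMK hex hexc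
  have hE₂le : P (⋃ f, E₂ f) ≤ ENNReal.ofReal (δ / 2) *
      P {ω | (fun j : Part1 N M => A j ω) ∈ G} := by
    rcases G'.eq_empty_or_nonempty with h0 | hne
    · have : (⋃ f, E₂ f) = ∅ := by simp [hE₂, h0]
      rw [this, measure_empty]
      exact zero_le
    obtain ⟨he8, hsum⟩ := hdom hne
    exact (hM.prob_exists_no_dominated_le hlam hlam1 hb0 hb hp0.le hp1 hMN hG'm
      (fun a ha => ha.1.1) (by positivity) he8).trans
      (mul_le_mul' (ENNReal.ofReal_le_ofReal hsum) (measure_mono fun ω hω => hω.1))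
  have hcol : ∀ᵐ ω ∂P, ∀ n, IsColStochastic (A n ω) :=
    ae_all_iff.2 fun n => (hM.law_factor n).ae_isColStochastic
  have hcover : P {ω | (fun j : Part1 N M => A j ω) ∈ G ∧ MassAtLeast M η (samples Z V ω) ∧
      ¬ BoundHolds M p δ η (samples Z V ω) fun n => A n ω} ≤ P (E₁ ∪ ⋃ f, E₂ f) := by
    refine measure_mono_ae ?_
    filter_upwards [hcol] with ω hω hbad
    obtain ⟨hcrit, hmass, hfail⟩ := hbad
    by_contra hcon
    have h1 : ω ∉ E₁ := fun h => hcon (Or.inl h)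
    have h2 : ∀ f, ω ∉ E₂ f := fun f h => hcon (Or.inr (Set.mem_iUnion.2 ⟨f, h⟩))
    have h3 : ∀ k : Part2 N M, ((fun j : Part1 N M => factorRecord A Z V j ω),
        factorRecord A Z V k ω) ∉ {z : (Part1 N M → FactorRecord I F S) × FactorRecord I F S |
          z.2 ∈ AtypicalRecord lam p e x fun i => H i ω} ∪ AtypicalPair p η K fun i => H i ω :=
      fun k hk => h1 ⟨hcrit, hmass, k, hk⟩
    refine hfail (boundHolds_of_typical (a := fun n => A n ω)
      (d := fun n i => (Z i n ω, V i n ω)) hF hM0 hMN hp0 hp1 hη0 hI hδ0 hδ hω hcrit hmass hK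
      h3 fun hlt => ?_)
    have hmem : (fun j : Part1 N M => A j ω) ∈ G' := ⟨hcrit, hlt⟩
    have hle := he1 _ hmem
    refine ⟨hle, fun f => ?_⟩
    by_contra hno
    push Not at hno
    exact h2 f ⟨hmem, hno⟩
  refine hcover.trans ((measure_union_le _ _).trans ((add_le_add hE₁le hE₂le).trans
    (le_of_eq ?_)))
  rw [← add_mul, ← ENNReal.ofReal_add (by positivity) (by positivity), add_halves]

end SmallMass

theorem theorem3 :
    ∃ CS > (0 : ℝ), ∃ C > (0 : ℝ),
    ∀ (F : ℕ) (lam : Fin F → ℝ), 2 ≤ F → (∀ f, 0 < lam f) → ∑ f, lam f = 1 →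
    ∃ CN > (0 : ℝ),
    ∀ (N M I S : ℕ) (p δ η : ℝ), M ≤ N → F ≤ M * I → 0 < p → p ≤ 1 → 0 < δ → δ ≤ 1 / 2 →
      0 < η → Real.sqrt (8 / S * Real.log (4 / δ)) ≤ p →
    ∀ (Ω : Type*) [MeasurableSpace Ω] (P : Measure Ω) [IsProbabilityMeasure P]
      (A : Fin N → Ω → Fin I → Fin F → ℝ) (H : Fin S → Ω → Fin F)
      (Z : Fin S → Fin N → Ω → Fin I) (V : Fin S → Fin N → Ω → Bool),
      IsModel P lam p A H Z V →
      P {ω | SizeConditions CS CN N M I S p δ η (stackedFactor M fun n => A n ω) ∧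
          MassAtLeast M η (samples Z V ω) ∧
          ¬ SPAErrorAtMost M (samples Z V ω) (fun n => A n ω)
            (C * (condNumber (stackedFactor M fun n => A n ω) ^ 2 * Real.sqrt F *
              spaZeta M I S p δ η (sigmaMax (stackedFactor M fun n => A n ω))
                (sepEps F M (condNumber (stackedFactor M fun n => A n ω)))))} ≤
        ENNReal.ofReal δ *
          P {ω | SizeConditions CS CN N M I S p δ η (stackedFactor M fun n => A n ω)} := by
  refine ⟨1, one_pos, 1000, by norm_num, fun F lam hF hlam hlam1 => ?_⟩
  have : NeZero F := ⟨by omega⟩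
  have hF0 : (2 : ℝ) ≤ F := by exact_mod_cast hF
  obtain ⟨Q, hQ1, hQ⟩ := exists_prob_sigmaMin_le F
  obtain ⟨s₁, hs₁, -, hexc⟩ := exists_exceptional_le hF
  have hΦ : 0 < recordConst F := by unfold recordConst; positivity
  set s₀ := min s₁ (1 / (Q * recordConst F))
  have hs₀ : 0 < s₀ := by positivity
  set η₀ := s₀ ^ 2 with hη₀d
  have hη₀ : 0 < η₀ := by positivity
  obtain ⟨f₀, hf₀⟩ := Finite.exists_min lam
  set c₁ := 2 * F / (η₀ ^ F * smallRowConst F ⌈1 / η₀⌉₊ η₀)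
  set c₂ := 2 * F / vertexConst F * (1728 * F ^ 2 / lam f₀) ^ (F - 1)
  have hc₂0 : 0 < c₂ := by
    have := hlam f₀
    have := vertexConst_pos (F := F)
    positivity
  refine ⟨max c₁ c₂, lt_max_of_lt_right hc₂0, ?_⟩
  intro N M I S p δ η hMN hFMI hp0 hp1 hδ0 hδ hη0 _ Ω _ P _ A H Z V hM
  have hCN : 0 < max c₁ c₂ := lt_max_of_lt_right hc₂0
  have hM0 : 0 < M := Nat.pos_of_ne_zero fun h => by subst h; omega
  have hI : 0 < I := Nat.pos_of_ne_zero fun h => by subst h; omega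
  have hI2 : 1 < I := by
    have := (hM.law_factor ⟨0, hM0.trans_le hMN⟩).le
    omega
  have hI1 : (1 : ℝ) ≤ I := by exact_mod_cast hI
  have hL := one_half_le_log_one_div hδ0 hδ
  set CN := max c₁ c₂
  set T : Set (Part1 N M → Fin I → Fin F → ℝ) := CriticalFactors CN N M I F S p δ η with hT
  have hTsize : P {ω | (fun j : Part1 N M => A j ω) ∈ T} ≤
      P {ω | SizeConditions 1 CN N M I S p δ η (stackedFactor M fun n => A n ω)} :=
    measure_mono fun ω hω => hω.2.1
  have hcol : ∀ᵐ ω ∂P, ∀ n, IsColStochastic (A n ω) :=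
    ae_all_iff.2 fun n => (hM.law_factor n).ae_isColStochastic
  -- the size conditions imply `M < N`, so that the mass condition is not vacuous
  have hfacts : ∀ ω, SizeConditions 1 CN N M I S p δ η (stackedFactor M fun n => A n ω) →
      MassAtLeast M η (samples Z V ω) → 0 < S ∧ I * η ≤ 1 := by
    intro ω hsize hmass
    have hlt : (M : ℝ) < N := by
      refine lt_of_lt_of_le (lt_add_of_pos_right _ (mul_pos hCN (mul_pos (div_pos (pow_pos
        (one_div_pos.2 (sepEps_pos hF hM0 (zero_lt_one.trans_le (one_le_condNumber hsize.1)))) _)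
        (by positivity)) (Real.log_pos ?_)))) hsize.2.2
      rw [lt_div_iff₀ hδ0]; linarith
    have hMN' : M < N := by exact_mod_cast hlt
    have hmass' : MassAtLeast M η (recordSamples fun n i => (Z i n ω, V i n ω)) := hmass
    set j : Part1 N M := ⟨⟨0, by omega⟩, hM0⟩
    set k : Part2 N M := ⟨⟨M, hMN'⟩, le_rfl⟩
    refine ⟨Nat.pos_of_ne_zero fun hS => ?_, hmass'.mul_le_one hη0 j k hI⟩
    subst hS
    have h1 := (hmass'.counts hη0 j k ⟨0, hI⟩).1
    obtain ⟨s, -⟩ := Finset.card_pos.1 h1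
    exact s.elim0
  by_cases hnt : 0 < S ∧ I * η ≤ 1
  swap
  · refine le_of_eq_of_le ?_ zero_le
    have h0 : {ω | SizeConditions 1 CN N M I S p δ η (stackedFactor M fun n => A n ω) ∧
        MassAtLeast M η (samples Z V ω) ∧
        ¬ BoundHolds M p δ η (samples Z V ω) fun n => A n ω} = ∅ :=
      Set.eq_empty_of_forall_notMem fun ω hω => hnt (hfacts ω hω.1 hω.2.1)
    exact (congrArg P h0).trans measure_empty
  obtain ⟨hS, hIη⟩ := hnt
  have hη1 : η ≤ 1 := (le_mul_of_one_le_left hη0.le hI1).trans hIη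
  have hbad : P {ω | SizeConditions 1 CN N M I S p δ η (stackedFactor M fun n => A n ω) ∧
      MassAtLeast M η (samples Z V ω) ∧
      ¬ BoundHolds M p δ η (samples Z V ω) fun n => A n ω} ≤
      P {ω | (fun j : Part1 N M => A j ω) ∈ T ∧ MassAtLeast M η (samples Z V ω) ∧
        ¬ BoundHolds M p δ η (samples Z V ω) fun n => A n ω} := by
    refine measure_mono_ae ?_
    filter_upwards [hcol] with ω hω h
    exact ⟨mem_criticalFactors hω hp0 hη0 hS hδ0 (by linarith) h.1 h.2.2, h.2⟩
  refine hbad.trans ?_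
  rcases lt_or_ge s₀ (Real.sqrt η) with hη | hη
  · -- large `η`: the mass condition fails, as some factor has a small row
    have hηη : η₀ ≤ η := by
      rw [hη₀d, ← Real.sq_sqrt hη0.le]
      exact pow_le_pow_left₀ hs₀.le hη.le 2
    refine (measure_mono fun ω hω => ?_).trans ((hM.prob_critical_mass_le hF (fun f => (hlam f).le)
      hlam1 hp0.le hp1 hM0 hMN hI hδ0 hδ hη₀ hηη hIη (le_max_left _ _)).trans
      (mul_le_mul_right hTsize _))
    exact ⟨hω.1, hω.2.1⟩
  rcases le_or_gt (Q * (I * Real.sqrt I * Real.log (1 / δ))) M with hQM | hQM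
  · -- many variables: the factors are hardly ever critical
    have hs : (0 : ℝ) < 2 * Real.sqrt F / M := by
      have : (0 : ℝ) < M := by exact_mod_cast hM0
      positivity
    refine (measure_mono fun ω hω => ?_).trans (prob_size_and_sigmaMin_le hF hM0 hMN hI2
      zero_le_one hCN.le hp0 hδ0 hδ hη0 hM.law_factor hs (hQ hMN hI hδ0 hδ hM.measurable_factor
        hM.indep_factor hM.law_factor hQM))
    exact ⟨hω.1.2.1, sigmaMin_le_of_critical hF hM0 hω.1.2.1.1 hω.1.2.2.1⟩
  · -- small `η` and few variables
    set K := I * Real.log (1 / δ) / η / recordConst F with hK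
    have hMK : M ≤ K := by
      refine hQM.le.trans ?_
      have h1 : Real.sqrt I * Real.sqrt η ≤ 1 := by
        rw [← Real.sqrt_mul (by linarith)]
        exact Real.sqrt_le_one.2 hIη
      have h2 : Real.sqrt η * (Q * recordConst F) ≤ 1 := by
        have := hη.trans (min_le_right _ _)
        rwa [le_div_iff₀ (by positivity)] at this
      rw [hK, le_div_iff₀ hΦ, le_div_iff₀ hη0]
      have h3 := mul_le_one₀ h1 (by positivity) h2
      have h4 : Q * (I * Real.sqrt I * Real.log (1 / δ)) * recordConst F * η =
          I * Real.log (1 / δ) * (Real.sqrt I * Real.sqrt η *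
            (Real.sqrt η * (Q * recordConst F))) := by
        nth_rewrite 1 [← Real.mul_self_sqrt hη0.le]
        ring
      rw [h4]
      exact mul_le_of_le_one_right (by positivity) h3
    exact (hM.prob_critical_failure_le hF (fun f => (hlam f).le) hlam1 (hlam f₀) hf₀ hp0 hp1 hM0
      hMN hI hS hδ0 hδ hη0 hη1 hK hMK
      (hexc hI hδ0 hδ hη0 (hη.trans (min_le_left _ _)) hK hMK) (le_max_right _ _)).trans
      (mul_le_mul_right hTsize _)
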